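/- Let $M\subset\mathbb C^{n+1}$ be a smooth real hypersurface and $p\in M$. Local holomorphic coordinates $(z,w)$, $z=(z_1,\dots,z_n)$, $w=u+iv$, centered at $p$ are always chosen so that $\{v=0\}$ is tangent to $M$ at $p$; then $M$ is a graph $v=\Psi(z,\bar z,u)$ near $p$. A *weight* is a tuple of rationals $\frac12\ge\lambda_1\ge\dots\ge\lambda_n\ge0$ such that for each $k$ either $\lambda_k=0$ or $\sum_{j\le k}a_j\lambda_j=1$ for some integers $a_j\ge0$ with $a_k>0$. For a weight $\Lambda$ put $|(\alpha,\hat\alpha)|_\Lambda=\sum_i(\alpha_i+\hat\alpha_i)\lambda_i$; the variables $w,u$ have weight one. $o_\Lambda(1)$ denotes a smooth function all of whose derivatives $\partial_z^\alpha\partial_{\bar z}^{\hat\alpha}\partial_u^l$ with $l+|(\alpha,\hat\alpha)|_\Lambda\le1$ vanish at $0$. If $v=P(z,\bar z)+o_\Lambda(1)$ with a $\Lambda$-homogeneous polynomial $P$ of weighted degree one, $P$ is called the leading polynomial (with respect to $\Lambda$); the coordinates are $\Lambda$-adapted if moreover $P\ne0$ and $P$ has no pluriharmonic terms. $\Lambda$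 is distinguished if $\Lambda$-adapted coordinates exist. The multitype weight $\Lambda_M=(\mu_1,\dots,\mu_n)$ of $M$ at $p$ is the lexicographic infimum of the distinguished weights. A $\Lambda$-homogeneous transformation is a nonsingular map $z_i^*=z_i+f_i(z,w)$, $w^*=w+g(z,w)$ preserving the above normal form of the coordinates, where $f_i$, $g$ are $\Lambda$-homogeneous polynomials of weighted degrees $\lambda_i$ and $1$. Suppose that distinguished weights exist and that all $\mu_i$ are positive (finite multitype). Consider the following procedure. *Step 1.* Choose coordinates in which the lowest order nonzero homogeneous polynomial in $z,\bar z$ of $\Psi(z,\bar z,0)$ has no pluriharmonic terms, let $m_1$ be its degree, and put $\Lambda_1=(\frac1{m_1},\dots,\frac1{m_1})$, $d_0=n$. *Step $j\ge2$* (performed as long as $d_{j-2}>0$). Let $d_{j-1}$ be the largest number of variables absent from the leading polynomial with respect to $\Lambda_{j-1}$ after a $\Lambda_{j-1}$-homogeneous transformation of the coordinates of the previous step. Choose a $\Lambda_{j-1}$-homogeneous transformation that attains this maximum and for which $z_{n-d_{j-1}+1},\dots,z_n$ are the absent variables. In the new coordinates let $C_{\alpha,\hat\alpha}$ be the coefficients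 of the Taylor series of $\Psi(z,\bar z,0)$ at the origin, write $\Lambda_{j-1}=(\lambda_1,\dots,\lambda_n)$, and put $$\Theta_{j-1}=\Big\{(\alpha,\hat\alpha):\ |(\alpha,\hat\alpha)|_{\Lambda_{j-1}}>1,\ C_{\alpha,\hat\alpha}\ne0,\ \sum_{i\le n-d_{j-1}}(\alpha_i+\hat\alpha_i)\lambda_i<1\Big\},$$ $$W_{j-1}(\alpha,\hat\alpha)=\frac{1-\sum_{i\le n-d_{j-1}}(\alpha_i+\hat\alpha_i)\lambda_i}{\sum_{i>n-d_{j-1}}(\alpha_i+\hat\alpha_i)}.$$ Let $\Lambda_j$ have the entries $\lambda_i$ for $i\le n-d_{j-1}$ and $\max_{\Theta_{j-1}}W_{j-1}$ for $i>n-d_{j-1}$. Then: 1. Step 1 can be performed, and $\mu_1=\frac1{m_1}$ for every choice made in it. 2. Whatever choices were made before, every $\Lambda_j$ is a weight and, if $d_{j-1}>0$, step $j+1$ can be performed: a transformation as required exists, and one exists for which the new coordinates are $\Lambda_j$-adapted. For every transformation as required, $d_j\le d_{j-1}$; $\mu_i$ equals the $i$-th entry of $\Lambda_j$ for $i\le n-d_j$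 (so the entries $\mu_i$, $n-d_{j-1}<i\le n-d_j$, are determined in this step) and $\mu_i$ is smaller than the $i$-th entry of $\Lambda_j$ for $i>n-d_j$; and, if $d_j>0$, the maximum of $W_j$ over $\Theta_j$ exists, so that $\Lambda_{j+1}$ is well defined. 3. The procedure terminates: there is a number $N$ depending only on $M$ and $p$ such that, for all possible choices, at most $N$ steps are performed. 4. When it terminates, all multitype entries have been found: the last weight equals $\Lambda_M$. -/

import Mathlib

open Filter Topology
open scoped ContDiff

noncomputable section

namespace Catlin

/-- The space of the parameters `(z, u)`, `z ∈ ℂⁿ`, `u ∈ ℝ`, of a real graph `v = Ψ(z, z̄, u)`. -/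
abbrev GraphSpace (n : ℕ) : Type := (Fin n → ℂ) × ℝ

/-- The target `ℂⁿ × ℂ` of a coordinate system `(z, w)`. -/
abbrev CoordSpace (n : ℕ) : Type := (Fin n → ℂ) × ℂ

/-! ### Wirtinger derivatives -/

/-- `∂f/∂z_i = (∂f/∂x_i - √-1 ∂f/∂y_i) / 2`. -/
def dz {n : ℕ} (i : Fin n) (f : GraphSpace n → ℂ) : GraphSpace n → ℂ := fun y =>
  (fderiv ℝ f y (Pi.single i 1, 0) - Complex.I * fderiv ℝ f y (Pi.single i Complex.I, 0)) / 2

/-- `∂f/∂z̄_i = (∂f/∂x_i + √-1 ∂f/∂y_i) / 2`. -/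
def dzbar {n : ℕ} (i : Fin n) (f : GraphSpace n → ℂ) : GraphSpace n → ℂ := fun y =>
  (fderiv ℝ f y (Pi.single i 1, 0) + Complex.I * fderiv ℝ f y (Pi.single i Complex.I, 0)) / 2

/-- `∂f/∂u`. -/
def du {n : ℕ} (f : GraphSpace n → ℂ) : GraphSpace n → ℂ := fun y =>
  fderiv ℝ f y (0, 1)

/-- `∂^{|α| + |β| + l} f / ∂z^α ∂z̄^β ∂u^l`. -/
def mixedDeriv {n : ℕ} (α β : Fin n → ℕ) (l : ℕ) (f : GraphSpace n → ℂ) : GraphSpace n → ℂ :=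
  (List.finRange n).foldr (fun i h => (dz i)^[α i] h)
    ((List.finRange n).foldr (fun i h => (dzbar i)^[β i] h) (du^[l] f))

/-- The coefficient of `z^α z̄^β` in the Taylor series of `Ψ(z, z̄, u)` at the origin. -/
def taylorCoeff {n : ℕ} (Ψ : GraphSpace n → ℝ) (α β : Fin n → ℕ) : ℂ :=
  mixedDeriv α β 0 (fun y => (Ψ y : ℂ)) 0 /
    ((∏ i, (Nat.factorial (α i) : ℂ)) * ∏ i, (Nat.factorial (β i) : ℂ))

/-! ### Weights and polynomials in `z, z̄` -/

/-- Weights: nonincreasing rational `n`-tuples with entries in `[0, 1/2]` such that each entry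
`Λ k` is zero or satisfies `∑_{j ≤ k} a_j Λ_j = 1` for some nonnegative integers with `a_k > 0`. -/
def IsWeight {n : ℕ} (Λ : Fin n → ℚ) : Prop :=
  (∀ k, 0 ≤ Λ k ∧ Λ k ≤ 1 / 2) ∧ (∀ j k, j ≤ k → Λ k ≤ Λ j) ∧
    ∀ k, Λ k = 0 ∨ ∃ a : Fin n → ℕ, 0 < a k ∧ ∑ j ∈ Finset.Iic k, (a j : ℚ) * Λ j = 1

/-- The weighted length `|(α, β)|_Λ`. -/
def wlen {n : ℕ} (Λ : Fin n → ℚ) (α β : Fin n → ℕ) : ℚ :=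
  ∑ i, ((α i : ℚ) + (β i : ℚ)) * Λ i

/-- Polynomials in `z` (variables `Sum.inl i`) and `z̄` (variables `Sum.inr i`). -/
abbrev ZPoly (n : ℕ) : Type := MvPolynomial (Fin n ⊕ Fin n) ℂ

/-- The value `P(z, z̄)`. -/
def ZPoly.value {n : ℕ} (P : ZPoly n) (z : Fin n → ℂ) : ℂ :=
  MvPolynomial.eval (Sum.elim z fun i => starRingEnd ℂ (z i)) P

/-- No monomial of `P` is of the form `z^α` or `z̄^β`. -/
def NoPluriharmonic {n : ℕ} (P : ZPoly n) : Prop :=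
  ∀ m ∈ P.support, (∃ i, m (Sum.inl i) ≠ 0) ∧ ∃ i, m (Sum.inr i) ≠ 0

/-- The variable `z_i` does not appear in `P(z, z̄)`. -/
def IsAbsent {n : ℕ} (P : ZPoly n) (i : Fin n) : Prop :=
  Sum.inl i ∉ P.vars ∧ Sum.inr i ∉ P.vars

/-- The number of variables which do not appear in `P(z, z̄)`. -/
def absentCount {n : ℕ} (P : ZPoly n) : ℕ := Set.ncard {i | IsAbsent P i}

/-- `R = o_Λ(1)`: all derivatives of `R` of weighted order at most one vanish at the origin. -/
def IsLittleOOne {n : ℕ} (Λ : Fin n → ℚ) (R : GraphSpace n → ℂ) : Prop :=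
  ∀ (α β : Fin n → ℕ) (l : ℕ), (l : ℚ) + wlen Λ α β ≤ 1 → mixedDeriv α β l R 0 = 0

/-- `P` is `Λ`-homogeneous of weighted degree one and `Ψ = P(z, z̄) + o_Λ(1)`. -/
def IsLeading {n : ℕ} (Λ : Fin n → ℚ) (Ψ : GraphSpace n → ℝ) (P : ZPoly n) : Prop :=
  MvPolynomial.IsWeightedHomogeneous (Sum.elim Λ Λ) P 1 ∧
    IsLittleOOne Λ fun y => (Ψ y : ℂ) - P.value y.1

/-! ### Hypersurfaces and coordinates -/

/-- `M` is, near its point `p`, a smooth real hypersurface of `ℂⁿ⁺¹`. -/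
def IsSmoothHypersurfaceAt {n : ℕ} (M : Set (Fin (n + 1) → ℂ)) (p : Fin (n + 1) → ℂ) : Prop :=
  p ∈ M ∧ ∃ ρ : (Fin (n + 1) → ℂ) → ℝ, (∀ᶠ x in 𝓝 p, ContDiffAt ℝ ∞ ρ x) ∧
    fderiv ℝ ρ p ≠ 0 ∧ ∀ᶠ x in 𝓝 p, (x ∈ M ↔ ρ x = 0)

/-- `Φ = (z, w)` is a system of local holomorphic coordinates centered at `p`, in which `M` is the
graph `v = Ψ(z, z̄, u)` (with `w = u + √-1 v`) of a smooth function, tangent to `{v = 0}` at `p`. -/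
def IsCoord {n : ℕ} (M : Set (Fin (n + 1) → ℂ)) (p : Fin (n + 1) → ℂ)
    (Φ : (Fin (n + 1) → ℂ) → CoordSpace n) (Ψ : GraphSpace n → ℝ) : Prop :=
  AnalyticAt ℂ Φ p ∧ Φ p = 0 ∧ (fderiv ℂ Φ p).IsInvertible ∧
    (∀ᶠ y in 𝓝 (0 : GraphSpace n), ContDiffAt ℝ ∞ Ψ y) ∧ Ψ 0 = 0 ∧ fderiv ℝ Ψ 0 = 0 ∧
    ∀ᶠ x in 𝓝 p, (x ∈ M ↔ (Φ x).2.im = Ψ ((Φ x).1, (Φ x).2.re))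

/-- The coordinates `Φ` are `Λ`-adapted. -/
def IsAdapted {n : ℕ} (M : Set (Fin (n + 1) → ℂ)) (p : Fin (n + 1) → ℂ) (Λ : Fin n → ℚ)
    (Φ : (Fin (n + 1) → ℂ) → CoordSpace n) (Ψ : GraphSpace n → ℝ) : Prop :=
  IsCoord M p Φ Ψ ∧ ∃ P : ZPoly n, P ≠ 0 ∧ NoPluriharmonic P ∧ IsLeading Λ Ψ P

/-- Distinguished weights of `M` at `p`. -/
def IsDistinguished {n : ℕ} (M : Set (Fin (n + 1) → ℂ)) (p : Fin (n + 1) → ℂ)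
    (Λ : Fin n → ℚ) : Prop :=
  IsWeight Λ ∧ ∃ (Φ : (Fin (n + 1) → ℂ) → CoordSpace n) (Ψ : GraphSpace n → ℝ),
    IsAdapted M p Λ Φ Ψ

/-- `μ` is the multitype weight of `M` at `p`: distinguished weights exist, and `μ` is their
infimum, among all weights, for the lexicographic ordering. -/
def IsMultitypeWeight {n : ℕ} (M : Set (Fin (n + 1) → ℂ)) (p : Fin (n + 1) → ℂ)
    (μ : Fin n → ℚ) : Prop :=
  (∃ Λ, IsDistinguished M p Λ) ∧ IsWeight μ ∧
    (∀ Λ, IsDistinguished M p Λ → toLex μ ≤ toLex Λ) ∧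
    ∀ ν : Fin n → ℚ, IsWeight ν → (∀ Λ, IsDistinguished M p Λ → toLex ν ≤ toLex Λ) →
      toLex ν ≤ toLex μ

/-- `Φ'` arises from `Φ` by a map `z_i* = z_i + f_i(z, w)`, `w* = w + g(z, w)` with `Λ`-homogeneous
polynomials `f_i` of weighted degree `Λ i` and `g` of weighted degree one. The variable `none`
stands for `w`, of weight one. That the map is nonsingular and preserves the form
`v = Ψ(z, z̄, u)` is expressed by requiring `IsCoord` of `Φ'` wherever this is used. -/
def HomogeneousChange {n : ℕ} (Λ : Fin n → ℚ)
    (Φ Φ' : (Fin (n + 1) → ℂ) → CoordSpace n) : Prop :=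
  ∃ (f : Fin n → MvPolynomial (Option (Fin n)) ℂ) (g : MvPolynomial (Option (Fin n)) ℂ),
    (∀ i, MvPolynomial.IsWeightedHomogeneous (fun o : Option (Fin n) => o.elim 1 Λ) (f i) (Λ i)) ∧
    MvPolynomial.IsWeightedHomogeneous (fun o : Option (Fin n) => o.elim 1 Λ) g 1 ∧
    ∀ x, Φ' x =
      ((fun i => (Φ x).1 i + MvPolynomial.eval (fun o => o.elim (Φ x).2 (Φ x).1) (f i)),
        (Φ x).2 + MvPolynomial.eval (fun o => o.elim (Φ x).2 (Φ x).1) g)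

/-! ### The procedure -/

/-- What is known after the `j`-th step: the weight `Λ = Λ_j`, the current coordinates `Φ` with the
graph function `Ψ`, and the number `d = d_{j-1}` of variables whose multitype entries are not yet
determined. -/
structure Stage (n : ℕ) where
  Λ : Fin n → ℚ
  Φ : (Fin (n + 1) → ℂ) → CoordSpace n
  Ψ : GraphSpace n → ℝ
  d : ℕ

/-- The result of the first step: coordinates in which the lowest order homogeneous polynomial in
`z, z̄` of the defining function has no pluriharmonic terms, the constant weight `1/m` with `m` the
degree of this polynomial, and no entry determined yet (`d_0 = n`). -/
def IsInitial {n : ℕ} (M : Set (Fin (n + 1) → ℂ)) (p : Fin (n + 1) → ℂ) (S : Stage n) : Prop :=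
  S.d = n ∧ ∃ m : ℕ, 0 < m ∧ (S.Λ = fun _ => 1 / (m : ℚ)) ∧ IsAdapted M p S.Λ S.Φ S.Ψ

/-- The numbers of variables absent from the leading polynomial, over all `Λ`-homogeneous
transformations of the coordinates `Φ`. -/
def absentCounts {n : ℕ} (M : Set (Fin (n + 1) → ℂ)) (p : Fin (n + 1) → ℂ) (Λ : Fin n → ℚ)
    (Φ : (Fin (n + 1) → ℂ) → CoordSpace n) : Set ℕ :=
  {k | ∃ (Φ' : (Fin (n + 1) → ℂ) → CoordSpace n) (Ψ' : GraphSpace n → ℝ) (P : ZPoly n),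
    HomogeneousChange Λ Φ Φ' ∧ IsCoord M p Φ' Ψ' ∧ IsLeading Λ Ψ' P ∧ absentCount P = k}

/-- `Φ'` arises from the coordinates `Φ` by a `Λ`-homogeneous transformation for which the number of
variables absent from the leading polynomial is the largest possible, namely `d'`, the absent
variables being the last `d'` ones. -/
def IsOptimalChange {n : ℕ} (M : Set (Fin (n + 1) → ℂ)) (p : Fin (n + 1) → ℂ) (Λ : Fin n → ℚ)
    (Φ Φ' : (Fin (n + 1) → ℂ) → CoordSpace n) (Ψ' : GraphSpace n → ℝ) (d' : ℕ) : Prop :=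
  HomogeneousChange Λ Φ Φ' ∧ IsCoord M p Φ' Ψ' ∧ IsGreatest (absentCounts M p Λ Φ) d' ∧
    ∃ P : ZPoly n, IsLeading Λ Ψ' P ∧ ∀ i : Fin n, n ≤ (i : ℕ) + d' → IsAbsent P i

/-- `∑_{i ≤ n - d} (α_i + β_i) Λ_i` (indices counted from one). -/
def headLength {n : ℕ} (Λ : Fin n → ℚ) (d : ℕ) (α β : Fin n → ℕ) : ℚ :=
  ∑ i ∈ Finset.univ.filter (fun i : Fin n => (i : ℕ) + d < n), ((α i : ℚ) + (β i : ℚ)) * Λ i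

/-- `∑_{i > n - d} (α_i + β_i)` (indices counted from one). -/
def tailDegree {n : ℕ} (d : ℕ) (α β : Fin n → ℕ) : ℚ :=
  ∑ i ∈ Finset.univ.filter (fun i : Fin n => n ≤ (i : ℕ) + d), ((α i : ℚ) + (β i : ℚ))

/-- The set `Θ` of the multiindex pairs of weighted length larger than one that occur in the Taylor
series of `Ψ(z, z̄, 0)` and whose part in the first `n - d` variables has length less than one. -/
def Theta {n : ℕ} (Λ : Fin n → ℚ) (d : ℕ) (Ψ : GraphSpace n → ℝ) :
    Set ((Fin n → ℕ) × (Fin n → ℕ)) :=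
  {γ | 1 < wlen Λ γ.1 γ.2 ∧ taylorCoeff Ψ γ.1 γ.2 ≠ 0 ∧ headLength Λ d γ.1 γ.2 < 1}

/-- The ratio `W(α, β)`. -/
def ratioW {n : ℕ} (Λ : Fin n → ℚ) (d : ℕ) (γ : (Fin n → ℕ) × (Fin n → ℕ)) : ℚ :=
  (1 - headLength Λ d γ.1 γ.2) / tailDegree d γ.1 γ.2

/-- `Λ'` keeps the first `n - d` entries of `Λ`; its other entries are `max_Θ W`. -/
def IsNextWeight {n : ℕ} (Λ : Fin n → ℚ) (d : ℕ) (Ψ : GraphSpace n → ℝ) (Λ' : Fin n → ℚ) : Prop :=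
  (∀ i : Fin n, (i : ℕ) + d < n → Λ' i = Λ i) ∧
    ∀ i : Fin n, n ≤ (i : ℕ) + d → IsGreatest (ratioW Λ d '' Theta Λ d Ψ) (Λ' i)

/-- One further step of the procedure, performed as long as some entry is not determined. -/
def IsStep {n : ℕ} (M : Set (Fin (n + 1) → ℂ)) (p : Fin (n + 1) → ℂ) (S S' : Stage n) : Prop :=
  S.d ≠ 0 ∧ IsOptimalChange M p S.Λ S.Φ S'.Φ S'.Ψ S'.d ∧ IsNextWeight S.Λ S'.d S'.Ψ S'.Λ

/-- `S` is a possible outcome of the `j`-th step of the procedure. -/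
inductive Reaches {n : ℕ} (M : Set (Fin (n + 1) → ℂ)) (p : Fin (n + 1) → ℂ) :
    ℕ → Stage n → Prop
  | first (S : Stage n) : IsInitial M p S → Reaches M p 1 S
  | next (j : ℕ) (S S' : Stage n) : Reaches M p j S → IsStep M p S S' → Reaches M p (j + 1) S'

end Catlin

end

noncomputable section

namespace Catlin

/-! ### Wirtinger derivatives and Taylor polynomials of smooth functions -/

/-! Since all `μ i` are positive, the lexicographic infimum is attained
(`IsMultitypeWeight.isDistinguished`). Fix once and for all a `μ`-adapted system `Φs` with leading
polynomial `Ps` (`IsMinimalSystem`). The coordinates occurring in the procedure are compared with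
this one system through the transition map `F` from them to `Φs`.

Weights are handled through anisotropic dilations: a leading polynomial is the limit of the rescaled
graph function (`isLeading_iff_wlim`), and such limits can be composed. If no component of `F` has
terms of weight below that of its variable (`IsSuperHom`), then its homogeneous part is again a
local biholomorphism, and with `z`-part `A` and last component `g` it relates the leading
polynomials by `P'(A(z)) = c P(z) + Im g(z)` (`IsTransition.exists_pull_eq`).

The heart is a rigidity statement, `IsMinimalSystem.rigidAt`. If `μ` drops after its first `h`
entries, no nonzero holomorphic vector field of negative weight in the first `h` variables
annihilates the part of `Ps` in these variables. If the field has a nonzero component in the last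
block of equal weights, that component is constant, so the polynomial flow straightens the field to
`∂/∂z_q`. The truncated leading polynomial then does not contain `z_q`, and the weights from `z_q`
on can be lowered, which gives a distinguished weight below `μ` (`IsMinimalSystem.false_of_absent`).
If there is no such component, one descends to a smaller `h`.

Let now `Λ` agree with `μ` in its first `k` entries and exceed it in the others. The derivation in
an absent variable is carried by `A` to a field of negative weight annihilating the truncation of
`Ps`. Hence the first `k` components of `A` do not depend on the absent variables
(`IsMinimalSystem.pderiv_eq_zero`), and a rank count bounds their number by `n - k`
(`IsMinimalSystem.absentCount_add_le`). Applying the homogeneous part of `F` as a change of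
coordinates attains this bound, so the maximum `d` is exactly `n - k`.

The tail of `Λ` may be lowered as far as the Taylor series allows without destroying
superhomogeneity (`IsMinimalSystem.exists_isSuperHom_tailWeight`). At the first value where it is
about to fail, all tail variables are absent, and rigidity excludes the offending monomial. The same
facts show that the maximal ratio is at least the next entry of `μ`, for otherwise too many
variables would be absent (`IsTracked.exists_next`). Thus the invariant `IsTracked` survives every
step. The weights decrease strictly, as long as entries are missing, inside the finite set of
weights above `μ` (`finite_setOf_isWeight`); so the procedure stops, and then all entries agree with
`μ`. The first step works because pluriharmonic terms cannot be removed to all orders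
(`exists_not_flat`, `IsMinimalSystem.exists_initial`). -/

/-- The variables `u` (`none`), `z_i` and `z̄_i` of functions on `GraphSpace n`. -/
abbrev GVar (n : ℕ) : Type := Option (Fin n ⊕ Fin n)

/-- The values of the variables `u, z, z̄` at a point. -/
def gcoord {n : ℕ} (y : GraphSpace n) : GVar n → ℂ := fun o =>
  o.elim (y.2 : ℂ) (Sum.elim y.1 fun i => starRingEnd ℂ (y.1 i))

/-- The derivations `∂/∂u`, `∂/∂z_i` and `∂/∂z̄_i`. -/
def wder {n : ℕ} : GVar n → (GraphSpace n → ℂ) → GraphSpace n → ℂ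
  | none => du
  | some (Sum.inl i) => dz i
  | some (Sum.inr i) => dzbar i

/-- Writing every Wirtinger derivation as a complex combination of two real directional derivatives
lets the proofs below treat `∂/∂u`, `∂/∂z_i` and `∂/∂z̄_i` uniformly. The second clause is the
duality with the coordinate functions. -/
lemma exists_wder_eq {n : ℕ} (o : GVar n) :
    ∃ (a b : ℂ) (v v' : GraphSpace n),
      (∀ f y, wder o f y = a * fderiv ℝ f y v + b * fderiv ℝ f y v') ∧
      ∀ o', a * gcoord v o' + b * gcoord v' o' = if o = o' then 1 else 0 := by
  have key : ∀ i j : Fin n, (Pi.single i (1 : ℂ) : Fin n → ℂ) j = if i = j then 1 else 0 := by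
    intro i j; simp [Pi.single_apply, eq_comm]
  have key' : ∀ i j : Fin n, (Pi.single i Complex.I : Fin n → ℂ) j = if i = j then Complex.I else 0 := by
    intro i j; simp [Pi.single_apply, eq_comm]
  rcases o with _ | i | i
  · refine ⟨1, 0, (0, 1), 0, fun f y => by simp [wder, du], ?_⟩
    rintro (_ | j | j) <;> simp [gcoord]
  · refine ⟨1 / 2, -Complex.I / 2, (Pi.single i 1, 0), (Pi.single i Complex.I, 0),
      fun f y => by simp [wder, dz]; ring, ?_⟩
    rintro (_ | j | j)
    · simp [gcoord]
    · by_cases h : i = j <;> simp [gcoord, key, key', h]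
      linear_combination (-1 / 2) * Complex.I_mul_I
    · by_cases h : i = j <;> simp [gcoord, key, key', h]
      linear_combination (1 / 2) * Complex.I_mul_I
  · refine ⟨1 / 2, Complex.I / 2, (Pi.single i 1, 0), (Pi.single i Complex.I, 0),
      fun f y => by simp [wder, dzbar]; ring, ?_⟩
    rintro (_ | j | j)
    · simp [gcoord]
    · by_cases h : i = j <;> simp [gcoord, key, key', h]
      linear_combination (1 / 2) * Complex.I_mul_I
    · by_cases h : i = j <;> simp [gcoord, key, key', h]
      linear_combination (-1 / 2) * Complex.I_mul_I

/-- The real differential is recovered from the Wirtinger derivatives. This is what allows estimates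
on `wder` to be integrated. -/
lemma fderiv_eq_sum_wder {n : ℕ} (f : GraphSpace n → ℂ) (y v : GraphSpace n) :
    fderiv ℝ f y v = ∑ o, gcoord v o * wder o f y := by
  set A := fderiv ℝ f y with hA
  have h1 : v = ∑ i, ((v.1 i).re • ((Pi.single i 1, 0) : GraphSpace n)
      + (v.1 i).im • ((Pi.single i Complex.I, 0) : GraphSpace n)) + v.2 • ((0, 1) : GraphSpace n) := by
    refine Prod.ext ?_ ?_
    · ext j
      simp only [Prod.fst_add, Prod.fst_sum, Prod.smul_fst, Pi.add_apply, Finset.sum_apply,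
        Pi.smul_apply, Pi.single_apply]
      rw [Finset.sum_eq_single j (by intro b _ hb; simp [hb.symm]) (by simp)]
      simp
    · simp [Prod.snd_sum]
  have h2 : A v = ∑ i, ((v.1 i).re • A (Pi.single i 1, 0)
      + (v.1 i).im • A (Pi.single i Complex.I, 0)) + v.2 • A (0, 1) := by
    conv_lhs => rw [h1]
    simp only [map_add, map_sum, map_smul]
  rw [h2, Fintype.sum_option, Fintype.sum_sum_type, add_comm, ← Finset.sum_add_distrib]
  congr 1
  refine Finset.sum_congr rfl fun i _ => ?_
  simp only [gcoord, wder, dz, dzbar, Option.elim, Sum.elim_inl, Sum.elim_inr, ← hA,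
    Complex.real_smul]
  have e1 : v.1 i = (v.1 i).re + (v.1 i).im * Complex.I := (Complex.re_add_im _).symm
  have e2 : (starRingEnd ℂ) (v.1 i) = (v.1 i).re - (v.1 i).im * Complex.I := by
    apply Complex.ext <;> simp
  rw [e2, e1]
  simp only [Complex.add_re, Complex.ofReal_re, Complex.mul_re, Complex.I_re, mul_zero,
    Complex.ofReal_im, Complex.I_im, mul_one, sub_self, add_zero, Complex.add_im, Complex.mul_im,
    zero_add]
  linear_combination ((v.1 i).im * A (Pi.single i Complex.I, 0)) * Complex.I_mul_I

lemma norm_gcoord_le {n : ℕ} (v : GraphSpace n) (o : GVar n) : ‖gcoord v o‖ ≤ ‖v‖ := by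
  rcases o with _ | i | i
  · simpa [gcoord] using norm_snd_le v
  · exact (norm_le_pi_norm v.1 i).trans (norm_fst_le v)
  · simpa [gcoord] using (norm_le_pi_norm v.1 i).trans (norm_fst_le v)

lemma norm_fderiv_le_sum_wder {n : ℕ} (f : GraphSpace n → ℂ) (y : GraphSpace n) :
    ‖fderiv ℝ f y‖ ≤ ∑ o, ‖wder o f y‖ := by
  refine ContinuousLinearMap.opNorm_le_bound _ (Finset.sum_nonneg fun _ _ => norm_nonneg _) ?_
  intro v
  rw [fderiv_eq_sum_wder, Finset.sum_mul]
  refine (norm_sum_le _ _).trans (Finset.sum_le_sum fun o _ => ?_)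
  rw [norm_mul, mul_comm]
  gcongr
  exact norm_gcoord_le v o

/-- The composition of the derivations in the list `L`, with the multiplicities `γ`. -/
def iterDer {n : ℕ} (γ : GVar n →₀ ℕ) (L : List (GVar n)) (f : GraphSpace n → ℂ) :
    GraphSpace n → ℂ :=
  L.foldr (fun o h => (wder o)^[γ o] h) f

/-- All variables, in the order of `mixedDeriv`. -/
def varList (n : ℕ) : List (GVar n) :=
  (List.finRange n).map (fun i => some (Sum.inl i)) ++
    ((List.finRange n).map (fun i => some (Sum.inr i)) ++ [none])

lemma mem_varList {n : ℕ} (o : GVar n) : o ∈ varList n := by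
  rcases o with _ | i | i <;> simp [varList]

lemma nodup_varList (n : ℕ) : (varList n).Nodup := by
  have h1 : ((List.finRange n).map (fun i => (some (Sum.inl i) : GVar n))).Nodup :=
    (List.nodup_finRange n).map fun a b h => by simpa using h
  have h2 : ((List.finRange n).map (fun i => (some (Sum.inr i) : GVar n))).Nodup :=
    (List.nodup_finRange n).map fun a b h => by simpa using h
  refine List.nodup_append'.2 ⟨h1, List.nodup_append'.2 ⟨h2, by simp, ?_⟩, ?_⟩
  · intro a ha hb
    simp only [List.mem_map, List.mem_singleton] at ha hb
    obtain ⟨i, -, rfl⟩ := ha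
    simp at hb
  · intro a ha hb
    simp only [List.mem_map, List.mem_append, List.mem_singleton] at ha hb
    obtain ⟨i, -, rfl⟩ := ha
    simp at hb

/-- The exponent of `z^α z̄^β u^l`. -/
def gexp {n : ℕ} (α β : Fin n → ℕ) (l : ℕ) : GVar n →₀ ℕ :=
  Finsupp.equivFunOnFinite.symm fun o => o.elim l (Sum.elim α β)

@[simp] lemma gexp_none {n : ℕ} (α β : Fin n → ℕ) (l : ℕ) : gexp α β l none = l := rfl
@[simp] lemma gexp_inl {n : ℕ} (α β : Fin n → ℕ) (l : ℕ) (i : Fin n) :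
    gexp α β l (some (Sum.inl i)) = α i := rfl
@[simp] lemma gexp_inr {n : ℕ} (α β : Fin n → ℕ) (l : ℕ) (i : Fin n) :
    gexp α β l (some (Sum.inr i)) = β i := rfl

lemma eq_gexp {n : ℕ} (γ : GVar n →₀ ℕ) :
    γ = gexp (fun i => γ (some (Sum.inl i))) (fun i => γ (some (Sum.inr i))) (γ none) := by
  ext o; rcases o with _ | i | i <;> rfl

lemma mixedDeriv_eq_iterDer {n : ℕ} (α β : Fin n → ℕ) (l : ℕ) (f : GraphSpace n → ℂ) :
    mixedDeriv α β l f = iterDer (gexp α β l) (varList n) f := by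
  simp only [mixedDeriv, iterDer, varList, List.foldr_append, List.foldr_map, List.foldr_cons,
    List.foldr_nil]
  rfl

lemma ContDiff.wder {n : ℕ} {f : GraphSpace n → ℂ} (hf : ContDiff ℝ ∞ f) (o : GVar n) :
    ContDiff ℝ ∞ (wder o f) := by
  obtain ⟨a, b, v, v', h, -⟩ := exists_wder_eq o
  have h' : Catlin.wder o f = fun y => a * fderiv ℝ f y v + b * fderiv ℝ f y v' := funext (h f)
  rw [h']
  have hd : ContDiff ℝ ∞ (fderiv ℝ f) := hf.fderiv_right (by simp)
  exact (contDiff_const.mul (hd.clm_apply contDiff_const)).add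
    (contDiff_const.mul (hd.clm_apply contDiff_const))

lemma wder_comm {n : ℕ} {f : GraphSpace n → ℂ} (hf : ContDiff ℝ ∞ f) (o o' : GVar n) :
    wder o (wder o' f) = wder o' (wder o f) := by
  obtain ⟨a, b, v, v', h, -⟩ := exists_wder_eq o
  obtain ⟨a', b', w, w', h', -⟩ := exists_wder_eq o'
  have hd : Differentiable ℝ (fderiv ℝ f) :=
    (hf.fderiv_right (m := 1) (by norm_cast)).differentiable (by simp)
  have e1 : wder o f = fun y => a * fderiv ℝ f y v + b * fderiv ℝ f y v' := funext (h f)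
  have e2 : wder o' f = fun y => a' * fderiv ℝ f y w + b' * fderiv ℝ f y w' := funext (h' f)
  have hs : ∀ y s t, fderiv ℝ (fderiv ℝ f) y s t = fderiv ℝ (fderiv ℝ f) y t s := fun y s t =>
    second_derivative_symmetric (𝕜 := ℝ) (fun y => (hf.differentiable (by simp) y).hasFDerivAt)
      (hd y).hasFDerivAt s t
  have e3 : ∀ (c d : ℂ) (s s' : GraphSpace n) (y t : GraphSpace n),
      fderiv ℝ (fun y => c * fderiv ℝ f y s + d * fderiv ℝ f y s') y t
        = c * fderiv ℝ (fderiv ℝ f) y t s + d * fderiv ℝ (fderiv ℝ f) y t s' := by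
    intro c d s s' y t
    have hc : ∀ s, HasFDerivAt (fun y => fderiv ℝ f y s)
        ((ContinuousLinearMap.apply ℝ ℂ s).comp (fderiv ℝ (fderiv ℝ f) y)) y := fun s =>
      (ContinuousLinearMap.apply ℝ ℂ s).hasFDerivAt.comp y (hd y).hasFDerivAt
    have hh : HasFDerivAt (fun y => c * fderiv ℝ f y s + d * fderiv ℝ f y s') _ y :=
      ((hc s).const_mul c).add ((hc s').const_mul d)
    rw [hh.fderiv]
    simp
  ext y
  rw [h, h', e1, e2, e3, e3, e3, e3, hs y v, hs y v', hs y v, hs y v']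
  ring

lemma ContDiff.wder_iterate {n : ℕ} {f : GraphSpace n → ℂ} (hf : ContDiff ℝ ∞ f) (o : GVar n)
    (k : ℕ) : ContDiff ℝ ∞ ((Catlin.wder o)^[k] f) := by
  induction k with
  | zero => exact hf
  | succ k ih => rw [Function.iterate_succ_apply']; exact ContDiff.wder ih o

lemma ContDiff.iterDer {n : ℕ} {f : GraphSpace n → ℂ} (hf : ContDiff ℝ ∞ f) (γ : GVar n →₀ ℕ)
    (L : List (GVar n)) : ContDiff ℝ ∞ (iterDer γ L f) := by
  induction L with
  | nil => exact hf
  | cons o L ih => exact ContDiff.wder_iterate ih o _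

lemma wder_iterate_comm {n : ℕ} {f : GraphSpace n → ℂ} (hf : ContDiff ℝ ∞ f) (o o' : GVar n)
    (k : ℕ) : (wder o)^[k] (wder o' f) = wder o' ((wder o)^[k] f) := by
  induction k with
  | zero => rfl
  | succ k ih =>
    rw [Function.iterate_succ_apply', Function.iterate_succ_apply', ih,
      wder_comm (ContDiff.wder_iterate hf o k)]

lemma iterDer_wder {n : ℕ} {f : GraphSpace n → ℂ} (hf : ContDiff ℝ ∞ f) (o : GVar n)
    (γ : GVar n →₀ ℕ) (L : List (GVar n)) :
    iterDer γ L (wder o f) = wder o (iterDer γ L f) := by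
  induction L with
  | nil => rfl
  | cons o' L ih =>
    change (wder o')^[γ o'] (iterDer γ L (wder o f)) = wder o ((wder o')^[γ o'] (iterDer γ L f))
    rw [ih, wder_iterate_comm (ContDiff.iterDer hf γ L)]

-- Derivations of smooth functions commute, so raising one multiplicity amounts to one derivative
-- applied outside, whatever the order fixed by the list.
open Classical in
lemma iterDer_add_single {n : ℕ} {f : GraphSpace n → ℂ} (hf : ContDiff ℝ ∞ f) (o : GVar n)
    (γ : GVar n →₀ ℕ) (L : List (GVar n)) (hL : L.Nodup) :
    iterDer (γ + Finsupp.single o 1) L f =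
      if o ∈ L then wder o (iterDer γ L f) else iterDer γ L f := by
  induction L with
  | nil => simp [iterDer]
  | cons o' L ih =>
    have ih := ih hL.of_cons
    change (wder o')^[(γ + Finsupp.single o 1 : GVar n →₀ ℕ) o'] (iterDer (γ + Finsupp.single o 1) L f) = _
    have hc : iterDer γ (o' :: L) f = (wder o')^[γ o'] (iterDer γ L f) := rfl
    rw [ih, hc]
    by_cases h : o = o'
    · subst h
      have hn : o ∉ L := (List.nodup_cons.1 hL).1
      simp [hn, Function.iterate_succ_apply']
    · have h1 : (γ + Finsupp.single o 1 : GVar n →₀ ℕ) o' = γ o' := by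
        simp [h]
      rw [h1]
      by_cases h2 : o ∈ L
      · simp only [h2, if_true, List.mem_cons, or_true]
        exact wder_iterate_comm (ContDiff.iterDer hf γ L) _ _ _
      · simp [h2, h]

/-- The mean value inequality on the segment from `0` to `y` gains one power of `‖y‖`. -/
lemma isBigO_of_fderiv {n : ℕ} {f : GraphSpace n → ℂ} (hf : ContDiff ℝ ∞ f) (h0 : f 0 = 0) (N : ℕ)
    (h : fderiv ℝ f =O[𝓝 0] fun y => ‖y‖ ^ N) : f =O[𝓝 0] fun y => ‖y‖ ^ (N + 1) := by
  obtain ⟨C, hCp, hC⟩ := h.exists_nonneg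
  replace hC := hC.bound
  obtain ⟨ε, hε, hb⟩ := Metric.eventually_nhds_iff_ball.1 hC
  refine Asymptotics.IsBigO.of_bound C ?_
  filter_upwards [Metric.ball_mem_nhds (0 : GraphSpace n) hε] with y hy
  have hseg : ∀ x ∈ segment ℝ 0 y, ‖fderiv ℝ f x‖ ≤ C * ‖y‖ ^ N := by
    intro x hx
    obtain ⟨θ, hθ, rfl⟩ := (segment_eq_image' ℝ (0 : GraphSpace n) y) ▸ hx
    have hn : ‖0 + θ • (y - 0)‖ ≤ ‖y‖ := by
      rw [zero_add, sub_zero, norm_smul, Real.norm_of_nonneg hθ.1]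
      exact mul_le_of_le_one_left (norm_nonneg _) hθ.2
    have hm : 0 + θ • (y - 0) ∈ Metric.ball (0 : GraphSpace n) ε := by
      rw [mem_ball_zero_iff] at hy ⊢
      exact hn.trans_lt hy
    have h1 := hb _ hm
    rw [norm_pow, norm_norm] at h1
    exact h1.trans (by gcongr)
  have := (convex_segment (0 : GraphSpace n) y).norm_image_sub_le_of_norm_fderiv_le
    (𝕜 := ℝ) (fun x _ => hf.differentiable (by simp) x) hseg (left_mem_segment ℝ 0 y)
    (right_mem_segment ℝ 0 y)
  rw [h0, sub_zero, sub_zero] at this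
  rw [norm_pow, norm_norm, pow_succ, ← mul_assoc]
  exact this

/-- Taylor's theorem by induction: the derivatives of `wder o f` up to order `N` are derivatives of
`f` up to order `N + 1`, so the differential of `f` is already small, and `isBigO_of_fderiv`
integrates this. -/
lemma isBigO_of_iterDer_eq_zero {n : ℕ} (N : ℕ) : ∀ {f : GraphSpace n → ℂ}, ContDiff ℝ ∞ f →
    (∀ γ : GVar n →₀ ℕ, γ.degree ≤ N → iterDer γ (varList n) f 0 = 0) →
    f =O[𝓝 0] fun y => ‖y‖ ^ (N + 1) := by
  classical
  induction N with
  | zero =>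
    intro f hf h
    have h0 : f 0 = 0 := by
      have := h 0 (by simp)
      simpa [iterDer, List.foldr_fixed] using this
    refine isBigO_of_fderiv hf h0 0 ?_
    simp only [pow_zero]
    exact ((hf.continuous_fderiv (by simp)).tendsto 0).isBigO_one ℝ
  | succ N ih =>
    intro f hf h
    have h0 : f 0 = 0 := by
      have := h 0 (by simp)
      simpa [iterDer, List.foldr_fixed] using this
    refine isBigO_of_fderiv hf h0 (N + 1) ?_
    have h1 : ∀ o, wder o f =O[𝓝 0] fun y => ‖y‖ ^ (N + 1) := by
      intro o
      refine ih (ContDiff.wder hf o) fun γ hγ => ?_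
      have := h (γ + Finsupp.single o 1) (by simp [map_add]; omega)
      rw [iterDer_add_single hf o γ _ (nodup_varList n), if_pos (mem_varList o)] at this
      rw [iterDer_wder hf, this]
    have h2 : (fun y => ∑ o, ‖wder o f y‖) =O[𝓝 0] fun y => ‖y‖ ^ (N + 1) :=
      Asymptotics.IsBigO.fun_sum fun o _ => (h1 o).norm_left
    refine Asymptotics.IsBigO.trans (Asymptotics.IsBigO.of_bound 1 ?_) h2
    filter_upwards with y
    rw [one_mul]
    exact (norm_fderiv_le_sum_wder f y).trans (le_abs_self _)

lemma contDiff_gcoord {n : ℕ} (o : GVar n) : ContDiff ℝ ∞ fun y : GraphSpace n => gcoord y o := by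
  rcases o with _ | i | i
  · exact Complex.ofRealCLM.contDiff.comp contDiff_snd
  · exact (contDiff_apply ℝ ℂ i).comp contDiff_fst
  · exact Complex.conjCLE.contDiff.comp ((contDiff_apply ℝ ℂ i).comp contDiff_fst)

lemma contDiff_eval_gcoord {n : ℕ} (p : MvPolynomial (GVar n) ℂ) :
    ContDiff ℝ ∞ fun y : GraphSpace n => MvPolynomial.eval (gcoord y) p := by
  induction p using MvPolynomial.induction_on with
  | C a => simpa using contDiff_const
  | add p q hp hq => simpa using hp.add hq
  | mul_X p o hp => simpa using hp.mul (contDiff_gcoord o)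

lemma wder_add {n : ℕ} {f g : GraphSpace n → ℂ} (hf : ContDiff ℝ ∞ f) (hg : ContDiff ℝ ∞ g)
    (o : GVar n) : wder o (fun y => f y + g y) = fun y => wder o f y + wder o g y := by
  obtain ⟨a, b, v, v', h, -⟩ := exists_wder_eq o
  ext y
  have : fderiv ℝ (fun y => f y + g y) y = fderiv ℝ f y + fderiv ℝ g y :=
    fderiv_add (hf.differentiable (by simp) y) (hg.differentiable (by simp) y)
  rw [h, h, h, this]
  simp
  ring

lemma wder_mul {n : ℕ} {f g : GraphSpace n → ℂ} (hf : ContDiff ℝ ∞ f) (hg : ContDiff ℝ ∞ g)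
    (o : GVar n) :
    wder o (fun y => f y * g y) = fun y => wder o f y * g y + f y * wder o g y := by
  obtain ⟨a, b, v, v', h, -⟩ := exists_wder_eq o
  ext y
  have : fderiv ℝ (fun y => f y * g y) y = f y • fderiv ℝ g y + g y • fderiv ℝ f y :=
    fderiv_mul (hf.differentiable (by simp) y) (hg.differentiable (by simp) y)
  rw [h, h, h, this]
  simp
  ring

lemma wder_const {n : ℕ} (c : ℂ) (o : GVar n) : wder o (fun _ => c) = fun _ => 0 := by
  obtain ⟨a, b, v, v', h, -⟩ := exists_wder_eq o
  ext y
  simp [h]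

lemma wder_gcoord {n : ℕ} (o o' : GVar n) :
    wder o (fun y => gcoord y o') = fun _ => if o = o' then 1 else 0 := by
  obtain ⟨a, b, v, v', h, h'⟩ := exists_wder_eq o
  have hl : ∃ L : GraphSpace n →L[ℝ] ℂ, (fun y => gcoord y o') = L := by
    rcases o' with _ | i | i
    · exact ⟨Complex.ofRealCLM.comp (ContinuousLinearMap.snd ℝ _ _), rfl⟩
    · exact ⟨(ContinuousLinearMap.proj i).comp (ContinuousLinearMap.fst ℝ _ _), rfl⟩
    · exact ⟨(Complex.conjCLE : ℂ →L[ℝ] ℂ).comp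
        ((ContinuousLinearMap.proj i).comp (ContinuousLinearMap.fst ℝ _ _)), rfl⟩
  obtain ⟨L, hL⟩ := hl
  ext y
  rw [h, hL, L.fderiv, ← hL]
  exact h' o'

lemma wder_eval {n : ℕ} (o : GVar n) (p : MvPolynomial (GVar n) ℂ) :
    wder o (fun y => MvPolynomial.eval (gcoord y) p) =
      fun y => MvPolynomial.eval (gcoord y) (MvPolynomial.pderiv o p) := by
  induction p using MvPolynomial.induction_on with
  | C a => simpa using wder_const a o
  | add p q hp hq =>
    simp only [map_add]
    rw [wder_add (contDiff_eval_gcoord p) (contDiff_eval_gcoord q), hp, hq]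
  | mul_X p o' hp =>
    simp only [map_mul, MvPolynomial.eval_X]
    rw [wder_mul (contDiff_eval_gcoord p) (contDiff_gcoord o'), hp, wder_gcoord]
    ext y
    rw [Derivation.leibniz, map_add, MvPolynomial.pderiv_X]
    by_cases h : o = o' <;> simp [h, eq_comm] <;> ring

/-- The derivation of polynomials corresponding to `iterDer`. -/
def iterPderiv {n : ℕ} (γ : GVar n →₀ ℕ) (L : List (GVar n)) (p : MvPolynomial (GVar n) ℂ) :
    MvPolynomial (GVar n) ℂ :=
  L.foldr (fun o h => (MvPolynomial.pderiv o)^[γ o] h) p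

lemma iterDer_eval {n : ℕ} (γ : GVar n →₀ ℕ) (L : List (GVar n)) (p : MvPolynomial (GVar n) ℂ) :
    iterDer γ L (fun y => MvPolynomial.eval (gcoord y) p) =
      fun y => MvPolynomial.eval (gcoord y) (iterPderiv γ L p) := by
  have hk : ∀ (o : GVar n) (k : ℕ) (p : MvPolynomial (GVar n) ℂ),
      (wder o)^[k] (fun y => MvPolynomial.eval (gcoord y) p) =
        fun y => MvPolynomial.eval (gcoord y) ((MvPolynomial.pderiv o)^[k] p) := by
    intro o k p
    induction k with
    | zero => rfl
    | succ k ih => rw [Function.iterate_succ_apply', ih, wder_eval, Function.iterate_succ_apply']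
  induction L with
  | nil => rfl
  | cons o L ih =>
    change (wder o)^[γ o] (iterDer γ L _) = _
    rw [ih, hk]
    rfl

/-- Splitting the exponent into `m` with `m o = 0` and a power `j` of the variable `o`, with
factorials on both sides, keeps the induction free of divisions. -/
lemma coeff_pderiv_iterate {σ : Type*} (o : σ) (k : ℕ) (p : MvPolynomial σ ℂ) (m : σ →₀ ℕ)
    (hm : m o = 0) (j : ℕ) :
    (j.factorial : ℂ) * MvPolynomial.coeff (m + Finsupp.single o j) ((MvPolynomial.pderiv o)^[k] p)
      = ((j + k).factorial : ℂ) * MvPolynomial.coeff (m + Finsupp.single o (j + k)) p := by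
  classical
  induction k generalizing j with
  | zero => simp
  | succ k ih =>
    rw [Function.iterate_succ_apply', MvPolynomial.coeff_pderiv]
    have e : m + Finsupp.single o j + Finsupp.single o 1 = m + Finsupp.single o (j + 1) := by
      rw [add_assoc, ← Finsupp.single_add]
    have := ih (j + 1)
    rw [e]
    simp only [Finsupp.add_apply, hm, Finsupp.single_eq_same, zero_add]
    rw [Nat.factorial_succ] at this
    push_cast at this
    rw [show j + (k + 1) = j + 1 + k by ring, ← this]
    ring

lemma coeff_iterPderiv {n : ℕ} (γ : GVar n →₀ ℕ) (L : List (GVar n)) (hL : L.Nodup)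
    (p : MvPolynomial (GVar n) ℂ) (m : GVar n →₀ ℕ) (hm : ∀ o ∈ L, m o = 0) :
    MvPolynomial.coeff m (iterPderiv γ L p) = (L.map fun o => ((γ o).factorial : ℂ)).prod *
      MvPolynomial.coeff (m + (L.map fun o => Finsupp.single o (γ o)).sum) p := by
  classical
  induction L generalizing m with
  | nil => simp [iterPderiv]
  | cons o L ih =>
    change MvPolynomial.coeff m ((MvPolynomial.pderiv o)^[γ o] (iterPderiv γ L p)) = _
    have h1 := coeff_pderiv_iterate o (γ o) (iterPderiv γ L p) m (hm o (by simp)) 0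
    simp only [Nat.factorial_zero, Nat.cast_one, one_mul, Finsupp.single_zero, add_zero,
      zero_add] at h1
    rw [h1, ih hL.of_cons]
    · simp [mul_assoc, add_assoc]
    · intro o' ho'
      have hne : o ≠ o' := fun h => (List.nodup_cons.1 hL).1 (h ▸ ho')
      simp [hm o' (by simp [ho']), hne]

/-- The product of the factorials of the entries of a multiindex. -/
def multiFact {n : ℕ} (γ : GVar n →₀ ℕ) : ℂ := ∏ o, ((γ o).factorial : ℂ)

lemma multiFact_ne_zero {n : ℕ} (γ : GVar n →₀ ℕ) : multiFact γ ≠ 0 :=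
  Finset.prod_ne_zero_iff.2 fun _ _ => by exact_mod_cast Nat.factorial_ne_zero _

lemma iterDer_eval_zero {n : ℕ} (γ : GVar n →₀ ℕ) (p : MvPolynomial (GVar n) ℂ) :
    iterDer γ (varList n) (fun y => MvPolynomial.eval (gcoord y) p) 0 =
      multiFact γ * MvPolynomial.coeff γ p := by
  classical
  have h0 : gcoord (0 : GraphSpace n) = 0 := by
    ext o; rcases o with _ | i | i <;> simp [gcoord]
  have hu : (varList n).toFinset = Finset.univ := by
    ext o; simp [mem_varList]
  rw [iterDer_eval]
  change MvPolynomial.eval (gcoord 0) _ = _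
  rw [h0, MvPolynomial.eval_zero, MvPolynomial.constantCoeff_eq,
    coeff_iterPderiv γ _ (nodup_varList n) p 0 (by simp), zero_add,
    ← List.prod_toFinset _ (nodup_varList n), ← List.sum_toFinset _ (nodup_varList n), hu,
    Finsupp.univ_sum_single]
  rfl

lemma iterDer_add {n : ℕ} {f g : GraphSpace n → ℂ} (hf : ContDiff ℝ ∞ f) (hg : ContDiff ℝ ∞ g)
    (γ : GVar n →₀ ℕ) (L : List (GVar n)) :
    iterDer γ L (fun y => f y + g y) = fun y => iterDer γ L f y + iterDer γ L g y := by
  have hk : ∀ (o : GVar n) (k : ℕ) {f g : GraphSpace n → ℂ}, ContDiff ℝ ∞ f → ContDiff ℝ ∞ g →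
      (wder o)^[k] (fun y => f y + g y) = fun y => (wder o)^[k] f y + (wder o)^[k] g y := by
    intro o k f g hf hg
    induction k with
    | zero => rfl
    | succ k ih =>
      simp only [Function.iterate_succ_apply']
      rw [ih, wder_add (ContDiff.wder_iterate hf o k) (ContDiff.wder_iterate hg o k)]
  induction L with
  | nil => rfl
  | cons o L ih =>
    change (wder o)^[γ o] (iterDer γ L _) = _
    rw [ih, hk o _ (ContDiff.iterDer hf γ L) (ContDiff.iterDer hg γ L)]
    rfl

lemma iterDer_congr {n : ℕ} {f g : GraphSpace n → ℂ} {y : GraphSpace n} (h : f =ᶠ[𝓝 y] g)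
    (γ : GVar n →₀ ℕ) (L : List (GVar n)) : iterDer γ L f =ᶠ[𝓝 y] iterDer γ L g := by
  have h1 : ∀ (o : GVar n) {f g : GraphSpace n → ℂ}, f =ᶠ[𝓝 y] g → wder o f =ᶠ[𝓝 y] wder o g := by
    intro o f g h
    obtain ⟨a, b, v, v', h', -⟩ := exists_wder_eq o
    filter_upwards [h.fderiv (𝕜 := ℝ)] with x hx
    rw [h', h', hx]
  have hk : ∀ (o : GVar n) (k : ℕ) {f g : GraphSpace n → ℂ}, f =ᶠ[𝓝 y] g →
      (wder o)^[k] f =ᶠ[𝓝 y] (wder o)^[k] g := by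
    intro o k f g h
    induction k with
    | zero => exact h
    | succ k ih => simp only [Function.iterate_succ_apply']; exact h1 o ih
  induction L with
  | nil => exact h
  | cons o L ih => exact hk o _ ih

/-- Smoothness in a neighbourhood of the origin. -/
def SmoothNear {n : ℕ} (f : GraphSpace n → ℂ) : Prop := ∀ᶠ y in 𝓝 0, ContDiffAt ℝ ∞ f y

/-- Multiplication by a bump function equal to one near the origin. The calculus rules above are
stated for globally smooth functions, and only germs matter. -/
lemma SmoothNear.exists_contDiff {n : ℕ} {f : GraphSpace n → ℂ} (hf : SmoothNear f) :
    ∃ g : GraphSpace n → ℂ, ContDiff ℝ ∞ g ∧ f =ᶠ[𝓝 0] g := by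
  obtain ⟨ε, hε, hb⟩ := Metric.eventually_nhds_iff_ball.1 hf
  let χ : ContDiffBump (0 : GraphSpace n) := ⟨ε / 4, ε / 2, by positivity, by linarith⟩
  refine ⟨fun y => (χ y : ℂ) * f y, ?_, ?_⟩
  · rw [contDiff_iff_contDiffAt]
    intro y
    by_cases hy : y ∈ Metric.ball (0 : GraphSpace n) ε
    · exact (Complex.ofRealCLM.contDiff.contDiffAt.comp y χ.contDiffAt).mul (hb y hy)
    · have hy' : y ∉ tsupport χ := by
        rw [χ.tsupport_eq]
        intro h
        apply hy
        rw [Metric.mem_closedBall] at h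
        rw [Metric.mem_ball]
        have : χ.rOut = ε / 2 := rfl
        linarith
      have h0 : (fun y => (χ y : ℂ) * f y) =ᶠ[𝓝 y] fun _ => 0 := by
        filter_upwards [notMem_tsupport_iff_eventuallyEq.1 hy'] with x hx
        simp [hx]
      exact contDiffAt_const.congr_of_eventuallyEq h0
  · filter_upwards [χ.eventuallyEq_one] with y hy
    simp [hy]

lemma SmoothNear.taylor {n : ℕ} {f : GraphSpace n → ℂ} (hf : SmoothNear f) (N : ℕ) :
    ∃ p : MvPolynomial (GVar n) ℂ,
      (∀ γ : GVar n →₀ ℕ, γ.degree ≤ N →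
        iterDer γ (varList n) f 0 = multiFact γ * MvPolynomial.coeff γ p) ∧
      (fun y => f y - MvPolynomial.eval (gcoord y) p) =O[𝓝 0] fun y => ‖y‖ ^ (N + 1) := by
  classical
  obtain ⟨g, hg, hfg⟩ := hf.exists_contDiff
  have hfin : {γ : GVar n →₀ ℕ | γ.degree ≤ N}.Finite := Finsupp.finite_of_degree_le N
  let p : MvPolynomial (GVar n) ℂ := ∑ γ ∈ hfin.toFinset,
    MvPolynomial.monomial γ (iterDer γ (varList n) g 0 / multiFact γ)
  have hp : ∀ γ : GVar n →₀ ℕ, γ.degree ≤ N →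
      multiFact γ * MvPolynomial.coeff γ p = iterDer γ (varList n) g 0 := by
    intro γ hγ
    rw [MvPolynomial.coeff_sum, Finset.sum_eq_single γ]
    · rw [MvPolynomial.coeff_monomial, if_pos rfl, mul_div_cancel₀ _ (multiFact_ne_zero γ)]
    · intro b _ hb
      rw [MvPolynomial.coeff_monomial, if_neg hb]
    · intro h; exact absurd (hfin.mem_toFinset.2 hγ) h
  refine ⟨p, fun γ hγ => ?_, ?_⟩
  · rw [hp γ hγ]; exact (iterDer_congr hfg γ _).eq_of_nhds
  · have h1 : (fun y => g y + MvPolynomial.eval (gcoord y) (-p)) =O[𝓝 0]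
        fun y => ‖y‖ ^ (N + 1) := by
      refine isBigO_of_iterDer_eq_zero N (hg.add (contDiff_eval_gcoord (-p))) fun γ hγ => ?_
      rw [iterDer_add hg (contDiff_eval_gcoord (-p))]
      change _ + iterDer γ (varList n) _ 0 = 0
      rw [iterDer_eval_zero, MvPolynomial.coeff_neg, mul_neg, hp γ hγ, add_neg_cancel]
    refine h1.congr' ?_ .rfl
    filter_upwards [hfg] with y hy
    simp [hy, sub_eq_add_neg]

lemma taylorCoeff_eq_iterDer {n : ℕ} (Ψ : GraphSpace n → ℝ) (α β : Fin n → ℕ) :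
    iterDer (gexp α β 0) (varList n) (fun y => (Ψ y : ℂ)) 0 =
      multiFact (gexp α β 0) * taylorCoeff Ψ α β := by
  have h : multiFact (gexp α β 0) =
      (∏ i, (Nat.factorial (α i) : ℂ)) * ∏ i, (Nat.factorial (β i) : ℂ) := by
    simp [multiFact, Fintype.prod_option]
  rw [taylorCoeff, mixedDeriv_eq_iterDer, h, mul_div_cancel₀]
  rw [← h]; exact multiFact_ne_zero _

/-! ### Dilations and weighted limits -/

/-- A space with finitely many complex coordinates and dilations acting on the coordinates with
positive weights. -/
structure Dilation (E σ : Type*) [NormedAddCommGroup E] where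
  coord : E → σ → ℂ
  w : σ → ℚ
  D : ℝ → E → E
  ε : ℚ
  ε_pos : 0 < ε
  isInducing : IsInducing coord
  coord_D : ∀ s x i, coord (D s x) i = ((s ^ (w i : ℝ) : ℝ) : ℂ) * coord x i
  D_D_inv : ∀ s x, 0 < s → D s (D s⁻¹ x) = x
  norm_D : ∀ s x, 0 < s → s ≤ 1 → ‖D s x‖ ≤ s ^ (ε : ℝ) * ‖x‖
  eq_zero : ∀ p : MvPolynomial σ ℂ, (∀ x, MvPolynomial.eval (coord x) p = 0) → p = 0

/-- `f (D s x) / s ^ ρ` converges to `f₀ x` as `s → 0`, locally uniformly in `x`. -/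
def WLim {E σ : Type*} [NormedAddCommGroup E] (δ : Dilation E σ) (ρ : ℚ) (f f₀ : E → ℂ) : Prop :=
  ∀ x₀, Tendsto (fun q : ℝ × E => (((q.1 ^ (ρ : ℝ))⁻¹ : ℝ) : ℂ) * f (δ.D q.1 q.2))
    (𝓝[>] 0 ×ˢ 𝓝 x₀) (𝓝 (f₀ x₀))

/-- `D s⁻¹ (F (D s x))` converges to `F₀ x` as `s → 0`, locally uniformly in `x`. -/
def DLim {E σ E' σ' : Type*} [NormedAddCommGroup E] [NormedAddCommGroup E'] (δ : Dilation E σ)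
    (δ' : Dilation E' σ') (F F₀ : E → E') : Prop :=
  ∀ x₀, Tendsto (fun q : ℝ × E => δ'.D q.1⁻¹ (F (δ.D q.1 q.2))) (𝓝[>] 0 ×ˢ 𝓝 x₀) (𝓝 (F₀ x₀))

lemma tendsto_rpow_nhdsGT_zero {r : ℝ} (hr : 0 < r) :
    Tendsto (fun s : ℝ => s ^ r) (𝓝[>] 0) (𝓝 0) := by
  have : Tendsto (fun s : ℝ => s ^ r) (𝓝 0) (𝓝 ((0 : ℝ) ^ r)) :=
    (Real.continuousAt_rpow_const 0 r (Or.inr hr.le)).tendsto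
  rw [Real.zero_rpow hr.ne'] at this
  exact this.mono_left nhdsWithin_le_nhds

lemma eventually_pos_fst {E : Type*} (l : Filter E) : ∀ᶠ q : ℝ × E in 𝓝[>] 0 ×ˢ l, 0 < q.1 :=
  tendsto_fst.eventually (eventually_mem_nhdsWithin : ∀ᶠ s : ℝ in 𝓝[>] 0, 0 < s)

/-! ### Calculus of weighted limits. -/

section WLim

variable {E σ E' σ' E'' σ'' : Type*} [NormedAddCommGroup E] [NormedAddCommGroup E']
  [NormedAddCommGroup E''] {δ : Dilation E σ} {δ' : Dilation E' σ'} {δ'' : Dilation E'' σ''}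
  {ρ ρ' : ℚ} {f g f₀ g₀ : E → ℂ}

/-- Dilations contract to the origin locally uniformly; hence weighted limits depend only on germs.
-/
lemma Dilation.tendsto_D (δ : Dilation E σ) (x₀ : E) :
    Tendsto (fun q : ℝ × E => δ.D q.1 q.2) (𝓝[>] 0 ×ˢ 𝓝 x₀) (𝓝 0) := by
  have h1 : Tendsto (fun q : ℝ × E => q.1 ^ (δ.ε : ℝ) * ‖q.2‖) (𝓝[>] 0 ×ˢ 𝓝 x₀) (𝓝 (0 * ‖x₀‖)) :=
    ((tendsto_rpow_nhdsGT_zero (by exact_mod_cast δ.ε_pos)).comp tendsto_fst).mul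
      ((continuous_norm.tendsto x₀).comp tendsto_snd)
  rw [zero_mul] at h1
  refine squeeze_zero_norm' ?_ h1
  have h2 : ∀ᶠ q : ℝ × E in 𝓝[>] 0 ×ˢ 𝓝 x₀, q.1 < 1 :=
    tendsto_fst.eventually ((eventually_lt_nhds zero_lt_one).filter_mono nhdsWithin_le_nhds)
  filter_upwards [h2, eventually_pos_fst _] with q h1 h0
  exact δ.norm_D _ _ h0 h1.le

lemma WLim.unique (h : WLim δ ρ f f₀) (h' : WLim δ ρ f g₀) : f₀ = g₀ :=
  funext fun x => tendsto_nhds_unique (h x) (h' x)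

lemma WLim.congr (h : WLim δ ρ f f₀) (hfg : f =ᶠ[𝓝 0] g) : WLim δ ρ g f₀ := fun x => by
  refine (h x).congr' ?_
  filter_upwards [(δ.tendsto_D x).eventually hfg] with q hq
  rw [hq]

lemma WLim.zero : WLim δ ρ (fun _ => 0) (fun _ => 0) := fun x => by
  simp

lemma WLim.add (h : WLim δ ρ f f₀) (h' : WLim δ ρ g g₀) :
    WLim δ ρ (fun x => f x + g x) (fun x => f₀ x + g₀ x) := fun x => by
  simpa only [mul_add] using (h x).add (h' x)

lemma WLim.const_mul (h : WLim δ ρ f f₀) (c : ℂ) :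
    WLim δ ρ (fun x => c * f x) (fun x => c * f₀ x) := fun x => by
  simpa only [mul_left_comm] using (h x).const_mul c

lemma WLim.sub (h : WLim δ ρ f f₀) (h' : WLim δ ρ g g₀) :
    WLim δ ρ (fun x => f x - g x) (fun x => f₀ x - g₀ x) := fun x => by
  simpa only [mul_sub] using (h x).sub (h' x)

lemma WLim.sum {ι : Type*} (s : Finset ι) {f f₀ : ι → E → ℂ} (h : ∀ i ∈ s, WLim δ ρ (f i) (f₀ i)) :
    WLim δ ρ (fun x => ∑ i ∈ s, f i x) (fun x => ∑ i ∈ s, f₀ i x) := fun x => by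
  simpa only [Finset.mul_sum] using tendsto_finsetSum s fun i hi => h i hi x

lemma WLim.im (h : WLim δ ρ f f₀) :
    WLim δ ρ (fun x => ((f x).im : ℂ)) (fun x => ((f₀ x).im : ℂ)) := fun x => by
  have := (Complex.continuous_ofReal.tendsto _).comp ((Complex.continuous_im.tendsto _).comp (h x))
  refine this.congr fun q => ?_
  simp

lemma WLim.re (h : WLim δ ρ f f₀) :
    WLim δ ρ (fun x => ((f x).re : ℂ)) (fun x => ((f₀ x).re : ℂ)) := fun x => by
  have := (Complex.continuous_ofReal.tendsto _).comp ((Complex.continuous_re.tendsto _).comp (h x))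
  refine this.congr fun q => ?_
  simp

lemma WLim.conj (h : WLim δ ρ f f₀) :
    WLim δ ρ (fun x => starRingEnd ℂ (f x)) (fun x => starRingEnd ℂ (f₀ x)) := fun x => by
  have := (Complex.continuous_conj.tendsto _).comp (h x)
  refine this.congr fun q => ?_
  simp

lemma WLim.of_lt (h : WLim δ ρ f f₀) (hρ : ρ' < ρ) : WLim δ ρ' f fun _ => 0 := fun x => by
  have h1 : Tendsto (fun q : ℝ × E => ((q.1 ^ ((ρ : ℝ) - ρ') : ℝ) : ℂ)) (𝓝[>] 0 ×ˢ 𝓝 x)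
      (𝓝 ((0 : ℝ) : ℂ)) :=
    (Complex.continuous_ofReal.tendsto _).comp
      ((tendsto_rpow_nhdsGT_zero (by rw [sub_pos]; exact_mod_cast hρ)).comp tendsto_fst)
  have h2 := h1.mul (h x)
  simp only [Complex.ofReal_zero, zero_mul] at h2
  refine h2.congr' ?_
  filter_upwards [eventually_pos_fst _] with q hq
  rw [← mul_assoc, ← Complex.ofReal_mul, Real.rpow_sub hq]
  congr 2
  have : q.1 ^ (ρ : ℝ) ≠ 0 := (Real.rpow_pos_of_pos hq _).ne'
  field_simp

/-- Multiplication with a function tending to zero. -/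
lemma WLim.mul_tendsto_zero (h : WLim δ ρ f f₀)
    (hg : Tendsto g (𝓝 0) (𝓝 0)) : WLim δ ρ (fun x => g x * f x) fun _ => 0 := fun x => by
  have h2 := (hg.comp (δ.tendsto_D x)).mul (h x)
  rw [zero_mul] at h2
  refine h2.congr fun q => ?_
  simp only [Function.comp]
  ring

/-- Write `F (D s x)` as `D s` applied to `D s⁻¹ (F (D s x))`. The inner points converge but move
with `s`, which is why limits are taken jointly in `(s, x)`. -/
lemma WLim.comp {F F₀ : E → E'} {f f₀ : E' → ℂ} (h : WLim δ' ρ f f₀) (hF : DLim δ δ' F F₀) :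
    WLim δ ρ (fun x => f (F x)) (fun x => f₀ (F₀ x)) := fun x => by
  have h1 : Tendsto (fun q : ℝ × E => (q.1, δ'.D q.1⁻¹ (F (δ.D q.1 q.2)))) (𝓝[>] 0 ×ˢ 𝓝 x)
      (𝓝[>] 0 ×ˢ 𝓝 (F₀ x)) := tendsto_fst.prodMk (hF x)
  refine ((h (F₀ x)).comp h1).congr' ?_
  filter_upwards [eventually_pos_fst _] with q hq
  simp only [Function.comp]
  rw [δ'.D_D_inv _ _ hq]

lemma DLim.comp {F F₀ : E → E'} {G G₀ : E' → E''} (hG : DLim δ' δ'' G G₀) (hF : DLim δ δ' F F₀) :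
    DLim δ δ'' (fun x => G (F x)) (fun x => G₀ (F₀ x)) := fun x => by
  have h1 : Tendsto (fun q : ℝ × E => (q.1, δ'.D q.1⁻¹ (F (δ.D q.1 q.2)))) (𝓝[>] 0 ×ˢ 𝓝 x)
      (𝓝[>] 0 ×ˢ 𝓝 (F₀ x)) := tendsto_fst.prodMk (hF x)
  refine ((hG (F₀ x)).comp h1).congr' ?_
  filter_upwards [eventually_pos_fst _] with q hq
  simp only [Function.comp]
  rw [δ'.D_D_inv _ _ hq]

lemma DLim.of_coord {F F₀ : E → E'}
    (h : ∀ i, WLim δ (δ'.w i) (fun x => δ'.coord (F x) i) (fun x => δ'.coord (F₀ x) i)) :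
    DLim δ δ' F F₀ := fun x => by
  rw [δ'.isInducing.nhds_eq_comap, tendsto_comap_iff, tendsto_pi_nhds]
  intro i
  refine (h i x).congr' ?_
  filter_upwards [eventually_pos_fst _] with q hq
  simp only [Function.comp]
  rw [δ'.coord_D, Real.inv_rpow hq.le]

lemma wlim_coord (i : σ) : WLim δ (δ.w i) (fun x => δ.coord x i) (fun x => δ.coord x i) := fun x => by
  have h1 : Tendsto (fun q : ℝ × E => δ.coord q.2 i) (𝓝[>] 0 ×ˢ 𝓝 x) (𝓝 (δ.coord x i)) :=
    (((continuous_apply i).comp δ.isInducing.continuous).tendsto x).comp tendsto_snd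
  refine h1.congr' ?_
  filter_upwards [eventually_pos_fst _] with q hq
  rw [δ.coord_D, ← mul_assoc, ← Complex.ofReal_mul,
    inv_mul_cancel₀ (Real.rpow_pos_of_pos hq _).ne', Complex.ofReal_one, one_mul]

lemma WLim.mul (h : WLim δ ρ f f₀) (h' : WLim δ ρ' g g₀) :
    WLim δ (ρ + ρ') (fun x => f x * g x) (fun x => f₀ x * g₀ x) := fun x => by
  refine ((h x).mul (h' x)).congr' ?_
  filter_upwards [eventually_pos_fst _] with q hq
  rw [Rat.cast_add, Real.rpow_add hq, mul_inv, Complex.ofReal_mul]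
  ring

lemma wlim_const (c : ℂ) : WLim δ 0 (fun _ => c) (fun _ => c) := fun x => by
  simp

lemma wlim_monomial (m : σ →₀ ℕ) (c : ℂ) :
    WLim δ (Finsupp.weight δ.w m) (fun x => MvPolynomial.eval (δ.coord x) (MvPolynomial.monomial m c))
      (fun x => MvPolynomial.eval (δ.coord x) (MvPolynomial.monomial m c)) := by
  classical
  induction m using Finsupp.induction_linear generalizing c with
  | zero => simpa using wlim_const c
  | add m m' h h' =>
    have := (h c).mul (h' 1)
    simpa [MvPolynomial.eval_monomial, Finsupp.prod_add_index', pow_add, mul_assoc] using this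
  | single i k =>
    have : WLim δ (k * δ.w i) (fun x => c * δ.coord x i ^ k) (fun x => c * δ.coord x i ^ k) := by
      have hk : WLim δ (k * δ.w i) (fun x => δ.coord x i ^ k) (fun x => δ.coord x i ^ k) := by
        induction k with
        | zero => simpa using wlim_const 1
        | succ k ih =>
          have := ih.mul (wlim_coord i)
          simpa [pow_succ, add_mul] using this
      exact hk.const_mul c
    simpa [MvPolynomial.eval_monomial, Finsupp.weight_apply] using this

open Classical in
lemma wlim_eval {p : MvPolynomial σ ℂ} (hp : ∀ m ∈ p.support, ρ ≤ Finsupp.weight δ.w m) :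
    WLim δ ρ (fun x => MvPolynomial.eval (δ.coord x) p)
      (fun x => MvPolynomial.eval (δ.coord x)
        (MvPolynomial.weightedHomogeneousComponent δ.w ρ p)) := by
  have h1 : ∀ m ∈ p.support, WLim δ ρ
      (fun x => MvPolynomial.eval (δ.coord x) (MvPolynomial.monomial m (MvPolynomial.coeff m p)))
      (fun x => if Finsupp.weight δ.w m = ρ then
        MvPolynomial.eval (δ.coord x) (MvPolynomial.monomial m (MvPolynomial.coeff m p)) else 0) := by
    intro m hm
    have := wlim_monomial (δ := δ) m (MvPolynomial.coeff m p)
    by_cases h : Finsupp.weight δ.w m = ρ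
    · simpa [h] using h ▸ this
    · simpa [h] using this.of_lt (lt_of_le_of_ne (hp m hm) (Ne.symm h))
  have h2 := WLim.sum p.support h1
  convert! h2 using 2 with x x
  · conv_lhs => rw [p.as_sum]
    rw [map_sum]
  · rw [MvPolynomial.weightedHomogeneousComponent_apply, map_sum, Finset.sum_filter]

/-- A dilation shrinks norms by at least the factor `s ^ ε`, so a function of order `N` has weight
at least `N ε`. -/
lemma WLim.of_isBigO {N : ℕ} (h : f =O[𝓝 0] fun x => ‖x‖ ^ N) (hN : ρ < N * δ.ε) :
    WLim δ ρ f fun _ => 0 := fun x => by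
  obtain ⟨C, hC⟩ := h.bound
  have h1 : Tendsto (fun q : ℝ × E => q.1 ^ ((N : ℝ) * δ.ε - ρ) * (|C| * ‖q.2‖ ^ N))
      (𝓝[>] 0 ×ˢ 𝓝 x) (𝓝 (0 * (|C| * ‖x‖ ^ N))) :=
    ((tendsto_rpow_nhdsGT_zero (by rw [sub_pos]; exact_mod_cast hN)).comp tendsto_fst).mul
      ((((continuous_norm.pow N).const_mul |C|).tendsto x).comp tendsto_snd)
  rw [zero_mul] at h1
  refine squeeze_zero_norm' ?_ h1
  have h2 : ∀ᶠ q : ℝ × E in 𝓝[>] 0 ×ˢ 𝓝 x, q.1 < 1 :=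
    tendsto_fst.eventually ((eventually_lt_nhds zero_lt_one).filter_mono nhdsWithin_le_nhds)
  filter_upwards [h2, eventually_pos_fst _, (δ.tendsto_D x).eventually hC] with q h1 h0 h
  rw [norm_pow, norm_norm] at h
  have h3 : ‖f (δ.D q.1 q.2)‖ ≤ |C| * (q.1 ^ (δ.ε : ℝ) * ‖q.2‖) ^ N :=
    h.trans (mul_le_mul (le_abs_self C) (by gcongr; exact δ.norm_D _ _ h0 h1.le) (by positivity)
      (abs_nonneg C))
  rw [norm_mul, Complex.norm_real, norm_inv, Real.norm_of_nonneg (Real.rpow_nonneg h0.le _),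
    Real.rpow_sub h0]
  have h4 : q.1 ^ ((N : ℝ) * δ.ε) = (q.1 ^ (δ.ε : ℝ)) ^ N := by
    rw [mul_comm, Real.rpow_mul h0.le, Real.rpow_natCast]
  rw [h4]
  have h5 : 0 < q.1 ^ (ρ : ℝ) := Real.rpow_pos_of_pos h0 _
  rw [inv_mul_le_iff₀ h5]
  refine h3.trans (le_of_eq ?_)
  rw [mul_pow]
  field_simp

/-- `p` is a Taylor polynomial of `f` of order `N`. -/
def IsApprox (δ : Dilation E σ) (N : ℕ) (f : E → ℂ) (p : MvPolynomial σ ℂ) : Prop :=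
  (fun x => f x - MvPolynomial.eval (δ.coord x) p) =O[𝓝 0] fun x => ‖x‖ ^ N

lemma IsApprox.wlim {N : ℕ} {p : MvPolynomial σ ℂ} (h : IsApprox δ N f p) (hN : ρ < N * δ.ε)
    (hp : ∀ m ∈ p.support, ρ ≤ Finsupp.weight δ.w m) :
    WLim δ ρ f (fun x => MvPolynomial.eval (δ.coord x)
        (MvPolynomial.weightedHomogeneousComponent δ.w ρ p)) := by
  have := (WLim.of_isBigO h hN).add (wlim_eval hp)
  simpa using this

/-- Terms of weight below `ρ` cannot hide: the part of least weight of the Taylor polynomial is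
itself a weighted limit, and it is nonzero. This is the source of most contradictions below. -/
lemma IsApprox.exists_lower {N : ℕ} {p : MvPolynomial σ ℂ} (h : IsApprox δ N f p)
    (hN : ρ < N * δ.ε) {m : σ →₀ ℕ} (hm : m ∈ p.support) (hmρ : Finsupp.weight δ.w m < ρ) :
    ∃ ρ' < ρ, ∃ m₀ ∈ p.support, Finsupp.weight δ.w m₀ = ρ' ∧ ∃ q : MvPolynomial σ ℂ, q ≠ 0 ∧
      q.IsWeightedHomogeneous δ.w ρ' ∧ WLim δ ρ' f fun x => MvPolynomial.eval (δ.coord x) q := by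
  classical
  obtain ⟨m₀, hm₀, hmin⟩ := p.support.exists_min_image (fun m => Finsupp.weight δ.w m) ⟨m, hm⟩
  have hlt : Finsupp.weight δ.w m₀ < ρ := (hmin m hm).trans_lt hmρ
  refine ⟨_, hlt, m₀, hm₀, rfl, _, ?_,
    MvPolynomial.weightedHomogeneousComponent_isWeightedHomogeneous _ p,
    h.wlim (hlt.trans hN) hmin⟩
  intro h0
  have := congrArg (MvPolynomial.coeff m₀) h0
  rw [MvPolynomial.coeff_weightedHomogeneousComponent, if_pos rfl] at this
  exact MvPolynomial.mem_support_iff.1 hm₀ this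

/-- Otherwise the nonzero limit at a smaller weight, given by `IsApprox.exists_lower`, would have to
be zero by `WLim.of_lt`. -/
lemma IsApprox.le_weight {N : ℕ} {p : MvPolynomial σ ℂ} (h : IsApprox δ N f p)
    (hN : ρ < N * δ.ε) (hf : WLim δ ρ f f₀) : ∀ m ∈ p.support, ρ ≤ Finsupp.weight δ.w m := by
  intro m hm
  by_contra hlt
  obtain ⟨ρ', hρ', -, -, -, q, hq, -, hlim⟩ := h.exists_lower hN hm (not_le.1 hlt)
  have := hlim.unique (hf.of_lt hρ')
  exact hq (δ.eq_zero q fun x => congrFun this x)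

lemma IsApprox.wlim_component {N : ℕ} {p : MvPolynomial σ ℂ} (h : IsApprox δ N f p)
    (hN : ρ < N * δ.ε) (hf : WLim δ ρ f f₀) :
    f₀ = fun x => MvPolynomial.eval (δ.coord x)
        (MvPolynomial.weightedHomogeneousComponent δ.w ρ p) :=
  hf.unique (h.wlim hN (h.le_weight hN hf))

lemma wlim_eval_of_homogeneous {p : MvPolynomial σ ℂ} (hp : p.IsWeightedHomogeneous δ.w ρ) :
    WLim δ ρ (fun x => MvPolynomial.eval (δ.coord x) p)
      (fun x => MvPolynomial.eval (δ.coord x) p) := by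
  have := wlim_eval (δ := δ) (ρ := ρ) (p := p) fun m hm => (hp (MvPolynomial.mem_support_iff.1 hm)).ge
  rwa [hp.weightedHomogeneousComponent_same] at this

lemma exists_nat_mul_gt (δ : Dilation E σ) (ρ : ℚ) : ∃ N : ℕ, ρ < N * δ.ε := by
  obtain ⟨N, hN⟩ := exists_nat_gt (ρ / δ.ε)
  exact ⟨N, by rwa [div_lt_iff₀ δ.ε_pos] at hN⟩

end WLim

/-! ### The dilations of the spaces of coordinates and of parameters -/

/-- The weights of `w` (`none`) and of the `z_i`. -/
def hw {n : ℕ} (Λ : Fin n → ℚ) : Option (Fin n) → ℚ := fun o => o.elim 1 Λ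

/-- The weights of `u`, `z_i` and `z̄_i`. -/
def gw {n : ℕ} (Λ : Fin n → ℚ) : GVar n → ℚ := fun o => o.elim 1 (Sum.elim Λ Λ)

/-- The values of the variables `w` (`none`) and `z_i` at a point. -/
def hcoord {n : ℕ} (x : CoordSpace n) : Option (Fin n) → ℂ := fun o => o.elim x.2 x.1

/-- The smallest of the weights of `w` and the `z_i`. -/
def minWeight {n : ℕ} (Λ : Fin n → ℚ) : ℚ :=
  Finset.univ.inf' ⟨none, Finset.mem_univ _⟩ (hw Λ)

lemma minWeight_spec {n : ℕ} {Λ : Fin n → ℚ} (hΛ : ∀ i, 0 < Λ i) :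
    0 < minWeight Λ ∧ minWeight Λ ≤ 1 ∧ ∀ i, minWeight Λ ≤ Λ i := by
  refine ⟨?_, Finset.inf'_le (hw Λ) (Finset.mem_univ none),
    fun i => Finset.inf'_le (hw Λ) (Finset.mem_univ (some i))⟩
  refine (Finset.lt_inf'_iff _).2 fun o _ => ?_
  rcases o with _ | i
  · exact one_pos
  · exact hΛ i

lemma minWeight_mono {n : ℕ} {Λ Λ' : Fin n → ℚ} (h : ∀ i, Λ i ≤ Λ' i) :
    minWeight Λ ≤ minWeight Λ' := by
  refine Finset.inf'_mono_fun fun o _ => ?_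
  rcases o with _ | i
  · exact le_rfl
  · exact h i

lemma exists_le_weights {n : ℕ} {Λ : Fin n → ℚ} (hΛ : ∀ i, 0 < Λ i) :
    ∃ ε : ℚ, 0 < ε ∧ ε ≤ 1 ∧ ∀ i, ε ≤ Λ i :=
  ⟨_, minWeight_spec hΛ⟩

lemma isInducing_of_leftInverse {X Y : Type*} [TopologicalSpace X] [TopologicalSpace Y] {f : X → Y}
    {g : Y → X} (hf : Continuous f) (hg : Continuous g) (h : Function.LeftInverse g f) :
    IsInducing f := by
  refine (isInducing_iff_nhds).2 fun x => le_antisymm ?_ ?_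
  · exact tendsto_iff_comap.1 (hf.tendsto x)
  · have h1 := hg.tendsto (f x)
    rw [h x] at h1
    refine (comap_mono (tendsto_iff_comap.1 h1)).trans ?_
    rw [comap_comap]
    have : g ∘ f = id := funext h
    rw [this, comap_id]

lemma rpow_le_rpow_of_weight_le {s : ℝ} (h0 : 0 < s) (h1 : s ≤ 1) {ε r : ℚ} (h : ε ≤ r) :
    s ^ (r : ℝ) ≤ s ^ (ε : ℝ) :=
  Real.rpow_le_rpow_of_exponent_ge h0 h1 (by exact_mod_cast h)

lemma rpow_smul_rpow_inv_smul {s : ℝ} (hs : 0 < s) (r : ℝ) {V : Type*} [AddCommGroup V] [Module ℝ V]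
    (x : V) : s ^ r • (s⁻¹) ^ r • x = x := by
  rw [smul_smul, Real.inv_rpow hs.le, mul_inv_cancel₀ (Real.rpow_pos_of_pos hs _).ne', one_smul]

/-- The dilations of the space of coordinates `(z, w)`. -/
def hDil {n : ℕ} (Λ : Fin n → ℚ) (hΛ : ∀ i, 0 < Λ i) :
    Dilation (CoordSpace n) (Option (Fin n)) where
  coord := hcoord
  w := hw Λ
  D s x := (fun i => s ^ (Λ i : ℝ) • x.1 i, s • x.2)
  ε := minWeight Λ
  ε_pos := (minWeight_spec hΛ).1
  isInducing := by
    refine isInducing_of_leftInverse (g := fun c => (fun i => c (some i), c none)) ?_ ?_ fun x => rfl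
    · refine continuous_pi fun o => ?_
      rcases o with _ | i
      · exact continuous_snd
      · exact (continuous_apply i).comp continuous_fst
    · fun_prop
  coord_D s x o := by rcases o with _ | i <;> simp [hcoord, hw]
  D_D_inv s x hs := by
    refine Prod.ext (funext fun i => rpow_smul_rpow_inv_smul hs _ _) ?_
    change s • s⁻¹ • x.2 = x.2
    rw [smul_smul, mul_inv_cancel₀ hs.ne', one_smul]
  norm_D s x h0 h1 := by
    obtain ⟨-, hε1, hε⟩ := (minWeight_spec hΛ)
    have hp : 0 < s ^ (minWeight Λ : ℝ) := Real.rpow_pos_of_pos h0 _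
    refine max_le ((pi_norm_le_iff_of_nonneg (by positivity)).2 fun i => ?_) ?_
    · rw [norm_smul, Real.norm_of_nonneg (Real.rpow_nonneg h0.le _)]
      exact mul_le_mul (rpow_le_rpow_of_weight_le h0 h1 (hε i))
        ((norm_le_pi_norm x.1 i).trans (norm_fst_le x)) (norm_nonneg _) hp.le
    · change ‖s • x.2‖ ≤ _
      rw [norm_smul, Real.norm_of_nonneg h0.le]
      have := rpow_le_rpow_of_weight_le h0 h1 hε1
      rw [Rat.cast_one, Real.rpow_one] at this
      exact mul_le_mul this (norm_snd_le x) (norm_nonneg _) hp.le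
  eq_zero p hp := by
    refine MvPolynomial.funext fun c => ?_
    rw [map_zero]
    have := hp (fun i => c (some i), c none)
    convert! this using 2
    congr 1
    ext o
    rcases o with _ | i <;> rfl

/-- The variables `z` and `z̄` are algebraically independent as functions: the invertible
substitution `φ`, that is `z = x + i y` and `z̄ = x - i y`, reduces this to polynomials vanishing at
all real points. -/
lemma eq_zero_of_eval_gcoord {n : ℕ} (p : MvPolynomial (GVar n) ℂ)
    (hp : ∀ y, MvPolynomial.eval (gcoord y) p = 0) : p = 0 := by
  let φ : MvPolynomial (GVar n) ℂ →ₐ[ℂ] MvPolynomial (GVar n) ℂ :=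
    MvPolynomial.aeval fun o => o.elim (MvPolynomial.X none) (Sum.elim
      (fun i => MvPolynomial.X (some (Sum.inl i)) + MvPolynomial.C Complex.I * MvPolynomial.X (some (Sum.inr i)))
      (fun i => MvPolynomial.X (some (Sum.inl i)) - MvPolynomial.C Complex.I * MvPolynomial.X (some (Sum.inr i))))
  let ψ : MvPolynomial (GVar n) ℂ →ₐ[ℂ] MvPolynomial (GVar n) ℂ :=
    MvPolynomial.aeval fun o => o.elim (MvPolynomial.X none) (Sum.elim
      (fun i => MvPolynomial.C (1 / 2) * (MvPolynomial.X (some (Sum.inl i)) + MvPolynomial.X (some (Sum.inr i))))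
      (fun i => MvPolynomial.C (-Complex.I / 2) *
        (MvPolynomial.X (some (Sum.inl i)) - MvPolynomial.X (some (Sum.inr i)))))
  have hI : (MvPolynomial.C Complex.I : MvPolynomial (GVar n) ℂ) * MvPolynomial.C (-Complex.I / 2)
      = MvPolynomial.C (1 / 2) := by
    rw [← map_mul]; congr 1; linear_combination (-1 / 2) * Complex.I_mul_I
  have hh : (MvPolynomial.C (1 / 2) : MvPolynomial (GVar n) ℂ) + MvPolynomial.C (1 / 2) = 1 := by
    rw [← map_add, ← map_one MvPolynomial.C]; norm_num
  have hψφ : ψ.comp φ = AlgHom.id ℂ _ := by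
    refine MvPolynomial.algHom_ext fun o => ?_
    rcases o with _ | i | i
    · simp [φ, ψ]
    · simp only [φ, ψ, AlgHom.comp_apply, MvPolynomial.aeval_X, Option.elim, Sum.elim_inl, map_add,
        map_mul, Sum.elim_inr, MvPolynomial.algHom_C, AlgHom.id_apply, MvPolynomial.algebraMap_eq]
      linear_combination (MvPolynomial.X (some (Sum.inl i)) - MvPolynomial.X (some (Sum.inr i))) * hI
        + (MvPolynomial.X (some (Sum.inl i))) * hh
    · simp only [φ, ψ, AlgHom.comp_apply, MvPolynomial.aeval_X, Option.elim, Sum.elim_inl, map_sub,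
        map_mul, Sum.elim_inr, MvPolynomial.algHom_C, AlgHom.id_apply, MvPolynomial.algebraMap_eq]
      linear_combination (MvPolynomial.X (some (Sum.inr i)) - MvPolynomial.X (some (Sum.inl i))) * hI
        + (MvPolynomial.X (some (Sum.inr i))) * hh
  have h0 : φ p = 0 := by
    refine MvPolynomial.funext_set (fun _ => Set.range ((↑) : ℝ → ℂ))
      (fun _ => Set.infinite_range_of_injective Complex.ofReal_injective) fun x hx => ?_
    choose r hr using fun i => hx i (Set.mem_univ i)
    rw [map_zero, ← hp (fun i => x (some (Sum.inl i)) + Complex.I * x (some (Sum.inr i)), r none)]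
    have : (MvPolynomial.aeval x).comp φ = MvPolynomial.aeval (gcoord
        (fun i => x (some (Sum.inl i)) + Complex.I * x (some (Sum.inr i)), r none)) := by
      refine MvPolynomial.algHom_ext fun o => ?_
      rcases o with _ | i | i
      · simp [φ, gcoord, hr]
      · simp [φ, gcoord]
      · simp [φ, gcoord, ← hr, sub_eq_add_neg]
    exact DFunLike.congr_fun this p
  have := DFunLike.congr_fun hψφ p
  simpa [h0] using this.symm

/-- The dilations of the space of the parameters `(z, u)`. -/
def gDil {n : ℕ} (Λ : Fin n → ℚ) (hΛ : ∀ i, 0 < Λ i) : Dilation (GraphSpace n) (GVar n) where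
  coord := gcoord
  w := gw Λ
  D s y := (fun i => s ^ (Λ i : ℝ) • y.1 i, s * y.2)
  ε := minWeight Λ
  ε_pos := (minWeight_spec hΛ).1
  isInducing := by
    refine isInducing_of_leftInverse (g := fun c => (fun i => c (some (Sum.inl i)), (c none).re))
      ?_ ?_ fun x => rfl
    · exact continuous_pi fun o => (contDiff_gcoord o).continuous
    · fun_prop
  coord_D s x o := by rcases o with _ | i | i <;> simp [gcoord, gw]
  D_D_inv s x hs := by
    refine Prod.ext (funext fun i => rpow_smul_rpow_inv_smul hs _ _) ?_
    simp [← mul_assoc, mul_inv_cancel₀ hs.ne']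
  norm_D s x h0 h1 := by
    obtain ⟨-, hε1, hε⟩ := (minWeight_spec hΛ)
    have hp : 0 < s ^ (minWeight Λ : ℝ) := Real.rpow_pos_of_pos h0 _
    refine max_le ((pi_norm_le_iff_of_nonneg (by positivity)).2 fun i => ?_) ?_
    · rw [norm_smul, Real.norm_of_nonneg (Real.rpow_nonneg h0.le _)]
      exact mul_le_mul (rpow_le_rpow_of_weight_le h0 h1 (hε i))
        ((norm_le_pi_norm x.1 i).trans (norm_fst_le x)) (norm_nonneg _) hp.le
    · change ‖s * x.2‖ ≤ _
      rw [norm_mul, Real.norm_of_nonneg h0.le]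
      have := rpow_le_rpow_of_weight_le h0 h1 hε1
      rw [Rat.cast_one, Real.rpow_one] at this
      exact mul_le_mul this (norm_snd_le x) (norm_nonneg _) hp.le
  eq_zero := eq_zero_of_eval_gcoord

/-! ### Taylor polynomials of holomorphic functions -/

/-- Partial sums of the power series, expanded multilinearly in the coordinate basis. -/
lemma exists_isApprox_of_analyticAt {n : ℕ} {f : CoordSpace n → ℂ} (hf : AnalyticAt ℂ f 0) (N : ℕ)
    {Λ : Fin n → ℚ} (hΛ : ∀ i, 0 < Λ i) :
    ∃ p : MvPolynomial (Option (Fin n)) ℂ, IsApprox (hDil Λ hΛ) N f p := by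
  classical
  obtain ⟨P, hP⟩ := hf
  have h1 := hP.isBigO_sub_partialSum_pow N
  simp only [zero_add] at h1
  let e : Option (Fin n) → CoordSpace n := fun o => o.elim (0, 1) fun i => (Pi.single i 1, 0)
  have he : ∀ x : CoordSpace n, x = ∑ o, hcoord x o • e o := by
    intro x
    rw [Fintype.sum_option]
    refine Prod.ext ?_ ?_
    · ext j
      simp [e, hcoord, Prod.fst_sum, Finset.sum_apply, Pi.single_apply]
    · simp [e, hcoord, Prod.snd_sum]
  refine ⟨∑ k ∈ Finset.range N, ∑ r : Fin k → Option (Fin n),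
    MvPolynomial.C (P k fun j => e (r j)) * ∏ j, MvPolynomial.X (r j), ?_⟩
  refine h1.congr_left fun x => ?_
  congr 1
  change _ = MvPolynomial.eval (hcoord x) _
  rw [map_sum]
  refine Finset.sum_congr rfl fun k _ => ?_
  have h2 : (fun _ : Fin k => x) = fun _ => ∑ o, hcoord x o • e o := by
    funext _; exact he x
  rw [h2, map_sum]
  rw [ContinuousMultilinearMap.map_sum]
  refine Finset.sum_congr rfl fun r _ => ?_
  rw [ContinuousMultilinearMap.map_smul_univ]
  simp [mul_comm]

/-! ### Leading polynomials -/

/-- The exponent of `z^α z̄^β` in polynomials in `z, z̄`. -/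
def zexp {n : ℕ} (α β : Fin n → ℕ) : Fin n ⊕ Fin n →₀ ℕ :=
  Finsupp.equivFunOnFinite.symm (Sum.elim α β)

@[simp] lemma zexp_inl {n : ℕ} (α β : Fin n → ℕ) (i : Fin n) : zexp α β (Sum.inl i) = α i := rfl
@[simp] lemma zexp_inr {n : ℕ} (α β : Fin n → ℕ) (i : Fin n) : zexp α β (Sum.inr i) = β i := rfl

lemma eq_zexp {n : ℕ} (m : Fin n ⊕ Fin n →₀ ℕ) :
    m = zexp (fun i => m (Sum.inl i)) (fun i => m (Sum.inr i)) := by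
  ext o; rcases o with i | i <;> rfl

lemma weight_eq_sum {σ : Type*} [Fintype σ] (w : σ → ℚ) (m : σ →₀ ℕ) :
    Finsupp.weight w m = ∑ i, (m i : ℚ) * w i := by
  rw [Finsupp.weight_apply, Finsupp.sum_fintype _ _ (by simp)]
  simp

lemma weight_gexp {n : ℕ} (Λ : Fin n → ℚ) (α β : Fin n → ℕ) (l : ℕ) :
    Finsupp.weight (gw Λ) (gexp α β l) = l + wlen Λ α β := by
  rw [weight_eq_sum, Fintype.sum_option, Fintype.sum_sum_type, ← Finset.sum_add_distrib]
  simp [gw, wlen, add_mul]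

lemma weight_zexp {n : ℕ} (Λ : Fin n → ℚ) (α β : Fin n → ℕ) :
    Finsupp.weight (Sum.elim Λ Λ) (zexp α β) = wlen Λ α β := by
  rw [weight_eq_sum, Fintype.sum_sum_type, ← Finset.sum_add_distrib]
  simp [wlen, add_mul]

lemma mul_degree_le_weight {σ : Type*} [Fintype σ] {w : σ → ℚ} {ε : ℚ} (h : ∀ i, ε ≤ w i)
    (m : σ →₀ ℕ) : (m.degree : ℚ) * ε ≤ Finsupp.weight w m := by
  rw [weight_eq_sum, Finsupp.degree_eq_sum]
  push_cast
  rw [Finset.sum_mul]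
  gcongr with i _
  exact h i

lemma gexp_zero_eq {n : ℕ} (α β : Fin n → ℕ) :
    gexp α β 0 = Finsupp.mapDomain some (zexp α β) := by
  ext o
  rcases o with _ | o
  · rw [Finsupp.mapDomain_of_notMem_range _ _ (by simp)]; rfl
  · rw [Finsupp.mapDomain_apply (Option.some_injective _)]
    rcases o with i | i <;> rfl

lemma coeff_rename_gexp {n : ℕ} (P : ZPoly n) (α β : Fin n → ℕ) (l : ℕ) :
    MvPolynomial.coeff (gexp α β l) (MvPolynomial.rename some P : MvPolynomial (GVar n) ℂ) =
      if l = 0 then MvPolynomial.coeff (zexp α β) P else 0 := by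
  split_ifs with h
  · rw [h, gexp_zero_eq, MvPolynomial.coeff_rename_mapDomain _ (Option.some_injective _)]
  · refine MvPolynomial.coeff_rename_eq_zero _ _ _ fun m hm => ?_
    exfalso
    have := DFunLike.congr_fun hm none
    rw [Finsupp.mapDomain_of_notMem_range _ _ (by simp)] at this
    exact h this.symm

lemma eval_rename_some {n : ℕ} (P : ZPoly n) (y : GraphSpace n) :
    MvPolynomial.eval (gcoord y) (MvPolynomial.rename some P : MvPolynomial (GVar n) ℂ)
      = P.value y.1 := by
  rw [MvPolynomial.eval_rename]; rfl

lemma ZPoly.value_injective {n : ℕ} {P Q : ZPoly n} (h : ∀ z, P.value z = Q.value z) : P = Q := by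
  refine MvPolynomial.rename_injective _ (Option.some_injective _) (sub_eq_zero.1 ?_)
  refine eq_zero_of_eval_gcoord _ fun y => ?_
  rw [map_sub, eval_rename_some, eval_rename_some, h, sub_self]

/-- The properties of the graph functions `Ψ` of coordinate systems which do not refer to `M`. -/
def IsGraphFun {n : ℕ} (Ψ : GraphSpace n → ℝ) : Prop :=
  (∀ᶠ y in 𝓝 (0 : GraphSpace n), ContDiffAt ℝ ∞ Ψ y) ∧ Ψ 0 = 0 ∧ fderiv ℝ Ψ 0 = 0

lemma IsGraphFun.smoothNear {n : ℕ} {Ψ : GraphSpace n → ℝ} (h : IsGraphFun Ψ) :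
    SmoothNear fun y => (Ψ y : ℂ) :=
  h.1.mono fun _ hy => Complex.ofRealCLM.contDiff.contDiffAt.comp _ hy

/-- The bridge between the definition of `o_Λ(1)` by derivatives and the behaviour under dilations.
The latter composes well, so changes of coordinates are studied through it. -/
lemma isLeading_iff_wlim {n : ℕ} {Λ : Fin n → ℚ} (hΛ : ∀ i, 0 < Λ i) {Ψ : GraphSpace n → ℝ}
    (hΨ : IsGraphFun Ψ) (P : ZPoly n) :
    IsLeading Λ Ψ P ↔ MvPolynomial.IsWeightedHomogeneous (Sum.elim Λ Λ) P 1 ∧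
      WLim (gDil Λ hΛ) 1 (fun y => (Ψ y : ℂ)) (fun y => P.value y.1) := by
  classical
  refine and_congr_right fun hP => ?_
  have hPe : ∀ y : GraphSpace n, P.value y.1 = MvPolynomial.eval (gcoord y)
    (MvPolynomial.rename some P : MvPolynomial (GVar n) ℂ) := fun y => (eval_rename_some P y).symm
  have hPw : WLim (gDil Λ hΛ) 1 (fun y => P.value y.1) (fun y => P.value y.1) := by
    simp only [hPe]
    refine wlim_eval_of_homogeneous (δ := gDil Λ hΛ) ?_
    intro m hm
    rw [eq_gexp m, coeff_rename_gexp] at hm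
    rw [eq_gexp m]
    change Finsupp.weight (gw Λ) _ = 1
    split_ifs at hm with h
    · rw [weight_gexp, h, ← weight_zexp]
      simpa using hP hm
    · exact absurd rfl hm
  have hR : SmoothNear fun y => (Ψ y : ℂ) - P.value y.1 := by
    filter_upwards [hΨ.smoothNear] with y hy
    refine hy.sub ?_
    simp only [hPe]
    exact (contDiff_eval_gcoord _).contDiffAt
  obtain ⟨N, hN⟩ := exists_nat_mul_gt (gDil Λ hΛ) 1
  obtain ⟨p, hp, hO⟩ := hR.taylor N
  have hN' : 1 < ((N + 1 : ℕ) : ℚ) * (gDil Λ hΛ).ε := by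
    push_cast; nlinarith [(gDil Λ hΛ).ε_pos]
  have hA : IsApprox (gDil Λ hΛ) (N + 1) (fun y => (Ψ y : ℂ) - P.value y.1) p := hO
  -- As `N ε` exceeds one, a Taylor polynomial of order `N` sees every monomial of weight at most
  -- one.
  have hdeg : ∀ γ : GVar n →₀ ℕ, Finsupp.weight (gw Λ) γ ≤ 1 → γ.degree ≤ N := by
    intro γ hγ
    obtain ⟨-, h1, h2⟩ := (minWeight_spec hΛ)
    have h3 : (γ.degree : ℚ) * (gDil Λ hΛ).ε ≤ Finsupp.weight (gw Λ) γ := by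
      refine mul_degree_le_weight (fun o => ?_) γ
      rcases o with _ | i | i
      · exact h1
      · exact h2 i
      · exact h2 i
    have h4 : (γ.degree : ℚ) * (gDil Λ hΛ).ε < N * (gDil Λ hΛ).ε := by linarith
    have := lt_of_mul_lt_mul_right h4 (gDil Λ hΛ).ε_pos.le
    exact_mod_cast this.le
  have hiff : IsLittleOOne Λ (fun y => (Ψ y : ℂ) - P.value y.1) ↔
      ∀ γ : GVar n →₀ ℕ, Finsupp.weight (gw Λ) γ ≤ 1 → MvPolynomial.coeff γ p = 0 := by
    constructor
    · intro h γ hγ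
      have h1 := hp γ (hdeg γ hγ)
      rw [eq_gexp γ, weight_gexp] at hγ
      have h2 := h _ _ _ hγ
      rw [mixedDeriv_eq_iterDer, ← eq_gexp, h1] at h2
      exact (mul_eq_zero.1 h2).resolve_left (multiFact_ne_zero γ)
    · intro h α β l hl
      rw [← weight_gexp] at hl
      rw [mixedDeriv_eq_iterDer, hp _ (hdeg _ hl), h _ hl, mul_zero]
  rw [hiff]
  constructor
  · intro h
    have hsupp : ∀ m ∈ p.support, 1 < Finsupp.weight (gw Λ) m := by
      intro m hm
      by_contra hlt
      exact MvPolynomial.mem_support_iff.1 hm (h m (not_lt.1 hlt))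
    have h1 := (hA.wlim hN' fun m hm => (hsupp m hm).le).add hPw
    convert! h1 using 2 with y y
    · simp
    · have : MvPolynomial.weightedHomogeneousComponent (gDil Λ hΛ).w 1 p = 0 :=
        MvPolynomial.weightedHomogeneousComponent_eq_zero' _ _ fun m hm => (hsupp m hm).ne'
      simp [this]
  · intro h γ hγ
    have h1 : WLim (gDil Λ hΛ) 1 (fun y => (Ψ y : ℂ) - P.value y.1) fun _ => 0 := by
      simpa using h.sub hPw
    rcases hγ.lt_or_eq with hlt | heq
    · by_contra hne
      exact absurd (hA.le_weight hN' h1 γ (MvPolynomial.mem_support_iff.2 hne)) (not_le.2 hlt)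
    · have h2 := hA.wlim_component hN' h1
      have h3 := (gDil Λ hΛ).eq_zero _ fun x => (congrFun h2 x).symm
      have h4 := congrArg (MvPolynomial.coeff γ) h3
      rw [MvPolynomial.coeff_weightedHomogeneousComponent] at h4
      rw [if_pos (show Finsupp.weight (gDil Λ hΛ).w γ = 1 from heq)] at h4
      simpa using h4

lemma iterDer_sub_value {n : ℕ} {Ψ : GraphSpace n → ℝ} (hΨ : IsGraphFun Ψ) (P : ZPoly n)
    (γ : GVar n →₀ ℕ) :
    iterDer γ (varList n) (fun y => (Ψ y : ℂ) - P.value y.1) 0 =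
      iterDer γ (varList n) (fun y => (Ψ y : ℂ)) 0 -
        multiFact γ * MvPolynomial.coeff γ (MvPolynomial.rename some P : MvPolynomial (GVar n) ℂ) := by
  obtain ⟨g, hg, hfg⟩ := hΨ.smoothNear.exists_contDiff
  set q : MvPolynomial (GVar n) ℂ := MvPolynomial.rename some P with hq
  have h1 : (fun y => (Ψ y : ℂ) - P.value y.1) =ᶠ[𝓝 0]
      fun y => g y + MvPolynomial.eval (gcoord y) (-q) := by
    filter_upwards [hfg] with y hy
    rw [hy, map_neg, hq, eval_rename_some, sub_eq_add_neg]
  rw [(iterDer_congr h1 γ _).eq_of_nhds, iterDer_add hg (contDiff_eval_gcoord _),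
    (iterDer_congr hfg γ _).eq_of_nhds]
  change _ + iterDer γ (varList n) _ 0 = _
  rw [iterDer_eval_zero, MvPolynomial.coeff_neg]
  ring

lemma wlen_nonneg {n : ℕ} {Λ : Fin n → ℚ} (hΛ : ∀ i, 0 ≤ Λ i) (α β : Fin n → ℕ) :
    0 ≤ wlen Λ α β :=
  Finset.sum_nonneg fun i _ => mul_nonneg (by positivity) (hΛ i)

lemma eq_zero_of_wlen_le_zero {n : ℕ} {Λ : Fin n → ℚ} (hΛ : ∀ i, 0 < Λ i) {α β : Fin n → ℕ}
    (h : wlen Λ α β ≤ 0) : α = 0 ∧ β = 0 := by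
  have h1 : ∀ i ∈ Finset.univ, ((α i : ℚ) + β i) * Λ i = 0 :=
    (Finset.sum_eq_zero_iff_of_nonneg fun i _ => mul_nonneg (by positivity) (hΛ i).le).1
      (le_antisymm h (wlen_nonneg (fun i => (hΛ i).le) α β))
  constructor <;> ext i <;>
  · have h2 := (mul_eq_zero.1 (h1 i (Finset.mem_univ i))).resolve_right (hΛ i).ne'
    norm_cast at h2
    simp at h2 ⊢
    omega

/-- Since `u` has weight one, the only condition involving `∂/∂u` is the vanishing of the first
derivative itself, and this is part of `IsGraphFun`. So `Ψ(z, z̄, 0)` decides. -/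
lemma isLeading_iff_coeff {n : ℕ} {Λ : Fin n → ℚ} (hΛ : ∀ i, 0 < Λ i) {Ψ : GraphSpace n → ℝ}
    (hΨ : IsGraphFun Ψ) (P : ZPoly n) :
    IsLeading Λ Ψ P ↔ MvPolynomial.IsWeightedHomogeneous (Sum.elim Λ Λ) P 1 ∧
      ∀ α β, wlen Λ α β ≤ 1 → taylorCoeff Ψ α β = MvPolynomial.coeff (zexp α β) P := by
  refine and_congr_right fun hP => ?_
  have key : ∀ α β, mixedDeriv α β 0 (fun y => (Ψ y : ℂ) - P.value y.1) 0 =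
      multiFact (gexp α β 0) * (taylorCoeff Ψ α β - MvPolynomial.coeff (zexp α β) P) := by
    intro α β
    rw [mixedDeriv_eq_iterDer, iterDer_sub_value hΨ, taylorCoeff_eq_iterDer, coeff_rename_gexp,
      if_pos rfl, mul_sub]
  constructor
  · intro h α β hαβ
    have h1 := h α β 0 (by simpa using hαβ)
    rw [key] at h1
    exact sub_eq_zero.1 ((mul_eq_zero.1 h1).resolve_left (multiFact_ne_zero _))
  · intro h α β l hl
    have hw := wlen_nonneg (fun i => (hΛ i).le) α β
    have hl1 : l ≤ 1 := by
      have : (l : ℚ) ≤ 1 := by linarith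
      exact_mod_cast this
    interval_cases l
    · rw [key, h α β (by simpa using hl), sub_self, mul_zero]
    · obtain ⟨rfl, rfl⟩ := eq_zero_of_wlen_le_zero hΛ (α := α) (β := β) (by push_cast at hl; linarith)
      have h1 : iterDer (gexp 0 0 1) (varList n) (fun y => (Ψ y : ℂ)) 0 = 0 := by
        rw [← mixedDeriv_eq_iterDer]
        have h2 : mixedDeriv 0 0 1 (fun y => (Ψ y : ℂ)) = du (fun y => (Ψ y : ℂ)) := by
          simp [mixedDeriv, List.foldr_fixed]
        have hd : HasFDerivAt Ψ (0 : GraphSpace n →L[ℝ] ℝ) 0 := by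
          rw [← hΨ.2.2]
          exact (hΨ.1.self_of_nhds.differentiableAt (by simp)).hasFDerivAt
        have h3 : HasFDerivAt (fun y => (Ψ y : ℂ)) (Complex.ofRealCLM.comp 0) 0 :=
          Complex.ofRealCLM.hasFDerivAt.comp 0 hd
        rw [h2, du, h3.fderiv]
        simp
      rw [mixedDeriv_eq_iterDer, iterDer_sub_value hΨ, h1, coeff_rename_gexp]
      simp

lemma finite_setOf_wlen_le {n : ℕ} {Λ : Fin n → ℚ} (hΛ : ∀ i, 0 < Λ i) (ρ : ℚ) :
    {m : Fin n ⊕ Fin n →₀ ℕ | Finsupp.weight (Sum.elim Λ Λ) m ≤ ρ}.Finite := by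
  obtain ⟨ε, hε, -, h⟩ := exists_le_weights hΛ
  obtain ⟨N, hN⟩ := exists_nat_ge (ρ / ε)
  refine (Finsupp.finite_of_degree_le N).subset fun m hm => ?_
  have h1 : (m.degree : ℚ) * ε ≤ ρ :=
    (mul_degree_le_weight (by rintro (i | i) <;> exact h i) m).trans hm
  have h2 : (m.degree : ℚ) ≤ N := ((le_div_iff₀ hε).2 h1).trans hN
  exact_mod_cast h2

/-- The polynomial is the sum of the Taylor terms of weight exactly one; these are finitely many
because the weights are positive. -/
lemma exists_isLeading {n : ℕ} {Λ : Fin n → ℚ} (hΛ : ∀ i, 0 < Λ i) {Ψ : GraphSpace n → ℝ}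
    (hΨ : IsGraphFun Ψ) (h : ∀ α β, wlen Λ α β < 1 → taylorCoeff Ψ α β = 0) :
    ∃ P : ZPoly n, IsLeading Λ Ψ P := by
  classical
  have hfin : {m : Fin n ⊕ Fin n →₀ ℕ | Finsupp.weight (Sum.elim Λ Λ) m = 1}.Finite :=
    (finite_setOf_wlen_le hΛ 1).subset fun m hm => le_of_eq hm
  let P : ZPoly n := ∑ m ∈ hfin.toFinset, MvPolynomial.monomial m
    (taylorCoeff Ψ (fun i => m (Sum.inl i)) fun i => m (Sum.inr i))
  have hP : ∀ m, MvPolynomial.coeff m P = if Finsupp.weight (Sum.elim Λ Λ) m = 1 then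
      taylorCoeff Ψ (fun i => m (Sum.inl i)) (fun i => m (Sum.inr i)) else 0 := by
    intro m
    simp only [P, MvPolynomial.coeff_sum, MvPolynomial.coeff_monomial]
    rw [Finset.sum_ite_eq' hfin.toFinset m]
    simp
  refine ⟨P, (isLeading_iff_coeff hΛ hΨ P).2 ⟨fun m hm => ?_, fun α β hαβ => ?_⟩⟩
  · by_contra hne
    rw [hP, if_neg hne] at hm
    exact hm rfl
  · rw [hP, weight_zexp]
    split_ifs with h1
    · rfl
    · exact h α β (lt_of_le_of_ne hαβ h1)

lemma IsLeading.taylorCoeff_eq_zero {n : ℕ} {Λ : Fin n → ℚ} (hΛ : ∀ i, 0 < Λ i)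
    {Ψ : GraphSpace n → ℝ} (hΨ : IsGraphFun Ψ) {P : ZPoly n} (h : IsLeading Λ Ψ P) {α β : Fin n → ℕ}
    (hαβ : wlen Λ α β < 1) : taylorCoeff Ψ α β = 0 := by
  obtain ⟨h1, h2⟩ := (isLeading_iff_coeff hΛ hΨ P).1 h
  rw [h2 α β hαβ.le]
  by_contra hne
  have := h1 hne
  rw [weight_zexp] at this
  exact hαβ.ne this

/-! ### Changes of coordinates -/

/-- Germs at the origin of biholomorphic maps fixing the origin. -/
structure IsGermIso {n : ℕ} (F : CoordSpace n → CoordSpace n) : Prop where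
  analyticAt : AnalyticAt ℂ F 0
  map_zero : F 0 = 0
  isInvertible : (fderiv ℂ F 0).IsInvertible

lemma exists_localInverse {E E' : Type*} [NormedAddCommGroup E] [NormedSpace ℂ E] [CompleteSpace E]
    [NormedAddCommGroup E'] [NormedSpace ℂ E'] [CompleteSpace E'] {f : E → E'} {a : E}
    (hf : AnalyticAt ℂ f a) (hi : (fderiv ℂ f a).IsInvertible) :
    ∃ g : E' → E, AnalyticAt ℂ g (f a) ∧ g (f a) = a ∧ (fderiv ℂ g (f a)).IsInvertible ∧
      (∀ᶠ x in 𝓝 a, g (f x) = x) ∧ ∀ᶠ y in 𝓝 (f a), f (g y) = y := by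
  obtain ⟨e, he⟩ := hi
  have hs : HasStrictFDerivAt f (e : E →L[ℂ] E') a := he ▸ hf.hasStrictFDerivAt
  refine ⟨hs.localInverse f e a, ?_, hs.localInverse_apply_image, ?_, hs.eventually_left_inverse,
    hs.eventually_right_inverse⟩
  · exact (hs.toOpenPartialHomeomorph f).analyticAt_symm' hs.mem_toOpenPartialHomeomorph_source hf
      he.symm
  · rw [hs.to_localInverse.hasFDerivAt.fderiv]
    exact ⟨e.symm, rfl⟩

lemma IsGermIso.exists_inverse {n : ℕ} {F : CoordSpace n → CoordSpace n} (hF : IsGermIso F) :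
    ∃ G, IsGermIso G ∧ (∀ᶠ x in 𝓝 0, G (F x) = x) ∧ ∀ᶠ x in 𝓝 0, F (G x) = x := by
  obtain ⟨g, h1, h2, h3, h4, h5⟩ := exists_localInverse hF.analyticAt hF.isInvertible
  rw [hF.map_zero] at h1 h2 h3 h5
  exact ⟨g, ⟨h1, h2, h3⟩, h4, h5⟩

lemma IsGermIso.tendsto {n : ℕ} {F : CoordSpace n → CoordSpace n} (hF : IsGermIso F) :
    Tendsto F (𝓝 0) (𝓝 0) := by
  have := hF.analyticAt.continuousAt.tendsto
  rwa [hF.map_zero] at this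

/-- The point of the graph `v = Ψ(z, z̄, u)` with the parameters `y = (z, u)`. -/
def graphLift {n : ℕ} (Ψ : GraphSpace n → ℝ) (y : GraphSpace n) : CoordSpace n :=
  (y.1, (y.2 : ℂ) + (Ψ y : ℂ) * Complex.I)

/-- The parameters `(z, u)` of a point. -/
def graphProj {n : ℕ} (x : CoordSpace n) : GraphSpace n := (x.1, x.2.re)

/-- The map `F` takes the hypersurface `v = Ψ` to the hypersurface `v = Ψ'`. -/
structure IsTransition {n : ℕ} (Ψ Ψ' : GraphSpace n → ℝ) (F : CoordSpace n → CoordSpace n) : Prop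
    extends IsGermIso F where
  graph : ∀ᶠ y in 𝓝 (0 : GraphSpace n),
    (F (graphLift Ψ y)).2.im = Ψ' (graphProj (F (graphLift Ψ y)))

section Coord

variable {n : ℕ} {M : Set (Fin (n + 1) → ℂ)} {p : Fin (n + 1) → ℂ}
  {Φ Φ' : (Fin (n + 1) → ℂ) → CoordSpace n} {Ψ Ψ' : GraphSpace n → ℝ}

lemma IsCoord.isGraphFun (h : IsCoord M p Φ Ψ) : IsGraphFun Ψ := ⟨h.2.2.2.1, h.2.2.2.2.1, h.2.2.2.2.2.1⟩

lemma IsCoord.tendsto (h : IsCoord M p Φ Ψ) : Tendsto Φ (𝓝 p) (𝓝 0) := by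
  have := h.1.continuousAt.tendsto
  rwa [h.2.1] at this

lemma IsGraphFun.continuousAt (h : IsGraphFun Ψ) : ContinuousAt Ψ 0 :=
  h.1.self_of_nhds.continuousAt

lemma IsGraphFun.tendsto_graphLift (h : IsGraphFun Ψ) : Tendsto (graphLift Ψ) (𝓝 0) (𝓝 0) := by
  have h1 : ContinuousAt (graphLift Ψ) 0 := by
    refine ContinuousAt.prodMk continuousAt_fst ?_
    exact (Complex.continuous_ofReal.continuousAt.comp continuousAt_snd).add
      ((Complex.continuous_ofReal.continuousAt.comp h.continuousAt).mul continuousAt_const)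
  have h2 : graphLift Ψ 0 = 0 := by simp [graphLift, h.2.1]
  have := h1.tendsto
  rwa [h2] at this

lemma IsCoord.isTransition (h : IsCoord M p Φ Ψ) (h' : IsCoord M p Φ' Ψ')
    {F : CoordSpace n → CoordSpace n} (hF : IsGermIso F) (hΦ : ∀ᶠ x in 𝓝 p, F (Φ x) = Φ' x) :
    IsTransition Ψ Ψ' F := by
  refine ⟨hF, ?_⟩
  obtain ⟨L, hL1, hL2, -, -, hL5⟩ := exists_localInverse h.1 h.2.2.1
  rw [h.2.1] at hL1 hL2 hL5
  have hLt : Tendsto L (𝓝 0) (𝓝 p) := by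
    have := hL1.continuousAt.tendsto
    rwa [hL2] at this
  have ht := h.isGraphFun.tendsto_graphLift
  filter_upwards [ht.eventually hL5, (hLt.comp ht).eventually hΦ,
    (hLt.comp ht).eventually h.2.2.2.2.2.2, (hLt.comp ht).eventually h'.2.2.2.2.2.2] with y e1 e2 e3 e4
  simp only [Function.comp] at e2 e3 e4
  rw [e1] at e2 e3
  rw [e2]
  refine e4.1 (e3.2 ?_)
  simp [graphLift]

lemma IsCoord.exists_transition (h : IsCoord M p Φ Ψ) (h' : IsCoord M p Φ' Ψ') :
    ∃ F, IsTransition Ψ Ψ' F ∧ ∀ᶠ x in 𝓝 p, F (Φ x) = Φ' x := by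
  obtain ⟨L, hL1, hL2, hL3, hL4, hL5⟩ := exists_localInverse h.1 h.2.2.1
  rw [h.2.1] at hL1 hL2 hL3 hL5
  have hΦ' : AnalyticAt ℂ Φ' (L 0) := by rw [hL2]; exact h'.1
  have hF : IsGermIso fun x => Φ' (L x) := by
    refine ⟨hΦ'.comp hL1, by rw [hL2, h'.2.1], ?_⟩
    have := fderiv_comp (𝕜 := ℂ) (0 : CoordSpace n) hΦ'.differentiableAt hL1.differentiableAt
    have h2 : fderiv ℂ (fun x => Φ' (L x)) 0 = _ := this
    rw [h2, hL2]
    exact h'.2.2.1.comp hL3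
  have hc : ∀ᶠ x in 𝓝 p, Φ' (L (Φ x)) = Φ' x := hL4.mono fun x hx => by rw [hx]
  exact ⟨_, h.isTransition h' hF hc, hc⟩

end Coord

/-- The inverse function theorem for the parameters together with the defining function `R`. The
condition on the last component of the differential, with a real factor `c`, says that the tangent
hyperplane `v = 0` is preserved. -/
lemma exists_graph {n : ℕ} {M : Set (Fin (n + 1) → ℂ)} {p : Fin (n + 1) → ℂ}
    {Φ : (Fin (n + 1) → ℂ) → CoordSpace n} {Ψ : GraphSpace n → ℝ} (h : IsCoord M p Φ Ψ)
    {H : CoordSpace n → CoordSpace n} (hH : IsGermIso H) {c : ℝ}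
    (hc : ∀ v, (fderiv ℂ H 0 v).2 = c * v.2) :
    ∃ Ψ', IsCoord M p (fun x => H (Φ x)) Ψ' := by
  have hc0 : c ≠ 0 := by
    rintro rfl
    obtain ⟨e, he⟩ := hH.isInvertible
    have h1 : fderiv ℂ H 0 (e.symm (0, 1)) = (0, 1) := by
      rw [← he]; exact e.apply_symm_apply _
    have h2 := hc (e.symm (0, 1))
    rw [h1] at h2
    simp at h2
  obtain ⟨K, hK, hKH, hHK⟩ := hH.exists_inverse
  have hKd : ∀ v, (fderiv ℂ K 0 v).2 = (c : ℂ)⁻¹ * v.2 := by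
    intro v
    have h1 : fderiv ℂ (fun x => H (K x)) 0 = (fderiv ℂ H 0).comp (fderiv ℂ K 0) := by
      have hH' : DifferentiableAt ℂ H (K 0) := by rw [hK.map_zero]; exact hH.analyticAt.differentiableAt
      have := fderiv_comp (𝕜 := ℂ) (0 : CoordSpace n) hH' hK.analyticAt.differentiableAt
      rw [hK.map_zero] at this
      exact this
    have h2 : fderiv ℂ (fun x => H (K x)) 0 = ContinuousLinearMap.id ℂ _ := by
      have : (fun x => H (K x)) =ᶠ[𝓝 0] id := hHK
      rw [this.fderiv_eq, fderiv_id]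
    have h3 := hc (fderiv ℂ K 0 v)
    have h4 : fderiv ℂ H 0 (fderiv ℂ K 0 v) = v := by
      have := DFunLike.congr_fun (h1.symm.trans h2) v
      simpa using this
    rw [h4] at h3
    rw [h3, ← mul_assoc, inv_mul_cancel₀ (by exact_mod_cast hc0), one_mul]
  -- the defining function in the new coordinates
  let R : CoordSpace n → ℝ := fun x => (K x).2.im - Ψ (graphProj (K x))
  let T : CoordSpace n → GraphSpace n × ℝ := fun x => (graphProj x, R x)
  have hproj : ContDiff ℝ ∞ (graphProj : CoordSpace n → GraphSpace n) :=
    contDiff_fst.prodMk (Complex.reCLM.contDiff.comp contDiff_snd)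
  have hproj0 : graphProj (0 : CoordSpace n) = 0 := by simp [graphProj]
  have hKs : ∀ᶠ x in 𝓝 (0 : CoordSpace n), ContDiffAt ℝ ∞ K x := by
    filter_upwards [hK.analyticAt.eventually_analyticAt] with x hx
    exact hx.contDiffAt.restrict_scalars ℝ
  have hpt : Tendsto (fun x => graphProj (K x)) (𝓝 (0 : CoordSpace n)) (𝓝 0) := by
    have := (hproj.continuous.tendsto 0).comp hK.tendsto
    rwa [hproj0] at this
  have hRs : ∀ᶠ x in 𝓝 (0 : CoordSpace n), ContDiffAt ℝ ∞ R x := by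
    filter_upwards [hKs, hpt.eventually h.isGraphFun.1] with x h1 h2
    refine ContDiffAt.sub ?_ (h2.comp x (hproj.contDiffAt.comp x h1))
    exact Complex.imCLM.contDiff.contDiffAt.comp x (contDiff_snd.contDiffAt.comp x h1)
  have hTs : ∀ᶠ x in 𝓝 (0 : CoordSpace n), ContDiffAt ℝ ∞ T x :=
    hRs.mono fun x hx => hproj.contDiffAt.prodMk hx
  have hR0 : R 0 = 0 := by
    simp only [R, hK.map_zero, hproj0, h.isGraphFun.2.1]
    simp
  have hT0 : T 0 = 0 := by simp only [T, hR0, hproj0]; rfl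
  -- The differential of `T` at the origin. `Ψ` contributes nothing because its differential
  -- vanishes, and the inverse map scales `w` by `c⁻¹`.
  let e : CoordSpace n ≃L[ℝ] GraphSpace n × ℝ :=
    ContinuousLinearEquiv.equivOfInverse
      ((((ContinuousLinearMap.fst ℝ (Fin n → ℂ) ℂ).prod
        (Complex.reCLM.comp (ContinuousLinearMap.snd ℝ (Fin n → ℂ) ℂ)))).prod
        (c⁻¹ • (Complex.imCLM.comp (ContinuousLinearMap.snd ℝ (Fin n → ℂ) ℂ))))
      (((ContinuousLinearMap.fst ℝ (Fin n → ℂ) ℝ).comp (ContinuousLinearMap.fst ℝ _ ℝ)).prod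
        (Complex.ofRealCLM.comp ((ContinuousLinearMap.snd ℝ (Fin n → ℂ) ℝ).comp
          (ContinuousLinearMap.fst ℝ _ ℝ)) + c • (Complex.I •
          Complex.ofRealCLM.comp (ContinuousLinearMap.snd ℝ (GraphSpace n) ℝ))))
      (by
        rintro ⟨z, w⟩
        refine Prod.ext rfl ?_
        apply Complex.ext <;> simp [hc0])
      (by
        rintro ⟨⟨z, u⟩, v⟩
        refine Prod.ext (Prod.ext rfl ?_) ?_ <;> simp [hc0])
  have hTd : HasStrictFDerivAt T (e : CoordSpace n →L[ℝ] GraphSpace n × ℝ) 0 := by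
    have h1 : HasFDerivAt K ((fderiv ℂ K 0).restrictScalars ℝ) 0 :=
      hK.analyticAt.differentiableAt.hasFDerivAt.restrictScalars ℝ
    have h2 : HasFDerivAt Ψ (0 : GraphSpace n →L[ℝ] ℝ) (graphProj (K 0)) := by
      rw [hK.map_zero, hproj0, ← h.isGraphFun.2.2]
      exact (h.isGraphFun.1.self_of_nhds.differentiableAt (by simp)).hasFDerivAt
    have h3 : HasFDerivAt (fun x => graphProj (K x)) (fderiv ℝ (fun x => graphProj (K x)) 0)
        (0 : CoordSpace n) :=
      ((hproj.contDiffAt.comp 0 hKs.self_of_nhds).differentiableAt (by simp)).hasFDerivAt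
    have h4 : HasFDerivAt (fun x => Ψ (graphProj (K x))) (0 : CoordSpace n →L[ℝ] ℝ) 0 := by
      have := h2.comp (0 : CoordSpace n) h3
      rw [ContinuousLinearMap.zero_comp] at this
      exact this
    have h5 : HasFDerivAt (fun x => (K x).2.im) (Complex.imCLM.comp
        ((ContinuousLinearMap.snd ℝ (Fin n → ℂ) ℂ).comp ((fderiv ℂ K 0).restrictScalars ℝ))) 0 :=
      Complex.imCLM.hasFDerivAt.comp 0 (hasFDerivAt_snd.comp 0 h1)
    have h6 : HasFDerivAt (graphProj : CoordSpace n → GraphSpace n)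
        ((ContinuousLinearMap.fst ℝ (Fin n → ℂ) ℂ).prod
        (Complex.reCLM.comp (ContinuousLinearMap.snd ℝ (Fin n → ℂ) ℂ))) 0 :=
      hasFDerivAt_fst.prodMk (Complex.reCLM.hasFDerivAt.comp 0 hasFDerivAt_snd)
    have h7 := h6.prodMk (h5.sub h4)
    have h8 := hTs.self_of_nhds.hasStrictFDerivAt (by simp)
    have h9 : fderiv ℝ T 0 = (e : CoordSpace n →L[ℝ] GraphSpace n × ℝ) := by
      refine (HasFDerivAt.fderiv (f := T) h7).trans ?_
      refine ContinuousLinearMap.ext fun v => Prod.ext rfl ?_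
      simp [e, hKd, ← Complex.ofReal_inv]
    rwa [h9] at h8
  let S := hTd.toOpenPartialHomeomorph T
  have hS0 : (0 : CoordSpace n) ∈ S.source := hTd.mem_toOpenPartialHomeomorph_source
  have hSt : (0 : GraphSpace n × ℝ) ∈ S.target := by
    have := hTd.image_mem_toOpenPartialHomeomorph_target
    rwa [hT0] at this
  have hSs : S.symm 0 = 0 := by
    have : S.symm (T 0) = 0 := S.left_inv hS0
    rwa [hT0] at this
  have hSsm : ∀ᶠ y in 𝓝 (0 : GraphSpace n × ℝ), ContDiffAt ℝ ∞ S.symm y := by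
    -- Invertibility is an open condition; it is needed at all nearby points to obtain smoothness of
    -- the inverse in a neighbourhood and not only at the origin.
    have h1 : ∀ᶠ x in 𝓝 (0 : CoordSpace n), fderiv ℝ T x ∈ Set.range
        ((↑) : (CoordSpace n ≃L[ℝ] GraphSpace n × ℝ) → CoordSpace n →L[ℝ] GraphSpace n × ℝ) := by
      have h2 : ContinuousAt (fderiv ℝ T) 0 :=
        (hTs.self_of_nhds.fderiv_right (m := 1) (by norm_cast)).continuousAt
      refine h2.eventually_mem ?_
      rw [hTd.hasFDerivAt.fderiv]
      exact ContinuousLinearEquiv.nhds e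
    have h3 : Tendsto S.symm (𝓝 0) (𝓝 0) := by
      have := (S.continuousAt_symm hSt).tendsto
      rwa [hSs] at this
    filter_upwards [h3.eventually h1, h3.eventually hTs, S.open_target.mem_nhds hSt] with y e1 e2 e3
    obtain ⟨e', he'⟩ := e1
    refine S.contDiffAt_symm e3 (f₀' := e') ?_ e2
    rw [he']
    exact (e2.differentiableAt (by simp)).hasFDerivAt
  have hι : ContDiff ℝ ∞ (fun y : GraphSpace n => (y, (0 : ℝ))) := contDiff_id.prodMk contDiff_const
  have hιt : Tendsto (fun y : GraphSpace n => (y, (0 : ℝ))) (𝓝 0) (𝓝 0) := hι.continuous.tendsto 0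
  have hΨ's : ∀ᶠ y in 𝓝 (0 : GraphSpace n), ContDiffAt ℝ ∞ (fun y => (S.symm (y, 0)).2.im) y := by
    filter_upwards [hιt.eventually hSsm] with y hy
    exact Complex.imCLM.contDiff.contDiffAt.comp y (contDiff_snd.contDiffAt.comp y
      (hy.comp y hι.contDiffAt))
  refine ⟨fun y => (S.symm (y, 0)).2.im, ?_, ?_, ?_, hΨ's, ?_, ?_, ?_⟩
  · have : AnalyticAt ℂ H (Φ p) := by rw [h.2.1]; exact hH.analyticAt
    exact this.comp h.1
  · change H (Φ p) = 0
    rw [h.2.1, hH.map_zero]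
  · have hH' : DifferentiableAt ℂ H (Φ p) := by rw [h.2.1]; exact hH.analyticAt.differentiableAt
    have := fderiv_comp (𝕜 := ℂ) p hH' h.1.differentiableAt
    have h2 : fderiv ℂ (fun x => H (Φ x)) p = _ := this
    rw [h2, h.2.1]
    exact hH.isInvertible.comp h.2.2.1
  · change (S.symm 0).2.im = 0
    rw [hSs]; rfl
  · have h1 : HasFDerivAt S.symm (e.symm : GraphSpace n × ℝ →L[ℝ] CoordSpace n) 0 := by
      have := hTd.to_localInverse.hasFDerivAt
      rwa [hT0] at this
    have h2 : HasFDerivAt (fun y : GraphSpace n => (y, (0 : ℝ)))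
        ((ContinuousLinearMap.id ℝ (GraphSpace n)).prod 0) 0 :=
      (hasFDerivAt_id _).prodMk (hasFDerivAt_const _ _)
    have h3 : HasFDerivAt (fun y : GraphSpace n => S.symm (y, (0 : ℝ)))
      ((e.symm : GraphSpace n × ℝ →L[ℝ] CoordSpace n).comp
        ((ContinuousLinearMap.id ℝ (GraphSpace n)).prod 0)) 0 :=
      HasFDerivAt.comp (f := fun y : GraphSpace n => (y, (0 : ℝ))) (0 : GraphSpace n) h1 h2
    have h4 : HasFDerivAt (fun y : GraphSpace n => (S.symm (y, (0 : ℝ))).2.im) _ 0 :=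
      Complex.imCLM.hasFDerivAt.comp (0 : GraphSpace n) (hasFDerivAt_snd.comp 0 h3)
    rw [h4.fderiv]
    ext v <;> simp [e]
  · have h1 : Tendsto (fun x => H (Φ x)) (𝓝 p) (𝓝 0) := hH.tendsto.comp h.tendsto
    have h2 : Tendsto (fun x => (graphProj (H (Φ x)), (0 : ℝ))) (𝓝 p) (𝓝 0) := by
      have h3 := (hproj.continuous.tendsto 0).comp h1
      rw [hproj0] at h3
      exact hιt.comp h3
    filter_upwards [h.2.2.2.2.2.2, h.tendsto.eventually hKH, h1.eventually (S.open_source.mem_nhds hS0),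
      h2.eventually (S.open_target.mem_nhds hSt)] with x e1 e2 e3 e4
    have hRx : R (H (Φ x)) = (Φ x).2.im - Ψ ((Φ x).1, (Φ x).2.re) := by
      simp only [R, e2]; rfl
    rw [e1, ← sub_eq_zero, ← hRx]
    change _ ↔ (H (Φ x)).2.im = (S.symm (graphProj (H (Φ x)), 0)).2.im
    constructor
    · intro h0
      have h5 : S.symm (T (H (Φ x))) = H (Φ x) := S.left_inv e3
      simp only [T, h0] at h5
      rw [h5]
    · intro h0
      have h5 : T (S.symm (graphProj (H (Φ x)), 0)) = (graphProj (H (Φ x)), 0) := S.right_inv e4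
      have h6 : graphProj (S.symm (graphProj (H (Φ x)), 0)) = graphProj (H (Φ x)) :=
        congrArg Prod.fst h5
      have h7 : R (S.symm (graphProj (H (Φ x)), 0)) = 0 := congrArg Prod.snd h5
      have h8 : S.symm (graphProj (H (Φ x)), 0) = H (Φ x) := by
        refine Prod.ext (Prod.ext_iff.1 h6).1 (Complex.ext (Prod.ext_iff.1 h6).2 h0.symm)
      rwa [h8] at h7

/-! ### Weighted homogeneous parts of holomorphic maps -/

section Homogeneous

variable {σ : Type*} {w : σ → ℚ} {ρ : ℚ}

lemma eval_exp_mul_of_homogeneous [Fintype σ] {q : MvPolynomial σ ℂ} (hq : q.IsWeightedHomogeneous w ρ)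
    (t : ℂ) (x : σ → ℂ) :
    MvPolynomial.eval (fun i => Complex.exp (t * w i) * x i) q =
      Complex.exp (t * ρ) * MvPolynomial.eval x q := by
  rw [MvPolynomial.eval_eq', MvPolynomial.eval_eq', Finset.mul_sum]
  refine Finset.sum_congr rfl fun m hm => ?_
  have h1 := hq (MvPolynomial.mem_support_iff.1 hm)
  rw [weight_eq_sum] at h1
  have h2 : ∏ i, (Complex.exp (t * w i) * x i) ^ m i = Complex.exp (t * ρ) * ∏ i, x i ^ m i := by
    simp only [mul_pow, Finset.prod_mul_distrib, ← Complex.exp_nat_mul]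
    rw [← Complex.exp_sum, ← h1]
    congr 2
    push_cast
    rw [Finset.mul_sum]
    exact Finset.sum_congr rfl fun i _ => by ring
  rw [h2]; ring

/-- A homogeneous polynomial of positive weight with real values vanishes. -/
lemma eval_eq_zero_of_im_eq_zero [Fintype σ] {q : MvPolynomial σ ℂ}
    (hq : q.IsWeightedHomogeneous w ρ) (hρ : 0 < ρ) (h : ∀ x, (MvPolynomial.eval x q).im = 0)
    (x : σ → ℂ) : MvPolynomial.eval x q = 0 := by
  refine Complex.ext ?_ (h x)
  -- This rotation of the variables multiplies the value by `exp (iπ/2) = i`, so the real part of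
  -- the original value becomes an imaginary part.
  have h1 := h fun i => Complex.exp ((Real.pi / 2 / ρ : ℂ) * Complex.I * w i) * x i
  rw [eval_exp_mul_of_homogeneous hq] at h1
  have h2 : (Real.pi / 2 / ρ : ℂ) * Complex.I * ρ = Real.pi / 2 * Complex.I := by
    have : (ρ : ℂ) ≠ 0 := by exact_mod_cast hρ.ne'
    field_simp
  rw [h2, Complex.exp_pi_div_two_mul_I] at h1
  simpa using h1

/-- By homogeneity a polynomial is its own weighted limit, and limits only see the germ at the
origin. -/
lemma eval_eq_zero_of_eventually {E : Type*} [NormedAddCommGroup E] {δ : Dilation E σ}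
    {q : MvPolynomial σ ℂ} (hq : q.IsWeightedHomogeneous δ.w ρ)
    (h : ∀ᶠ x in 𝓝 0, MvPolynomial.eval (δ.coord x) q = 0) (x : E) :
    MvPolynomial.eval (δ.coord x) q = 0 := by
  have h1 : WLim δ ρ (fun _ => 0) (fun x => MvPolynomial.eval (δ.coord x) q) :=
    (wlim_eval_of_homogeneous hq).congr h
  exact congrFun (h1.unique WLim.zero) x

lemma WLim.of_isLittleO {E : Type*} [NormedAddCommGroup E] {δ : Dilation E σ} {f g g₀ : E → ℂ}
    (hg : WLim δ ρ g g₀) (h : f =o[𝓝 0] g) : WLim δ ρ f fun _ => 0 := by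
  obtain ⟨φ, hφ, hf⟩ := h.exists_eq_mul
  exact (hg.mul_tendsto_zero hφ).congr hf.symm

end Homogeneous

/-- The polynomials in `w` and the `z_i`. -/
abbrev HPoly (n : ℕ) : Type := MvPolynomial (Option (Fin n)) ℂ

/-- The polynomial map with the components `q (some i)` and `q none`. -/
def polyMap {n : ℕ} (q : Option (Fin n) → HPoly n) (x : CoordSpace n) : CoordSpace n :=
  (fun i => MvPolynomial.eval (hcoord x) (q (some i)), MvPolynomial.eval (hcoord x) (q none))

lemma hcoord_polyMap {n : ℕ} (q : Option (Fin n) → HPoly n) (x : CoordSpace n) (o : Option (Fin n)) :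
    hcoord (polyMap q x) o = MvPolynomial.eval (hcoord x) (q o) := by
  rcases o with _ | i <;> rfl

lemma hcoord_injective {n : ℕ} {x y : CoordSpace n} (h : ∀ o, hcoord x o = hcoord y o) : x = y :=
  Prod.ext (funext fun i => h (some i)) (h none)

/-- The coordinates of `CoordSpace n`, as linear forms. -/
def hcoordL {n : ℕ} : Option (Fin n) → CoordSpace n →L[ℂ] ℂ
  | none => ContinuousLinearMap.snd ℂ _ _
  | some i => (ContinuousLinearMap.proj i).comp (ContinuousLinearMap.fst ℂ _ _)

lemma hcoordL_apply {n : ℕ} (o : Option (Fin n)) (x : CoordSpace n) : hcoordL o x = hcoord x o := by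
  rcases o with _ | i <;> rfl

lemma hasFDerivAt_hcoord {n : ℕ} (o : Option (Fin n)) (x : CoordSpace n) :
    HasFDerivAt (fun x => hcoord x o) (hcoordL o : CoordSpace n →L[ℂ] ℂ) x := by
  simpa only [← hcoordL_apply] using (hcoordL o).hasFDerivAt

lemma analyticAt_eval_hcoord {n : ℕ} (p : HPoly n) (x : CoordSpace n) :
    AnalyticAt ℂ (fun x => MvPolynomial.eval (hcoord x) p) x := by
  induction p using MvPolynomial.induction_on with
  | C a => simpa using analyticAt_const
  | add p q hp hq => simp only [map_add]; exact hp.add hq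
  | mul_X p o hp =>
    have : AnalyticAt ℂ (fun x => hcoord x o) x := by
      simpa only [← hcoordL_apply] using (hcoordL o).analyticAt x
    simp only [map_mul, MvPolynomial.eval_X]
    exact hp.mul this

lemma hasFDerivAt_eval_hcoord {n : ℕ} (p : HPoly n) (x : CoordSpace n) :
    HasFDerivAt (fun x => MvPolynomial.eval (hcoord x) p)
      (∑ o, MvPolynomial.eval (hcoord x) (MvPolynomial.pderiv o p) • hcoordL o) x := by
  classical
  induction p using MvPolynomial.induction_on with
  | C a =>
    have h : (fun x : CoordSpace n => MvPolynomial.eval (hcoord x) (MvPolynomial.C a)) =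
        fun _ => a := by simp
    rw [h]
    refine (hasFDerivAt_const a x).congr_fderiv ?_
    ext v <;> simp
  | add p q hp hq =>
    simp only [map_add]
    refine (hp.add hq).congr_fderiv ?_
    rw [← Finset.sum_add_distrib]
    exact Finset.sum_congr rfl fun o _ => (add_smul _ _ _).symm
  | mul_X p o hp =>
    simp only [map_mul, MvPolynomial.eval_X]
    refine (hp.mul (hasFDerivAt_hcoord o x)).congr_fderiv ?_
    have h1 : ∀ o', MvPolynomial.eval (hcoord x) (MvPolynomial.pderiv o' (p * MvPolynomial.X o)) •
        (hcoordL o' : CoordSpace n →L[ℂ] ℂ) =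
        (if o' = o then MvPolynomial.eval (hcoord x) p • hcoordL o' else 0) +
          hcoord x o • (MvPolynomial.eval (hcoord x) (MvPolynomial.pderiv o' p) • hcoordL o') := by
      intro o'
      rw [Derivation.leibniz, smul_smul, MvPolynomial.pderiv_X]
      by_cases h : o' = o
      · subst h
        simp only [Pi.single_eq_same, smul_eq_mul, mul_one, map_add, map_mul, MvPolynomial.eval_X,
          if_true]
        exact add_smul (MvPolynomial.eval (hcoord x) p) _ (hcoordL o' : CoordSpace n →L[ℂ] ℂ)
      · simp [h, Ne.symm h]
    rw [Finset.sum_congr rfl fun o' _ => h1 o', Finset.sum_add_distrib, Finset.smul_sum,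
      Finset.sum_ite_eq' Finset.univ o, if_pos (Finset.mem_univ o)]

lemma hcoord_zero {n : ℕ} : hcoord (0 : CoordSpace n) = 0 := by
  ext o; rcases o with _ | i <;> rfl

lemma fderiv_eval_hcoord_zero {n : ℕ} (p : HPoly n) (v : CoordSpace n) :
    fderiv ℂ (fun x => MvPolynomial.eval (hcoord x) p) 0 v =
      ∑ o, MvPolynomial.coeff (Finsupp.single o 1) p * hcoord v o := by
  rw [(hasFDerivAt_eval_hcoord p 0).fderiv]
  simp only [_root_.sum_apply, _root_.smul_apply, hcoordL_apply,
    smul_eq_mul, hcoord_zero, MvPolynomial.eval_zero, MvPolynomial.constantCoeff_eq,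
    MvPolynomial.coeff_pderiv]
  simp

/-- `q` is the homogeneous part of weight `ρ` of `f`, and `f` has no terms of lower weight. -/
def HasLead {n : ℕ} (Λ : Fin n → ℚ) (hΛ : ∀ i, 0 < Λ i) (ρ : ℚ) (f : CoordSpace n → ℂ)
    (q : HPoly n) : Prop :=
  q.IsWeightedHomogeneous (hw Λ) ρ ∧
    WLim (hDil Λ hΛ) ρ f fun x => MvPolynomial.eval (hcoord x) q

/-- The components of `F` have no terms of weight less than that of the corresponding variables,
and the homogeneous parts of this weight are the components of `q`. -/
def IsSuperHom {n : ℕ} (Λ : Fin n → ℚ) (hΛ : ∀ i, 0 < Λ i) (F : CoordSpace n → CoordSpace n)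
    (q : Option (Fin n) → HPoly n) : Prop :=
  ∀ o, HasLead Λ hΛ (hw Λ o) (fun x => hcoord (F x) o) (q o)

/-! ### Superhomogeneous maps: composition, inversion and invertibility of the homogeneous part. -/

section SuperHom

variable {n : ℕ} {Λ : Fin n → ℚ} {hΛ : ∀ i, 0 < Λ i} {F G : CoordSpace n → CoordSpace n}
  {q r : Option (Fin n) → HPoly n} {ρ : ℚ} {f : CoordSpace n → ℂ}

lemma hw_pos (hΛ : ∀ i, 0 < Λ i) (o : Option (Fin n)) : 0 < hw Λ o := by
  rcases o with _ | i
  · exact one_pos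
  · exact hΛ i

lemma IsSuperHom.dlim (h : IsSuperHom Λ hΛ F q) : DLim (hDil Λ hΛ) (hDil Λ hΛ) F (polyMap q) := by
  refine DLim.of_coord fun o => ?_
  have := (h o).2
  simp only [← hcoord_polyMap] at this
  exact this

lemma HasLead.comp {q' : HPoly n} (hf : HasLead Λ hΛ ρ f q') (hF : IsSuperHom Λ hΛ F q) :
    WLim (hDil Λ hΛ) ρ (fun x => f (F x)) fun x => MvPolynomial.eval (hcoord (polyMap q x)) q' :=
  hf.2.comp hF.dlim

lemma polyMap_unique (h : IsSuperHom Λ hΛ F q) (hG : IsSuperHom Λ hΛ G r)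
    (h' : ∀ᶠ x in 𝓝 0, G (F x) = x) (x : CoordSpace n) : polyMap r (polyMap q x) = x := by
  refine hcoord_injective fun o => ?_
  have h1 := (hG o).comp h
  have h2 : WLim (hDil Λ hΛ) (hw Λ o) (fun x => hcoord (G (F x)) o) fun x => hcoord x o := by
    refine (wlim_coord (δ := hDil Λ hΛ) o).congr ?_
    filter_upwards [h'] with x hx
    rw [hx]; rfl
  rw [hcoord_polyMap]
  exact congrFun (h1.unique h2) x

lemma constantCoeff_eq_zero_of_homogeneous {σ : Type*} {w : σ → ℚ} {p : MvPolynomial σ ℂ}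
    (hp : p.IsWeightedHomogeneous w ρ) (hρ : 0 < ρ) : MvPolynomial.eval 0 p = 0 := by
  rw [MvPolynomial.eval_zero, MvPolynomial.constantCoeff_eq]
  by_contra h
  have := hp h
  simp at this
  exact hρ.ne this

lemma polyMap_zero (hq : ∀ o, (q o).IsWeightedHomogeneous (hw Λ) (hw Λ o)) (hΛ : ∀ i, 0 < Λ i) :
    polyMap q 0 = 0 := by
  refine hcoord_injective fun o => ?_
  rw [hcoord_polyMap, hcoord_zero]
  exact constantCoeff_eq_zero_of_homogeneous (hq o) (hw_pos hΛ o)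

lemma analyticAt_polyMap (q : Option (Fin n) → HPoly n) (x : CoordSpace n) :
    AnalyticAt ℂ (polyMap q) x := by
  refine AnalyticAt.prod (AnalyticAt.pi fun i => analyticAt_eval_hcoord _ _)
    (analyticAt_eval_hcoord _ _)

lemma hcoord_fderiv {F : CoordSpace n → CoordSpace n} (hF : DifferentiableAt ℂ F 0)
    (v : CoordSpace n) (o : Option (Fin n)) :
    hcoord (fderiv ℂ F 0 v) o = fderiv ℂ (fun x => hcoord (F x) o) 0 v := by
  have h1 : HasFDerivAt (fun x => hcoordL o (F x)) ((hcoordL o).comp (fderiv ℂ F 0)) 0 :=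
    (hcoordL o).hasFDerivAt.comp 0 hF.hasFDerivAt
  simp only [hcoordL_apply] at h1
  rw [h1.fderiv, ContinuousLinearMap.comp_apply, hcoordL_apply]

lemma isInvertible_of_injective {L : CoordSpace n →L[ℂ] CoordSpace n} (h : ∀ v, L v = 0 → v = 0) :
    L.IsInvertible := by
  have hi : Function.Injective (L : CoordSpace n →ₗ[ℂ] CoordSpace n) :=
    (injective_iff_map_eq_zero _).2 h
  exact ⟨(LinearEquiv.ofInjectiveEndo _ hi).toContinuousLinearEquiv, by ext v <;> rfl⟩

lemma isGermIso_polyMap_of_det (hΛ : ∀ i, 0 < Λ i)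
    (hq : ∀ o, (q o).IsWeightedHomogeneous (hw Λ) (hw Λ o))
    (hd : (Matrix.of fun o o' => MvPolynomial.coeff (Finsupp.single o' 1) (q o)).det ≠ 0) :
    IsGermIso (polyMap q) := by
  refine ⟨analyticAt_polyMap q 0, polyMap_zero hq hΛ, isInvertible_of_injective fun v hv => ?_⟩
  by_contra hne
  refine hd (Matrix.exists_mulVec_eq_zero_iff.1 ⟨hcoord v, fun h => hne ?_, ?_⟩)
  · exact hcoord_injective fun o => by rw [congrFun h o, hcoord_zero]
  · ext o
    have h1 := hcoord_fderiv (analyticAt_polyMap q 0).differentiableAt v o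
    simp only [hcoord_polyMap] at h1
    rw [hv, fderiv_eval_hcoord_zero, hcoord_zero] at h1
    exact h1.symm

/-- Conjugation with the diagonal matrix of the powers `s ^ w` does not change the determinant. As
`s → 0` the entries with `w i < w j` are scaled away, while those with `w j < w i` vanish by
assumption. -/
lemma det_scaling_limit {ι : Type*} [Fintype ι] [DecidableEq ι] {J : Matrix ι ι ℂ} {w : ι → ℚ}
    (hJ : ∀ i j, w j < w i → J i j = 0) :
    (Matrix.of fun i j => if w j = w i then J i j else 0).det = J.det := by
  let D : ℝ → Matrix ι ι ℂ := fun s =>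
    Matrix.diagonal (fun i => ((s ^ (-(w i) : ℝ) : ℝ) : ℂ)) * J *
      Matrix.diagonal (fun i => ((s ^ (w i : ℝ) : ℝ) : ℂ))
  have h1 : ∀ s : ℝ, 0 < s → (D s).det = J.det := by
    intro s hs
    simp only [D, Matrix.det_mul, Matrix.det_diagonal]
    have : (∏ i, ((s ^ (-(w i) : ℝ) : ℝ) : ℂ)) * ∏ i, ((s ^ (w i : ℝ) : ℝ) : ℂ) = 1 := by
      rw [← Finset.prod_mul_distrib]
      refine Finset.prod_eq_one fun i _ => ?_
      rw [← Complex.ofReal_mul, ← Real.rpow_add hs]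
      simp
    linear_combination J.det * this
  have h2 : Tendsto D (𝓝[>] 0) (𝓝 (Matrix.of fun i j => if w j = w i then J i j else 0)) := by
    refine tendsto_pi_nhds.2 fun i => tendsto_pi_nhds.2 fun j => ?_
    simp only [Matrix.of_apply]
    have h3 : ∀ᶠ s : ℝ in 𝓝[>] 0, D s i j = ((s ^ ((w j : ℝ) - w i) : ℝ) : ℂ) * J i j := by
      filter_upwards [self_mem_nhdsWithin] with s hs
      simp only [D, Matrix.mul_diagonal, Matrix.diagonal_mul]
      rw [sub_eq_neg_add, Real.rpow_add hs]
      push_cast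
      ring
    refine Tendsto.congr' (EventuallyEq.symm h3) ?_
    rcases lt_trichotomy (w j) (w i) with h | h | h
    · simp [hJ i j h]
    · rw [if_pos h, h]
      simp
    · rw [if_neg h.ne']
      have := (Complex.continuous_ofReal.tendsto _).comp
        (tendsto_rpow_nhdsGT_zero (r := (w j : ℝ) - w i) (by rw [sub_pos]; exact_mod_cast h))
      simpa using this.mul_const (J i j)
  have h3 := (Continuous.matrix_det continuous_id).tendsto
    (Matrix.of fun i j => if w j = w i then J i j else 0)
  have h4 := h3.comp h2
  refine tendsto_nhds_unique h4 (tendsto_const_nhds.congr' ?_)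
  filter_upwards [self_mem_nhdsWithin] with s hs
  exact (h1 s hs).symm

lemma exists_eps_mul_gt (δ : Dilation (CoordSpace n) (Option (Fin n))) (ρ : ℚ) :
    ∃ N : ℕ, 2 ≤ N ∧ ρ < N * δ.ε := by
  obtain ⟨N, hN⟩ := exists_nat_mul_gt δ ρ
  refine ⟨N + 2, by omega, ?_⟩
  push_cast
  nlinarith [δ.ε_pos]

lemma fderiv_of_isApprox {N : ℕ} (hN : 2 ≤ N) {p : HPoly n} (h : IsApprox (hDil Λ hΛ) N f p)
    (v : CoordSpace n) :
    fderiv ℂ f 0 v = ∑ o, MvPolynomial.coeff (Finsupp.single o 1) p * hcoord v o := by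
  have h1 : HasFDerivAt (fun x => f x - MvPolynomial.eval (hcoord x) p) (0 : CoordSpace n →L[ℂ] ℂ) 0 := by
    refine Asymptotics.IsBigO.hasFDerivAt (n := N) ?_ (by omega)
    have h' : (fun x => f x - MvPolynomial.eval (hcoord x) p) =O[𝓝 0] fun x => ‖x‖ ^ N := h
    simpa using h'
  have h2 := h1.add (analyticAt_eval_hcoord p 0).differentiableAt.hasFDerivAt
  have h3 : HasFDerivAt f _ 0 := h2.congr_of_eventuallyEq (Eventually.of_forall fun x => by simp)
  rw [h3.fderiv, zero_add, fderiv_eval_hcoord_zero]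

/-- The Jacobian of `F` is block triangular with respect to the weights, and the Jacobian of the
homogeneous part consists of its diagonal blocks. Both have the same determinant by
`det_scaling_limit`. -/
lemma IsGermIso.polyMap (hF : IsGermIso F) (h : IsSuperHom Λ hΛ F q) : IsGermIso (polyMap q) := by
  classical
  refine isGermIso_polyMap_of_det hΛ (fun o => (h o).1) ?_
  have hA : ∀ o, AnalyticAt ℂ (fun x => hcoord (F x) o) 0 := by
    intro o
    simp only [← hcoordL_apply]
    exact ((hcoordL o).analyticAt _).comp hF.analyticAt
  obtain ⟨N, hN, hN1⟩ : ∃ N : ℕ, 2 ≤ N ∧ ∀ o, hw Λ o < N * (hDil Λ hΛ).ε := by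
    choose N h1 h2 using fun o => exists_eps_mul_gt (hDil Λ hΛ) (hw Λ o)
    refine ⟨∑ o, N o, (h1 none).trans (Finset.single_le_sum (fun _ _ => Nat.zero_le _)
      (Finset.mem_univ none)), fun o => (h2 o).trans_le ?_⟩
    have : (N o : ℚ) ≤ (∑ o, N o : ℕ) := by
      exact_mod_cast Finset.single_le_sum (fun _ _ => Nat.zero_le _) (Finset.mem_univ o)
    exact mul_le_mul_of_nonneg_right this (hDil Λ hΛ).ε_pos.le
  choose p hp using fun o => exists_isApprox_of_analyticAt (hA o) N hΛ
  have hq : ∀ o, q o = MvPolynomial.weightedHomogeneousComponent (hw Λ) (hw Λ o) (p o) := by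
    intro o
    have h1 := (hp o).wlim_component (hN1 o) (h o).2
    refine sub_eq_zero.1 ((hDil Λ hΛ).eq_zero _ fun x => ?_)
    rw [map_sub, sub_eq_zero]
    exact congrFun h1 x
  have hw1 : ∀ o : Option (Fin n), Finsupp.weight (hw Λ) (Finsupp.single o 1) = hw Λ o := by
    intro o; simp [Finsupp.weight_apply]
  let J : Matrix (Option (Fin n)) (Option (Fin n)) ℂ :=
    Matrix.of fun o o' => MvPolynomial.coeff (Finsupp.single o' 1) (p o)
  have hJ0 : ∀ o o', hw Λ o' < hw Λ o → J o o' = 0 := by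
    intro o o' hlt
    by_contra hne
    have := (hp o).le_weight (hN1 o) (h o).2 _ (MvPolynomial.mem_support_iff.2 hne)
    change hw Λ o ≤ Finsupp.weight (hw Λ) _ at this
    rw [hw1] at this
    exact absurd hlt (not_lt.2 this)
  have h1 : (Matrix.of fun o o' => MvPolynomial.coeff (Finsupp.single o' 1) (q o)) =
      Matrix.of fun o o' => if hw Λ o' = hw Λ o then J o o' else 0 := by
    ext o o'
    simp only [Matrix.of_apply, hq, MvPolynomial.coeff_weightedHomogeneousComponent, hw1, J]
  rw [h1, det_scaling_limit hJ0]
  intro hdet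
  obtain ⟨v, hv, hJv⟩ := Matrix.exists_mulVec_eq_zero_iff.2 hdet
  obtain ⟨e, he⟩ := hF.isInvertible
  let v' : CoordSpace n := (fun i => v (some i), v none)
  have hv' : hcoord v' = v := by ext o; rcases o with _ | i <;> rfl
  have h2 : fderiv ℂ F 0 v' = 0 := by
    refine hcoord_injective fun o => ?_
    rw [hcoord_fderiv hF.analyticAt.differentiableAt, fderiv_of_isApprox hN (hp o), hv', hcoord_zero]
    exact congrFun hJv o
  rw [← he] at h2
  have h3 : v' = 0 := e.injective (h2.trans (_root_.map_zero e).symm)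
  apply hv
  rw [← hv', h3, hcoord_zero]

lemma IsGermIso.eventually_exists (hF : IsGermIso F) : ∀ᶠ y in 𝓝 0, ∃ x, F x = y := by
  obtain ⟨G, -, -, h⟩ := hF.exists_inverse
  exact h.mono fun y hy => ⟨_, hy⟩

/-- Polynomials vanishing on the image of a germ of a biholomorphic map vanish. -/
lemma eq_zero_of_eval_comp {p : HPoly n} (hp : p.IsWeightedHomogeneous (hw Λ) ρ)
    (hΛ : ∀ i, 0 < Λ i) (hF : IsGermIso F)
    (h : ∀ x, MvPolynomial.eval (hcoord (F x)) p = 0) : p = 0 := by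
  refine (hDil Λ hΛ).eq_zero p (eval_eq_zero_of_eventually (δ := hDil Λ hΛ) hp ?_)
  filter_upwards [hF.eventually_exists] with y ⟨x, hx⟩
  rw [← hx]
  exact h x

/-- If `f` had terms of weight below `ρ`, its lowest part would vanish on the image of the
polynomial map `q`. This image contains a neighbourhood of the origin, so the lowest part would be
zero. -/
lemma exists_hasLead_of_comp (hf : AnalyticAt ℂ f 0) (hF : IsGermIso F) (h : IsSuperHom Λ hΛ F q)
    {g₀ : CoordSpace n → ℂ} (hg : WLim (hDil Λ hΛ) ρ (fun x => f (F x)) g₀) :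
    ∃ q', HasLead Λ hΛ ρ f q' := by
  classical
  obtain ⟨N, hN⟩ := exists_nat_mul_gt (hDil Λ hΛ) ρ
  obtain ⟨p, hp⟩ := exists_isApprox_of_analyticAt hf N hΛ
  by_cases hw' : ∀ m ∈ p.support, ρ ≤ Finsupp.weight (hw Λ) m
  · exact ⟨_, MvPolynomial.weightedHomogeneousComponent_isWeightedHomogeneous _ _, hp.wlim hN hw'⟩
  · push Not at hw'
    obtain ⟨m, hm, hlt⟩ := hw'
    obtain ⟨ρ', hρ', -, -, -, q', hq', hq'h, hlim⟩ := hp.exists_lower hN hm hlt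
    exfalso
    have h1 := hlim.comp h.dlim
    have h2 := h1.unique (hg.of_lt hρ')
    exact hq' (eq_zero_of_eval_comp hq'h hΛ (hF.polyMap h) fun x => congrFun h2 x)

lemma IsGermIso.analyticAt_hcoord (hF : IsGermIso F) (o : Option (Fin n)) :
    AnalyticAt ℂ (fun x => hcoord (F x) o) 0 := by
  simp only [← hcoordL_apply]
  exact ((hcoordL o).analyticAt _).comp hF.analyticAt

/-- If `G ∘ F` and `F` are superhomogeneous, so is `G`. -/
lemma exists_isSuperHom_of_comp (hF : IsGermIso F) (h : IsSuperHom Λ hΛ F q) (hG : IsGermIso G)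
    (hGF : IsSuperHom Λ hΛ (fun x => G (F x)) r) : ∃ q', IsSuperHom Λ hΛ G q' := by
  choose q' hq' using fun o => exists_hasLead_of_comp (hG.analyticAt_hcoord o) hF h (hGF o).2
  exact ⟨q', hq'⟩

lemma isSuperHom_id : IsSuperHom Λ hΛ (fun x => x) MvPolynomial.X := fun o =>
  ⟨MvPolynomial.isWeightedHomogeneous_X _ _ _, by
    simp only [MvPolynomial.eval_X]
    exact wlim_coord (δ := hDil Λ hΛ) o⟩

lemma IsSuperHom.congr (h : IsSuperHom Λ hΛ F q) (hFG : ∀ᶠ x in 𝓝 0, F x = G x) :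
    IsSuperHom Λ hΛ G q := fun o =>
  ⟨(h o).1, (h o).2.congr (hFG.mono fun x hx => by simp only [hx])⟩

lemma exists_isSuperHom_inverse (hF : IsGermIso F) (h : IsSuperHom Λ hΛ F q) (hG : IsGermIso G)
    (hGF : ∀ᶠ x in 𝓝 0, G (F x) = x) : ∃ q', IsSuperHom Λ hΛ G q' :=
  exists_isSuperHom_of_comp hF h hG ((isSuperHom_id (hΛ := hΛ)).congr (hGF.mono fun _ h => h.symm))

lemma isSuperHom_polyMap (hΛ : ∀ i, 0 < Λ i)
    (hq : ∀ o, (q o).IsWeightedHomogeneous (hw Λ) (hw Λ o)) : IsSuperHom Λ hΛ (polyMap q) q :=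
  fun o => ⟨hq o, by
    simp only [hcoord_polyMap]
    exact wlim_eval_of_homogeneous (δ := hDil Λ hΛ) (hq o)⟩

/-! ### The part of a polynomial in `z` alone -/

/-- The polynomial `q(z, 0)`. -/
def toZ : HPoly n →ₐ[ℂ] MvPolynomial (Fin n) ℂ :=
  MvPolynomial.aeval fun o => o.elim 0 MvPolynomial.X

lemma eval_toZ (p : HPoly n) (z : Fin n → ℂ) :
    MvPolynomial.eval z (toZ p) = MvPolynomial.eval (hcoord (z, 0)) p := by
  have : (MvPolynomial.aeval z).comp (toZ (n := n)) =
      (MvPolynomial.aeval (hcoord (z, (0 : ℂ))) : HPoly n →ₐ[ℂ] ℂ) := by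
    refine MvPolynomial.algHom_ext fun o => ?_
    rcases o with _ | i <;> simp [toZ, hcoord]
  exact DFunLike.congr_fun this p

lemma weight_hw_of_none (hΛ : ∀ i, 0 < Λ i) {m : Option (Fin n) →₀ ℕ}
    (hm : Finsupp.weight (hw Λ) m ≤ 1) : m none = 0 ∨ m = Finsupp.single none 1 := by
  rw [weight_eq_sum, Fintype.sum_option] at hm
  have h0 : 0 ≤ ∑ i, (m (some i) : ℚ) * hw Λ (some i) :=
    Finset.sum_nonneg fun i _ => mul_nonneg (by positivity) (hΛ i).le
  by_cases hn : m none = 0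
  · exact Or.inl hn
  · right
    have h1 : (1 : ℚ) ≤ m none := by exact_mod_cast Nat.one_le_iff_ne_zero.2 hn
    simp only [hw, Option.elim, mul_one] at hm h0
    have h2 : (m none : ℚ) = 1 := by linarith
    have h3 : ∑ i, (m (some i) : ℚ) * Λ i = 0 := by linarith
    have h4 := (Finset.sum_eq_zero_iff_of_nonneg
      fun i _ => mul_nonneg (by positivity) (hΛ i).le).1 h3
    ext o
    rcases o with _ | i
    · simpa using h2
    · have := (mul_eq_zero.1 (h4 i (Finset.mem_univ i))).resolve_right (hΛ i).ne'
      simpa using this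

/-- Since `w` has weight one, it can occur in a polynomial of weight at most one only as a linear
term on its own. -/
lemma eval_hcoord_eq (hΛ : ∀ i, 0 < Λ i) {p : HPoly n} (hp : p.IsWeightedHomogeneous (hw Λ) ρ)
    (hρ : ρ ≤ 1) (x : CoordSpace n) :
    MvPolynomial.eval (hcoord x) p =
      MvPolynomial.coeff (Finsupp.single none 1) p * x.2 + MvPolynomial.eval x.1 (toZ p) := by
  classical
  rw [eval_toZ, ← sub_eq_iff_eq_add, MvPolynomial.eval_eq', MvPolynomial.eval_eq',
    ← Finset.sum_sub_distrib]
  have h1 : ∀ m ∈ p.support, MvPolynomial.coeff m p * ∏ o, hcoord x o ^ m o -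
      MvPolynomial.coeff m p * ∏ o, hcoord (x.1, (0 : ℂ)) o ^ m o =
      if m = Finsupp.single none 1 then MvPolynomial.coeff m p * x.2 else 0 := by
    intro m hm
    have h2 := hp (MvPolynomial.mem_support_iff.1 hm)
    rcases weight_hw_of_none hΛ (h2.le.trans hρ) with h3 | h3
    · have hne : m ≠ Finsupp.single none 1 := by rintro rfl; simp at h3
      rw [if_neg hne, Fintype.prod_option, Fintype.prod_option, h3]
      simp [hcoord]
    · rw [if_pos h3, h3, Fintype.prod_option, Fintype.prod_option]
      simp [hcoord]
  rw [Finset.sum_congr rfl h1, Finset.sum_ite_eq']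
  split_ifs with h
  · rfl
  · rw [MvPolynomial.notMem_support_iff.1 h, zero_mul]

lemma coeff_none_eq_zero {p : HPoly n} (hp : p.IsWeightedHomogeneous (hw Λ) ρ) (hρ : ρ < 1) :
    MvPolynomial.coeff (Finsupp.single none 1) p = 0 := by
  by_contra h
  have := hp h
  simp [Finsupp.weight_apply, hw] at this
  exact hρ.ne this.symm

end SuperHom

/-! ### Transition maps and leading polynomials -/

section Transition

variable {n : ℕ} {Λ : Fin n → ℚ} {hΛ : ∀ i, 0 < Λ i} {Ψ Ψ' : GraphSpace n → ℝ} {P P' : ZPoly n}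
  {F : CoordSpace n → CoordSpace n} {q : Option (Fin n) → HPoly n} {ρ : ℚ}

lemma hcoord_surjective : Function.Surjective (hcoord (n := n)) := fun c =>
  ⟨(fun i => c (some i), c none), by ext o; rcases o with _ | i <;> rfl⟩

/-- The parametrization of the hypersurface `v = P(z, z̄)`. -/
def liftLead (P : ZPoly n) (y : GraphSpace n) : CoordSpace n :=
  (y.1, (y.2 : ℂ) + P.value y.1 * Complex.I)

lemma dlim_graphLift (hΨ : IsGraphFun Ψ) (h : IsLeading Λ Ψ P) :
    DLim (gDil Λ hΛ) (hDil Λ hΛ) (graphLift Ψ) (liftLead P) := by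
  refine DLim.of_coord fun o => ?_
  rcases o with _ | i
  · have h1 : WLim (gDil Λ hΛ) 1 (fun y => (y.2 : ℂ)) fun y => (y.2 : ℂ) :=
      wlim_coord (δ := gDil Λ hΛ) none
    have h2 := (((isLeading_iff_wlim hΛ hΨ P).1 h).2).const_mul Complex.I
    have h3 := h1.add h2
    simp only [mul_comm Complex.I] at h3
    exact h3
  · exact wlim_coord (δ := gDil Λ hΛ) (some (Sum.inl i))

lemma dlim_graphProj : DLim (hDil Λ hΛ) (gDil Λ hΛ) graphProj graphProj := by
  refine DLim.of_coord fun o => ?_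
  rcases o with _ | i | i
  · exact (wlim_coord (δ := hDil Λ hΛ) none).re
  · exact wlim_coord (δ := hDil Λ hΛ) (some i)
  · exact (wlim_coord (δ := hDil Λ hΛ) (some i)).conj

lemma IsLeading.value_im (hΛ : ∀ i, 0 < Λ i) (hΨ : IsGraphFun Ψ) (h : IsLeading Λ Ψ P)
    (z : Fin n → ℂ) : (P.value z).im = 0 := by
  have h1 := (((isLeading_iff_wlim hΛ hΨ P).1 h).2).im
  simp only [Complex.ofReal_im, Complex.ofReal_zero] at h1
  have := congrFun (h1.unique WLim.zero) ((z, 0) : GraphSpace n)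
  simpa using this

/-- Because the differential of `Ψ` vanishes at the origin, strict differentiability makes the
dependence on `u` negligible against `u`. This handles `u` before the weight of the last component
of a transition map is known. -/
lemma IsGraphFun.isLittleO (hΨ : IsGraphFun Ψ) :
    (fun x : CoordSpace n => (Ψ (graphProj x) : ℂ) - Ψ (x.1, 0)) =o[𝓝 0]
      fun x => ((x.2.re : ℝ) : ℂ) := by
  have h1 : HasStrictFDerivAt Ψ (0 : GraphSpace n →L[ℝ] ℝ) 0 := by
    rw [← hΨ.2.2]
    exact hΨ.1.self_of_nhds.hasStrictFDerivAt (by simp)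
  have h2 := h1.isLittleO
  have h3 : Tendsto (fun x : CoordSpace n => ((graphProj x, (x.1, (0 : ℝ))) :
      GraphSpace n × GraphSpace n)) (𝓝 0) (𝓝 (0, 0)) := by
    have : Continuous (fun x : CoordSpace n => ((graphProj x, (x.1, (0 : ℝ))) :
        GraphSpace n × GraphSpace n)) := by unfold graphProj; fun_prop
    exact this.tendsto' _ _ (by simp [graphProj])
  have h4 := h2.comp_tendsto h3
  refine (Asymptotics.isLittleO_iff).2 fun c hc => ?_
  filter_upwards [(Asymptotics.isLittleO_iff.1 h4) hc] with x hx
  simp only [Function.comp, zero_apply, sub_zero] at hx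
  rw [← Complex.ofReal_sub, Complex.norm_real, Complex.norm_real]
  refine hx.trans (le_of_eq ?_)
  simp [graphProj, Prod.norm_def]

lemma IsTransition.tendsto_lift (hF : IsTransition Ψ Ψ' F) (hΨ : IsGraphFun Ψ) :
    Tendsto (fun y => F (graphLift Ψ y)) (𝓝 0) (𝓝 0) :=
  hF.toIsGermIso.tendsto.comp hΨ.tendsto_graphLift

/-- On the image hypersurface `v = Ψ'(z, 0) + o(u)`. If `w` has a limit of weight `ρ`, then `o(u)`
contributes nothing in this weight, so `v` has limit zero there. -/
lemma IsTransition.im_eq_zero (hF : IsTransition Ψ Ψ' F) (hΨ : IsGraphFun Ψ) (hΨ' : IsGraphFun Ψ')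
    {g₀ : GraphSpace n → ℂ}
    (h0 : WLim (gDil Λ hΛ) ρ (fun y => (Ψ' ((F (graphLift Ψ y)).1, 0) : ℂ)) fun _ => 0)
    (hG : WLim (gDil Λ hΛ) ρ (fun y => (F (graphLift Ψ y)).2) g₀) (y : GraphSpace n) :
    (g₀ y).im = 0 := by
  have h1 := hΨ'.isLittleO.comp_tendsto (hF.tendsto_lift hΨ)
  have h2 := (hG.re.of_isLittleO h1).add h0
  have h3 := h2.congr (g := fun y => (((F (graphLift Ψ y)).2.im : ℝ) : ℂ)) (by
    filter_upwards [hF.graph] with y hy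
    simp [hy])
  have h4 := congrFun (hG.im.unique h3) y
  simpa using h4

/-- If `Ψ'` is small on the image of the hypersurface, the last component of a transition map has no
terms of weight less than one. -/
lemma IsTransition.exists_hasLead_snd (hF : IsTransition Ψ Ψ' F) (hΨ : IsGraphFun Ψ)
    (hΨ' : IsGraphFun Ψ') (hP : IsLeading Λ Ψ P)
    (h0 : ∀ ρ < 1, WLim (gDil Λ hΛ) ρ (fun y => (Ψ' ((F (graphLift Ψ y)).1, 0) : ℂ)) fun _ => 0) :
    ∃ q, HasLead Λ hΛ 1 (fun x => (F x).2) q := by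
  classical
  have hA : AnalyticAt ℂ (fun x => (F x).2) 0 := hF.toIsGermIso.analyticAt_hcoord none
  obtain ⟨N, hN⟩ := exists_nat_mul_gt (hDil Λ hΛ) 1
  obtain ⟨p, hp⟩ := exists_isApprox_of_analyticAt hA N hΛ
  by_cases hw' : ∀ m ∈ p.support, 1 ≤ Finsupp.weight (hw Λ) m
  · exact ⟨_, MvPolynomial.weightedHomogeneousComponent_isWeightedHomogeneous _ _, hp.wlim hN hw'⟩
  push Not at hw'
  obtain ⟨m, hm, hlt⟩ := hw'
  obtain ⟨ρ', hρ', m₀, -, hm₀, q, hq, hqh, hlim⟩ := hp.exists_lower hN hm hlt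
  exfalso
  have hnn : 0 ≤ ρ' := by
    rw [← hm₀, weight_eq_sum]
    exact Finset.sum_nonneg fun o _ => mul_nonneg (by positivity) (hw_pos hΛ o).le
  have hq0 : ∀ x, MvPolynomial.eval (hcoord x) q = 0 := by
    rcases hnn.eq_or_lt with h | hpos
    -- The rotation argument needs positive weight. In weight zero the limit would be a constant
    -- term, excluded by `F 0 = 0`.
    · have hT : Tendsto (fun x => (F x).2) (𝓝 0) (𝓝 0) := by
        have := (continuous_snd.tendsto (0 : CoordSpace n)).comp hF.toIsGermIso.tendsto
        exact this
      have h1 := (wlim_const (δ := hDil Λ hΛ) 1).mul_tendsto_zero hT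
      simp only [mul_one] at h1
      rw [h] at h1
      exact fun x => congrFun (hlim.unique h1) x
    · have h1 := hlim.comp (dlim_graphLift hΨ hP)
      have h2 : ∀ y, (MvPolynomial.eval (hcoord (liftLead P y)) q).im = 0 :=
        hF.im_eq_zero hΨ hΨ' (h0 ρ' hρ') h1
      -- Below weight one the polynomial does not contain `w`, so what is known on the hypersurface
      -- `v = P` holds at every point.
      have h3 : ∀ x : CoordSpace n, (MvPolynomial.eval (hcoord x) q).im = 0 := by
        intro x
        have := h2 (x.1, 0)
        rw [eval_hcoord_eq hΛ hqh hρ'.le, coeff_none_eq_zero hqh hρ'] at this ⊢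
        simpa [liftLead] using this
      intro x
      refine eval_eq_zero_of_im_eq_zero hqh hpos (fun c => ?_) _
      obtain ⟨x', rfl⟩ := hcoord_surjective c
      exact h3 x'
  exact hq ((hDil Λ hΛ).eq_zero q hq0)

lemma dlim_flat {f : GraphSpace n → Fin n → ℂ} {f₀ : Fin n → GraphSpace n → ℂ}
    (hf : ∀ i, WLim (gDil Λ hΛ) (Λ i) (fun y => f y i) (f₀ i)) :
    DLim (gDil Λ hΛ) (gDil Λ hΛ) (fun y => (f y, (0 : ℝ))) fun y => (fun i => f₀ i y, (0 : ℝ)) := by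
  refine DLim.of_coord fun o => ?_
  rcases o with _ | i | i
  · have : WLim (gDil Λ hΛ) 1 (fun _ => ((0 : ℝ) : ℂ)) (fun _ => ((0 : ℝ) : ℂ)) := by
      simpa using WLim.zero
    exact this
  · exact hf i
  · exact (hf i).conj

lemma IsLeading.wlim_flat (hΨ' : IsGraphFun Ψ') (hP' : IsLeading Λ Ψ' P')
    {f : GraphSpace n → Fin n → ℂ} {f₀ : Fin n → GraphSpace n → ℂ}
    (hf : ∀ i, WLim (gDil Λ hΛ) (Λ i) (fun y => f y i) (f₀ i)) :
    WLim (gDil Λ hΛ) 1 (fun y => (Ψ' (f y, 0) : ℂ)) fun y => P'.value fun i => f₀ i y := by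
  have h1 := ((isLeading_iff_wlim hΛ hΨ' P').1 hP').2
  have h2 := h1.comp (dlim_flat hf)
  exact h2

/-- A transition map whose first components are superhomogeneous is superhomogeneous. -/
lemma IsTransition.exists_isSuperHom (hF : IsTransition Ψ Ψ' F) (hΨ : IsGraphFun Ψ)
    (hΨ' : IsGraphFun Ψ') (hP : IsLeading Λ Ψ P) (hP' : IsLeading Λ Ψ' P')
    (h : ∀ i, ∃ q, HasLead Λ hΛ (Λ i) (fun x => (F x).1 i) q) : ∃ q, IsSuperHom Λ hΛ F q := by
  choose r hr using h
  have h1 := hP'.wlim_flat (hΛ := hΛ) hΨ' (f := fun y => (F (graphLift Ψ y)).1)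
    fun i => (hr i).2.comp (dlim_graphLift hΨ hP)
  obtain ⟨g, hg⟩ := hF.exists_hasLead_snd hΨ hΨ' hP fun ρ hρ => h1.of_lt hρ
  exact ⟨fun o => o.elim g r, fun o => by rcases o with _ | i; exacts [hg, hr i]⟩

/-- As the `z_i` have weight less than one, they do not occur linearly in the last component.
Without a linear term in `w` its differential would vanish, contradicting invertibility. -/
lemma coeff_none_ne_zero (hF : IsGermIso F) (hΛ1 : ∀ i, Λ i < 1) {q : HPoly n}
    (hq : HasLead Λ hΛ 1 (fun x => (F x).2) q) :
    MvPolynomial.coeff (Finsupp.single none 1) q ≠ 0 := by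
  classical
  intro h0
  have hA : AnalyticAt ℂ (fun x => (F x).2) 0 := hF.analyticAt_hcoord none
  obtain ⟨N, hN2, hN⟩ := exists_eps_mul_gt (hDil Λ hΛ) 1
  obtain ⟨p, hp⟩ := exists_isApprox_of_analyticAt hA N hΛ
  have h1 := hp.le_weight hN hq.2
  have h2 : q = MvPolynomial.weightedHomogeneousComponent (hw Λ) 1 p := by
    refine sub_eq_zero.1 ((hDil Λ hΛ).eq_zero _ fun x => ?_)
    rw [map_sub, sub_eq_zero]
    exact congrFun (hp.wlim_component hN hq.2) x
  have hw1 : ∀ o : Option (Fin n), Finsupp.weight (hw Λ) (Finsupp.single o 1) = hw Λ o := by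
    intro o; simp [Finsupp.weight_apply]
  have h3 : ∀ o, MvPolynomial.coeff (Finsupp.single o 1) p = 0 := by
    rintro (_ | i)
    · rw [h2, MvPolynomial.coeff_weightedHomogeneousComponent, if_pos (show _ = (1 : ℚ) from hw1 none)] at h0
      exact h0
    · by_contra hne
      have := h1 _ (MvPolynomial.mem_support_iff.2 hne)
      change 1 ≤ Finsupp.weight (hw Λ) _ at this
      rw [hw1] at this
      exact absurd (hΛ1 i) (not_lt.2 this)
  obtain ⟨e, he⟩ := hF.isInvertible
  have h4 := fderiv_of_isApprox hN2 hp (e.symm (0, 1))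
  have h5 := hcoord_fderiv hF.analyticAt.differentiableAt (e.symm (0, 1)) none
  rw [← he] at h5
  simp only [h3, zero_mul, Finset.sum_const_zero] at h4
  change hcoord (e (e.symm (0, 1))) none = fderiv ℂ (fun x => (F x).2) 0 (e.symm (0, 1)) at h5
  rw [h4, e.apply_symm_apply] at h5
  simp [hcoord] at h5

lemma weight_gw_of_lt (hΛ : ∀ i, 0 < Λ i) {m : GVar n →₀ ℕ} (hm : Finsupp.weight (gw Λ) m < 1) :
    m none = 0 := by
  rw [eq_gexp m, weight_gexp] at hm
  have := wlen_nonneg (fun i => (hΛ i).le) (fun i => m (some (Sum.inl i)))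
    (fun i => m (some (Sum.inr i)))
  by_contra h
  have h1 : (1 : ℚ) ≤ m none := by exact_mod_cast Nat.one_le_iff_ne_zero.2 h
  linarith

lemma eval_gcoord_of_lt (hΛ : ∀ i, 0 < Λ i) {p : MvPolynomial (GVar n) ℂ}
    (hp : p.IsWeightedHomogeneous (gw Λ) ρ) (hρ : ρ < 1) (z : Fin n → ℂ) (u u' : ℝ) :
    MvPolynomial.eval (gcoord (z, u)) p = MvPolynomial.eval (gcoord (z, u')) p := by
  rw [MvPolynomial.eval_eq', MvPolynomial.eval_eq']
  refine Finset.sum_congr rfl fun m hm => ?_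
  have h1 := weight_gw_of_lt hΛ ((hp (MvPolynomial.mem_support_iff.1 hm)).trans_lt hρ)
  rw [Fintype.prod_option, Fintype.prod_option, h1]
  simp [gcoord]

/-- A function bounded by weight one on a hypersurface has a leading polynomial. -/
lemma exists_isLeading_of_lower (hΛ : ∀ i, 0 < Λ i) (hΨ : IsGraphFun Ψ)
    (h : ∀ ρ < 1, ∀ p : MvPolynomial (GVar n) ℂ, p.IsWeightedHomogeneous (gw Λ) ρ →
      WLim (gDil Λ hΛ) ρ (fun y => (Ψ y : ℂ)) (fun y => MvPolynomial.eval (gcoord y) p) → p = 0) :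
    ∃ P, IsLeading Λ Ψ P := by
  classical
  obtain ⟨N, hN⟩ := exists_nat_mul_gt (gDil Λ hΛ) 1
  obtain ⟨p, hp, hO⟩ := hΨ.smoothNear.taylor N
  have hN' : 1 < ((N + 1 : ℕ) : ℚ) * (gDil Λ hΛ).ε := by
    push_cast; nlinarith [(gDil Λ hΛ).ε_pos]
  have hA : IsApprox (gDil Λ hΛ) (N + 1) (fun y => (Ψ y : ℂ)) p := hO
  refine exists_isLeading hΛ hΨ fun α β hαβ => ?_
  have h1 : MvPolynomial.coeff (gexp α β 0) p = 0 := by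
    by_contra hne
    have hlt : Finsupp.weight (gDil Λ hΛ).w (gexp α β 0) < 1 := by
      change Finsupp.weight (gw Λ) _ < 1
      rw [weight_gexp]; simpa using hαβ
    obtain ⟨ρ', hρ', -, -, -, q, hq, hqh, hlim⟩ :=
      hA.exists_lower hN' (MvPolynomial.mem_support_iff.2 hne) hlt
    exact hq (h ρ' hρ' q hqh hlim)
  have hdeg : (gexp α β 0).degree ≤ N := by
    obtain ⟨-, h1, h2⟩ := minWeight_spec hΛ
    have h3 : ((gexp α β 0).degree : ℚ) * (gDil Λ hΛ).ε ≤ Finsupp.weight (gw Λ) (gexp α β 0) := by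
      refine mul_degree_le_weight (fun o => ?_) _
      rcases o with _ | i | i
      · exact h1
      · exact h2 i
      · exact h2 i
    rw [weight_gexp] at h3
    have h4 : ((gexp α β 0).degree : ℚ) * (gDil Λ hΛ).ε < N * (gDil Λ hΛ).ε := by
      push_cast at h3; linarith
    have := lt_of_mul_lt_mul_right h4 (gDil Λ hΛ).ε_pos.le
    exact_mod_cast this.le
  have h2 := hp _ hdeg
  rw [taylorCoeff_eq_iterDer, h1, mul_zero] at h2
  exact (mul_eq_zero.1 h2).resolve_left (multiFact_ne_zero _)

/-- The image of a hypersurface with a leading polynomial under a superhomogeneous map has a leading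
polynomial. -/
lemma IsTransition.exists_isLeading (hF : IsTransition Ψ Ψ' F) (hΨ : IsGraphFun Ψ)
    (hΨ' : IsGraphFun Ψ') (hP : IsLeading Λ Ψ P) (hΛ1 : ∀ i, Λ i < 1) (h : IsSuperHom Λ hΛ F q) :
    ∃ P', IsLeading Λ Ψ' P' := by
  refine exists_isLeading_of_lower hΛ hΨ' fun ρ hρ r hr hlim => ?_
  have hD := h.dlim.comp (dlim_graphLift hΨ hP)
  have h1 := hlim.comp (dlim_graphProj.comp hD)
  have h2 : WLim (gDil Λ hΛ) 1 (fun y => (((F (graphLift Ψ y)).2.im : ℝ) : ℂ)) _ :=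
    ((h none).2.comp (dlim_graphLift hΨ hP)).im
  have h3 := (h2.of_lt hρ).congr (g := fun y => (Ψ' (graphProj (F (graphLift Ψ y))) : ℂ)) (by
    filter_upwards [hF.graph] with y hy
    simp [hy])
  have h4 := h1.unique h3
  refine (gDil Λ hΛ).eq_zero r (eval_eq_zero_of_eventually (δ := gDil Λ hΛ) hr ?_)
  have h5 : Tendsto (fun y : GraphSpace n => ((y.1, 0) : CoordSpace n)) (𝓝 0) (𝓝 0) := by
    have : Continuous fun y : GraphSpace n => ((y.1, 0) : CoordSpace n) := by fun_prop
    exact this.tendsto' _ _ rfl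
  -- The `z`-components of the homogeneous map have weight below one and ignore `w`, so every nearby
  -- `z` is hit by a point of the hypersurface `v = P`. There the lower limit `r` is zero.
  filter_upwards [h5.eventually (hF.toIsGermIso.polyMap h).eventually_exists] with y ⟨x, hx⟩
  have h6 : (polyMap q (liftLead P (x.1, 0))).1 = y.1 := by
    ext i
    have h7 : (polyMap q x).1 i = y.1 i := by rw [hx]
    rw [← h7]
    change MvPolynomial.eval (hcoord _) _ = MvPolynomial.eval (hcoord _) _
    have h8 := coeff_none_eq_zero (h (some i)).1 (hΛ1 i)
    rw [eval_hcoord_eq hΛ (h (some i)).1 (hΛ1 i).le, eval_hcoord_eq hΛ (h (some i)).1 (hΛ1 i).le, h8]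
    simp [liftLead]
  refine Eq.trans ?_ (congrFun h4 (x.1, 0))
  refine (eval_gcoord_of_lt hΛ hr hρ y.1 y.2
    (graphProj (polyMap q (liftLead P (x.1, 0)))).2).trans ?_
  rw [← h6]
  rfl

/-- The relation between the leading polynomials with respect to superhomogeneously related
coordinates. -/
lemma IsTransition.leading_relation (hF : IsTransition Ψ Ψ' F) (hΨ : IsGraphFun Ψ)
    (hΨ' : IsGraphFun Ψ') (hP : IsLeading Λ Ψ P) (hP' : IsLeading Λ Ψ' P') (hΛ1 : ∀ i, Λ i < 1)
    (h : IsSuperHom Λ hΛ F q) :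
    ∃ c : ℝ, c ≠ 0 ∧ MvPolynomial.coeff (Finsupp.single none 1) (q none) = c ∧ ∀ z,
      P'.value (fun i => MvPolynomial.eval z (toZ (q (some i)))) =
        c * P.value z + ((MvPolynomial.eval z (toZ (q none))).im : ℝ) := by
  have hD := h.dlim.comp (dlim_graphLift hΨ hP)
  have h1 := (((isLeading_iff_wlim hΛ hΨ' P').1 hP').2).comp (dlim_graphProj.comp hD)
  have h2 : WLim (gDil Λ hΛ) 1 (fun y => (((F (graphLift Ψ y)).2.im : ℝ) : ℂ)) _ :=
    ((h none).2.comp (dlim_graphLift hΨ hP)).im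
  have h3 := h2.congr (g := fun y => (Ψ' (graphProj (F (graphLift Ψ y))) : ℂ)) (by
    filter_upwards [hF.graph] with y hy
    simp [hy])
  have h4 := h1.unique h3
  have h5 : ∀ y : GraphSpace n, (graphProj (polyMap q (liftLead P y))).1 =
      fun i => MvPolynomial.eval y.1 (toZ (q (some i))) := by
    intro y
    ext i
    change MvPolynomial.eval (hcoord _) _ = _
    rw [eval_hcoord_eq hΛ (h (some i)).1 (hΛ1 i).le, coeff_none_eq_zero (h (some i)).1 (hΛ1 i)]
    simp [liftLead]
  set c := MvPolynomial.coeff (Finsupp.single none 1) (q none) with hc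
  have h6 : ∀ y : GraphSpace n, P'.value (fun i => MvPolynomial.eval y.1 (toZ (q (some i)))) =
      ((c * ((y.2 : ℂ) + P.value y.1 * Complex.I) + MvPolynomial.eval y.1 (toZ (q none))).im : ℝ) := by
    intro y
    have := congrFun h4 y
    simp only [h5] at this
    rw [this, eval_hcoord_eq hΛ (h none).1 le_rfl]
    rfl
  -- The left side of the identity does not depend on `u`; comparing `u = 1` with `u = 0` at `z = 0`
  -- shows that `c` is real.
  have hci : c.im = 0 := by
    have e1 := h6 (0, 1)
    have e2 := h6 (0, 0)
    simp only at e1 e2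
    rw [e1] at e2
    have e3 := Complex.ofReal_injective e2
    simp only [Complex.add_im, Complex.mul_im, Complex.mul_re, Complex.add_re] at e3
    simp at e3
    linarith
  have hcr : c = ((c.re : ℝ) : ℂ) := Complex.ext rfl (by simp [hci])
  refine ⟨c.re, fun h0 => ?_, hcr, fun z => ?_⟩
  · refine coeff_none_ne_zero hF.toIsGermIso hΛ1 (h none) ?_
    change c = 0
    rw [hcr, h0, Complex.ofReal_zero]
  · rw [h6 (z, 0)]
    have h7 : P.value z = (((P.value z).re : ℝ) : ℂ) :=
      Complex.ext rfl (by simp [hP.value_im hΛ hΨ z])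
    rw [h7]
    simp [hci]

end Transition

/-! ### Polynomials with variables set to zero -/

section Kill

open MvPolynomial

variable {σ τ : Type*} {w : σ → ℚ} {ρ : ℚ} {S T : Set σ}

open Classical in
/-- Setting the variables in `S` to zero. -/
def kill (S : Set σ) : MvPolynomial σ ℂ →ₐ[ℂ] MvPolynomial σ ℂ :=
  aeval fun i => if i ∈ S then 0 else X i

lemma kill_X_of_mem {i : σ} (h : i ∈ S) : kill S (X i) = 0 := by simp [kill, h]

lemma kill_X_of_notMem {i : σ} (h : i ∉ S) : kill S (X i) = X i := by simp [kill, h]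

open Classical in
lemma kill_monomial (m : σ →₀ ℕ) (c : ℂ) :
    kill S (monomial m c) = if ∀ i ∈ S, m i = 0 then monomial m c else 0 := by
  rw [kill, aeval_monomial]
  split_ifs with h
  · rw [monomial_eq]
    congr 1
    refine Finsupp.prod_congr fun i hi => ?_
    rw [if_neg fun hS => Finsupp.mem_support_iff.1 hi (h i hS)]
  · push Not at h
    obtain ⟨i, hi, hm⟩ := h
    rw [Finsupp.prod, Finset.prod_eq_zero (Finsupp.mem_support_iff.2 hm), mul_zero]
    rw [if_pos hi, zero_pow hm]

open Classical in
lemma coeff_kill (m : σ →₀ ℕ) (p : MvPolynomial σ ℂ) :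
    coeff m (kill S p) = if ∀ i ∈ S, m i = 0 then coeff m p else 0 := by
  induction p using MvPolynomial.induction_on' with
  | monomial u a =>
    rw [kill_monomial]
    by_cases h : u = m
    · subst h; split_ifs <;> simp
    · split_ifs <;> simp [coeff_monomial, h]
  | add p q hp hq => rw [map_add, coeff_add, hp, hq, coeff_add]; split_ifs <;> simp

lemma coeff_kill_of_forall {m : σ →₀ ℕ} (h : ∀ i ∈ S, m i = 0) (p : MvPolynomial σ ℂ) :
    coeff m (kill S p) = coeff m p := by
  classical rw [coeff_kill, if_pos h]

lemma eq_zero_of_coeff_kill {m : σ →₀ ℕ} {p : MvPolynomial σ ℂ} (h : coeff m (kill S p) ≠ 0) {i : σ}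
    (hi : i ∈ S) : m i = 0 := by
  classical
  rw [coeff_kill] at h
  by_contra hm
  exact h (if_neg fun h' => hm (h' i hi))

lemma kill_kill (p : MvPolynomial σ ℂ) : kill S (kill T p) = kill (S ∪ T) p := by
  classical
  ext m
  simp only [coeff_kill, Set.mem_union, or_imp, forall_and]
  split_ifs <;> simp_all

lemma kill_comm (p : MvPolynomial σ ℂ) : kill S (kill T p) = kill T (kill S p) := by
  rw [kill_kill, kill_kill, Set.union_comm]

lemma kill_eq_self_iff {p : MvPolynomial σ ℂ} :
    kill S p = p ↔ ∀ m, coeff m p ≠ 0 → ∀ i ∈ S, m i = 0 := by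
  classical
  constructor
  · intro h m hm i hi
    rw [← h] at hm
    exact eq_zero_of_coeff_kill hm hi
  · intro h
    ext m
    rw [coeff_kill]
    split_ifs with h1
    · rfl
    · by_contra h2
      exact h1 (h m (Ne.symm h2))

lemma isWeightedHomogeneous_kill {p : MvPolynomial σ ℂ} (hp : p.IsWeightedHomogeneous w ρ) :
    (kill S p).IsWeightedHomogeneous w ρ := by
  classical
  intro m hm
  rw [coeff_kill] at hm
  exact hp fun h => hm (by rw [h, ite_self])

lemma pderiv_aeval [Fintype σ] (A : σ → MvPolynomial τ ℂ) (p : MvPolynomial σ ℂ) (i : τ) :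
    pderiv i (aeval A p) = ∑ j, aeval A (pderiv j p) * pderiv i (A j) := by
  classical
  induction p using MvPolynomial.induction_on with
  | C a => simp
  | add p q hp hq => simp only [map_add, hp, hq, add_mul, Finset.sum_add_distrib]
  | mul_X p k hp =>
    simp only [map_mul, Derivation.leibniz, hp, aeval_X, smul_eq_mul, map_add, add_mul,
      Finset.sum_add_distrib, pderiv_X, Finset.mul_sum]
    congr 1
    · rw [Finset.sum_eq_single k]
      · simp
      · intro b _ hb; simp [Ne.symm hb]
      · simp
    · exact Finset.sum_congr rfl fun j _ => by ring

lemma pderiv_kill_of_notMem [Fintype σ] {i : σ} (h : i ∉ S) (p : MvPolynomial σ ℂ) :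
    pderiv i (kill S p) = kill S (pderiv i p) := by
  classical
  rw [kill, pderiv_aeval, Finset.sum_eq_single i]
  · simp [h]
  · intro b _ hb
    split_ifs with hS
    · simp
    · rw [pderiv_X_of_ne hb, mul_zero]
  · simp

lemma coeff_pderiv_ne_zero {i : σ} {p : MvPolynomial σ ℂ} {m : σ →₀ ℕ} (hm : coeff m p ≠ 0)
    (hi : m i ≠ 0) : coeff (m - Finsupp.single i 1) (pderiv i p) ≠ 0 := by
  have h1 : m - Finsupp.single i 1 + Finsupp.single i 1 = m :=
    tsub_add_cancel_of_le (Finsupp.single_le_iff.2 (Nat.one_le_iff_ne_zero.2 hi))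
  rw [coeff_pderiv, h1]
  refine mul_ne_zero hm ?_
  exact Nat.cast_add_one_ne_zero _

lemma pderiv_eq_zero_iff {i : σ} {p : MvPolynomial σ ℂ} :
    pderiv i p = 0 ↔ ∀ m, coeff m p ≠ 0 → m i = 0 := by
  constructor
  · intro h m hm
    by_contra hi
    exact coeff_pderiv_ne_zero hm hi (by rw [h, coeff_zero])
  · intro h
    ext m
    rw [coeff_pderiv, coeff_zero]
    by_contra hne
    have := h _ (left_ne_zero_of_mul hne)
    simp at this

lemma pderiv_eq_zero_of_kill_eq {i : σ} {p : MvPolynomial σ ℂ} (h : kill S p = p) (hi : i ∈ S) :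
    pderiv i p = 0 :=
  pderiv_eq_zero_iff.2 fun m hm => kill_eq_self_iff.1 h m hm i hi

lemma isWeightedHomogeneous_aeval [Fintype σ] {w' : τ → ℚ} {A : σ → MvPolynomial τ ℂ}
    (hA : ∀ i, (A i).IsWeightedHomogeneous w' (w i)) {p : MvPolynomial σ ℂ}
    (hp : p.IsWeightedHomogeneous w ρ) : (aeval A p).IsWeightedHomogeneous w' ρ := by
  rw [p.as_sum, map_sum]
  refine IsWeightedHomogeneous.sum _ _ _ fun m hm => ?_
  have h1 := hp (mem_support_iff.1 hm)
  rw [weight_eq_sum] at h1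
  rw [aeval_monomial, Finsupp.prod_fintype _ _ (by simp), algebraMap_eq]
  refine IsWeightedHomogeneous.C_mul ?_ _
  have h2 := IsWeightedHomogeneous.prod Finset.univ (fun i => A i ^ m i) (fun i => m i • w i)
    (w := w') fun i _ => (hA i).pow (m i)
  simpa [h1] using h2

lemma X_dvd_of_kill_eq_zero {i : σ} {p : MvPolynomial σ ℂ} (h : kill {i} p = 0) : X i ∣ p := by
  classical
  rw [X_dvd_iff_modMonomial_eq_zero]
  ext m
  rw [coeff_zero]
  by_cases hm : Finsupp.single i 1 ≤ m
  · exact coeff_modMonomial_of_le _ hm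
  · rw [coeff_modMonomial_of_not_le _ hm]
    have hmi : m i = 0 := by
      by_contra h0
      exact hm (Finsupp.single_le_iff.2 (Nat.one_le_iff_ne_zero.2 h0))
    rw [← coeff_kill_of_forall (S := {i}) (by simpa using hmi), h, coeff_zero]

lemma isWeightedHomogeneous_of_X_mul {i : σ} {p : MvPolynomial σ ℂ}
    (h : (X i * p).IsWeightedHomogeneous w ρ) : p.IsWeightedHomogeneous w (ρ - w i) := by
  intro m hm
  have h1 : coeff (Finsupp.single i 1 + m) (X i * p) ≠ 0 := by rwa [coeff_X_mul]
  have h2 := h h1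
  rw [map_add] at h2
  have h3 : Finsupp.weight w (Finsupp.single i 1) = w i := by simp [Finsupp.weight_apply]
  rw [h3] at h2
  linarith

lemma isWeightedHomogeneous_pderiv {i : σ} {p : MvPolynomial σ ℂ}
    (h : p.IsWeightedHomogeneous w ρ) : (pderiv i p).IsWeightedHomogeneous w (ρ - w i) :=
  h.pderiv (sub_add_cancel _ _)

lemma le_weight_of_ne_zero [Fintype σ] (hw : ∀ i, 0 ≤ w i) {m : σ →₀ ℕ} {i : σ} (hm : m i ≠ 0) :
    w i ≤ Finsupp.weight w m := by
  rw [weight_eq_sum]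
  refine le_trans ?_ (Finset.single_le_sum
    (fun j _ => mul_nonneg (by positivity) (hw j)) (Finset.mem_univ i))
  have h1 : (1 : ℚ) ≤ m i := by exact_mod_cast Nat.one_le_iff_ne_zero.2 hm
  nlinarith [hw i]

end Kill

/-! ### Real polynomials and pluriharmonic terms -/

section Real

open MvPolynomial

variable {n : ℕ} {P Q : ZPoly n}

/-- The polynomial whose coefficients are the conjugates of those of `g`. -/
abbrev conjPoly {σ : Type*} (g : MvPolynomial σ ℂ) : MvPolynomial σ ℂ := map (starRingEnd ℂ) g

lemma eval_conjPoly {σ : Type*} (g : MvPolynomial σ ℂ) (z : σ → ℂ) :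
    eval (fun i => starRingEnd ℂ (z i)) (conjPoly g) = starRingEnd ℂ (eval z g) := by
  rw [eval_map]
  exact (eval₂_comp (starRingEnd ℂ) z g).symm

/-- `g(z)` as a polynomial in `z, z̄`. -/
abbrev holPoly (g : MvPolynomial (Fin n) ℂ) : ZPoly n := rename Sum.inl g

/-- The conjugate of `g(z)` as a polynomial in `z, z̄`. -/
abbrev antiPoly (g : MvPolynomial (Fin n) ℂ) : ZPoly n := rename Sum.inr (conjPoly g)

lemma value_holPoly (g : MvPolynomial (Fin n) ℂ) (z : Fin n → ℂ) :
    ZPoly.value (holPoly g) z = eval z g := by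
  rw [ZPoly.value, eval_rename]; rfl

lemma value_antiPoly (g : MvPolynomial (Fin n) ℂ) (z : Fin n → ℂ) :
    ZPoly.value (antiPoly g) z = starRingEnd ℂ (eval z g) := by
  rw [ZPoly.value, eval_rename, ← eval_conjPoly]; rfl

/-- The polynomial `Im g(z)`. -/
def imPoly (g : MvPolynomial (Fin n) ℂ) : ZPoly n :=
  C (-Complex.I / 2) * holPoly g + C (Complex.I / 2) * antiPoly g

lemma value_imPoly (g : MvPolynomial (Fin n) ℂ) (z : Fin n → ℂ) :
    (imPoly g).value z = ((eval z g).im : ℝ) := by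
  have h1 : (imPoly g).value z = -Complex.I / 2 * ZPoly.value (holPoly g) z +
      Complex.I / 2 * ZPoly.value (antiPoly g) z := by
    simp [ZPoly.value, imPoly]
  rw [h1, value_holPoly, value_antiPoly]
  apply Complex.ext <;> simp <;> ring

/-- `Q(A(z), \bar{A(z)})`. -/
def pull (A : Fin n → MvPolynomial (Fin n) ℂ) : ZPoly n →ₐ[ℂ] ZPoly n :=
  aeval (Sum.elim (fun i => holPoly (A i)) fun i => antiPoly (A i))

lemma value_pull (A : Fin n → MvPolynomial (Fin n) ℂ) (Q : ZPoly n) (z : Fin n → ℂ) :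
    (pull A Q).value z = Q.value fun i => eval z (A i) := by
  have : (aeval (Sum.elim z fun i => starRingEnd ℂ (z i))).comp (pull A) =
      (aeval (Sum.elim (fun i => eval z (A i)) fun i => starRingEnd ℂ (eval z (A i))) :
        ZPoly n →ₐ[ℂ] ℂ) := by
    refine algHom_ext fun o => ?_
    rcases o with i | i
    · simp only [pull, AlgHom.comp_apply, aeval_X, Sum.elim_inl]
      exact value_holPoly (A i) z
    · simp only [pull, AlgHom.comp_apply, aeval_X, Sum.elim_inr]
      exact value_antiPoly (A i) z
  exact DFunLike.congr_fun this Q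

/-- The variables `z̄_i`. -/
def inrSet (n : ℕ) : Set (Fin n ⊕ Fin n) := Set.range Sum.inr

/-- The variables `z_i`. -/
def inlSet (n : ℕ) : Set (Fin n ⊕ Fin n) := Set.range Sum.inl

lemma kill_inr_holPoly (g : MvPolynomial (Fin n) ℂ) : kill (inrSet n) (holPoly g) = holPoly g := by
  have : (kill (inrSet n)).comp (rename Sum.inl) =
      (rename Sum.inl : MvPolynomial (Fin n) ℂ →ₐ[ℂ] ZPoly n) := by
    refine algHom_ext fun i => ?_
    simp only [AlgHom.comp_apply, rename_X]
    exact kill_X_of_notMem (by simp [inrSet])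
  exact DFunLike.congr_fun this g

lemma kill_inr_antiPoly (g : MvPolynomial (Fin n) ℂ) :
    kill (inrSet n) (antiPoly g) = C (starRingEnd ℂ (constantCoeff g)) := by
  have : (kill (inrSet n)).comp (rename Sum.inr) =
      ((Algebra.ofId ℂ (ZPoly n)).comp (aeval 0 : MvPolynomial (Fin n) ℂ →ₐ[ℂ] ℂ)) := by
    refine algHom_ext fun i => ?_
    simp only [AlgHom.comp_apply, rename_X, aeval_X, Pi.zero_apply, map_zero]
    exact kill_X_of_mem (by simp [inrSet])
  refine (DFunLike.congr_fun this (conjPoly g)).trans ?_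
  simp only [AlgHom.comp_apply, Algebra.ofId_apply, algebraMap_eq]
  congr 1
  have h2 := eval_conjPoly g 0
  simp only [Pi.zero_apply, map_zero] at h2
  rw [← eval_zero, ← h2]
  rfl

lemma noPluriharmonic_iff : NoPluriharmonic P ↔ kill (inrSet n) P = 0 ∧ kill (inlSet n) P = 0 := by
  classical
  constructor
  · intro h
    constructor <;> ext m <;> rw [coeff_kill, coeff_zero] <;> split_ifs with h1
    · by_contra hne
      obtain ⟨-, i, hi⟩ := h m (mem_support_iff.2 hne)
      exact hi (h1 _ ⟨i, rfl⟩)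
    · rfl
    · by_contra hne
      obtain ⟨⟨i, hi⟩, -⟩ := h m (mem_support_iff.2 hne)
      exact hi (h1 _ ⟨i, rfl⟩)
    · rfl
  · rintro ⟨h1, h2⟩ m hm
    constructor
    · by_contra! hc
      refine mem_support_iff.1 hm ?_
      rw [← coeff_kill_of_forall (S := inlSet n) (by rintro _ ⟨i, rfl⟩; exact hc i), h2, coeff_zero]
    · by_contra! hc
      refine mem_support_iff.1 hm ?_
      rw [← coeff_kill_of_forall (S := inrSet n) (by rintro _ ⟨i, rfl⟩; exact hc i), h1, coeff_zero]

lemma isAbsent_iff {i : Fin n} :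
    IsAbsent P i ↔ pderiv (Sum.inl i) P = 0 ∧ pderiv (Sum.inr i) P = 0 := by
  simp only [IsAbsent, mem_vars_iff_mem_support, not_exists, not_and, mem_support_iff, Finsupp.mem_support_iff,
    pderiv_eq_zero_iff, not_not]

/-- Both sides have the same values, and a polynomial in `z, z̄` is determined by its values. -/
lemma hermitian (h : ∀ z, (P.value z).im = 0) : rename Sum.swap (conjPoly P) = P := by
  refine ZPoly.value_injective fun z => ?_
  have h1 : ZPoly.value (rename Sum.swap (conjPoly P)) z = starRingEnd ℂ (P.value z) := by
    rw [ZPoly.value, eval_rename, ZPoly.value, ← eval_conjPoly]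
    congr 2
    ext o; rcases o with i | i <;> simp
  rw [h1, Complex.conj_eq_iff_im, h]

lemma coeff_conj_swap (h : ∀ z, (P.value z).im = 0) (m : Fin n ⊕ Fin n →₀ ℕ) :
    coeff (m.mapDomain Sum.swap) P = starRingEnd ℂ (coeff m P) := by
  have hs : Function.Injective (Sum.swap : Fin n ⊕ Fin n → Fin n ⊕ Fin n) :=
    (Equiv.sumComm _ _).injective
  conv_lhs => rw [← hermitian h]
  rw [coeff_rename_mapDomain _ hs, coeff_map]

/-- The holomorphic terms of `P`. -/
def holPart : ZPoly n →ₐ[ℂ] MvPolynomial (Fin n) ℂ := aeval (Sum.elim X 0)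

lemma holPoly_holPart (P : ZPoly n) : holPoly (holPart P) = kill (inrSet n) P := by
  have : (rename Sum.inl).comp holPart = (kill (inrSet n) : ZPoly n →ₐ[ℂ] ZPoly n) := by
    refine algHom_ext fun o => ?_
    rcases o with i | i
    · simp only [AlgHom.comp_apply, holPart, aeval_X, Sum.elim_inl, rename_X]
      exact (kill_X_of_notMem (by simp [inrSet])).symm
    · simp only [AlgHom.comp_apply, holPart, aeval_X, Sum.elim_inr, Pi.zero_apply, map_zero]
      exact (kill_X_of_mem (by simp [inrSet])).symm
  exact DFunLike.congr_fun this P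

lemma antiPoly_holPart (h : ∀ z, (P.value z).im = 0) :
    antiPoly (holPart P) = kill (inlSet n) P := by
  classical
  have hs : Function.Injective (Sum.swap : Fin n ⊕ Fin n → Fin n ⊕ Fin n) :=
    (Equiv.sumComm _ _).injective
  have h1 : antiPoly (holPart P) = rename Sum.swap (conjPoly (holPoly (holPart P))) := by
    rw [conjPoly, map_rename, rename_rename]; rfl
  rw [h1, holPoly_holPart]
  ext m
  obtain ⟨m', rfl⟩ : ∃ m', m = Finsupp.mapDomain Sum.swap m' := by
    refine ⟨m.mapDomain Sum.swap, ?_⟩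
    rw [← Finsupp.mapDomain_comp]
    simp [Sum.swap_swap_eq]
  rw [coeff_rename_mapDomain _ hs, coeff_map, coeff_kill, coeff_kill, coeff_conj_swap h]
  have h2 : (∀ i ∈ inlSet n, Finsupp.mapDomain Sum.swap m' i = 0) ↔ ∀ i ∈ inrSet n, m' i = 0 := by
    simp only [inlSet, inrSet, Set.forall_mem_range]
    refine forall_congr' fun i => ?_
    have h3 := Finsupp.mapDomain_apply hs m' (Sum.inr i)
    rw [← h3]; rfl
  simp only [h2]
  split_ifs <;> simp

/-- `P` without its pluriharmonic terms. -/
def mixedPart (P : ZPoly n) : ZPoly n := P - kill (inrSet n) P - kill (inlSet n) P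

lemma coeff_mixedPart {m : Fin n ⊕ Fin n →₀ ℕ} (h1 : ∃ i, m (Sum.inl i) ≠ 0)
    (h2 : ∃ i, m (Sum.inr i) ≠ 0) : coeff m (mixedPart P) = coeff m P := by
  classical
  obtain ⟨i, hi⟩ := h1
  obtain ⟨j, hj⟩ := h2
  rw [mixedPart, coeff_sub, coeff_sub, coeff_kill, coeff_kill, if_neg fun h => hj (h _ ⟨j, rfl⟩),
    if_neg fun h => hi (h _ ⟨i, rfl⟩), sub_zero, sub_zero]

/-- Without the hypothesis on the constant term, that term would be subtracted twice. -/
lemma noPluriharmonic_mixedPart (h0 : coeff 0 P = 0) : NoPluriharmonic (mixedPart P) := by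
  classical
  have h1 : kill (inrSet n) (kill (inlSet n) P) = 0 := by
    rw [kill_kill]
    ext m
    rw [coeff_kill, coeff_zero]
    split_ifs with h
    · have : m = 0 := by
        ext o
        rcases o with i | i
        · exact h _ (Or.inr ⟨i, rfl⟩)
        · exact h _ (Or.inl ⟨i, rfl⟩)
      rw [this, h0]
    · rfl
  rw [noPluriharmonic_iff, mixedPart]
  constructor
  · rw [map_sub, map_sub, h1, kill_kill, Set.union_self, sub_self, sub_zero]
  · rw [map_sub, map_sub, kill_comm, h1, kill_kill, Set.union_self, sub_zero, sub_self]

/-- Without constant terms the substitution sends each `z̄_i` to a polynomial in `z̄` vanishing at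
the origin, so it commutes with setting `z̄ = 0`. -/
lemma pull_noPluriharmonic_inr {A : Fin n → MvPolynomial (Fin n) ℂ} (hA : ∀ i, constantCoeff (A i) = 0)
    (hQ : NoPluriharmonic Q) : kill (inrSet n) (pull A Q) = 0 := by
  have : (kill (inrSet n)).comp (pull A) = (pull A).comp (kill (inrSet n)) := by
    refine algHom_ext fun o => ?_
    rcases o with i | i
    · simp only [AlgHom.comp_apply, pull, aeval_X, Sum.elim_inl]
      rw [kill_inr_holPoly, kill_X_of_notMem (by simp [inrSet]), aeval_X, Sum.elim_inl]
    · simp only [AlgHom.comp_apply, pull, aeval_X, Sum.elim_inr]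
      rw [kill_inr_antiPoly, hA, kill_X_of_mem (by simp [inrSet])]
      simp
  rw [← AlgHom.comp_apply, this, AlgHom.comp_apply, (noPluriharmonic_iff.1 hQ).1, map_zero]

lemma kill_inr_imPoly {g : MvPolynomial (Fin n) ℂ} (hg : constantCoeff g = 0) :
    kill (inrSet n) (imPoly g) = C (-Complex.I / 2) * holPoly g := by
  have hC : ∀ a : ℂ, kill (inrSet n) (C a) = C a := fun a => by
    rw [← algebraMap_eq]; exact AlgHom.commutes _ _
  rw [imPoly, map_add, map_mul, map_mul, kill_inr_holPoly, kill_inr_antiPoly, hg, hC, hC]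
  simp

/-- A polynomial without pluriharmonic terms which is the imaginary part of a holomorphic
polynomial vanishes. -/
lemma eq_zero_of_holPoly {g : MvPolynomial (Fin n) ℂ} (h : C (-Complex.I / 2) * holPoly g = 0) :
    g = 0 := by
  have h1 : holPoly g = 0 := by
    refine (mul_eq_zero.1 h).resolve_left fun h2 => ?_
    rw [C_eq_zero] at h2
    simp at h2
  exact rename_injective _ Sum.inl_injective (by rw [map_zero]; exact h1)

end Real

/-! ### Homogeneous transformations -/

section Change

open MvPolynomial

variable {n : ℕ} {M : Set (Fin (n + 1) → ℂ)} {p : Fin (n + 1) → ℂ} {Λ μ : Fin n → ℚ}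
  {Φ Φ' : (Fin (n + 1) → ℂ) → CoordSpace n} {Ψ Ψ' : GraphSpace n → ℝ} {P P' : ZPoly n}
  {q : Option (Fin n) → HPoly n} {F : CoordSpace n → CoordSpace n}

/-- The components of the polynomial map `q` are homogeneous of the weights of the variables. -/
def IsHomMap (Λ : Fin n → ℚ) (q : Option (Fin n) → HPoly n) : Prop :=
  ∀ o, (q o).IsWeightedHomogeneous (hw Λ) (hw Λ o)

lemma homogeneousChange_iff : HomogeneousChange Λ Φ Φ' ↔
    ∃ q, IsHomMap Λ q ∧ ∀ x, Φ' x = polyMap q (Φ x) := by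
  constructor
  · rintro ⟨f, g, hf, hg, h⟩
    refine ⟨fun o => X o + o.elim g f, fun o => ?_, fun x => ?_⟩
    · refine (isWeightedHomogeneous_X _ _ _).add ?_
      rcases o with _ | i
      · exact hg
      · exact hf i
    · rw [h x]
      refine Prod.ext (funext fun i => ?_) ?_ <;> simp [polyMap, hcoord] <;> rfl
  · rintro ⟨q, hq, h⟩
    refine ⟨fun i => q (some i) - X (some i), q none - X none, fun i => ?_, ?_, fun x => ?_⟩
    · exact (hq (some i)).sub (isWeightedHomogeneous_X ℂ (hw Λ) (some i))
    · exact (hq none).sub (isWeightedHomogeneous_X ℂ (hw Λ) none)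
    · rw [h x]
      refine Prod.ext (funext fun i => ?_) ?_
      · change eval (hcoord (Φ x)) (q (some i)) = _ + eval (hcoord (Φ x)) _
        simp [hcoord]
      · change eval (hcoord (Φ x)) (q none) = _ + eval (hcoord (Φ x)) _
        simp [hcoord]

/-- A linear term in `z_i` has weight less than one and cannot occur in the component of weight one.
-/
lemma fderiv_polyMap_snd (hΛ1 : ∀ i, Λ i < 1) (hq : IsHomMap Λ q) (v : CoordSpace n) :
    (fderiv ℂ (polyMap q) 0 v).2 = coeff (Finsupp.single none 1) (q none) * v.2 := by
  have h1 := hcoord_fderiv (analyticAt_polyMap q 0).differentiableAt v none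
  simp only [hcoord_polyMap] at h1
  rw [fderiv_eval_hcoord_zero, Fintype.sum_option] at h1
  have h2 : ∀ i : Fin n, coeff (Finsupp.single (some i) 1) (q none) = 0 := by
    intro i
    by_contra hne
    have h3 := hq none hne
    simp [Finsupp.weight_apply, hw] at h3
    exact (hΛ1 i).ne h3
  simp only [h2, zero_mul, Finset.sum_const_zero, add_zero] at h1
  exact h1

/-- The graph of a hypersurface in homogeneously transformed coordinates. -/
lemma IsCoord.exists_polyMap (hΛ1 : ∀ i, Λ i < 1) (h : IsCoord M p Φ Ψ) (hq : IsHomMap Λ q)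
    (hqi : IsGermIso (polyMap q)) {c : ℝ} (hc : coeff (Finsupp.single none 1) (q none) = c) :
    ∃ Ψ', IsCoord M p (fun x => polyMap q (Φ x)) Ψ' :=
  exists_graph h hqi (c := c) fun v => by rw [fderiv_polyMap_snd hΛ1 hq, hc]

lemma IsCoord.isTransition_polyMap (h : IsCoord M p Φ Ψ)
    (hqi : IsGermIso (polyMap q)) (h' : IsCoord M p (fun x => polyMap q (Φ x)) Ψ') :
    IsTransition Ψ Ψ' (polyMap q) :=
  h.isTransition h' hqi (Eventually.of_forall fun _ => rfl)

lemma coeff_zero_eq_zero {σ : Type*} {w : σ → ℚ} {ρ : ℚ} {p : MvPolynomial σ ℂ}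
    (hp : p.IsWeightedHomogeneous w ρ) (hρ : 0 < ρ) : coeff 0 p = 0 := by
  rw [← constantCoeff_eq, ← eval_zero]
  exact constantCoeff_eq_zero_of_homogeneous hp hρ

lemma isWeightedHomogeneous_holPart (hP : P.IsWeightedHomogeneous (Sum.elim Λ Λ) 1) :
    (rename some (holPart P) : HPoly n).IsWeightedHomogeneous (hw Λ) 1 := by
  have : (rename some (holPart P) : HPoly n) = aeval (Sum.elim (fun i => X (some i)) 0) P := by
    have : (rename some).comp holPart =
        (aeval (Sum.elim (fun i => X (some i)) 0) : ZPoly n →ₐ[ℂ] HPoly n) := by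
      refine algHom_ext fun o => ?_
      rcases o with i | i <;> simp [holPart]
    exact DFunLike.congr_fun this P
  rw [this]
  refine isWeightedHomogeneous_aeval (fun o => ?_) hP
  rcases o with i | i
  · exact isWeightedHomogeneous_X ℂ (hw Λ) (some i)
  · exact isWeightedHomogeneous_zero _ _ _

lemma toZ_rename (g : MvPolynomial (Fin n) ℂ) : toZ (rename some g) = g := by
  have : toZ.comp (rename some) = AlgHom.id ℂ (MvPolynomial (Fin n) ℂ) := by
    refine algHom_ext fun i => ?_
    simp [toZ]
  exact DFunLike.congr_fun this g

/-- The pluriharmonic terms of a leading polynomial can be removed by a homogeneous change. -/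
lemma exists_change_mixedPart (hΛ : ∀ i, 0 < Λ i) (hΛ1 : ∀ i, Λ i < 1) (h : IsCoord M p Φ Ψ)
    (hP : IsLeading Λ Ψ P) :
    ∃ Φ' Ψ', HomogeneousChange Λ Φ Φ' ∧ IsCoord M p Φ' Ψ' ∧ IsLeading Λ Ψ' (mixedPart P) := by
  classical
  -- With `h` the holomorphic terms of `P`, `Im (-2 i h) = -(h + h̄)`; adding this to `v` cancels
  -- exactly the pluriharmonic terms of the real polynomial `P`.
  let g : HPoly n := C (-2 * Complex.I) * rename some (holPart P)
  let q : Option (Fin n) → HPoly n := fun o => X o + o.elim g 0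
  have hg : g.IsWeightedHomogeneous (hw Λ) 1 := (isWeightedHomogeneous_holPart hP.1).C_mul _
  have hq : IsHomMap Λ q := by
    intro o
    refine (isWeightedHomogeneous_X _ _ _).add ?_
    rcases o with _ | i
    · exact hg
    · exact isWeightedHomogeneous_zero _ _ _
  have hgn : coeff (Finsupp.single none 1) g = 0 := by
    rw [coeff_C_mul, coeff_rename_eq_zero, mul_zero]
    intro u hu
    have := DFunLike.congr_fun hu none
    rw [Finsupp.mapDomain_of_notMem_range _ _ (by simp)] at this
    simp at this
  have hc : coeff (Finsupp.single none 1) (q none) = ((1 : ℝ) : ℂ) := by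
    simp [q, hgn]
  have hqi : IsGermIso (polyMap q) := by
    refine ⟨analyticAt_polyMap q 0, polyMap_zero hq hΛ, isInvertible_of_injective fun v hv => ?_⟩
    have h2 := fderiv_polyMap_snd hΛ1 hq v
    rw [hv, hc] at h2
    refine Prod.ext (funext fun i => ?_) (by simpa using h2.symm)
    have h1 := hcoord_fderiv (analyticAt_polyMap q 0).differentiableAt v (some i)
    simp only [hcoord_polyMap] at h1
    rw [fderiv_eval_hcoord_zero, hv, hcoord_zero] at h1
    have h3 : ∀ o, coeff (Finsupp.single o 1) (q (some i)) = if o = some i then 1 else 0 := by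
      intro o
      simp only [q, Option.elim, Pi.zero_apply, add_zero, coeff_X,
        Finsupp.single_left_inj one_ne_zero, eq_comm]
    simp only [h3, ite_mul, one_mul, zero_mul, Finset.sum_ite_eq', Finset.mem_univ, if_true] at h1
    exact h1.symm
  obtain ⟨Ψ', h'⟩ := h.exists_polyMap hΛ1 hq hqi hc
  have hT := h.isTransition_polyMap hqi h'
  have hS := isSuperHom_polyMap hΛ hq
  obtain ⟨P', hP'⟩ := hT.exists_isLeading h.isGraphFun h'.isGraphFun hP hΛ1 hS
  obtain ⟨c, -, hc', hrel⟩ := hT.leading_relation h.isGraphFun h'.isGraphFun hP hP' hΛ1 hS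
  have hc1 : c = 1 := by
    rw [hc] at hc'; exact_mod_cast hc'.symm
  refine ⟨_, Ψ', homogeneousChange_iff.2 ⟨q, hq, fun _ => rfl⟩, h', ?_⟩
  convert hP'
  refine ZPoly.value_injective fun z => ?_
  have h1 := hrel z
  have h2 : (fun i => eval z (toZ (q (some i)))) = z := by
    funext i; simp [q, toZ]
  have h3 : toZ (q none) = C (-2 * Complex.I) * holPart P := by
    have h4 : toZ (X none + g) = C (-2 * Complex.I) * holPart P := by
      simp only [g, map_add, map_mul, toZ_rename]
      simp [toZ]
    exact h4
  rw [h2, h3, hc1] at h1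
  rw [h1]
  have h5 : (mixedPart P).value z = P.value z - eval z (holPart P) -
      starRingEnd ℂ (eval z (holPart P)) := by
    rw [mixedPart, ← holPoly_holPart, ← antiPoly_holPart (hP.value_im hΛ h.isGraphFun),
      ← value_antiPoly, ← value_holPoly]
    simp [ZPoly.value]
  rw [h5]
  apply Complex.ext <;> simp <;> ring

/-- The relation between the leading polynomials as an identity of polynomials. -/
lemma IsTransition.exists_pull_eq {hΛ : ∀ i, 0 < Λ i} (hF : IsTransition Ψ Ψ' F) (hΨ : IsGraphFun Ψ)
    (hΨ' : IsGraphFun Ψ') (hP : IsLeading Λ Ψ P) (hP' : IsLeading Λ Ψ' P') (hΛ1 : ∀ i, Λ i < 1)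
    (h : IsSuperHom Λ hΛ F q) :
    ∃ c : ℝ, c ≠ 0 ∧ coeff (Finsupp.single none 1) (q none) = c ∧
      pull (fun i => toZ (q (some i))) P' = C (c : ℂ) * P + imPoly (toZ (q none)) := by
  obtain ⟨c, hc0, hc, hrel⟩ := hF.leading_relation hΨ hΨ' hP hP' hΛ1 h
  refine ⟨c, hc0, hc, ZPoly.value_injective fun z => ?_⟩
  rw [value_pull, hrel]
  have : ZPoly.value (C (c : ℂ) * P + imPoly (toZ (q none))) z =
      c * P.value z + (imPoly (toZ (q none))).value z := by simp [ZPoly.value]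
  rw [this, value_imPoly]

lemma constantCoeff_toZ {ρ : ℚ} {g : HPoly n} (hg : g.IsWeightedHomogeneous (hw Λ) ρ) (hρ : 0 < ρ) :
    constantCoeff (toZ g) = 0 := by
  rw [← eval_zero, show (eval 0) (toZ g) = eval (hcoord ((0 : Fin n → ℂ), (0 : ℂ))) g from
    eval_toZ g 0]
  have := hcoord_zero (n := n)
  rw [show ((0 : Fin n → ℂ), (0 : ℂ)) = (0 : CoordSpace n) from rfl, this]
  exact constantCoeff_eq_zero_of_homogeneous hg hρ

lemma imPoly_zero : imPoly (0 : MvPolynomial (Fin n) ℂ) = 0 := by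
  simp [imPoly, holPoly, antiPoly, conjPoly]

/-- If both leading polynomials have no pluriharmonic terms, they correspond to each other up to a
constant. -/
lemma IsTransition.exists_pull_eq_of_noPluriharmonic {hΛ : ∀ i, 0 < Λ i} (hF : IsTransition Ψ Ψ' F)
    (hΨ : IsGraphFun Ψ) (hΨ' : IsGraphFun Ψ') (hP : IsLeading Λ Ψ P) (hP' : IsLeading Λ Ψ' P')
    (hΛ1 : ∀ i, Λ i < 1) (h : IsSuperHom Λ hΛ F q) (hn : NoPluriharmonic P)
    (hn' : NoPluriharmonic P') :
    ∃ c : ℝ, c ≠ 0 ∧ coeff (Finsupp.single none 1) (q none) = c ∧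
      pull (fun i => toZ (q (some i))) P' = C (c : ℂ) * P := by
  obtain ⟨c, hc0, hc, hrel⟩ := hF.exists_pull_eq hΨ hΨ' hP hP' hΛ1 h
  refine ⟨c, hc0, hc, ?_⟩
  -- Setting `z̄ = 0` leaves only the holomorphic half of `Im g`, so `g = 0`.
  have h1 := congrArg (kill (inrSet n)) hrel
  rw [pull_noPluriharmonic_inr (fun i => constantCoeff_toZ (h (some i)).1 (hΛ i)) hn', map_add,
    map_mul, (noPluriharmonic_iff.1 hn).1, mul_zero, zero_add,
    kill_inr_imPoly (constantCoeff_toZ (h none).1 one_pos)] at h1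
  rw [eq_zero_of_holPoly h1.symm, imPoly_zero, add_zero] at hrel
  exact hrel

lemma wlen_mono {Λ Λ' : Fin n → ℚ} (h : ∀ i, Λ i ≤ Λ' i) (α β : Fin n → ℕ) :
    wlen Λ α β ≤ wlen Λ' α β :=
  Finset.sum_le_sum fun i _ => mul_le_mul_of_nonneg_left (h i) (by positivity)

/-- Raising weights raises the weighted lengths, so no term falls below weight one. The new leading
polynomial may be zero. -/
lemma IsLeading.exists_of_le (hμ : ∀ i, 0 < μ i) (hle : ∀ i, μ i ≤ Λ i) (hΨ : IsGraphFun Ψ)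
    (hP : IsLeading μ Ψ P) : ∃ Q, IsLeading Λ Ψ Q :=
  Catlin.exists_isLeading (fun i => (hμ i).trans_le (hle i)) hΨ fun α β h =>
    hP.taylorCoeff_eq_zero hμ hΨ ((wlen_mono hle α β).trans_lt h)

lemma IsLeading.coeff_eq (hΛ : ∀ i, 0 < Λ i) (hΨ : IsGraphFun Ψ) (hP : IsLeading Λ Ψ P)
    {α β : Fin n → ℕ} (h : coeff (zexp α β) P ≠ 0) :
    wlen Λ α β = 1 ∧ taylorCoeff Ψ α β = coeff (zexp α β) P := by
  have h1 := hP.1 h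
  rw [weight_zexp] at h1
  exact ⟨h1, ((isLeading_iff_coeff hΛ hΨ P).1 hP).2 α β h1.le⟩

/-- A holomorphic function vanishing at the origin has order at least the smallest weight. -/
lemma exists_hasLead_of_le {hΛ : ∀ i, 0 < Λ i} {f : CoordSpace n → ℂ} (hf : AnalyticAt ℂ f 0)
    (h0 : f 0 = 0) {ε : ℚ} (hε : ∀ o, ε ≤ hw Λ o) : ∃ q, HasLead Λ hΛ ε f q := by
  classical
  obtain ⟨N, hN2, hN⟩ := exists_eps_mul_gt (hDil Λ hΛ) ε
  obtain ⟨p, hp⟩ := exists_isApprox_of_analyticAt hf N hΛ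
  refine ⟨_, weightedHomogeneousComponent_isWeightedHomogeneous _ _, hp.wlim hN fun m hm => ?_⟩
  have hm0 : m ≠ 0 := by
    rintro rfl
    refine mem_support_iff.1 hm ?_
    have h1 : (fun x => f x - eval (hcoord x) p) =O[𝓝 0] fun x => ‖x‖ ^ N := hp
    have h2 := Asymptotics.IsBigO.eq_zero_of_norm_pow (x₀ := (0 : CoordSpace n)) (n := N)
      (by simpa only [sub_zero] using h1) (by omega)
    rw [h0, hcoord_zero, eval_zero, constantCoeff_eq, zero_sub, neg_eq_zero] at h2
    exact h2
  obtain ⟨o, ho⟩ := Finsupp.ne_iff.1 hm0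
  exact (hε o).trans (le_weight_of_ne_zero (w := hw Λ) (fun o => (hw_pos hΛ o).le) ho)

end Change

/-! ### Minimal distinguished weights and the first step -/

section Initial

open MvPolynomial

variable {n : ℕ} {M : Set (Fin (n + 1) → ℂ)} {p : Fin (n + 1) → ℂ} {Λ μ : Fin n → ℚ}
  {Φ Φ' Φs : (Fin (n + 1) → ℂ) → CoordSpace n} {Ψ Ψ' Ψs : GraphSpace n → ℝ} {P P' Ps : ZPoly n}
  {F : CoordSpace n → CoordSpace n}

lemma eval_kill {σ : Type*} {S : Set σ} {x : σ → ℂ} (hx : ∀ i ∈ S, x i = 0)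
    (p : MvPolynomial σ ℂ) : eval x (kill S p) = eval x p := by
  have : (aeval x).comp (kill S) = (aeval x : MvPolynomial σ ℂ →ₐ[ℂ] ℂ) := by
    refine algHom_ext fun i => ?_
    by_cases h : i ∈ S
    · simp [kill_X_of_mem h, hx i h]
    · simp [kill_X_of_notMem h]
  exact DFunLike.congr_fun this p

lemma isBigO_eval_of_degree {p : MvPolynomial (GVar n) ℂ} {R : ℕ}
    (h : ∀ m ∈ p.support, R ≤ m.degree) :
    (fun y => eval (gcoord y) p) =O[𝓝 0] fun y => ‖y‖ ^ R := by
  simp only [eval_eq']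
  refine Asymptotics.IsBigO.fun_sum fun m hm => ?_
  refine Asymptotics.IsBigO.of_bound ‖coeff m p‖ ?_
  have h1 : ∀ᶠ y : GraphSpace n in 𝓝 0, ‖y‖ < 1 :=
    continuous_norm.continuousAt.eventually_lt continuousAt_const (by simp)
  filter_upwards [h1] with y hy
  rw [norm_mul, norm_prod, norm_pow, norm_norm]
  refine mul_le_mul_of_nonneg_left ?_ (norm_nonneg _)
  calc ∏ o, ‖gcoord y o ^ m o‖ ≤ ∏ o, ‖y‖ ^ m o := by
        refine Finset.prod_le_prod (fun _ _ => norm_nonneg _) fun o _ => ?_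
        rw [norm_pow]
        exact pow_le_pow_left₀ (norm_nonneg _) (norm_gcoord_le y o) _
    _ = ‖y‖ ^ m.degree := by rw [Finset.prod_pow_eq_pow_sum, Finsupp.degree_eq_sum]
    _ ≤ ‖y‖ ^ R := pow_le_pow_of_le_one (norm_nonneg _) hy.le (h m hm)

lemma degree_gexp (α β : Fin n → ℕ) (l : ℕ) :
    (gexp α β l).degree = l + (∑ i, α i + ∑ i, β i) := by
  rw [Finsupp.degree_eq_sum, Fintype.sum_option, Fintype.sum_sum_type]
  simp

lemma isBigO_of_taylorCoeff (hΨ : IsGraphFun Ψ) {R : ℕ}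
    (h : ∀ α β, ∑ i, α i + ∑ i, β i < R → taylorCoeff Ψ α β = 0) :
    (fun z : Fin n → ℂ => (Ψ (z, 0) : ℂ)) =O[𝓝 0] fun z => ‖z‖ ^ R := by
  obtain ⟨p, hp, hO⟩ := hΨ.smoothNear.taylor R
  have hT : Tendsto (fun z : Fin n → ℂ => ((z, 0) : GraphSpace n)) (𝓝 0) (𝓝 0) := by
    have : Continuous fun z : Fin n → ℂ => ((z, 0) : GraphSpace n) := by fun_prop
    exact this.tendsto' _ _ rfl
  have hn : ∀ z : Fin n → ℂ, ‖((z, 0) : GraphSpace n)‖ = ‖z‖ := fun z => by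
    simp [Prod.norm_def]
  have h1 := hO.comp_tendsto hT
  have h2 : (fun y => eval (gcoord y) (kill {none} p)) =O[𝓝 0] fun y => ‖y‖ ^ R := by
    refine isBigO_eval_of_degree fun m hm => ?_
    rw [mem_support_iff] at hm
    by_contra hlt
    have hm0 : m none = 0 := eq_zero_of_coeff_kill hm rfl
    rw [coeff_kill_of_forall (by simpa using hm0)] at hm
    have h3 := hp m (by omega)
    rw [eq_gexp m, hm0] at h3 hm hlt
    rw [degree_gexp, zero_add] at hlt
    rw [taylorCoeff_eq_iterDer, h _ _ (by omega), mul_zero] at h3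
    exact (mul_ne_zero (multiFact_ne_zero _) hm) h3.symm
  have h3 := h2.comp_tendsto hT
  have h4 : (fun z : Fin n → ℂ => ‖((z, 0) : GraphSpace n)‖ ^ (R + 1)) =O[𝓝 0]
      fun z => ‖z‖ ^ R := by
    simp only [hn]
    refine Asymptotics.IsBigO.of_bound 1 ?_
    have h1 : ∀ᶠ z : Fin n → ℂ in 𝓝 0, ‖z‖ < 1 :=
      continuous_norm.continuousAt.eventually_lt continuousAt_const (by simp)
    filter_upwards [h1] with z hz
    rw [norm_pow, norm_norm, norm_pow, norm_norm, one_mul]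
    exact pow_le_pow_of_le_one (norm_nonneg _) hz.le (Nat.le_succ R)
  have h5 := (h1.trans h4).add (by simpa only [Function.comp_def, hn] using h3)
  refine h5.congr_left fun z => ?_
  have h6 : eval (gcoord ((z, 0) : GraphSpace n)) (kill {none} p) =
      eval (gcoord ((z, 0) : GraphSpace n)) p := eval_kill (by simp [gcoord]) p
  simp only [Function.comp]
  rw [h6, sub_add_cancel]

/-- The dependence on `u` makes `c` real. Then `c P + Im g = 0`; setting `z̄ = 0` gives `g = 0`,
because `P` has no holomorphic terms, and hence `P = 0`. -/
lemma eq_zero_of_im_eq_zero (hPr : ∀ z, (P.value z).im = 0) (hP : NoPluriharmonic P)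
    {c : ℂ} (hc : c ≠ 0) {g : MvPolynomial (Fin n) ℂ} (hg : constantCoeff g = 0)
    (h : ∀ (z : Fin n → ℂ) (u : ℝ),
      (c * ((u : ℂ) + P.value z * Complex.I) + eval z g).im = 0) : P = 0 := by
  have hci : c.im = 0 := by
    have e1 := h 0 1
    have e2 := h 0 0
    simp only [Complex.add_im, Complex.mul_im, Complex.mul_re, Complex.add_re] at e1 e2
    simp at e1 e2
    linarith
  have hcr : c = ((c.re : ℝ) : ℂ) := Complex.ext rfl (by simp [hci])
  have h1 : C c * P + imPoly g = 0 := by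
    refine ZPoly.value_injective fun z => ?_
    have h2 : ZPoly.value (C c * P + imPoly g) z = c * P.value z + (imPoly g).value z := by
      simp [ZPoly.value]
    rw [h2, value_imPoly]
    have h3 := h z 0
    have h4 : ZPoly.value (0 : ZPoly n) z = 0 := by simp [ZPoly.value]
    rw [h4]
    simp only [Complex.add_im, Complex.mul_im, Complex.mul_re, Complex.add_re] at h3
    apply Complex.ext
    · simp [hci] at h3 ⊢
      exact h3
    · simp [hci, hPr z]
  have h2 := congrArg (kill (inrSet n)) h1
  rw [map_add, map_mul, (noPluriharmonic_iff.1 hP).1, mul_zero, zero_add, kill_inr_imPoly hg,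
    map_zero] at h2
  rw [eq_zero_of_holPoly h2, imPoly_zero, add_zero] at h1
  refine (mul_eq_zero.1 h1).resolve_left fun h3 => hc ?_
  rwa [C_eq_zero] at h3

lemma IsTransition.isBigO_fst (hF : IsTransition Ψ Ψ' F) (hΨ : IsGraphFun Ψ) :
    (fun y => (F (graphLift Ψ y)).1) =O[𝓝 0] fun y => ‖y‖ := by
  have h1 : F =O[𝓝 0] fun x => x := by
    simpa [hF.map_zero] using hF.analyticAt.differentiableAt.hasFDerivAt.isBigO_sub
  have h2 : Ψ =O[𝓝 0] fun y => ‖y‖ := by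
    have h3 : DifferentiableAt ℝ Ψ 0 := hΨ.1.self_of_nhds.differentiableAt (by simp)
    simpa [hΨ.2.1] using h3.hasFDerivAt.isBigO_sub.norm_right
  have h3 : graphLift Ψ =O[𝓝 0] fun y => ‖y‖ := by
    have e1 : (fun y : GraphSpace n => y.1) =O[𝓝 0] fun y => ‖y‖ :=
      Asymptotics.IsBigO.of_bound 1 (Eventually.of_forall fun y => by simpa using norm_fst_le y)
    have e2 : (fun y : GraphSpace n => (y.2 : ℂ)) =O[𝓝 0] fun y => ‖y‖ :=
      Asymptotics.IsBigO.of_bound 1 (Eventually.of_forall fun y => by simpa using norm_snd_le y)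
    have e3 : (fun y : GraphSpace n => (Ψ y : ℂ) * Complex.I) =O[𝓝 0] fun y => ‖y‖ := by
      refine (Asymptotics.IsBigO.of_bound 1 (Eventually.of_forall fun y => ?_)).trans h2
      simp
    exact e1.prod_left (e2.add e3)
  have h4 := (h1.comp_tendsto hΨ.tendsto_graphLift).trans h3
  refine (Asymptotics.IsBigO.of_bound 1 (Eventually.of_forall fun y => ?_)).trans h4
  simpa using norm_fst_le (F (graphLift Ψ y))

/-- Distinguished weights with positive entries bound the order of tangency. -/
lemma exists_not_flat (hΛ : ∀ i, 0 < Λ i) (hΛ1 : ∀ i, Λ i < 1) (h : IsCoord M p Φ Ψ) (hP0 : P ≠ 0)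
    (hn : NoPluriharmonic P) (hP : IsLeading Λ Ψ P) :
    ∃ R : ℕ, ∀ Φ' Ψ', IsCoord M p Φ' Ψ' →
      ¬∀ α β, ∑ i, α i + ∑ i, β i < R → taylorCoeff Ψ' α β = 0 := by
  -- A function of order `R` in the parameters then has weight more than one. If `Ψ'(z, 0)` is flat
  -- to order `R`, it disappears from the weight-one part of the transition, which forces `P = 0`.
  obtain ⟨R, hR⟩ := exists_nat_mul_gt (gDil Λ hΛ) 1
  refine ⟨R, fun Φ' Ψ' h' hflat => hP0 ?_⟩
  obtain ⟨F, hF, -⟩ := h.exists_transition h'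
  have hz := hF.isBigO_fst h.isGraphFun
  have hzt : Tendsto (fun y => (F (graphLift Ψ y)).1) (𝓝 0) (𝓝 0) :=
    (continuous_fst.tendsto (0 : CoordSpace n)).comp (hF.tendsto_lift h.isGraphFun)
  have h1 : (fun y => (Ψ' ((F (graphLift Ψ y)).1, 0) : ℂ)) =O[𝓝 0] fun y => ‖y‖ ^ R :=
    ((isBigO_of_taylorCoeff h'.isGraphFun hflat).comp_tendsto hzt).trans (hz.norm_left.pow R)
  have h2 : ∀ ρ ≤ 1, WLim (gDil Λ hΛ) ρ (fun y => (Ψ' ((F (graphLift Ψ y)).1, 0) : ℂ))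
      fun _ => 0 := fun ρ hρ => WLim.of_isBigO h1 (hρ.trans_lt hR)
  obtain ⟨q, hq⟩ := hF.exists_hasLead_snd h.isGraphFun h'.isGraphFun hP fun ρ hρ => h2 ρ hρ.le
  have h3 : ∀ y, (eval (hcoord (liftLead P y)) q).im = 0 :=
    hF.im_eq_zero h.isGraphFun h'.isGraphFun (h2 1 le_rfl)
      (hq.2.comp (dlim_graphLift h.isGraphFun hP))
  refine eq_zero_of_im_eq_zero (hP.value_im hΛ h.isGraphFun) hn
    (coeff_none_ne_zero hF.toIsGermIso hΛ1 hq) (g := toZ q) (constantCoeff_toZ hq.1 one_pos)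
    fun z u => ?_
  have h4 := h3 (z, u)
  rw [eval_hcoord_eq hΛ hq.1 le_rfl] at h4
  exact h4

/-- `μ` is the smallest distinguished weight, it is positive, and `Φ` is a `μ`-adapted system of
coordinates. -/
structure IsMinimalSystem (M : Set (Fin (n + 1) → ℂ)) (p : Fin (n + 1) → ℂ) (μ : Fin n → ℚ)
    (Φ : (Fin (n + 1) → ℂ) → CoordSpace n) (Ψ : GraphSpace n → ℝ) (P : ZPoly n) : Prop where
  isWeight : IsWeight μ
  pos : ∀ i, 0 < μ i
  isCoord : IsCoord M p Φ Ψ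
  ne_zero : P ≠ 0
  noPluriharmonic : NoPluriharmonic P
  isLeading : IsLeading μ Ψ P
  le : ∀ Λ, IsDistinguished M p Λ → toLex μ ≤ toLex Λ

lemma IsWeight.lt_one (h : IsWeight Λ) (i : Fin n) : Λ i < 1 :=
  (h.1 i).2.trans_lt (by norm_num)

lemma wlen_const (c : ℚ) (α β : Fin n → ℕ) :
    wlen (fun _ => c) α β = ((∑ i, α i + ∑ i, β i : ℕ) : ℚ) * c := by
  rw [wlen, ← Finset.sum_mul, Finset.sum_add_distrib]
  push_cast
  rfl

/-- With all weights equal to one, `Ψ = o(‖y‖)` says that zero is a leading polynomial, and the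
coefficients of order at most one can be read off. -/
lemma taylorCoeff_eq_zero_of_lt_two (hΨ : IsGraphFun Ψ) {α β : Fin n → ℕ}
    (h : ∑ i, α i + ∑ i, β i < 2) : taylorCoeff Ψ α β = 0 := by
  have hΛ : ∀ i : Fin n, (0 : ℚ) < (fun _ => 1 : Fin n → ℚ) i := fun _ => one_pos
  have hD : ∀ (s : ℝ) (y : GraphSpace n), 0 < s →
      ‖(gDil (fun _ => 1) hΛ).D s y‖ = s * ‖y‖ := by
    intro s y hs
    have : (gDil (fun _ => 1) hΛ).D s y = s • y := by
      refine Prod.ext (funext fun i => ?_) rfl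
      change s ^ (((1 : ℚ) : ℝ)) • y.1 i = s • y.1 i
      simp
    rw [this, norm_smul, Real.norm_of_nonneg hs.le]
  have h1 : (fun y => (Ψ y : ℂ)) =o[𝓝 0] fun y => ((‖y‖ : ℝ) : ℂ) := by
    have h3 : HasFDerivAt Ψ (fderiv ℝ Ψ 0) 0 :=
      (hΨ.1.self_of_nhds.differentiableAt (by simp)).hasFDerivAt
    rw [hΨ.2.2] at h3
    have h4 := h3.isLittleO
    simp only [hΨ.2.1, sub_zero, zero_apply] at h4
    refine (Asymptotics.isLittleO_iff).2 fun c hc => ?_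
    filter_upwards [Asymptotics.isLittleO_iff.1 h4 hc] with y hy
    simpa using hy
  have h2 : WLim (gDil (fun _ => 1) hΛ) 1 (fun y => (Ψ y : ℂ)) fun _ => 0 := by
    intro y₀
    have hφ := (h1.tendsto_div_nhds_zero.comp ((gDil (fun _ => 1) hΛ).tendsto_D y₀)).mul
      (((Complex.continuous_ofReal.comp continuous_norm).tendsto y₀).comp
        (tendsto_snd (f := 𝓝[>] (0 : ℝ))))
    rw [zero_mul] at hφ
    refine hφ.congr' ?_
    filter_upwards [eventually_pos_fst _] with q hq
    simp only [Function.comp, hD _ _ hq, Rat.cast_one, Real.rpow_one]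
    have hs : (q.1 : ℂ) ≠ 0 := by exact_mod_cast hq.ne'
    by_cases hy : ‖q.2‖ = 0
    · have h0 : (gDil (fun _ => 1) hΛ).D q.1 q.2 = 0 := by
        rw [← norm_eq_zero, hD _ _ hq, hy, mul_zero]
      rw [h0, hΨ.2.1]
      simp
    · have hy' : ((‖q.2‖ : ℝ) : ℂ) ≠ 0 := by exact_mod_cast hy
      push_cast
      field_simp
  have h3 : IsLeading (fun _ => 1) Ψ 0 := by
    refine (isLeading_iff_wlim hΛ hΨ 0).2 ⟨isWeightedHomogeneous_zero _ _ _, ?_⟩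
    simpa [ZPoly.value] using h2
  have h4 := ((isLeading_iff_coeff hΛ hΨ 0).1 h3).2 α β (by
    rw [wlen_const, mul_one]
    exact_mod_cast Nat.lt_succ_iff.1 h)
  simpa using h4

lemma wlen_inv (m : ℕ) (hm : 0 < m) (α β : Fin n → ℕ) (r : ℚ) :
    wlen (fun _ => 1 / (m : ℚ)) α β ≤ r ↔ ((∑ i, α i + ∑ i, β i : ℕ) : ℚ) ≤ r * m := by
  have hm' : (0 : ℚ) < m := by exact_mod_cast hm
  rw [wlen_const, mul_one_div, div_le_iff₀ hm']

/-- If it failed, the lowest homogeneous polynomial would consist of pluriharmonic terms at every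
order, and removing these repeatedly would give coordinates flat to any prescribed order, against
`exists_not_flat`. -/
lemma IsMinimalSystem.exists_initial (h : IsMinimalSystem M p μ Φ Ψ P) :
    ∃ (m : ℕ) (Φ' : (Fin (n + 1) → ℂ) → CoordSpace n) (Ψ' : GraphSpace n → ℝ), 0 < m ∧
      IsAdapted M p (fun _ => 1 / (m : ℚ)) Φ' Ψ' := by
  by_contra! hno
  have key : ∀ R : ℕ, 2 ≤ R → ∃ Φ' Ψ', IsCoord M p Φ' Ψ' ∧
      ∀ α β, ∑ i, α i + ∑ i, β i < R → taylorCoeff Ψ' α β = 0 := by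
    intro R hR
    induction R, hR using Nat.le_induction with
    | base => exact ⟨Φ, Ψ, h.isCoord, fun α β => taylorCoeff_eq_zero_of_lt_two h.isCoord.isGraphFun⟩
    | succ R hR ih =>
      obtain ⟨Φ₁, Ψ₁, h₁, hflat⟩ := ih
      have hR0 : 0 < R := by omega
      have hR' : (0 : ℚ) < R := by exact_mod_cast hR0
      have hΛ : ∀ i : Fin n, (0 : ℚ) < (fun _ => 1 / (R : ℚ) : Fin n → ℚ) i := fun _ => by positivity
      have hΛ1 : ∀ i : Fin n, (fun _ => 1 / (R : ℚ) : Fin n → ℚ) i < 1 := fun _ => by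
        change 1 / (R : ℚ) < 1
        rw [div_lt_one hR']
        exact_mod_cast hR
      obtain ⟨P₁, hP₁⟩ := exists_isLeading hΛ h₁.isGraphFun fun α β hαβ => hflat α β (by
        rw [wlen_const, mul_one_div, div_lt_one hR'] at hαβ
        exact_mod_cast hαβ)
      obtain ⟨Φ₂, Ψ₂, -, h₂, hP₂⟩ := exists_change_mixedPart hΛ hΛ1 h₁ hP₁
      have hn := noPluriharmonic_mixedPart (coeff_zero_eq_zero hP₁.1 one_pos)
      by_cases h0 : mixedPart P₁ = 0
      · refine ⟨Φ₂, Ψ₂, h₂, fun α β hαβ => ?_⟩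
        have h3 := ((isLeading_iff_coeff hΛ h₂.isGraphFun _).1 hP₂).2 α β (by
          rw [wlen_inv R hR0, one_mul]
          exact_mod_cast Nat.lt_succ_iff.1 hαβ)
        rw [h3, h0, coeff_zero]
      · exact absurd ⟨h₂, _, h0, hn, hP₂⟩ (hno R Φ₂ Ψ₂ hR0)
  obtain ⟨R, hR⟩ := exists_not_flat h.pos h.isWeight.lt_one h.isCoord h.ne_zero h.noPluriharmonic
    h.isLeading
  obtain ⟨Φ', Ψ', h', hflat⟩ := key (R + 2) (by omega)
  exact hR Φ' Ψ' h' fun α β hαβ => hflat α β (by omega)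

lemma isWeight_const {m : ℕ} (hm : 2 ≤ m) : IsWeight (fun _ : Fin n => 1 / (m : ℚ)) := by
  have hm' : (2 : ℚ) ≤ m := by exact_mod_cast hm
  refine ⟨fun k => ⟨by positivity, ?_⟩, fun _ _ _ => le_rfl, fun k => Or.inr
    ⟨Pi.single k m, by simp; omega, ?_⟩⟩
  · exact one_div_le_one_div_of_le two_pos hm'
  · rw [Finset.sum_eq_single k]
    · rw [Pi.single_eq_same]; field_simp
    · intro b _ hb; simp [hb]
    · simp

/-- The first difference of the two tuples cannot occur before the position `k`. -/
lemma toLex_le_head {a b : Fin n → ℚ} (h : toLex a ≤ toLex b) {k : Fin n}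
    (hk : ∀ i < k, a i = b i) : a k ≤ b k := by
  rcases h.eq_or_lt with h | ⟨i, hi, hlt⟩
  · exact (congrFun (toLex.injective h) k).le
  · rcases lt_trichotomy i k with hik | rfl | hik
    · exact absurd hlt (by change ¬a i < b i; rw [hk i hik]; exact lt_irrefl _)
    · exact le_of_lt hlt
    · exact (hi k hik).le

/-- The first step determines the first entry. -/
lemma IsMinimalSystem.initial (h : IsMinimalSystem M p μ Φs Ψs Ps) (hc : IsCoord M p Φ Ψ)
    (hP0 : P ≠ 0) (hn : NoPluriharmonic P) {m : ℕ} (hm : 0 < m)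
    (hP : IsLeading (fun _ => 1 / (m : ℚ)) Ψ P) :
    IsWeight (fun _ : Fin n => 1 / (m : ℚ)) ∧ (∀ i, μ i ≤ 1 / (m : ℚ)) ∧
    (∀ F, IsTransition Ψ Ψs F → ∃ q, IsSuperHom (fun _ => 1 / (m : ℚ))
      (fun _ => by positivity) F q) ∧
    (∃ i, μ i = 1 / (m : ℚ)) ∧ kill {o | μ (Sum.elim id id o) ≠ 1 / (m : ℚ)} Ps ≠ 0 := by
  set Λ : Fin n → ℚ := fun _ => 1 / (m : ℚ) with hΛdef
  have hm' : (0 : ℚ) < m := by exact_mod_cast hm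
  have hΛ : ∀ i, 0 < Λ i := fun _ => by positivity
  obtain ⟨e, he⟩ := ne_zero_iff.1 hP0
  rw [eq_zexp e] at he
  obtain ⟨hw1, hco⟩ := hP.coeff_eq hΛ hc.isGraphFun he
  have hm2 : 2 ≤ m := by
    by_contra hlt
    refine he (hco ▸ taylorCoeff_eq_zero_of_lt_two hc.isGraphFun ?_)
    rw [hΛdef, wlen_const, mul_one_div, div_eq_one_iff_eq hm'.ne'] at hw1
    have : (∑ i, e (Sum.inl i) + ∑ i, e (Sum.inr i)) = m := by exact_mod_cast hw1
    omega
  have hwt := isWeight_const (n := n) hm2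
  have hlex := h.le Λ ⟨hwt, Φ, Ψ, hc, P, hP0, hn, hP⟩
  -- Minimality compares the first entries; the others follow because `μ` is nonincreasing and `Λ`
  -- is constant.
  have hle : ∀ i, μ i ≤ Λ i := by
    intro i
    have hn0 : 0 < n := i.pos
    refine (h.isWeight.2.1 ⟨0, hn0⟩ i (Nat.zero_le _)).trans ?_
    exact toLex_le_head hlex fun j hj => absurd hj (by simp [Fin.lt_def])
  have hΨs := h.isCoord.isGraphFun
  obtain ⟨Q, hQ⟩ := h.isLeading.exists_of_le h.pos hle hΨs
  have hsup : ∀ F, IsTransition Ψ Ψs F → ∃ q, IsSuperHom Λ hΛ F q := by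
    intro F hF
    refine hF.exists_isSuperHom hc.isGraphFun hΨs hP hQ fun i =>
      exists_hasLead_of_le (hF.toIsGermIso.analyticAt_hcoord (some i)) ?_ fun o => ?_
    · change (F 0).1 i = 0
      rw [hF.map_zero]; rfl
    · rcases o with _ | j
      · exact (hwt.lt_one i).le
      · exact le_rfl
  obtain ⟨F, hF, -⟩ := hc.exists_transition h.isCoord
  obtain ⟨q, hq⟩ := hsup F hF
  -- The leading polynomials for the constant weight correspond to each other up to a nonzero
  -- constant, so `Q = 0` would imply `P = 0`.
  have hQ0 : Q ≠ 0 := by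
    rintro rfl
    obtain ⟨c, hc0, -, hrel⟩ := hF.exists_pull_eq_of_noPluriharmonic hc.isGraphFun hΨs hP hQ
      hwt.lt_one hq hn (fun m hm => by simp at hm)
    rw [map_zero, zero_eq_mul, C_eq_zero] at hrel
    rcases hrel with h1 | h1
    · exact hc0 (by exact_mod_cast h1)
    · exact hP0 h1
  obtain ⟨e, he⟩ := ne_zero_iff.1 hQ0
  rw [eq_zexp e] at he
  set α : Fin n → ℕ := fun i => e (Sum.inl i) with hα
  set β : Fin n → ℕ := fun i => e (Sum.inr i) with hβ
  obtain ⟨hwe, hce⟩ := hQ.coeff_eq hΛ hΨs he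
  -- A monomial of `Q` has weight one for `Λ` and at least one for the smaller weight `μ`. So the
  -- weights of all variables in it agree: its variables have `μ i = 1 / m`, and it also occurs in
  -- `Ps`.
  have hge : 1 ≤ wlen μ α β := by
    by_contra hlt
    rw [← hce] at he
    exact he (h.isLeading.taylorCoeff_eq_zero h.pos hΨs (not_le.1 hlt))
  have heq : wlen μ α β = wlen Λ α β :=
    le_antisymm (wlen_mono hle α β) (hwe.trans_le hge)
  have hterm := (Finset.sum_eq_sum_iff_of_le fun i _ =>
    mul_le_mul_of_nonneg_left (hle i) (by positivity : (0 : ℚ) ≤ (α i : ℚ) + β i)).1 heq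
  have hcase : ∀ i, α i + β i ≠ 0 → μ i = 1 / (m : ℚ) := by
    intro i hi
    have h1 := hterm i (Finset.mem_univ i)
    refine mul_left_cancel₀ ?_ h1
    exact_mod_cast hi
  refine ⟨hwt, hle, hsup, ?_, fun h0 => ?_⟩
  · by_contra! hno
    have h0 : wlen Λ α β = 0 := by
      refine Finset.sum_eq_zero fun i _ => ?_
      have : α i + β i = 0 := by
        by_contra hi
        exact hno i (hcase i hi)
      have h1 : ((α i : ℚ) + β i) = 0 := by exact_mod_cast this
      rw [h1, zero_mul]
    rw [h0] at hwe
    exact zero_ne_one hwe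
  · have h1 : coeff (zexp α β) Ps = 0 := by
      rw [← coeff_kill_of_forall (S := {o | μ (Sum.elim id id o) ≠ 1 / (m : ℚ)}), h0, coeff_zero]
      rintro (i | i) hi
      · by_contra h2
        exact hi (hcase i (by simp at h2; omega))
      · by_contra h2
        exact hi (hcase i (by simp at h2; omega))
    have h2 := ((isLeading_iff_coeff h.pos hΨs Ps).1 h.isLeading).2 α β
      ((heq.trans hwe).le)
    rw [← hce, h2] at he
    exact he h1

end Initial

/-! ### Weights -/

section Weights

variable {n : ℕ} {M : Set (Fin (n + 1) → ℂ)} {p : Fin (n + 1) → ℂ} {Λ Λ' μ : Fin n → ℚ}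

lemma exists_nat_bound {ε : ℚ} (hε : 0 < ε) : ∃ N : ℕ, ∀ a : ℕ, (a : ℚ) * ε ≤ 1 → a ≤ N := by
  obtain ⟨N, hN⟩ := exists_nat_ge (1 / ε)
  refine ⟨N, fun a ha => ?_⟩
  have : (a : ℚ) ≤ N := ((le_div_iff₀ hε).2 ha).trans hN
  exact_mod_cast this

lemma mul_le_one_of_sum_eq {s : Finset (Fin n)} {a : Fin n → ℕ} {x : Fin n → ℚ}
    (hx : ∀ j ∈ s, 0 ≤ x j) (h : ∑ j ∈ s, (a j : ℚ) * x j = 1) {j : Fin n} (hj : j ∈ s) :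
    (a j : ℚ) * x j ≤ 1 := by
  rw [← h]
  exact Finset.single_le_sum (f := fun j => (a j : ℚ) * x j)
    (fun i hi => mul_nonneg (by positivity) (hx i hi)) hj

/-- There are finitely many weights above a given positive weight. -/
lemma finite_setOf_isWeight (hμ : ∀ i, 0 < μ i) : {Λ | IsWeight Λ ∧ ∀ i, μ i ≤ Λ i}.Finite := by
  classical
  obtain ⟨ε, hε, -, hle⟩ := exists_le_weights hμ
  obtain ⟨N, hN⟩ := exists_nat_bound hε
  -- The relations are triangular with positive diagonal, so the coefficient matrix determines the
  -- weight entry by entry.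
  let R : (Fin n → Fin n → ℕ) → Set (Fin n → ℚ) := fun a =>
    {Λ | ∀ k, 0 < a k k ∧ ∑ j ∈ Finset.Iic k, (a k j : ℚ) * Λ j = 1}
  refine ((Set.finite_Iic (fun _ _ => N : Fin n → Fin n → ℕ)).biUnion (t := R)
    fun a _ => Set.Subsingleton.finite fun Λ hΛ Λ' hΛ' => ?_).subset ?_
  · funext k
    induction k using WellFoundedLT.induction with
    | ind k ih =>
      obtain ⟨h1, h2⟩ := hΛ k
      obtain ⟨-, h3⟩ := hΛ' k
      rw [← Finset.Iio_insert, Finset.sum_insert (by simp)] at h2 h3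
      have h4 : ∑ j ∈ Finset.Iio k, (a k j : ℚ) * Λ j = ∑ j ∈ Finset.Iio k, (a k j : ℚ) * Λ' j :=
        Finset.sum_congr rfl fun j hj => by rw [ih j (Finset.mem_Iio.1 hj)]
      have h5 : (a k k : ℚ) * Λ k = a k k * Λ' k := by linarith
      exact mul_left_cancel₀ (by exact_mod_cast h1.ne') h5
  · rintro Λ ⟨hΛ, hμΛ⟩
    have hpos : ∀ k, 0 < Λ k := fun k => (hμ k).trans_le (hμΛ k)
    have : ∀ k, ∃ a : Fin n → ℕ, 0 < a k ∧ ∑ j ∈ Finset.Iic k, (a j : ℚ) * Λ j = 1 :=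
      fun k => (hΛ.2.2 k).resolve_left (hpos k).ne'
    choose a ha1 ha2 using this
    -- The relation for the entry `k` leaves the coefficients beyond `k` free; setting them to zero
    -- makes the matrix bounded.
    refine Set.mem_biUnion (x := fun k j => if j ≤ k then a k j else 0) ?_ fun k => ⟨?_, ?_⟩
    · intro k j
      change (if j ≤ k then a k j else 0) ≤ N
      split_ifs with hjk
      · refine hN _ ((mul_le_mul_of_nonneg_left ((hle j).trans (hμΛ j)) (by positivity)).trans
          (mul_le_one_of_sum_eq (fun j _ => (hpos j).le) (ha2 k) (Finset.mem_Iic.2 hjk)))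
      · exact Nat.zero_le _
    · simpa using ha1 k
    · rw [← ha2 k]
      exact Finset.sum_congr rfl fun j hj => by
        simp only [if_pos (Finset.mem_Iic.1 hj)]

/-- A positive multitype weight is distinguished. -/
lemma IsMultitypeWeight.isDistinguished (h : IsMultitypeWeight M p μ) (hpos : ∀ i, 0 < μ i) :
    IsDistinguished M p μ := by
  classical
  obtain ⟨⟨Λ₁, hΛ₁⟩, hμ, hle, hgr⟩ := h
  by_contra hno
  have hex : ∀ Λ, IsDistinguished M p Λ → ∃ k, (∀ j < k, μ j = Λ j) ∧ μ k < Λ k := by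
    intro Λ hΛ
    have hne : toLex μ ≠ toLex Λ := fun h => hno (toLex.injective h ▸ hΛ)
    exact lt_of_le_of_ne (hle Λ hΛ) hne
  -- Positions where a distinguished weight first differs from `μ`. The last such position `k` is
  -- used.
  let K : Set (Fin n) := {k | ∃ Λ, IsDistinguished M p Λ ∧ (∀ j < k, μ j = Λ j) ∧ μ k < Λ k}
  have hKne : K.Nonempty := (hex Λ₁ hΛ₁).imp fun k hk => ⟨Λ₁, hΛ₁, hk⟩
  obtain ⟨k, ⟨Λ₂, hΛ₂⟩, hkmax⟩ := K.exists_max_image id K.toFinite hKne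
  -- Values at `k` of the distinguished weights which leave `μ` there. There are finitely many: they
  -- exceed `μ k > 0`, which bounds the coefficients of their relations, and the earlier entries are
  -- those of `μ`. So a least value exists.
  let V : Set ℚ := {x | ∃ Λ, IsDistinguished M p Λ ∧ (∀ j < k, μ j = Λ j) ∧ μ k < Λ k ∧ Λ k = x}
  have hVfin : V.Finite := by
    obtain ⟨N, hN⟩ := exists_nat_bound (hpos k)
    refine ((Set.finite_Iic (fun _ => N : Fin n → ℕ)).image
      fun a => (1 - ∑ j ∈ Finset.Iio k, (a j : ℚ) * μ j) / a k).subset ?_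
    rintro x ⟨Λ, ⟨hΛ, -⟩, hj, hk, rfl⟩
    obtain ⟨a, ha1, ha2⟩ := (hΛ.2.2 k).resolve_left ((hpos k).trans hk).ne'
    refine ⟨fun j => if j ≤ k then a j else 0, fun j => ?_, ?_⟩
    · change (if j ≤ k then a j else 0) ≤ N
      split_ifs with hjk
      · refine hN _ ((mul_le_mul_of_nonneg_left (hk.le.trans (hΛ.2.1 j k hjk)) (by positivity)).trans
          (mul_le_one_of_sum_eq (fun j _ => (hΛ.1 j).1) ha2 (Finset.mem_Iic.2 hjk)))
      · exact Nat.zero_le _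
    · rw [← Finset.Iio_insert, Finset.sum_insert (by simp)] at ha2
      have h1 : ∑ j ∈ Finset.Iio k, ((if j ≤ k then a j else 0 : ℕ) : ℚ) * μ j =
          ∑ j ∈ Finset.Iio k, (a j : ℚ) * Λ j := by
        refine Finset.sum_congr rfl fun j hj' => ?_
        have hlt := Finset.mem_Iio.1 hj'
        rw [if_pos hlt.le, hj j hlt]
      have h2 : (a k : ℚ) ≠ 0 := by exact_mod_cast ha1.ne'
      simp only [h1, le_refl, if_true]
      rw [div_eq_iff h2]
      linarith
  obtain ⟨v, ⟨Λ, hD, hj, hk, rfl⟩, hvmin⟩ := V.exists_min_image id hVfin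
    ⟨_, Λ₂, hΛ₂.1, hΛ₂.2.1, hΛ₂.2.2, rfl⟩
  have hΛ := hD.1
  -- Cut off after the position `k` and filled up with zeros, a weight with least entry there
  -- becomes a lower bound of all distinguished weights. It is larger than `μ`, contradicting the
  -- choice of `μ` as infimum.
  let ν : Fin n → ℚ := fun i => if i ≤ k then Λ i else 0
  have hνle : ∀ i ≤ k, ν i = Λ i := fun i hi => if_pos hi
  have hν : IsWeight ν := by
    refine ⟨fun i => ?_, fun i j hij => ?_, fun i => ?_⟩
    · by_cases hi : i ≤ k
      · rw [hνle i hi]; exact hΛ.1 i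
      · simp only [ν, if_neg hi]; norm_num
    · by_cases hjk : j ≤ k
      · rw [hνle j hjk, hνle i (hij.trans hjk)]; exact hΛ.2.1 i j hij
      · simp only [ν, if_neg hjk]
        split_ifs
        · exact (hΛ.1 i).1
        · exact le_rfl
    · by_cases hi : i ≤ k
      · rw [hνle i hi]
        refine (hΛ.2.2 i).imp id fun ⟨a, ha1, ha2⟩ => ⟨a, ha1, ?_⟩
        rw [← ha2]
        exact Finset.sum_congr rfl fun j hj' => by rw [hνle j ((Finset.mem_Iic.1 hj').trans hi)]
      · left; simp only [ν, if_neg hi]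
  have h1 : toLex ν ≤ toLex μ := by
    refine hgr ν hν fun Λ' hD' => ?_
    obtain ⟨k', hj', hk'⟩ := hex Λ' hD'
    have hk'le : k' ≤ k := hkmax k' ⟨Λ', hD', hj', hk'⟩
    rcases hk'le.lt_or_eq with hlt | rfl
    · refine le_of_lt ⟨k', fun i hi => ?_, ?_⟩
      · change ν i = Λ' i
        rw [hνle i (hi.le.trans hk'le), ← hj i (hi.trans hlt), hj' i hi]
      · change ν k' < Λ' k'
        rw [hνle k' hk'le, ← hj k' hlt]; exact hk'
    · have h2 : Λ k' ≤ Λ' k' := hvmin _ ⟨Λ', hD', hj', hk', rfl⟩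
      rcases h2.lt_or_eq with hlt | heq
      · refine le_of_lt ⟨k', fun i hi => ?_, ?_⟩
        · change ν i = Λ' i
          rw [hνle i hi.le, ← hj i hi, hj' i hi]
        · change ν k' < Λ' k'
          rw [hνle k' le_rfl]; exact hlt
      · refine Pi.toLex_monotone fun i => ?_
        rcases lt_trichotomy i k' with hi | rfl | hi
        · rw [hνle i hi.le, ← hj i hi, hj' i hi]
        · rw [hνle i le_rfl, heq]
        · simp only [ν, if_neg (not_le.2 hi)]
          exact (hD'.1.1 i).1
  refine absurd h1 (not_le.2 ⟨k, fun i hi => ?_, ?_⟩)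
  · change μ i = ν i
    rw [hνle i hi.le, hj i hi]
  · change μ k < ν k
    rw [hνle k le_rfl]; exact hk

lemma IsMultitypeWeight.exists_isMinimalSystem (h : IsMultitypeWeight M p μ)
    (hpos : ∀ i, 0 < μ i) : ∃ Φ Ψ P, IsMinimalSystem M p μ Φ Ψ P := by
  obtain ⟨hw, Φ, Ψ, hc, P, h0, hn, hP⟩ := h.isDistinguished hpos
  exact ⟨Φ, Ψ, P, hw, hpos, hc, h0, hn, hP, h.2.2.1⟩

/-- The weight with the last `d` entries of `Λ` replaced by `W`. -/
def tailWeight (Λ : Fin n → ℚ) (d : ℕ) (W : ℚ) : Fin n → ℚ :=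
  fun i => if (i : ℕ) + d < n then Λ i else W

lemma tailWeight_head {d : ℕ} {W : ℚ} {i : Fin n} (h : (i : ℕ) + d < n) :
    tailWeight Λ d W i = Λ i := if_pos h

lemma tailWeight_tail {d : ℕ} {W : ℚ} {i : Fin n} (h : n ≤ (i : ℕ) + d) :
    tailWeight Λ d W i = W := if_neg (not_lt.2 h)

lemma wlen_eq_of_tail {d : ℕ} {W : ℚ} (h : ∀ i : Fin n, n ≤ (i : ℕ) + d → Λ i = W)
    (α β : Fin n → ℕ) : wlen Λ α β = headLength Λ d α β + W * tailDegree d α β := by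
  rw [wlen, ← Finset.sum_filter_add_sum_filter_not _ (fun i : Fin n => (i : ℕ) + d < n), headLength,
    tailDegree, Finset.mul_sum]
  simp only [not_lt]
  congr 1
  refine Finset.sum_congr rfl fun i hi => ?_
  rw [h i (Finset.mem_filter.1 hi).2, mul_comm]

lemma headLength_congr {d : ℕ} (h : ∀ i : Fin n, (i : ℕ) + d < n → Λ i = Λ' i) (α β : Fin n → ℕ) :
    headLength Λ d α β = headLength Λ' d α β :=
  Finset.sum_congr rfl fun i hi => by rw [h i (Finset.mem_filter.1 hi).2]

lemma wlen_tailWeight (d : ℕ) (W : ℚ) (α β : Fin n → ℕ) :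
    wlen (tailWeight Λ d W) α β = headLength Λ d α β + W * tailDegree d α β := by
  rw [wlen_eq_of_tail (d := d) (W := W) fun i hi => tailWeight_tail hi,
    headLength_congr fun i hi => tailWeight_head hi]

lemma tailDegree_nonneg (d : ℕ) (α β : Fin n → ℕ) : 0 ≤ tailDegree d α β :=
  Finset.sum_nonneg fun _ _ => by positivity

lemma tailWeight_pos (hΛ : ∀ i, 0 < Λ i) (d : ℕ) {W : ℚ} (hW : 0 < W) (i : Fin n) :
    0 < tailWeight Λ d W i := by
  unfold tailWeight; split_ifs
  exacts [hΛ i, hW]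

/-- One relation serves all tail entries: they are equal, so the whole multiplicity `t` can be
placed on the entry in question. -/
lemma isWeight_tailWeight (hΛ : IsWeight Λ) {d : ℕ} {W : ℚ} (hW0 : 0 ≤ W)
    (hW2 : W ≤ 1 / 2) (hW : ∀ i : Fin n, (i : ℕ) + d < n → W ≤ Λ i) {a : Fin n → ℕ} {t : ℕ} (ht : 0 < t)
    (hsum : ∑ i ∈ Finset.univ.filter (fun i : Fin n => (i : ℕ) + d < n), (a i : ℚ) * Λ i + t * W = 1) :
    IsWeight (tailWeight Λ d W) := by
  classical
  refine ⟨fun k => ?_, fun j k hjk => ?_, fun k => ?_⟩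
  · by_cases hk : (k : ℕ) + d < n
    · rw [tailWeight_head hk]; exact hΛ.1 k
    · rw [tailWeight_tail (not_lt.1 hk)]
      exact ⟨hW0, hW2⟩
  · have hjk' : (j : ℕ) ≤ k := hjk
    by_cases hk : (k : ℕ) + d < n
    · rw [tailWeight_head hk, tailWeight_head (by omega)]; exact hΛ.2.1 j k hjk
    · rw [tailWeight_tail (not_lt.1 hk)]
      by_cases hj : (j : ℕ) + d < n
      · rw [tailWeight_head hj]; exact hW j hj
      · rw [tailWeight_tail (not_lt.1 hj)]
  · by_cases hk : (k : ℕ) + d < n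
    · rw [tailWeight_head hk]
      refine (hΛ.2.2 k).imp id fun ⟨a, ha1, ha2⟩ => ⟨a, ha1, ?_⟩
      rw [← ha2]
      refine Finset.sum_congr rfl fun j hj => ?_
      have hjk : j ≤ k := Finset.mem_Iic.1 hj
      have : (j : ℕ) ≤ k := hjk
      rw [tailWeight_head (by omega)]
    · right
      refine ⟨fun j => if (j : ℕ) + d < n then a j else if j = k then t else 0, by simpa [hk] using ht,
        ?_⟩
      rw [← hsum, ← Finset.sum_filter_add_sum_filter_not _ (fun i : Fin n => (i : ℕ) + d < n)]
      congr 1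
      · rw [show (Finset.Iic k).filter (fun i : Fin n => (i : ℕ) + d < n) =
          Finset.univ.filter (fun i : Fin n => (i : ℕ) + d < n) from ?_]
        · refine Finset.sum_congr rfl fun i hi => ?_
          have := (Finset.mem_filter.1 hi).2
          simp only [if_pos this, tailWeight_head this]
        · ext i
          simp only [Finset.mem_filter, Finset.mem_Iic, Finset.mem_univ, true_and,
            and_iff_right_iff_imp, Fin.le_def]
          omega
      · rw [Finset.sum_eq_single k]
        · simp only [if_neg hk, if_true, tailWeight_tail (not_lt.1 hk)]
        · intro j hj hjk
          simp only [if_neg (Finset.mem_filter.1 hj).2, if_neg hjk, Nat.cast_zero, zero_mul]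
        · intro h
          exact (h (by simp [not_lt.1 hk])).elim

/-- The ratio is defined so that the monomial `γ` has weight exactly one for the new weight, which
is the relation required of its tail entries. -/
lemma isWeight_tailWeight_ratioW (hΛ : IsWeight Λ) {d : ℕ} {γ : (Fin n → ℕ) × (Fin n → ℕ)}
    (hh : headLength Λ d γ.1 γ.2 ≤ 1) (ht : 0 < tailDegree d γ.1 γ.2)
    (hW2 : ratioW Λ d γ ≤ 1 / 2) (hW : ∀ i : Fin n, (i : ℕ) + d < n → ratioW Λ d γ ≤ Λ i) :
    IsWeight (tailWeight Λ d (ratioW Λ d γ)) := by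
  have h1 : tailDegree d γ.1 γ.2 =
      ((∑ i ∈ Finset.univ.filter (fun i : Fin n => n ≤ (i : ℕ) + d), (γ.1 i + γ.2 i) : ℕ) : ℚ) := by
    rw [tailDegree]; push_cast; rfl
  refine isWeight_tailWeight hΛ (div_nonneg (by linarith) ht.le) hW2 hW (a := fun i => γ.1 i + γ.2 i)
    (t := ∑ i ∈ Finset.univ.filter (fun i : Fin n => n ≤ (i : ℕ) + d), (γ.1 i + γ.2 i)) ?_ ?_
  · rw [h1] at ht; exact_mod_cast ht
  · rw [← h1, ratioW, mul_div_cancel₀ _ ht.ne']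
    have : ∑ i ∈ Finset.univ.filter (fun i : Fin n => (i : ℕ) + d < n),
        ((γ.1 i + γ.2 i : ℕ) : ℚ) * Λ i = headLength Λ d γ.1 γ.2 := by
      rw [headLength]; push_cast; rfl
    rw [this]; ring

lemma zexp_injective : Function.Injective fun γ : (Fin n → ℕ) × (Fin n → ℕ) => zexp γ.1 γ.2 := by
  intro γ γ' h
  refine Prod.ext (funext fun i => ?_) (funext fun i => ?_)
  · exact DFunLike.congr_fun h (Sum.inl i)
  · exact DFunLike.congr_fun h (Sum.inr i)

/-- Ratios have a maximum. -/
lemma exists_isGreatest_ratioW (hΛ : ∀ i, 0 < Λ i) {d : ℕ}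
    {Θ : Set ((Fin n → ℕ) × (Fin n → ℕ))} (hne : Θ.Nonempty)
    (h : ∀ γ ∈ Θ, headLength Λ d γ.1 γ.2 < 1 ∧ 0 < tailDegree d γ.1 γ.2) :
    ∃ W, 0 < W ∧ IsGreatest (ratioW Λ d '' Θ) W := by
  obtain ⟨γ₀, h₀⟩ := hne
  have hpos : ∀ γ ∈ Θ, 0 < ratioW Λ d γ := fun γ hγ =>
    div_pos (sub_pos.2 (h γ hγ).1) (h γ hγ).2
  -- Pairs with a ratio at least that of `γ₀` have length at most one when the tail gets the weight
  -- `ratioW Λ d γ₀`, and only finitely many pairs do.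
  have hfin : {γ | γ ∈ Θ ∧ ratioW Λ d γ₀ ≤ ratioW Λ d γ}.Finite := by
    refine Set.Finite.of_finite_image ((finite_setOf_wlen_le
      (tailWeight_pos hΛ d (hpos γ₀ h₀)) 1).subset ?_) zexp_injective.injOn
    rintro _ ⟨γ, ⟨hγ, hle⟩, rfl⟩
    simp only [Set.mem_ofPred_eq]
    rw [weight_zexp, wlen_tailWeight]
    have h1 := mul_le_mul_of_nonneg_right hle (h γ hγ).2.le
    have h2 : ratioW Λ d γ * tailDegree d γ.1 γ.2 = 1 - headLength Λ d γ.1 γ.2 :=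
      div_mul_cancel₀ _ (h γ hγ).2.ne'
    linarith
  obtain ⟨γ, ⟨hγ, hle⟩, hmax⟩ := Set.exists_max_image _ (ratioW Λ d) hfin ⟨γ₀, h₀, le_rfl⟩
  refine ⟨ratioW Λ d γ, hpos γ hγ, ⟨γ, hγ, rfl⟩, ?_⟩
  rintro _ ⟨γ', hγ', rfl⟩
  rcases le_total (ratioW Λ d γ₀) (ratioW Λ d γ') with h1 | h1
  · exact hmax γ' ⟨hγ', h1⟩
  · exact h1.trans hle

end Weights

/-! ### A weight below a given one -/

section Lower

open MvPolynomial

variable {n : ℕ} {M : Set (Fin (n + 1) → ℂ)} {p : Fin (n + 1) → ℂ} {Λ μ : Fin n → ℚ}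
  {Φ Φ' Φs : (Fin (n + 1) → ℂ) → CoordSpace n} {Ψ Ψ' Ψs : GraphSpace n → ℝ} {P P' Q Ps : ZPoly n}
  {F : CoordSpace n → CoordSpace n}

/-- The variables `z_i`, `z̄_i` with `h ≤ i`. -/
def tailSet (n h : ℕ) : Set (Fin n ⊕ Fin n) := {o | h ≤ (Sum.elim id id o : Fin n).val}

/-- The variables `z_i` with `h ≤ i`. -/
def tailVars (n h : ℕ) : Set (Fin n) := {i | h ≤ i.val}

lemma inl_mem_tailSet {h : ℕ} {i : Fin n} : Sum.inl i ∈ tailSet n h ↔ h ≤ i.val := Iff.rfl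

lemma inr_mem_tailSet {h : ℕ} {i : Fin n} : Sum.inr i ∈ tailSet n h ↔ h ≤ i.val := Iff.rfl

lemma mem_tailVars {h : ℕ} {i : Fin n} : i ∈ tailVars n h ↔ h ≤ i.val := Iff.rfl

lemma kill_tailSet_tailSet {h h' : ℕ} (hh : h' ≤ h) (P : ZPoly n) :
    kill (tailSet n h') (kill (tailSet n h) P) = kill (tailSet n h') P := by
  rw [kill_kill, Set.union_eq_self_of_subset_right]
  exact fun o ho => le_trans hh ho

lemma noPluriharmonic_of_real (h : ∀ z, (P.value z).im = 0) (h' : kill (inrSet n) P = 0) :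
    NoPluriharmonic P := by
  refine noPluriharmonic_iff.2 ⟨h', ?_⟩
  have h1 : holPart P = 0 := rename_injective _ Sum.inl_injective (by
    rw [map_zero]; exact (holPoly_holPart P).trans h')
  rw [← antiPoly_holPart h, h1]
  simp [antiPoly, conjPoly]

lemma wlen_eq_head_add (d : ℕ) (α β : Fin n → ℕ) :
    wlen Λ α β = headLength Λ d α β +
      ∑ i ∈ Finset.univ.filter (fun i : Fin n => n ≤ (i : ℕ) + d), ((α i : ℚ) + β i) * Λ i := by
  rw [wlen, ← Finset.sum_filter_add_sum_filter_not _ (fun i : Fin n => (i : ℕ) + d < n), headLength]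
  simp only [not_lt]

lemma tailDegree_eq_zero_iff {d : ℕ} {α β : Fin n → ℕ} :
    tailDegree d α β = 0 ↔ ∀ i : Fin n, n ≤ (i : ℕ) + d → α i = 0 ∧ β i = 0 := by
  rw [tailDegree, Finset.sum_eq_zero_iff_of_nonneg fun i _ => by positivity]
  simp only [Finset.mem_filter, Finset.mem_univ, true_and]
  refine forall_congr' fun i => imp_congr_right fun _ => ?_
  rw [add_eq_zero_iff_of_nonneg (by positivity) (by positivity)]
  simp

lemma wlen_eq_head_of_tailDegree {d : ℕ} {α β : Fin n → ℕ} (h : tailDegree d α β = 0) :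
    wlen Λ α β = headLength Λ d α β := by
  rw [wlen_eq_head_add d, add_eq_left]
  refine Finset.sum_eq_zero fun i hi => ?_
  obtain ⟨h1, h2⟩ := tailDegree_eq_zero_iff.1 h i (Finset.mem_filter.1 hi).2
  simp [h1, h2]

/-- In coordinates adapted to the minimal weight no variable can be removed from a truncated leading
polynomial. -/
lemma IsMinimalSystem.false_of_absent (h : IsMinimalSystem M p μ Φs Ψs Ps) (hc : IsCoord M p Φ Ψ)
    (hP : IsLeading μ Ψ P) (hn : NoPluriharmonic P) {q : Fin n} (hq : ∀ j, q < j → μ j < μ q)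
    (hne : kill (tailSet n (q + 1)) P ≠ 0)
    (habs : pderiv (Sum.inl q) (kill (tailSet n (q + 1)) P) = 0) : False := by
  classical
  have hμ0 : ∀ i, 0 ≤ μ i := fun i => (h.pos i).le
  have hΨ := hc.isGraphFun
  have hreal := hP.value_im h.pos hΨ
  -- As `P` is real, absence of `z_q` from the truncation also gives absence of `z̄_q`. So monomials
  -- without variables beyond `q` have none from `q` on.
  have habs' : ∀ m, coeff m P ≠ 0 → (∀ o ∈ tailSet n (q + 1), m o = 0) →
      ∀ o ∈ tailSet n q, m o = 0 := by
    have hl : ∀ m, coeff m P ≠ 0 → (∀ o ∈ tailSet n (q + 1), m o = 0) → m (Sum.inl q) = 0 :=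
      fun m hm hm' => pderiv_eq_zero_iff.1 habs m (by rwa [coeff_kill_of_forall hm'])
    have hs : Function.Injective (Sum.swap : Fin n ⊕ Fin n → Fin n ⊕ Fin n) :=
      (Equiv.sumComm _ _).injective
    intro m hm hm' o ho
    by_cases ho' : o ∈ tailSet n (q + 1)
    · exact hm' o ho'
    rcases o with i | i
    · have hi : i = q := by
        rw [inl_mem_tailSet] at ho ho'; exact Fin.ext (by omega)
      rw [hi]; exact hl m hm hm'
    · have hi : i = q := by
        rw [inr_mem_tailSet] at ho ho'; exact Fin.ext (by omega)
      have h1 := hl (m.mapDomain Sum.swap) (by rw [coeff_conj_swap hreal]; simpa using hm) (by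
        intro o ho
        have h2 := Finsupp.mapDomain_apply hs m (Sum.swap o)
        rw [Sum.swap_swap] at h2
        rw [h2]
        refine hm' _ ?_
        rcases o with j | j <;> exact ho)
      have h2 := Finsupp.mapDomain_apply hs m (Sum.inr q)
      rw [hi, ← h2]; exact h1
  set d := n - (q : ℕ) with hd
  have hqn := q.isLt
  have htail : ∀ i : Fin n, n ≤ (i : ℕ) + d ↔ q ≤ i := fun i => by
    rw [Fin.le_def]; omega
  have hhead : ∀ i : Fin n, (i : ℕ) + d < n ↔ i < q := fun i => by
    rw [Fin.lt_def]; omega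
  have hanti := h.isWeight.2.1
  have hge : ∀ α β, taylorCoeff Ψ α β ≠ 0 → 1 ≤ wlen μ α β := fun α β hαβ => by
    by_contra hlt
    exact hαβ (hP.taylorCoeff_eq_zero h.pos hΨ (not_le.1 hlt))
  -- Equality would force the monomial to have weight one and to contain no variable beyond `q`,
  -- where `μ` is strictly smaller. It would then be a monomial of the truncation containing `z_q`
  -- or `z̄_q`.
  have hratio : ∀ α β, taylorCoeff Ψ α β ≠ 0 → headLength μ d α β < 1 → 0 < tailDegree d α β →
      1 < headLength μ d α β + μ q * tailDegree d α β := by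
    intro α β hαβ _ ht
    by_contra hle
    rw [not_lt] at hle
    have h1 := hge α β hαβ
    rw [wlen_eq_head_add d] at h1
    have h2 : ∀ i ∈ Finset.univ.filter (fun i : Fin n => n ≤ (i : ℕ) + d),
        ((α i : ℚ) + β i) * μ i ≤ ((α i : ℚ) + β i) * μ q := fun i hi =>
      mul_le_mul_of_nonneg_left (hanti q i ((htail i).1 (Finset.mem_filter.1 hi).2)) (by positivity)
    have h3 : ∑ i ∈ Finset.univ.filter (fun i : Fin n => n ≤ (i : ℕ) + d), ((α i : ℚ) + β i) * μ q =
        μ q * tailDegree d α β := by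
      rw [tailDegree, Finset.mul_sum]
      exact Finset.sum_congr rfl fun i _ => mul_comm _ _
    have h4 := Finset.sum_le_sum h2
    rw [h3] at h4
    have h5 := (Finset.sum_eq_sum_iff_of_le h2).1 (by rw [h3]; linarith)
    have hw1 : wlen μ α β = 1 := by rw [wlen_eq_head_add d]; linarith
    have hcP := ((isLeading_iff_coeff h.pos hΨ P).1 hP).2 α β hw1.le
    rw [hcP] at hαβ
    have h6 : ∀ i : Fin n, (q : ℕ) + 1 ≤ i → α i = 0 ∧ β i = 0 := by
      intro i hi
      have hqi : q < i := hi
      have h7 := h5 i (Finset.mem_filter.2 ⟨Finset.mem_univ i, (htail i).2 hqi.le⟩)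
      have h8 : ((α i : ℚ) + β i) * (μ q - μ i) = 0 := by linarith
      have h9 := (mul_eq_zero.1 h8).resolve_right (sub_pos.2 (hq i hqi)).ne'
      rw [add_eq_zero_iff_of_nonneg (by positivity) (by positivity)] at h9
      exact_mod_cast h9
    have h7 := habs' _ hαβ (by
      rintro (i | i) hi
      · exact (h6 i hi).1
      · exact (h6 i hi).2)
    refine ht.ne' (tailDegree_eq_zero_iff.2 fun i hi => ?_)
    have hqi : (q : ℕ) ≤ i := (htail i).1 hi
    exact ⟨h7 (Sum.inl i) hqi, h7 (Sum.inr i) hqi⟩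
  -- The strict inequalities leave room to lower the entries from `q` on to a common value `W < μ q`
  -- which still satisfies the arithmetic condition on weights.
  obtain ⟨W, hW0, hWq, hWt, hWmax⟩ : ∃ W, 0 < W ∧ W < μ q ∧ IsWeight (tailWeight μ d W) ∧
      ∀ α β, taylorCoeff Ψ α β ≠ 0 → headLength μ d α β < 1 → 0 < tailDegree d α β →
        1 ≤ headLength μ d α β + W * tailDegree d α β := by
    let Θ : Set ((Fin n → ℕ) × (Fin n → ℕ)) := {γ | taylorCoeff Ψ γ.1 γ.2 ≠ 0 ∧
      headLength μ d γ.1 γ.2 < 1 ∧ 0 < tailDegree d γ.1 γ.2}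
    rcases Θ.eq_empty_or_nonempty with hΘ | hΘ
    -- Without constraining monomials any small reciprocal of an integer will do; the integer
    -- provides the required relation.
    · obtain ⟨K, hK⟩ := exists_nat_gt (1 / μ q)
      have hK0 : (0 : ℚ) < K := (one_div_pos.2 (h.pos q)).trans hK
      have hKq : 1 / (K : ℚ) < μ q := by
        rw [div_lt_iff₀ (h.pos q)] at hK
        rw [div_lt_iff₀ hK0]; linarith
      refine ⟨1 / K, one_div_pos.2 hK0, hKq, isWeight_tailWeight h.isWeight (one_div_pos.2 hK0).le
        (hKq.le.trans (h.isWeight.1 q).2)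
        (fun i hi => hKq.le.trans (hanti i q ((hhead i).1 hi).le)) (a := 0) (t := K)
        (by exact_mod_cast hK0) ?_, fun α β h1 h2 h3 => ?_⟩
      · simp [hK0.ne']
      · exact (Set.notMem_empty (α, β) (hΘ ▸ (⟨h1, h2, h3⟩ : (α, β) ∈ Θ))).elim
    · obtain ⟨W, hW0, ⟨γ, hγ, rfl⟩, hmax⟩ := exists_isGreatest_ratioW h.pos hΘ fun γ hγ => hγ.2
      have hWq : ratioW μ d γ < μ q := by
        rw [ratioW, div_lt_iff₀ hγ.2.2]
        linarith [hratio _ _ hγ.1 hγ.2.1 hγ.2.2]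
      refine ⟨_, hW0, hWq, isWeight_tailWeight_ratioW h.isWeight hγ.2.1.le hγ.2.2
        (hWq.le.trans (h.isWeight.1 q).2)
        (fun i hi => hWq.le.trans (hanti i q ((hhead i).1 hi).le)), fun α β h1 h2 h3 => ?_⟩
      have := hmax ⟨(α, β), ⟨h1, h2, h3⟩, rfl⟩
      rw [ratioW, div_le_iff₀ h3] at this
      linarith
  have hνpos := tailWeight_pos h.pos d hW0
  have hνlead : ∀ α β, wlen (tailWeight μ d W) α β < 1 → taylorCoeff Ψ α β = 0 := by
    intro α β hlt
    by_contra hne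
    rw [wlen_tailWeight] at hlt
    rcases (tailDegree_nonneg d α β).eq_or_lt with h0 | h0
    · rw [← h0, mul_zero, add_zero, ← wlen_eq_head_of_tailDegree h0.symm] at hlt
      exact absurd hlt (not_lt.2 (hge α β hne))
    · have : 0 < W * tailDegree d α β := mul_pos hW0 h0
      exact absurd hlt (not_lt.2 (hWmax α β hne (by linarith) h0))
  obtain ⟨Pν, hPν⟩ := exists_isLeading hνpos hΨ hνlead
  obtain ⟨Φ', Ψ', -, hc', hP'⟩ := exists_change_mixedPart hνpos hWt.lt_one hc hPν
  obtain ⟨m, hm⟩ := ne_zero_iff.1 hne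
  have hmP : coeff m P ≠ 0 := by
    intro h0; rw [coeff_kill] at hm; exact hm (by rw [h0, ite_self])
  have hmq := habs' m hmP fun o ho => eq_zero_of_coeff_kill hm ho
  obtain ⟨hml, hmr⟩ := hn m (mem_support_iff.2 hmP)
  -- A monomial of the truncation involves only head variables, whose weights are unchanged, so it
  -- survives in the new leading polynomial and makes it nonzero.
  have hmν : coeff m (mixedPart Pν) ≠ 0 := by
    rw [coeff_mixedPart hml hmr]
    rw [eq_zexp m] at hmP ⊢
    obtain ⟨hw1, hco⟩ := hP.coeff_eq h.pos hΨ hmP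
    have ht : tailDegree d (fun i => m (Sum.inl i)) (fun i => m (Sum.inr i)) = 0 :=
      tailDegree_eq_zero_iff.2 fun i hi =>
        ⟨hmq (Sum.inl i) ((htail i).1 hi), hmq (Sum.inr i) ((htail i).1 hi)⟩
    have hw2 : wlen (tailWeight μ d W) (fun i => m (Sum.inl i)) (fun i => m (Sum.inr i)) = 1 := by
      rw [wlen_tailWeight, ht, mul_zero, add_zero, ← wlen_eq_head_of_tailDegree ht, hw1]
    rw [← ((isLeading_iff_coeff hνpos hΨ Pν).1 hPν).2 _ _ hw2.le, hco]
    exact hmP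
  have hlex := h.le _ ⟨hWt, Φ', Ψ', hc', mixedPart Pν, fun h0 => hmν (by rw [h0, coeff_zero]),
    noPluriharmonic_mixedPart (coeff_zero_eq_zero hPν.1 one_pos), hP'⟩
  have hle := toLex_le_head hlex (k := q) fun i hi => (tailWeight_head ((hhead i).2 hi)).symm
  rw [tailWeight_tail ((htail q).2 le_rfl)] at hle
  exact absurd hWq (not_lt.2 hle)

end Lower

/-! ### Holomorphic vector fields annihilating a polynomial -/

section VectorFields

open MvPolynomial

variable {n : ℕ} {M : Set (Fin (n + 1) → ℂ)} {p : Fin (n + 1) → ℂ} {Λ μ : Fin n → ℚ}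
  {P Q Ps : ZPoly n} {S : Set (Fin n)} {h : ℕ}

/-- The derivative of `P` along the holomorphic vector field `∑ b_j ∂/∂z_j`. -/
def vf (b : Fin n → MvPolynomial (Fin n) ℂ) (P : ZPoly n) : ZPoly n :=
  ∑ j, holPoly (b j) * pderiv (Sum.inl j) P

/-- The variables `z_i`, `z̄_i` with `i ∈ S`. -/
def bothSet (S : Set (Fin n)) : Set (Fin n ⊕ Fin n) := {o | Sum.elim id id o ∈ S}

lemma inl_mem_bothSet {i : Fin n} : Sum.inl i ∈ bothSet S ↔ i ∈ S := Iff.rfl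

lemma inr_mem_bothSet {i : Fin n} : Sum.inr i ∈ bothSet S ↔ i ∈ S := Iff.rfl

lemma tailSet_eq : tailSet n h = bothSet (tailVars n h) := rfl

lemma kill_bothSet_holPoly (g : MvPolynomial (Fin n) ℂ) :
    kill (bothSet S) (holPoly g) = holPoly (kill S g) := by
  have : (kill (bothSet S)).comp (rename Sum.inl) =
      ((rename Sum.inl).comp (kill S) : MvPolynomial (Fin n) ℂ →ₐ[ℂ] ZPoly n) := by
    refine algHom_ext fun i => ?_
    simp only [AlgHom.comp_apply, rename_X]
    by_cases hi : i ∈ S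
    · rw [kill_X_of_mem (inl_mem_bothSet.2 hi), kill_X_of_mem hi, map_zero]
    · rw [kill_X_of_notMem (mt inl_mem_bothSet.1 hi), kill_X_of_notMem hi, rename_X]
  exact DFunLike.congr_fun this g

lemma kill_conjPoly (g : MvPolynomial (Fin n) ℂ) : kill S (conjPoly g) = conjPoly (kill S g) := by
  classical
  ext m
  simp only [coeff_kill, coeff_map]
  split_ifs <;> simp

lemma kill_bothSet_antiPoly (g : MvPolynomial (Fin n) ℂ) :
    kill (bothSet S) (antiPoly g) = antiPoly (kill S g) := by
  have : (kill (bothSet S)).comp (rename Sum.inr) =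
      ((rename Sum.inr).comp (kill S) : MvPolynomial (Fin n) ℂ →ₐ[ℂ] ZPoly n) := by
    refine algHom_ext fun i => ?_
    simp only [AlgHom.comp_apply, rename_X]
    by_cases hi : i ∈ S
    · rw [kill_X_of_mem (inr_mem_bothSet.2 hi), kill_X_of_mem hi, map_zero]
    · rw [kill_X_of_notMem (mt inr_mem_bothSet.1 hi), kill_X_of_notMem hi, rename_X]
  refine (DFunLike.congr_fun this (conjPoly g)).trans ?_
  rw [AlgHom.comp_apply, kill_conjPoly]

/-- Setting variables to zero commutes with derivatives only in the other variables, hence the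
condition that the field has no components in `S`. -/
lemma kill_vf {b : Fin n → MvPolynomial (Fin n) ℂ} (hb : ∀ j ∈ S, b j = 0) (Q : ZPoly n) :
    kill (bothSet S) (vf b Q) = vf (fun j => kill S (b j)) (kill (bothSet S) Q) := by
  rw [vf, map_sum, vf]
  refine Finset.sum_congr rfl fun j _ => ?_
  by_cases hj : j ∈ S
  · simp [hb j hj]
  · rw [map_mul, kill_bothSet_holPoly, pderiv_kill_of_notMem (mt inl_mem_bothSet.1 hj)]

lemma vf_X_mul (m : Fin n) (b : Fin n → MvPolynomial (Fin n) ℂ) (Q : ZPoly n) :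
    vf (fun j => X m * b j) Q = X (Sum.inl m) * vf b Q := by
  simp only [vf, Finset.mul_sum, map_mul, rename_X, mul_assoc]

lemma vf_C_mul (c : ℂ) (b : Fin n → MvPolynomial (Fin n) ℂ) (Q : ZPoly n) :
    vf (fun j => C c * b j) Q = C c * vf b Q := by
  simp only [vf, Finset.mul_sum, map_mul, rename_C, mul_assoc]

/-- A homogeneous holomorphic vector field of negative weight in the variables `z_j`, `j ∉ T`. -/
structure IsNegField (Λ : Fin n → ℚ) (T : Set (Fin n)) (κ : ℚ)
    (b : Fin n → MvPolynomial (Fin n) ℂ) : Prop where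
  pos : 0 < κ
  hom : ∀ j, (b j).IsWeightedHomogeneous Λ (Λ j - κ)
  zero : ∀ j ∈ T, b j = 0

/-- As long as all coefficients are divisible by `z_m`, divide by it. This makes the weight of the
field more negative, still annihilates `Q` and lowers the degree, so it must stop. -/
lemma IsNegField.exists_kill_ne_zero {T : Set (Fin n)} (hΛ : ∀ i, 0 < Λ i) {m : Fin n}
    (hm : m ∉ S) {j₀ : Fin n} (N : ℕ) : ∀ (κ : ℚ) (b : Fin n → MvPolynomial (Fin n) ℂ),
    IsNegField Λ T κ b → vf b Q = 0 → (∀ j, kill S (b j) = b j) → b j₀ ≠ 0 →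
      (b j₀).totalDegree ≤ N → ∃ κ' b', IsNegField Λ T κ' b' ∧ vf b' Q = 0 ∧
        (∀ j, kill S (b' j) = b' j) ∧ ∃ j, kill {m} (b' j) ≠ 0 := by
  induction N with
  | zero =>
    intro κ b hb hv hk h0 hd
    refine ⟨κ, b, hb, hv, hk, j₀, fun hz => ?_⟩
    obtain ⟨g, hg⟩ := X_dvd_of_kill_eq_zero hz
    have hg0 : g ≠ 0 := by rintro rfl; exact h0 (by rw [hg, mul_zero])
    rw [hg, totalDegree_mul_of_isDomain (X_ne_zero m) hg0, totalDegree_X] at hd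
    omega
  | succ N ih =>
    intro κ b hb hv hk h0 hd
    by_cases hz : ∀ j, kill {m} (b j) = 0
    · choose g hg using fun j => X_dvd_of_kill_eq_zero (hz j)
      have hX : (X m : MvPolynomial (Fin n) ℂ) ≠ 0 := X_ne_zero m
      have hg0 : g j₀ ≠ 0 := by intro h; exact h0 (by rw [hg, h, mul_zero])
      refine ih (κ + Λ m) g ⟨by linarith [hb.pos, hΛ m], fun j => ?_, fun j hj => ?_⟩ ?_
        (fun j => ?_) hg0 ?_
      · rw [← sub_sub]
        exact isWeightedHomogeneous_of_X_mul (by rw [← hg]; exact hb.hom j)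
      · have := hb.zero j hj
        rw [hg] at this
        exact (mul_eq_zero.1 this).resolve_left hX
      · have h1 : vf b Q = X (Sum.inl m) * vf g Q := by
          rw [← vf_X_mul]; congr 1; funext j; exact hg j
        rw [h1] at hv
        exact (mul_eq_zero.1 hv).resolve_left (X_ne_zero _)
      · have := hk j
        rw [hg j, map_mul, kill_X_of_notMem hm] at this
        exact mul_left_cancel₀ hX this
      · rw [hg, totalDegree_mul_of_isDomain hX hg0, totalDegree_X] at hd
        omega
    · push Not at hz
      exact ⟨κ, b, hb, hv, hk, hz⟩

/-- No nonzero vector field of negative weight in the first `h` variables annihilates the part of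
`Ps` in these variables. -/
def RigidAt (μ : Fin n → ℚ) (Ps : ZPoly n) (h : ℕ) : Prop :=
  ∀ κ b, IsNegField μ (tailVars n h) κ b → (∀ j, kill (tailVars n h) (b j) = b j) →
    vf b (kill (tailSet n h) Ps) = 0 → ∀ j, b j = 0

/-- Rigidity persists for vector fields with coefficients depending on all variables. -/
lemma RigidAt.eq_zero (hR : RigidAt μ Ps h) (hΛ : ∀ i, 0 < Λ i) (hμ : ∀ i : Fin n, i.val < h → Λ i = μ i)
    (hQ : kill (tailSet n h) Q = kill (tailSet n h) Ps) {κ : ℚ}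
    {b : Fin n → MvPolynomial (Fin n) ℂ} (hb : IsNegField Λ (tailVars n h) κ b) (hv : vf b Q = 0)
    (j : Fin n) : b j = 0 := by
  classical
  by_contra hj
  -- The tail variables are eliminated one at a time: divide by powers of `z_m` until the field does
  -- not vanish on `z_m = 0`, then restrict to it. Restriction is harmless because the field has no
  -- component in `z_m`.
  have key : ∀ s : Finset (Fin n), (s : Set (Fin n)) ⊆ tailVars n h → ∃ κ b Q',
      IsNegField Λ (tailVars n h) κ b ∧ vf b Q' = 0 ∧ (∀ j, kill (s : Set (Fin n)) (b j) = b j) ∧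
      (∃ j, b j ≠ 0) ∧ kill (tailSet n h) Q' = kill (tailSet n h) Ps := by
    intro s
    induction s using Finset.induction_on with
    | empty =>
      exact fun _ => ⟨κ, b, Q, hb, hv, fun j => kill_eq_self_iff.2 (by simp), ⟨j, hj⟩, hQ⟩
    | insert m s hms ih =>
      intro hs
      rw [Finset.coe_insert, Set.insert_subset_iff] at hs
      obtain ⟨κ₁, b₁, Q₁, hb₁, hv₁, hk₁, ⟨j₁, hj₁⟩, hQ₁⟩ := ih hs.2
      obtain ⟨κ₂, b₂, hb₂, hv₂, hk₂, hj₂⟩ := IsNegField.exists_kill_ne_zero hΛ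
        (m := m) (by simpa using hms) _ κ₁ b₁ hb₁ hv₁ hk₁ hj₁ le_rfl
      refine ⟨κ₂, fun j => kill {m} (b₂ j), kill (bothSet {m}) Q₁, ⟨hb₂.pos, fun j =>
        isWeightedHomogeneous_kill (hb₂.hom j), fun j hj => by rw [hb₂.zero j hj, map_zero]⟩,
        ?_, fun j => ?_, hj₂, ?_⟩
      · rw [← kill_vf, hv₂, map_zero]
        rintro _ rfl
        exact hb₂.zero _ hs.1
      · have h1 : kill ({m} : Set (Fin n)) (b₂ j) = kill {m} (kill (s : Set (Fin n)) (b₂ j)) := by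
          rw [hk₂]
        change kill ((insert m s : Finset (Fin n)) : Set (Fin n)) (kill {m} (b₂ j)) =
          kill {m} (b₂ j)
        conv_rhs => rw [h1, kill_kill]
        rw [kill_kill, Finset.coe_insert]
        congr 2
        ext x; simp
      · rw [← hQ₁, kill_kill, Set.union_eq_self_of_subset_right]
        intro o ho
        have ho' : Sum.elim id id o = m := ho
        rw [tailSet_eq]
        change Sum.elim id id o ∈ tailVars n h
        rw [ho']; exact hs.1
  obtain ⟨κ', b', Q', hb', hv', hk', ⟨j', hj'⟩, hQ'⟩ :=
    key (Finset.univ.filter (· ∈ tailVars n h)) (by intro x; simp)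
  have hs : ((Finset.univ.filter (· ∈ tailVars n h) : Finset (Fin n)) : Set (Fin n)) =
      tailVars n h := by ext; simp
  rw [hs] at hk'
  refine hj' (hR κ' b' ⟨hb'.pos, fun j => ?_, hb'.zero⟩ hk' ?_ j')
  · by_cases hjt : j ∈ tailVars n h
    · rw [hb'.zero j hjt]; exact isWeightedHomogeneous_zero _ _ _
    · intro d hd
      rw [← hμ j (not_le.1 hjt), ← hb'.hom j hd, weight_eq_sum, weight_eq_sum]
      refine Finset.sum_congr rfl fun i _ => ?_
      by_cases hi : i ∈ tailVars n h
      · rw [kill_eq_self_iff.1 (hk' j) d hd i hi]; simp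
      · rw [hμ i (not_le.1 hi)]
  · rw [← hQ', tailSet_eq]
    have := kill_vf hb'.zero Q'
    simp only [hk'] at this
    rw [← this, hv', map_zero]

end VectorFields

/-! ### Polynomial flows -/

section Flow

open MvPolynomial

variable {n : ℕ} {μ : Fin n → ℚ}

/-- The antiderivative in `z_q` vanishing for `z_q = 0`. The explicit coefficients show that
homogeneity is kept and give the constant term of `g`. -/
lemma exists_antideriv {σ : Type*} (q : σ) (f : MvPolynomial σ ℂ) : ∃ g : MvPolynomial σ ℂ,
    (∀ m, coeff m g = coeff m f / (m q + 1)) ∧ pderiv q (X q * g) = f := by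
  classical
  have h1 : ∀ m, coeff m (∑ d ∈ f.support, monomial d (coeff d f / (d q + 1))) =
      coeff m f / (m q + 1) := by
    intro m
    rw [coeff_sum]
    simp only [coeff_monomial]
    rw [Finset.sum_ite_eq']
    split_ifs with hm
    · rfl
    · rw [notMem_support_iff.1 hm, zero_div]
  refine ⟨_, h1, ?_⟩
  ext m
  rw [coeff_pderiv, mul_comm (X q), coeff_mul_X, h1, div_mul_cancel₀]
  exact Nat.cast_add_one_ne_zero _

lemma aeval_congr_of_kill {σ τ : Type*} {S : Set σ} {f : MvPolynomial σ ℂ} (hf : kill S f = f)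
    {A B : σ → MvPolynomial τ ℂ} (h : ∀ i ∉ S, A i = B i) : aeval A f = aeval B f := by
  classical
  have : (aeval A).comp (kill S) = (aeval B).comp (kill S) := by
    refine algHom_ext fun i => ?_
    by_cases hi : i ∈ S
    · simp only [AlgHom.comp_apply, kill_X_of_mem hi, map_zero]
    · simp only [AlgHom.comp_apply, kill_X_of_notMem hi, aeval_X, h i hi]
  have h2 := DFunLike.congr_fun this f
  simpa only [AlgHom.comp_apply, hf] using h2

/-- The flow of a triangular polynomial vector field, with `z_q` as time. -/
lemma exists_flow {q : Fin n} {b : Fin n → MvPolynomial (Fin n) ℂ}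
    (hb : ∀ j, (b j).IsWeightedHomogeneous μ (μ j - μ q)) (htri : ∀ j, kill (Set.Iic j) (b j) = b j)
    (a : Fin n → MvPolynomial (Fin n) ℂ) (ha : ∀ j, (a j).IsWeightedHomogeneous μ (μ j))
    (ha' : ∀ j, pderiv q (a j) = 0) :
    ∃ g : Fin n → MvPolynomial (Fin n) ℂ, ∀ j,
      (a j + X q * g j).IsWeightedHomogeneous μ (μ j) ∧
      pderiv q (a j + X q * g j) = aeval (fun i => a i + X q * g i) (b j) ∧
      coeff 0 (g j) = coeff 0 (aeval (fun i => a i + X q * g i) (b j)) := by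
  classical
  -- The coefficient `b j` involves only variables beyond `j`, so the equations are solved by
  -- antidifferentiation from the last component to the first. After `k` rounds the last `k`
  -- components are known.
  have key : ∀ k : ℕ, ∃ g : Fin n → MvPolynomial (Fin n) ℂ, ∀ j : Fin n, n ≤ j.val + k →
      (a j + X q * g j).IsWeightedHomogeneous μ (μ j) ∧
      pderiv q (a j + X q * g j) = aeval (fun i => a i + X q * g i) (b j) ∧
      coeff 0 (g j) = coeff 0 (aeval (fun i => a i + X q * g i) (b j)) := by
    intro k
    induction k with
    | zero => exact ⟨0, fun j hj => by have := j.isLt; omega⟩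
    | succ k ih =>
      obtain ⟨g, hg⟩ := ih
      by_cases hk : n ≤ k
      · exact ⟨g, fun j _ => hg j (by omega)⟩
      have hlt : n - (k + 1) < n := by omega
      set l : Fin n := ⟨n - (k + 1), hlt⟩ with hl
      obtain ⟨f, hf1, hf2⟩ := exists_antideriv q (aeval (fun i => a i + X q * g i) (b l))
      have hcongr : ∀ j, n ≤ j.val + (k + 1) →
          aeval (fun i => a i + X q * Function.update g l f i) (b j) =
            aeval (fun i => a i + X q * g i) (b j) := by
        intro j hj
        refine aeval_congr_of_kill (htri j) fun i hi => ?_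
        have hji : j < i := not_le.1 hi
        have : i ≠ l := by
          rintro rfl
          have : j.val < n - (k + 1) := hji
          omega
        rw [Function.update_of_ne this]
      have hhom : (aeval (fun i => a i + X q * g i) (b l)).IsWeightedHomogeneous μ (μ l - μ q) := by
        rw [aeval_congr_of_kill (htri l) (B := fun i => if l < i then a i + X q * g i else 0)
          fun i hi => (if_pos (not_le.1 hi)).symm]
        refine isWeightedHomogeneous_aeval (fun i => ?_) (hb l)
        by_cases hi : l < i
        · simp only [if_pos hi]
          have : n - (k + 1) < i.val := hi
          exact (hg i (by omega)).1
        · simp only [if_neg hi]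
          exact isWeightedHomogeneous_zero _ _ _
      refine ⟨Function.update g l f, fun j hj => ?_⟩
      rw [hcongr j hj]
      by_cases hjl : j = l
      · rw [hjl, Function.update_self]
        refine ⟨(ha l).add ?_, by rw [map_add, ha', zero_add, hf2], by rw [hf1]; simp⟩
        have h1 : f.IsWeightedHomogeneous μ (μ l - μ q) := by
          intro m hm
          refine hhom fun h0 => hm ?_
          rw [hf1, h0, zero_div]
        have h2 := (isWeightedHomogeneous_X ℂ μ q).mul h1
        rwa [add_sub_cancel] at h2
      · rw [Function.update_of_ne hjl]
        refine hg j ?_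
        have : j.val ≠ n - (k + 1) := fun h => hjl (Fin.ext h)
        omega
  obtain ⟨g, hg⟩ := key n
  exact ⟨g, fun j => hg j (by omega)⟩

end Flow

/-! ### Pull-backs under polynomial maps: homogeneity, composition, derivatives and truncation. -/

section PullCalculus

open MvPolynomial

variable {n : ℕ} {Λ μ : Fin n → ℚ} {S : Set (Fin n)} {h : ℕ} {A B : Fin n → MvPolynomial (Fin n) ℂ}

lemma isWeightedHomogeneous_toZ {ρ : ℚ} {f : HPoly n} (hf : f.IsWeightedHomogeneous (hw Λ) ρ) :
    (toZ f).IsWeightedHomogeneous Λ ρ := by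
  refine isWeightedHomogeneous_aeval (fun o => ?_) hf
  rcases o with _ | i
  · exact isWeightedHomogeneous_zero _ _ _
  · exact isWeightedHomogeneous_X ℂ Λ i

lemma isWeightedHomogeneous_rename_some {ρ : ℚ} {f : MvPolynomial (Fin n) ℂ}
    (hf : f.IsWeightedHomogeneous Λ ρ) : (rename some f : HPoly n).IsWeightedHomogeneous (hw Λ) ρ := by
  have h : (rename some : MvPolynomial (Fin n) ℂ →ₐ[ℂ] HPoly n) = aeval fun i => X (some i) :=
    algHom_ext fun i => by simp
  rw [h]
  exact isWeightedHomogeneous_aeval (fun i => isWeightedHomogeneous_X ℂ (hw Λ) (some i)) hf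

lemma pull_holPoly (A : Fin n → MvPolynomial (Fin n) ℂ) (g : MvPolynomial (Fin n) ℂ) :
    pull A (holPoly g) = holPoly (aeval A g) := by
  have : (pull A).comp (rename Sum.inl) =
      ((rename Sum.inl).comp (aeval A) : MvPolynomial (Fin n) ℂ →ₐ[ℂ] ZPoly n) := by
    refine algHom_ext fun i => ?_
    simp [pull]
  exact DFunLike.congr_fun this g

lemma pull_pull (A B : Fin n → MvPolynomial (Fin n) ℂ) (Q : ZPoly n) :
    pull B (pull A Q) = pull (fun i => aeval B (A i)) Q := by
  refine ZPoly.value_injective fun z => ?_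
  rw [value_pull, value_pull, value_pull]
  congr 1
  funext i
  rw [← aeval_eq_eval, ← aeval_eq_eval, ← comp_aeval_apply]

lemma pderiv_inl_holPoly (g : MvPolynomial (Fin n) ℂ) (i : Fin n) :
    pderiv (Sum.inl i) (holPoly g) = holPoly (pderiv i g) :=
  pderiv_rename Sum.inl_injective _ _

lemma pderiv_inl_antiPoly (g : MvPolynomial (Fin n) ℂ) (i : Fin n) :
    pderiv (Sum.inl i) (antiPoly g) = 0 := by
  have h1 : kill ({Sum.inl i} : Set (Fin n ⊕ Fin n)) (antiPoly g) = antiPoly g := by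
    have : (kill ({Sum.inl i} : Set (Fin n ⊕ Fin n))).comp (rename Sum.inr) =
        (rename Sum.inr : MvPolynomial (Fin n) ℂ →ₐ[ℂ] ZPoly n) := by
      refine algHom_ext fun j => ?_
      simp only [AlgHom.comp_apply, rename_X]
      exact kill_X_of_notMem (by simp)
    exact DFunLike.congr_fun this (conjPoly g)
  exact pderiv_eq_zero_of_kill_eq h1 rfl

lemma pderiv_inl_pull (A : Fin n → MvPolynomial (Fin n) ℂ) (Q : ZPoly n) (i : Fin n) :
    pderiv (Sum.inl i) (pull A Q) =
      ∑ j, pull A (pderiv (Sum.inl j) Q) * holPoly (pderiv i (A j)) := by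
  rw [pull, pderiv_aeval, Fintype.sum_sum_type]
  simp only [Sum.elim_inl, Sum.elim_inr, pderiv_inl_holPoly, pderiv_inl_antiPoly, mul_zero,
    Finset.sum_const_zero, add_zero]

/-- The hypothesis says that the map preserves the coordinate subspace where the variables in `S`
vanish, so restricting to it commutes with pulling back. -/
lemma kill_pull (hA : ∀ j ∈ S, kill S (A j) = 0) (Q : ZPoly n) :
    kill (bothSet S) (pull A Q) = pull (fun j => kill S (A j)) (kill (bothSet S) Q) := by
  have : (kill (bothSet S)).comp (pull A) =
      (pull fun j => kill S (A j)).comp (kill (bothSet S)) := by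
    refine algHom_ext fun o => ?_
    rcases o with i | i
    · simp only [AlgHom.comp_apply, pull, aeval_X, Sum.elim_inl, kill_bothSet_holPoly]
      by_cases hi : i ∈ S
      · rw [kill_X_of_mem (inl_mem_bothSet.2 hi), map_zero, hA i hi]
        exact map_zero _
      · rw [kill_X_of_notMem (mt inl_mem_bothSet.1 hi), aeval_X, Sum.elim_inl]
    · simp only [AlgHom.comp_apply, pull, aeval_X, Sum.elim_inr, kill_bothSet_antiPoly]
      by_cases hi : i ∈ S
      · rw [kill_X_of_mem (inr_mem_bothSet.2 hi), map_zero, hA i hi]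
        simp [antiPoly, conjPoly]
      · rw [kill_X_of_notMem (mt inr_mem_bothSet.1 hi), aeval_X, Sum.elim_inr]
  exact DFunLike.congr_fun this Q

/-- The weight of `g` is too small for a monomial in head variables alone, and positive weight
excludes a constant. So each monomial contains a tail variable. -/
lemma kill_tailVars_eq_zero (hΛ : ∀ i, 0 < Λ i) {j : Fin n} (hj : ∀ i : Fin n, i.val < h → Λ j < Λ i)
    {g : MvPolynomial (Fin n) ℂ} (hg : g.IsWeightedHomogeneous Λ (Λ j)) :
    kill (tailVars n h) g = 0 := by
  ext m
  rw [coeff_zero]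
  by_contra hm
  have h1 := isWeightedHomogeneous_kill hg hm
  have hm0 : m ≠ 0 := by
    rintro rfl
    rw [map_zero] at h1
    exact (hΛ j).ne h1
  obtain ⟨i, hi⟩ := Finsupp.ne_iff.1 hm0
  have hlt : i.val < h := by
    by_contra hle
    exact hi (eq_zero_of_coeff_kill hm (mem_tailVars.2 (not_lt.1 hle)))
  have := le_weight_of_ne_zero (fun i => (hΛ i).le) hi
  rw [h1] at this
  exact absurd (hj i hlt) (not_lt.2 this)

end PullCalculus

/-! ### Rigidity of the leading polynomial of minimal weight -/

section Rigidity

open MvPolynomial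

variable {n : ℕ} {M : Set (Fin (n + 1) → ℂ)} {p : Fin (n + 1) → ℂ} {Λ μ : Fin n → ℚ}
  {Φ Φ' Φs : (Fin (n + 1) → ℂ) → CoordSpace n} {Ψ Ψ' Ψs : GraphSpace n → ℝ} {P P' Q Ps : ZPoly n}
  {F : CoordSpace n → CoordSpace n} {h : ℕ}

/-- The first `h` entries of `μ` are larger than the others. -/
def IsBreak (μ : Fin n → ℚ) (h : ℕ) : Prop :=
  ∀ i j : Fin n, i.val < h → h ≤ j.val → μ j < μ i

/-- By `IsMinimalSystem.initial` the part of `Ps` in the variables of weight `1 / m` is already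
nonzero; as `1 / m` bounds all entries and is attained, these variables precede every drop of `μ`.
-/
lemma IsMinimalSystem.kill_tailSet_ne_zero (hs : IsMinimalSystem M p μ Φs Ψs Ps)
    (hh : IsBreak μ h) (h0 : 0 < h) : kill (tailSet n h) Ps ≠ 0 := by
  obtain ⟨m, Φ', Ψ', hm, hc, P, hP0, hn, hP⟩ := hs.exists_initial
  obtain ⟨-, hle, -, ⟨i₀, -⟩, hne⟩ := hs.initial hc hP0 hn hm hP
  intro hz
  refine hne ?_
  have hsub : tailSet n h ⊆ {o | μ (Sum.elim id id o) ≠ 1 / (m : ℚ)} := by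
    intro o ho
    have h1 := hh ⟨0, i₀.pos⟩ _ h0 ho
    exact (h1.trans_le (hle _)).ne
  rw [← Set.union_eq_self_of_subset_right hsub, ← kill_kill, hz, map_zero]

/-- A polynomial change of coordinates `z = H(z*)`, `w = w*` with invertible linear part. -/
lemma IsMinimalSystem.exists_straighten (hs : IsMinimalSystem M p μ Φs Ψs Ps)
    {H : Fin n → MvPolynomial (Fin n) ℂ} (hH : ∀ j, (H j).IsWeightedHomogeneous μ (μ j))
    (hlin : ∀ v : Fin n → ℂ, (∀ j, ∑ i, coeff (Finsupp.single i 1) (H j) * v i = 0) → v = 0) :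
    ∃ Φ Ψ, IsCoord M p Φ Ψ ∧ IsLeading μ Ψ (pull H Ps) ∧ NoPluriharmonic (pull H Ps) ∧
      ∀ h, IsBreak μ h → 0 < h → kill (tailSet n h) (pull H Ps) ≠ 0 := by
  classical
  set q : Option (Fin n) → HPoly n := fun o => o.elim (X none) fun i => rename some (H i) with hq
  have hqhom : IsHomMap μ q := by
    rintro (_ | i)
    · exact isWeightedHomogeneous_X ℂ (hw μ) none
    · exact isWeightedHomogeneous_rename_some (hH i)
  have hHsnd : ∀ x, (polyMap q x).2 = x.2 := fun x => by
    have := hcoord_polyMap q x none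
    simpa [hq, hcoord] using this
  have hgerm : IsGermIso (polyMap q) := by
    refine ⟨analyticAt_polyMap q 0, polyMap_zero hqhom hs.pos, isInvertible_of_injective fun v hv => ?_⟩
    have h1 : ∀ o, ∑ o', coeff (Finsupp.single o' 1) (q o) * hcoord v o' = 0 := fun o => by
      rw [← fderiv_eval_hcoord_zero]
      simp only [← hcoord_polyMap]
      rw [← hcoord_fderiv (analyticAt_polyMap q 0).differentiableAt, hv, hcoord_zero]
      rfl
    have h2 : v.2 = 0 := by
      have := h1 none
      rw [Fintype.sum_option] at this
      simpa [hq, coeff_X, Finsupp.single_left_inj, hcoord] using this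
    have h3 : v.1 = 0 := hlin _ fun j => by
      have := h1 (some j)
      rw [Fintype.sum_option] at this
      have h4 : hcoord v none = 0 := h2
      rw [h4, mul_zero, zero_add] at this
      rw [← this]
      refine Finset.sum_congr rfl fun i _ => ?_
      congr 1
      have := coeff_rename_mapDomain some (Option.some_injective (Fin n)) (H j) (Finsupp.single i 1)
      rw [Finsupp.mapDomain_single] at this
      exact this.symm
    exact Prod.ext h3 h2
  have hsup := isSuperHom_polyMap hs.pos hqhom
  -- The new coordinates are obtained from `Φs` by the inverse of the given map, so that the leading
  -- polynomial becomes the pull-back of `Ps`.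
  obtain ⟨E, hE, hEH, hHE⟩ := hgerm.exists_inverse
  have hEsnd : ∀ᶠ x in 𝓝 0, (E x).2 = x.2 := by
    filter_upwards [hHE] with x hx
    rw [← hHsnd, hx]
  have hEd : ∀ v, (fderiv ℂ E 0 v).2 = ((1 : ℝ) : ℂ) * v.2 := fun v => by
    have h1 := hcoord_fderiv hE.analyticAt.differentiableAt v none
    have h2 : (fun x => hcoord (E x) none) =ᶠ[𝓝 0] fun x => hcoord x none := hEsnd
    rw [h2.fderiv_eq, (hasFDerivAt_hcoord none 0).fderiv] at h1
    rw [Complex.ofReal_one, one_mul]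
    exact h1.trans (hcoordL_apply none v)
  obtain ⟨Ψ, hc⟩ := exists_graph hs.isCoord hE hEd
  have hT1 := hs.isCoord.isTransition hc hE (Eventually.of_forall fun _ => rfl)
  have hT2 : IsTransition Ψ Ψs (polyMap q) :=
    hc.isTransition hs.isCoord hgerm (hs.isCoord.tendsto.eventually hHE)
  obtain ⟨r, hr⟩ := exists_isSuperHom_inverse hgerm hsup hE hEH
  have hμ1 := hs.isWeight.lt_one
  obtain ⟨P', hP'⟩ := hT1.exists_isLeading hs.isCoord.isGraphFun hc.isGraphFun hs.isLeading hμ1 hr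
  obtain ⟨c, -, hc1, hrel⟩ := hT2.exists_pull_eq hc.isGraphFun hs.isCoord.isGraphFun hP'
    hs.isLeading hμ1 hsup
  have hpull : pull H Ps = P' := by
    have h1 : (c : ℂ) = 1 := by rw [← hc1]; simp [hq]
    have h2 : toZ (q none) = 0 := by simp [hq, toZ]
    have h3 : (fun i => toZ (q (some i))) = H := funext fun i => by
      simp only [hq, Option.elim_some, toZ_rename]
    rw [h1, h2, h3, imPoly_zero, map_one, one_mul, add_zero] at hrel
    exact hrel
  have hn : NoPluriharmonic P' := by
    refine noPluriharmonic_of_real (hP'.value_im hs.pos hc.isGraphFun) ?_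
    rw [← hpull]
    exact pull_noPluriharmonic_inr (fun i => by
      rw [constantCoeff_eq]; exact coeff_zero_eq_zero (hH i) (hs.pos i)) hs.noPluriharmonic
  rw [hpull]
  -- At a drop of the weights homogeneous maps preserve the subspace where the tail vanishes. A zero
  -- truncation of the pull-back would therefore give a zero truncation of `Ps`.
  refine ⟨_, Ψ, hc, hP', hn, fun h hh h0 hz => hs.kill_tailSet_ne_zero hh h0 ?_⟩
  obtain ⟨c', hc0, -, hrel'⟩ := hT1.exists_pull_eq_of_noPluriharmonic hs.isCoord.isGraphFun
    hc.isGraphFun hs.isLeading hP' hμ1 hr hs.noPluriharmonic hn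
  have h1 := congrArg (kill (bothSet (tailVars n h))) hrel'
  rw [kill_pull (S := tailVars n h) fun j hj => kill_tailVars_eq_zero hs.pos (fun i hi => hh i j hi hj)
    (isWeightedHomogeneous_toZ (hr (some j)).1), ← tailSet_eq, hz, map_zero, map_mul] at h1
  refine (mul_eq_zero.1 h1.symm).resolve_left ?_
  rw [← algebraMap_eq, AlgHom.commutes, algebraMap_eq, C_eq_zero]
  exact_mod_cast hc0

/-- Induction over the blocks of equal entries of `μ`. A field with a component in the last block
can be straightened to `∂/∂z_q`, which would make `z_q` absent; a field without such a component
belongs to an earlier drop. -/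
lemma IsMinimalSystem.rigidAt (hs : IsMinimalSystem M p μ Φs Ψs Ps) (h : ℕ) (hhn : h ≤ n)
    (hh : IsBreak μ h) : RigidAt μ Ps h := by
  classical
  induction h using Nat.strong_induction_on with
  | _ h ih =>
  intro κ b hb hk hv
  rcases Nat.eq_zero_or_pos h with rfl | h0
  · exact fun j => hb.zero j (Nat.zero_le _)
  set q : Fin n := ⟨h - 1, by omega⟩ with hq
  have hq1 : (q : ℕ) + 1 = h := by simp [hq]; omega
  have hanti := hs.isWeight.2.1
  -- The least such `h'` is the start of the block of entries equal to `μ q`; it is again a drop, or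
  -- zero.
  have hex : ∃ h', ∀ i : Fin n, h' ≤ i.val → μ i ≤ μ q :=
    ⟨q, fun i hi => hanti q i hi⟩
  set h' := Nat.find hex with hh'
  have h'spec : ∀ i : Fin n, h' ≤ i.val → μ i ≤ μ q := Nat.find_spec hex
  have h'le : h' ≤ q := Nat.find_min' hex fun i hi => hanti q i hi
  have h'lt : ∀ i : Fin n, i.val < h' → μ q < μ i := by
    intro i hi
    by_contra hle
    exact Nat.find_min hex hi fun j hj => (hanti i j hj).trans (not_lt.1 hle)
  have hbr : IsBreak μ h' := fun i j hi hj => (h'spec j hj).trans_lt (h'lt i hi)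
  have hbl : ∀ j : Fin n, h' ≤ j.val → j.val < h → μ j = μ q := fun j h1 h2 =>
    le_antisymm (h'spec j h1) (hanti j q (by rw [Fin.le_def]; omega))
  -- If the components in the last block vanish, the coefficients may still depend on the variables
  -- of that block; this is what `RigidAt.eq_zero` allows.
  by_cases hz : ∀ j : Fin n, h' ≤ j.val → b j = 0
  · exact (ih h' (by omega) (by omega) hbr).eq_zero hs.pos (fun _ _ => rfl)
      (kill_tailSet_tailSet (by omega) Ps) ⟨hb.pos, hb.hom, hz⟩ hv
  push Not at hz
  obtain ⟨q₀, hq₀, hne⟩ := hz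
  have hq₀h : q₀.val < h := by
    by_contra hle
    exact hne (hb.zero q₀ (not_lt.1 hle))
  have hge : ∀ i : Fin n, i.val < h → μ q ≤ μ i := fun i hi =>
    hanti i q (by rw [Fin.le_def]; omega)
  -- A component in the last block has weight `μ q - κ`, less than the weight of every variable that
  -- may occur in it. So it is constant, and `κ = μ q`.
  have hmon : ∀ j m, coeff m (b j) ≠ 0 → μ j = μ q → m = 0 ∧ κ = μ q := by
    intro j m hm hj
    have h1 := hb.hom j hm
    have hm0 : m = 0 := by
      by_contra hm0
      obtain ⟨i, hi⟩ := Finsupp.ne_iff.1 hm0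
      have hih : i.val < h := by
        by_contra hle
        exact hi (kill_eq_self_iff.1 (hk j) m hm i (not_lt.1 hle))
      have := le_weight_of_ne_zero (fun i => (hs.pos i).le) hi
      linarith [hge i hih, hb.pos]
    refine ⟨hm0, ?_⟩
    rw [hm0, map_zero] at h1
    linarith
  have hconst : ∀ j, μ j = μ q → b j = C (coeff 0 (b j)) := by
    intro j hj
    ext m
    rw [coeff_C]
    split_ifs with h1
    · rw [h1]
    · by_contra hm
      exact h1 (hmon j m hm hj).1.symm
  have hq₀μ := hbl q₀ hq₀ hq₀h
  obtain ⟨m₀, hm₀⟩ := ne_zero_iff.1 hne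
  obtain ⟨rfl, hκ⟩ := hmon q₀ m₀ hm₀ hq₀μ
  subst hκ
  set c := coeff 0 (b q₀) with hc
  set b' : Fin n → MvPolynomial (Fin n) ℂ := fun j => C c⁻¹ * b j with hb'
  have hb'hom : ∀ j, (b' j).IsWeightedHomogeneous μ (μ j - μ q) := fun j => by
    have := (isWeightedHomogeneous_C μ c⁻¹).mul (hb.hom j)
    rwa [zero_add] at this
  have hb'0 : b' q₀ = 1 := by
    change C c⁻¹ * b q₀ = 1
    rw [hconst q₀ hq₀μ, ← C_mul, inv_mul_cancel₀ hm₀, C_1]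
  have htri : ∀ j, kill (Set.Iic j) (b' j) = b' j := by
    refine fun j => kill_eq_self_iff.2 fun m hm i hi => ?_
    by_contra hi0
    have h1 := le_weight_of_ne_zero (fun i => (hs.pos i).le) hi0
    rw [hb'hom j hm] at h1
    linarith [hanti i j hi, hs.pos q]
  -- Initial values of the flow on the hyperplane `z_{q₀} = 0`, transversal to the field. The
  -- indices `q₀` and `q` are swapped so that time is carried by the last variable `z_q` of the
  -- block; their weights agree.
  set a : Fin n → MvPolynomial (Fin n) ℂ :=
    fun j => if j = q₀ then 0 else X (Equiv.swap q₀ q j) with ha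
  have hsw : ∀ j, μ (Equiv.swap q₀ q j) = μ j := by
    intro j
    rcases eq_or_ne j q₀ with rfl | h1
    · rw [Equiv.swap_apply_left, hq₀μ]
    · rcases eq_or_ne j q with h2 | h2
      · rw [h2, Equiv.swap_apply_right, hq₀μ]
      · rw [Equiv.swap_apply_of_ne_of_ne h1 h2]
  obtain ⟨g, hg⟩ := exists_flow hb'hom htri a (fun j => by
    simp only [ha]
    split_ifs
    · exact isWeightedHomogeneous_zero _ _ _
    · have := isWeightedHomogeneous_X ℂ μ (Equiv.swap q₀ q j)
      rwa [hsw] at this) (fun j => by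
    simp only [ha]
    split_ifs with h1
    · exact map_zero _
    · refine pderiv_X_of_ne fun h2 => h1 ?_
      rw [← Equiv.swap_apply_right q₀ q] at h2
      have h3 := congrArg (Equiv.swap q₀ q) h2
      simpa using h3)
  set H : Fin n → MvPolynomial (Fin n) ℂ := fun j => a j + X q * g j with hH
  have hco : ∀ i j, coeff (Finsupp.single i 1) (H j) = coeff (Finsupp.single i 1) (a j) +
      if i = q then coeff 0 (g j) else 0 := by
    intro i j
    simp only [hH, coeff_add, coeff_X_mul']
    congr 1
    by_cases hi : i = q
    · subst hi; simp
    · simp [hi, Ne.symm hi]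
  obtain ⟨Φ, Ψ, hcΦ, hP, hn, hkn⟩ := hs.exists_straighten (H := H) (fun j => (hg j).1) (by
    -- The component `q₀` has linear part exactly `z_q`, since `b' q₀ = 1`; the other components
    -- supply the remaining variables up to multiples of `z_q`.
    intro v hv
    have hvq : v q = 0 := by
      have h1 := hv q₀
      simp only [hco, ha, if_true, coeff_zero, zero_add, ite_mul, zero_mul, Finset.sum_ite_eq',
        Finset.mem_univ] at h1
      rw [(hg q₀).2.2, hb'0, map_one, coeff_zero_one, one_mul] at h1
      exact h1
    funext i
    by_cases hi : i = q
    · rw [hi]; exact hvq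
    · have h1 := hv (Equiv.swap q₀ q i)
      have h2 : Equiv.swap q₀ q i ≠ q₀ := by
        intro h3
        have := congrArg (Equiv.swap q₀ q) h3
        simp at this
        exact hi this
      simp only [hco, ha, if_neg h2, add_mul, ite_mul, zero_mul, Finset.sum_add_distrib,
        Finset.sum_ite_eq', Finset.mem_univ, if_true, hvq, mul_zero, add_zero,
        Equiv.swap_apply_self, coeff_X, Finsupp.single_left_inj one_ne_zero, one_mul] at h1
      simpa using h1)
  refine (hs.false_of_absent hcΦ hP hn (q := q) (fun j hj => ?_) ?_ ?_).elim
  · refine hh q j (by omega) ?_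
    have : (q : ℕ) < j := hj
    omega
  · rw [hq1]; exact hkn h hh h0
  · have hHk : ∀ j ∈ tailVars n h, kill (tailVars n h) (H j) = 0 := fun j hj =>
      kill_tailVars_eq_zero hs.pos (fun i hi => hh i j hi hj) (hg j).1
    have hqn : q ∉ tailVars n h := by rw [mem_tailVars]; omega
    -- By the chain rule and the flow equation the derivative in `z_q` of the pull-back is the
    -- pull-back of the derivative along `b'`, which is zero.
    rw [hq1, tailSet_eq, kill_pull hHk, pderiv_inl_pull]
    have h1 : ∀ j, pderiv q (kill (tailVars n h) (H j)) =
        aeval (fun i => kill (tailVars n h) (H i)) (b' j) := fun j => by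
      rw [pderiv_kill_of_notMem hqn]
      simp only [hH, (hg j).2.1]
      rw [← AlgHom.comp_apply, comp_aeval]
    simp only [h1, ← pull_holPoly, ← map_mul, ← map_sum]
    have h2 : vf b' (kill (bothSet (tailVars n h)) Ps) = 0 := by
      rw [hb', vf_C_mul, ← tailSet_eq, hv, mul_zero]
    rw [vf] at h2
    simp only [mul_comm (holPoly _)] at h2
    rw [h2, map_zero]

end Rigidity

/-! ### Homogeneous maps into a minimal system -/

section Core

open MvPolynomial

variable {n : ℕ} {M : Set (Fin (n + 1) → ℂ)} {p : Fin (n + 1) → ℂ} {Λ μ : Fin n → ℚ}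
  {hΛ : ∀ i, 0 < Λ i}
  {Φ Φ' Φs : (Fin (n + 1) → ℂ) → CoordSpace n} {Ψ Ψ' Ψs : GraphSpace n → ℝ} {P P' Q Ps : ZPoly n}
  {F G : CoordSpace n → CoordSpace n} {q r : Option (Fin n) → HPoly n} {k : ℕ}

/-- The weight `Λ` agrees with `μ` in the first `k` entries and exceeds it in the others. -/
structure IsAbove (μ Λ : Fin n → ℚ) (k : ℕ) : Prop where
  lt_one : ∀ i, Λ i < 1
  anti : ∀ i j, i ≤ j → Λ j ≤ Λ i
  le : k ≤ n
  eq : ∀ i : Fin n, i.val < k → Λ i = μ i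
  lt : ∀ i : Fin n, k ≤ i.val → μ i < Λ i

lemma IsAbove.ge (h : IsAbove μ Λ k) (i : Fin n) : μ i ≤ Λ i := by
  rcases lt_or_ge i.val k with hi | hi
  · exact (h.eq i hi).ge
  · exact (h.lt i hi).le

lemma IsAbove.isBreak (h : IsAbove μ Λ k) : IsBreak μ k := fun i j hi hj => by
  rw [← h.eq i hi]
  exact (h.lt j hj).trans_le (h.anti i j (by rw [Fin.le_def]; omega))

lemma IsAbove.pos (h : IsAbove μ Λ k) (hs : IsMinimalSystem M p μ Φs Ψs Ps) (i : Fin n) : 0 < Λ i :=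
  (hs.pos i).trans_le (h.ge i)

/-- Monomials of weight one without tail variables keep their weight. A tail variable makes the
weight for `Λ` strictly larger than that for `μ`, hence larger than one. -/
lemma IsMinimalSystem.isLeading_kill (hs : IsMinimalSystem M p μ Φs Ψs Ps) (h : IsAbove μ Λ k) :
    IsLeading Λ Ψs (kill (tailSet n k) Ps) := by
  classical
  have hΨ := hs.isCoord.isGraphFun
  have hlead := (isLeading_iff_coeff hs.pos hΨ Ps).1 hs.isLeading
  refine (isLeading_iff_coeff (h.pos hs) hΨ _).2 ⟨fun m hm => ?_, fun α β hw => ?_⟩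
  · have h1 := isWeightedHomogeneous_kill hlead.1 hm
    rw [← h1, weight_eq_sum, weight_eq_sum]
    refine Finset.sum_congr rfl fun o _ => ?_
    by_cases ho : o ∈ tailSet n k
    · rw [eq_zero_of_coeff_kill hm ho]; simp
    · have ho' : (Sum.elim id id o : Fin n).val < k := not_le.1 ho
      rcases o with i | i <;> simp only [Sum.elim_inl, Sum.elim_inr] <;> rw [h.eq i ho']
  · rw [hlead.2 α β ((wlen_mono h.ge α β).trans hw), coeff_kill]
    split_ifs with h1
    · rfl
    · push Not at h1
      obtain ⟨o, ho, hne⟩ := h1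
      rw [← hlead.2 α β ((wlen_mono h.ge α β).trans hw)]
      refine hs.isLeading.taylorCoeff_eq_zero hs.pos hΨ (lt_of_lt_of_le ?_ hw)
      refine Finset.sum_lt_sum (fun i _ => mul_le_mul_of_nonneg_left (h.ge i) (by positivity))
        ⟨Sum.elim id id o, Finset.mem_univ _, mul_lt_mul_of_pos_left (h.lt _ ho) ?_⟩
      rcases o with i | i
      · have : (0 : ℚ) < α i := by exact_mod_cast Nat.pos_of_ne_zero hne
        simp only [Sum.elim_inl, id]; positivity
      · have : (0 : ℚ) < β i := by exact_mod_cast Nat.pos_of_ne_zero hne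
        simp only [Sum.elim_inr, id]; positivity

lemma noPluriharmonic_kill {S : Set (Fin n ⊕ Fin n)} (h : NoPluriharmonic P) :
    NoPluriharmonic (kill S P) := by
  obtain ⟨h1, h2⟩ := noPluriharmonic_iff.1 h
  exact noPluriharmonic_iff.2 ⟨by rw [kill_comm, h1, map_zero], by rw [kill_comm, h2, map_zero]⟩

lemma eval_hcoord_some (hΛ : ∀ i, 0 < Λ i) (hΛ1 : ∀ i, Λ i < 1) (hq : IsHomMap Λ q) (j : Fin n)
    (x : CoordSpace n) : eval (hcoord x) (q (some j)) = eval x.1 (toZ (q (some j))) := by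
  rw [eval_hcoord_eq hΛ (hq (some j)) (hΛ1 j).le, coeff_none_eq_zero (hq (some j)) (hΛ1 j), zero_mul,
    zero_add]

lemma aeval_toZ_eq_X (hΛ1 : ∀ i, Λ i < 1) (h : IsSuperHom Λ hΛ F q) (hG : IsSuperHom Λ hΛ G r)
    (h' : ∀ᶠ x in 𝓝 0, G (F x) = x) (j : Fin n) :
    aeval (fun i => toZ (q (some i))) (toZ (r (some j))) = X j := by
  refine MvPolynomial.funext fun z => ?_
  have h1 := polyMap_unique h hG h' (z, 0)
  have h2 := congrArg (fun x => hcoord x (some j)) h1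
  simp only [hcoord_polyMap] at h2
  rw [eval_hcoord_some hΛ hΛ1 (fun o => (hG o).1)] at h2
  have h3 : (polyMap q (z, 0)).1 = fun i => eval z (toZ (q (some i))) := by
    funext i
    have := hcoord_polyMap q (z, 0) (some i)
    rw [eval_hcoord_some hΛ hΛ1 (fun o => (h o).1)] at this
    exact this
  rw [h3] at h2
  have h4 : (aeval z).comp (aeval fun i => toZ (q (some i))) =
      (aeval fun i => eval z (toZ (q (some i))) : MvPolynomial (Fin n) ℂ →ₐ[ℂ] ℂ) := by
    rw [comp_aeval]; rfl
  rw [eval_X]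
  exact (DFunLike.congr_fun h4 (toZ (r (some j)))).trans h2

/-- The components of the homogeneous part of a map into a minimal system whose weights are already
minimal do not depend on the variables absent from the leading polynomial. -/
lemma IsMinimalSystem.pderiv_eq_zero (hs : IsMinimalSystem M p μ Φs Ψs Ps) (h : IsAbove μ Λ k)
    (hF : IsTransition Ψ Ψs F) (hΨ : IsGraphFun Ψ) (hP : IsLeading Λ Ψ P)
    (hq : IsSuperHom Λ hΛ F q) {i : Fin n} (hi : pderiv (Sum.inl i) P = 0) {j : Fin n}
    (hj : j.val < k) : pderiv i (toZ (q (some j))) = 0 := by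
  classical
  set Qs := kill (tailSet n k) Ps with hQs
  have hΛ1 := h.lt_one
  obtain ⟨G, hG, hGF, hFG⟩ := hF.toIsGermIso.exists_inverse
  obtain ⟨r, hr⟩ := exists_isSuperHom_inverse hF.toIsGermIso hq hG hGF
  set A : Fin n → MvPolynomial (Fin n) ℂ := fun i => toZ (q (some i)) with hA
  set B : Fin n → MvPolynomial (Fin n) ℂ := fun i => toZ (r (some i)) with hB
  have hBA : ∀ j, aeval B (A j) = X j := aeval_toZ_eq_X hΛ1 hr hq hFG
  have hAB : ∀ j, aeval A (B j) = X j := aeval_toZ_eq_X hΛ1 hq hr hGF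
  obtain ⟨c, -, -, hrel⟩ := hF.exists_pull_eq hΨ hs.isCoord.isGraphFun hP (hs.isLeading_kill h) hΛ1 hq
  set g := toZ (q none) with hg
  have hginr : (Sum.inl i : Fin n ⊕ Fin n) ∉ inrSet n := by simp [inrSet]
  -- Setting `z̄ = 0` in the relation determines `g` from the holomorphic terms of `P`, and these do
  -- not contain `z_i`.
  have hdg : pderiv i g = 0 := by
    have h1 := congrArg (kill (inrSet n)) hrel
    rw [pull_noPluriharmonic_inr (fun i => constantCoeff_toZ (hq (some i)).1 (hΛ i))
      (noPluriharmonic_kill hs.noPluriharmonic), map_add, map_mul,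
      kill_inr_imPoly (constantCoeff_toZ (hq none).1 one_pos)] at h1
    have h2 := congrArg (pderiv (Sum.inl i)) h1
    rw [map_zero, map_add, pderiv_C_mul, pderiv_inl_holPoly, ← map_mul, pderiv_kill_of_notMem hginr,
      pderiv_C_mul, hi, mul_zero, map_zero, zero_add] at h2
    refine eq_zero_of_holPoly ?_
    exact h2.symm
  have hsum : ∑ j, pull A (pderiv (Sum.inl j) Qs) * holPoly (pderiv i (A j)) = 0 := by
    rw [← pderiv_inl_pull, hrel, map_add, pderiv_C_mul, hi, mul_zero, zero_add, imPoly, map_add,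
      pderiv_C_mul, pderiv_C_mul, pderiv_inl_holPoly, pderiv_inl_antiPoly, hdg]
    simp
  -- Composing with the inverse `B` turns the derivative in `z_i` into a holomorphic vector field in
  -- the coordinates of the minimal system which annihilates `Qs`.
  have hsum2 : ∑ j, holPoly (aeval B (pderiv i (A j))) * pderiv (Sum.inl j) Qs = 0 := by
    have h1 := congrArg (pull B) hsum
    simp only [map_sum, map_mul, map_zero, pull_pull, hBA, pull_holPoly] at h1
    have h2 : (pull X : ZPoly n →ₐ[ℂ] ZPoly n) = AlgHom.id ℂ _ := by
      refine algHom_ext fun o => ?_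
      rcases o with l | l <;> simp [pull, antiPoly, conjPoly]
    simp only [h2, AlgHom.id_apply] at h1
    rw [← h1]
    exact Finset.sum_congr rfl fun _ _ => mul_comm _ _
  have hAhom : ∀ j, (A j).IsWeightedHomogeneous Λ (Λ j) := fun j =>
    isWeightedHomogeneous_toZ (hq (some j)).1
  have hBhom : ∀ j, (B j).IsWeightedHomogeneous Λ (Λ j) := fun j =>
    isWeightedHomogeneous_toZ (hr (some j)).1
  -- The transported field has weight `-Λ i`. Its components beyond `k` may be dropped because `Qs`
  -- does not contain these variables.
  have hR := (hs.rigidAt k h.le h.isBreak).eq_zero (Q := Qs) (κ := Λ i)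
    (b := fun j => if k ≤ j.val then 0 else aeval B (pderiv i (A j))) hΛ h.eq
    (kill_tailSet_tailSet le_rfl Ps) ⟨hΛ i, fun j => ?_, fun j hj => if_pos hj⟩ ?_ j
  · simp only [if_neg (not_le.2 hj)] at hR
    have h1 := congrArg (aeval A) hR
    rw [map_zero] at h1
    rw [← h1, ← AlgHom.comp_apply, comp_aeval]
    simp only [hAB]
    rw [aeval_X_left, AlgHom.id_apply]
  · split_ifs
    · exact isWeightedHomogeneous_zero _ _ _
    · exact isWeightedHomogeneous_aeval hBhom (isWeightedHomogeneous_pderiv (hAhom j))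
  · rw [vf, ← hsum2]
    refine Finset.sum_congr rfl fun j _ => ?_
    by_cases hjk : k ≤ j.val
    · rw [pderiv_eq_zero_of_kill_eq (kill_tailSet_tailSet le_rfl Ps) (inl_mem_tailSet.2 hjk),
        mul_zero, mul_zero]
    · simp only [if_neg hjk]

/-- The differential of `A` at the origin is injective on the directions in `T`, and their images
lie in the last `n - k` coordinate directions. The matrices `N` and `L` express the left inverse
through these directions. -/
lemma card_le_of_pderiv_eq_zero {A B : Fin n → MvPolynomial (Fin n) ℂ}
    (hAB : ∀ j, aeval A (B j) = X j) (T : Finset (Fin n)) (hk : k ≤ n)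
    (h : ∀ i ∈ T, ∀ j : Fin n, j.val < k → pderiv i (A j) = 0) : T.card + k ≤ n := by
  classical
  let N : Matrix T {l : Fin n // k ≤ l.val} ℂ := fun j l => eval 0 (aeval A (pderiv l.1 (B j)))
  let L : Matrix {l : Fin n // k ≤ l.val} T ℂ := fun l i => eval 0 (pderiv i.1 (A l))
  have h1 : N * L = 1 := by
    ext j i
    have h2 := congrArg (fun f => eval (0 : Fin n → ℂ) (pderiv i.1 f)) (hAB j)
    simp only [pderiv_aeval, map_sum, map_mul, pderiv_X] at h2
    have h3 : (N * L) j i = ∑ l, eval (0 : Fin n → ℂ) (aeval A (pderiv l (B j))) *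
        eval 0 (pderiv i.1 (A l)) := by
      rw [Matrix.mul_apply]
      refine (Finset.sum_subtype (Finset.univ.filter fun l : Fin n => k ≤ l.val) (by simp)
        (fun l => eval (0 : Fin n → ℂ) (aeval A (pderiv l (B j))) *
        eval 0 (pderiv i.1 (A l)))).symm.trans (Finset.sum_filter_of_ne fun l _ hl => ?_)
      by_contra hlk
      exact hl (by rw [h _ i.2 l (not_le.1 hlk), map_zero, mul_zero])
    rw [h3, h2, Matrix.one_apply]
    by_cases hij : j = i
    · simp [hij]
    · have : (j : Fin n) ≠ i := fun h => hij (Subtype.ext h)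
      simp [hij, this]
  have h2 := (Matrix.rank_mul_le_left N L).trans (Matrix.rank_le_card_width N)
  rw [h1, Matrix.rank_one, Fintype.card_coe] at h2
  have h3 : Fintype.card {l : Fin n // k ≤ l.val} = n - k := by
    have h4 := Fintype.card_subtype_compl fun l : Fin n => l.val < k
    have h5 : Fintype.card {l : Fin n // l.val < k} = k := by
      rw [Fintype.card_congr (Fin.castLEquiv hk).symm]; simp
    simp only [not_lt, Fintype.card_fin, h5] at h4
    exact h4
  omega

/-- The number of absent variables is at most the number of entries which are not yet minimal. -/
lemma IsMinimalSystem.absentCount_add_le (hs : IsMinimalSystem M p μ Φs Ψs Ps) (h : IsAbove μ Λ k)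
    (hF : IsTransition Ψ Ψs F) (hΨ : IsGraphFun Ψ) (hP : IsLeading Λ Ψ P)
    (hq : IsSuperHom Λ hΛ F q) : absentCount P + k ≤ n := by
  classical
  obtain ⟨G, hG, hGF, hFG⟩ := hF.toIsGermIso.exists_inverse
  obtain ⟨r, hr⟩ := exists_isSuperHom_inverse hF.toIsGermIso hq hG hGF
  rw [absentCount, Set.ncard_eq_toFinset_card']
  refine card_le_of_pderiv_eq_zero (aeval_toZ_eq_X h.lt_one hq hr hGF) _ h.le
    fun i hi j hj => hs.pderiv_eq_zero h hF hΨ hP hq ?_ hj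
  exact (isAbsent_iff.1 (by simpa using hi)).1

end Core

/-! ### Lowering the tail of a weight -/

section TailWeight

open MvPolynomial

variable {n : ℕ} {M : Set (Fin (n + 1) → ℂ)} {p : Fin (n + 1) → ℂ} {Λ μ : Fin n → ℚ}
  {hΛ : ∀ i, 0 < Λ i}
  {Φ Φ' Φs : (Fin (n + 1) → ℂ) → CoordSpace n} {Ψ Ψ' Ψs : GraphSpace n → ℝ} {P P' Q Ps : ZPoly n}
  {F G : CoordSpace n → CoordSpace n} {q r : Option (Fin n) → HPoly n} {k d : ℕ} {t : ℚ}

lemma rename_toZ (hΛ : ∀ i, 0 < Λ i) {f : HPoly n} {ρ : ℚ} (hf : f.IsWeightedHomogeneous (hw Λ) ρ)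
    (hρ : ρ < 1) : rename some (toZ f) = f := by
  refine MvPolynomial.funext fun c => ?_
  obtain ⟨x, rfl⟩ := hcoord_surjective c
  rw [eval_rename, eval_hcoord_eq hΛ hf hρ.le, coeff_none_eq_zero hf hρ, zero_mul, zero_add]
  rfl

/-- All monomials of the Taylor series containing one of the last `d` variables have weight at least
one when these variables are given the weight `t`. -/
def TailBound (Λ : Fin n → ℚ) (d : ℕ) (Ψ : GraphSpace n → ℝ) (t : ℚ) : Prop :=
  ∀ α β, taylorCoeff Ψ α β ≠ 0 → 0 < tailDegree d α β → 1 ≤ headLength Λ d α β + t * tailDegree d α β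

lemma exists_isLeading_tailWeight (hΛ : ∀ i, 0 < Λ i) (hΨ : IsGraphFun Ψ) (hP : IsLeading Λ Ψ P)
    (ht : 0 < t) (hb : TailBound Λ d Ψ t) : ∃ P', IsLeading (tailWeight Λ d t) Ψ P' := by
  refine exists_isLeading (tailWeight_pos hΛ d ht) hΨ fun α β hlt => ?_
  by_contra hne
  rw [wlen_tailWeight] at hlt
  rcases (tailDegree_nonneg d α β).eq_or_lt with h0 | h0
  · rw [← h0, mul_zero, add_zero, ← wlen_eq_head_of_tailDegree h0.symm] at hlt
    exact hne (hP.taylorCoeff_eq_zero hΛ hΨ hlt)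
  · exact absurd hlt (not_lt.2 (hb α β hne h0))

/-- By the strict bound every monomial containing a tail variable has weight more than one, so it is
not in the leading polynomial. -/
lemma isAbsent_of_lt (hΛ : ∀ i, 0 < Λ i) (hΨ : IsGraphFun Ψ) (ht : 0 < t)
    (hP : IsLeading (tailWeight Λ d t) Ψ P)
    (hb : ∀ α β, taylorCoeff Ψ α β ≠ 0 → 0 < tailDegree d α β →
      1 < headLength Λ d α β + t * tailDegree d α β) {i : Fin n} (hi : n ≤ i + d) : IsAbsent P i := by
  have key : ∀ m, coeff m P ≠ 0 → m (Sum.inl i) = 0 ∧ m (Sum.inr i) = 0 := by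
    intro m hm
    rw [eq_zexp m] at hm
    obtain ⟨h1, h2⟩ := hP.coeff_eq (tailWeight_pos hΛ d ht) hΨ hm
    rw [← h2] at hm
    rw [wlen_tailWeight] at h1
    have h3 : tailDegree d (fun i => m (Sum.inl i)) (fun i => m (Sum.inr i)) = 0 := by
      by_contra h0
      have := hb _ _ hm (lt_of_le_of_ne (tailDegree_nonneg _ _ _) (Ne.symm h0))
      linarith
    exact tailDegree_eq_zero_iff.1 h3 i hi
  exact isAbsent_iff.2 ⟨pderiv_eq_zero_iff.2 fun m hm => (key m hm).1,
    pderiv_eq_zero_iff.2 fun m hm => (key m hm).2⟩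

lemma tail_iff (hk : k ≤ n) {i : Fin n} : n ≤ (i : ℕ) + (n - k) ↔ k ≤ i.val := by
  omega

lemma head_iff (hk : k ≤ n) {i : Fin n} : (i : ℕ) + (n - k) < n ↔ i.val < k := by
  omega

/-- Superhomogeneity with respect to `tailWeight Λ (n - k) t` follows from estimates for the weights
of the monomials of the first `k` components. -/
lemma exists_isSuperHom_of_le (hs : IsMinimalSystem M p μ Φs Ψs Ps) (h : IsAbove μ Λ k) {lam : ℚ}
    (hlam : ∀ i : Fin n, k ≤ i.val → Λ i = lam) (hΛ : ∀ i, 0 < Λ i) (hkn : k < n)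
    (hF : IsTransition Ψ Ψs F) (hΨ : IsGraphFun Ψ) (ht0 : 0 < t)
    (htμ : ∀ i : Fin n, k ≤ i.val → μ i ≤ t) (htl : t ≤ lam) (hP : IsLeading (tailWeight Λ (n - k) t) Ψ P)
    {N : ℕ} (hN : 1 < N * minWeight (tailWeight Λ (n - k) t)) {f : Fin n → HPoly n}
    (hf : ∀ j, IsApprox (hDil Λ hΛ) N (fun x => (F x).1 j) (f j))
    (hle : ∀ j : Fin n, j.val < k → ∀ m ∈ (f j).support,
      Λ j ≤ Finsupp.weight (hw (tailWeight Λ (n - k) t)) m) :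
    ∃ q, IsSuperHom (tailWeight Λ (n - k) t) (tailWeight_pos hΛ _ ht0) F q := by
  have hle' : ∀ i, μ i ≤ tailWeight Λ (n - k) t i := fun i => by
    rcases lt_or_ge i.val k with hi | hi
    · rw [tailWeight_head ((head_iff h.le).2 hi)]; exact h.ge i
    · rw [tailWeight_tail ((tail_iff h.le).2 hi)]; exact htμ i hi
  obtain ⟨Q, hQ⟩ := hs.isLeading.exists_of_le hs.pos hle' hs.isCoord.isGraphFun
  refine hF.exists_isSuperHom hΨ hs.isCoord.isGraphFun hP hQ fun j => ?_
  rcases lt_or_ge j.val k with hj | hj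
  · rw [tailWeight_head ((head_iff h.le).2 hj)]
    have h1 : IsApprox (hDil (tailWeight Λ (n - k) t) (tailWeight_pos hΛ _ ht0)) N
      (fun x => (F x).1 j) (f j) := hf j
    exact ⟨_, weightedHomogeneousComponent_isWeightedHomogeneous _ _,
      h1.wlim ((h.lt_one j).trans hN) (hle j hj)⟩
  · rw [tailWeight_tail ((tail_iff h.le).2 hj)]
    -- The tail variables carry the smallest weight `t`, so their components satisfy the requirement
    -- simply by vanishing at the origin.
    refine exists_hasLead_of_le (hF.toIsGermIso.analyticAt_hcoord (some j)) ?_ fun o => ?_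
    · change (F 0).1 j = 0
      rw [hF.toIsGermIso.map_zero]; rfl
    · rcases o with _ | i
      · exact htl.trans (hlam ⟨k, hkn⟩ le_rfl ▸ (h.lt_one ⟨k, hkn⟩).le)
      · change t ≤ tailWeight Λ (n - k) t i
        rcases lt_or_ge i.val k with hi | hi
        · rw [tailWeight_head ((head_iff h.le).2 hi)]
          refine htl.trans ?_
          rw [← hlam ⟨k, hkn⟩ le_rfl]
          exact h.anti _ _ (by rw [Fin.le_def]; exact hi.le)
        · rw [tailWeight_tail ((tail_iff h.le).2 hi)]

/-- The part of the weight of a monomial in `z`, `w` which comes from `w` and the first variables. -/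
def headWeight (Λ : Fin n → ℚ) (d : ℕ) (m : Option (Fin n) →₀ ℕ) : ℚ :=
  m none + ∑ i ∈ Finset.univ.filter (fun i : Fin n => (i : ℕ) + d < n), (m (some i) : ℚ) * Λ i

/-- The degree of a monomial in the last `d` variables. -/
def tailDeg (d : ℕ) (m : Option (Fin n) →₀ ℕ) : ℚ :=
  ∑ i ∈ Finset.univ.filter (fun i : Fin n => n ≤ (i : ℕ) + d), (m (some i) : ℚ)

lemma weight_tailWeight (d : ℕ) (t : ℚ) (m : Option (Fin n) →₀ ℕ) :
    Finsupp.weight (hw (tailWeight Λ d t)) m = headWeight Λ d m + t * tailDeg d m := by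
  rw [weight_eq_sum, Fintype.sum_option, headWeight, tailDeg,
    ← Finset.sum_filter_add_sum_filter_not _ (fun i : Fin n => (i : ℕ) + d < n), add_assoc,
    Finset.mul_sum]
  simp only [not_lt]
  congr 1
  · simp [hw]
  congr 1
  · exact Finset.sum_congr rfl fun i hi => by
      simp only [hw, Option.elim_some, tailWeight_head (Finset.mem_filter.1 hi).2]
  · exact Finset.sum_congr rfl fun i hi => by
      simp only [hw, Option.elim_some, tailWeight_tail (Finset.mem_filter.1 hi).2, mul_comm]

lemma tailDeg_nonneg (d : ℕ) (m : Option (Fin n) →₀ ℕ) : 0 ≤ tailDeg d m :=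
  Finset.sum_nonneg fun _ _ => by positivity

lemma tailWeight_self {lam : ℚ} (hlam : ∀ i : Fin n, n ≤ i.val + d → Λ i = lam) :
    tailWeight Λ d lam = Λ := by
  funext i
  rcases lt_or_ge (i.val + d) n with hi | hi
  · rw [tailWeight_head hi]
  · rw [tailWeight_tail hi, hlam i hi]

/-- A map into a minimal system which is superhomogeneous for `Λ` remains so when the tail of `Λ` is
lowered, as long as the Taylor series of the source permits. -/
lemma IsMinimalSystem.exists_isSuperHom_tailWeight (hs : IsMinimalSystem M p μ Φs Ψs Ps)
    (h : IsAbove μ Λ k) {lam : ℚ} (hlam : ∀ i : Fin n, k ≤ i.val → Λ i = lam) (hkn : k < n)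
    (hF : IsTransition Ψ Ψs F) (hΨ : IsGraphFun Ψ) (hP : IsLeading Λ Ψ P)
    (hq : IsSuperHom Λ hΛ F q) (ht0 : 0 < t) (htμ : ∀ i : Fin n, k ≤ i.val → μ i ≤ t) (htl : t ≤ lam)
    (hb : TailBound Λ (n - k) Ψ t) :
    ∃ q, IsSuperHom (tailWeight Λ (n - k) t) (tailWeight_pos hΛ _ ht0) F q := by
  classical
  set d := n - k with hd
  -- One Taylor order for all tail weights from `t` to `lam`: it is largest for the smallest weight.
  obtain ⟨N, -, hN⟩ := exists_eps_mul_gt (hDil (tailWeight Λ d t) (tailWeight_pos hΛ _ ht0)) 1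
  replace hN : 1 < N * minWeight (tailWeight Λ d t) := hN
  have hNs : ∀ s, t ≤ s → 1 < N * minWeight (tailWeight Λ d s) := fun s hst =>
    hN.trans_le (mul_le_mul_of_nonneg_left (minWeight_mono fun i => by
      unfold tailWeight; split_ifs
      exacts [le_rfl, hst]) (by positivity))
  have hself : tailWeight Λ d lam = Λ := tailWeight_self fun i hi => hlam i ((tail_iff h.le).1 hi)
  have hNΛ : 1 < N * minWeight Λ := by have := hNs lam htl; rwa [hself] at this
  choose f hf using fun j => exists_isApprox_of_analyticAt
    (hF.toIsGermIso.analyticAt_hcoord (some j)) N hΛ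
  have hbs : ∀ s, t ≤ s → TailBound Λ d Ψ s := fun s hst α β h1 h2 =>
    (hb α β h1 h2).trans (by have := mul_le_mul_of_nonneg_right hst h2.le; linarith)
  obtain ⟨Pt, hPt⟩ := exists_isLeading_tailWeight hΛ hΨ hP ht0 hb
  refine exists_isSuperHom_of_le hs h hlam hΛ hkn hF hΨ ht0 htμ htl hPt hN hf ?_
  by_contra hV
  push Not at hV
  -- The violations at `t`: monomials of one of the first `k` components whose weight has become too
  -- small.
  let V : Finset (Fin n × (Option (Fin n) →₀ ℕ)) :=
    (Finset.univ.biUnion fun j => (f j).support.image fun m => (j, m)).filter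
      fun x => x.1.val < k ∧ Finsupp.weight (hw (tailWeight Λ d t)) x.2 < Λ x.1
  have hVmem : ∀ j m, (j, m) ∈ V ↔ m ∈ (f j).support ∧ j.val < k ∧
      Finsupp.weight (hw (tailWeight Λ d t)) m < Λ j := by
    intro j m
    simp only [V, Finset.mem_filter, Finset.mem_biUnion, Finset.mem_univ, true_and, Finset.mem_image,
      Prod.mk.injEq]
    constructor
    · rintro ⟨⟨_, _, h1, rfl, rfl⟩, h2⟩; exact ⟨h1, h2⟩
    · rintro ⟨h1, h2⟩; exact ⟨⟨j, m, h1, rfl, rfl⟩, h2⟩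
  obtain ⟨j₁, hj₁, m₁, hm₁, hlt₁⟩ := hV
  obtain ⟨⟨j, m⟩, hjm, hmax⟩ := V.exists_max_image
    (fun x => (Λ x.1 - headWeight Λ d x.2) / tailDeg d x.2) ⟨(j₁, m₁), (hVmem _ _).2 ⟨hm₁, hj₁, hlt₁⟩⟩
  have hupper : ∀ j, ∀ m ∈ (f j).support, Λ j ≤ headWeight Λ d m + lam * tailDeg d m := fun j m hm => by
    rw [← weight_tailWeight, hself]
    exact (hf j).le_weight ((h.lt_one j).trans hNΛ) (hq (some j)).2 m hm
  have hposV : ∀ j m, (j, m) ∈ V → 0 < tailDeg d m := fun j m hm => by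
    obtain ⟨h1, -, h2⟩ := (hVmem j m).1 hm
    rw [weight_tailWeight] at h2
    refine lt_of_le_of_ne (tailDeg_nonneg d m) fun h0 => ?_
    have := hupper j m h1
    rw [← h0] at this h2
    linarith
  have hT := hposV j m hjm
  obtain ⟨hms, hjk, hlt⟩ := (hVmem j m).1 hjm
  -- Lowering the tail weight from `lam`, this is the first value below which superhomogeneity
  -- fails. At `s` itself it still holds, and the monomial `m` has exactly the critical weight.
  set s := (Λ j - headWeight Λ d m) / tailDeg d m with hs'
  have hsT : headWeight Λ d m + s * tailDeg d m = Λ j := by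
    rw [hs', div_mul_cancel₀ _ hT.ne']; ring
  have hts : t < s := by
    rw [weight_tailWeight] at hlt
    rw [hs', lt_div_iff₀ hT]; linarith
  have hsl : s ≤ lam := by
    rw [hs', div_le_iff₀ hT]; linarith [hupper j m hms]
  have hs0 := ht0.trans hts
  obtain ⟨P₀, hP₀⟩ := exists_isLeading_tailWeight hΛ hΨ hP hs0 (hbs s hts.le)
  obtain ⟨q₀, hq₀⟩ := exists_isSuperHom_of_le hs h hlam hΛ hkn hF hΨ hs0
    (fun i hi => (htμ i hi).trans hts.le) hsl hP₀ (hNs s hts.le) hf (by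
      intro j' hj' m' hm'
      rw [weight_tailWeight]
      by_contra hlt'
      rw [not_le] at hlt'
      have hV' : (j', m') ∈ V := (hVmem _ _).2 ⟨hm', hj', by
        rw [weight_tailWeight]
        have := mul_le_mul_of_nonneg_right hts.le (tailDeg_nonneg d m')
        linarith⟩
      have := hmax _ hV'
      simp only at this
      rw [div_le_iff₀ (hposV _ _ hV')] at this
      linarith)
  have habove : IsAbove μ (tailWeight Λ d s) k := by
    refine ⟨fun i => ?_, fun i i' hii => ?_, h.le, fun i hi => ?_, fun i hi => ?_⟩
    · unfold tailWeight; split_ifs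
      · exact h.lt_one i
      · exact hsl.trans_lt (hlam ⟨k, hkn⟩ le_rfl ▸ h.lt_one ⟨k, hkn⟩)
    · have hii' : i.val ≤ i'.val := hii
      rcases lt_or_ge (i'.val + d) n with h1 | h1
      · rw [tailWeight_head h1, tailWeight_head (by omega)]; exact h.anti _ _ hii
      · rw [tailWeight_tail h1]
        rcases lt_or_ge (i.val + d) n with h2 | h2
        · rw [tailWeight_head h2]
          refine hsl.trans ?_
          rw [← hlam i' ((tail_iff h.le).1 h1)]
          exact h.anti _ _ hii
        · rw [tailWeight_tail h2]
    · rw [tailWeight_head ((head_iff h.le).2 hi)]; exact h.eq i hi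
    · rw [tailWeight_tail ((tail_iff h.le).2 hi)]; exact (htμ i hi).trans_lt hts
  obtain ⟨i, hi, hmi⟩ : ∃ i : Fin n, k ≤ i.val ∧ m (some i) ≠ 0 := by
    by_contra hno
    push Not at hno
    refine hT.ne' (Finset.sum_eq_zero fun i hi => ?_)
    rw [hno i ((tail_iff h.le).1 (Finset.mem_filter.1 hi).2), Nat.cast_zero]
  -- Since `s > t`, the tail bound is strict at `s`, so all tail variables are absent from the
  -- leading polynomial and rigidity applies.
  have hstrict : ∀ α β, taylorCoeff Ψ α β ≠ 0 → 0 < tailDegree d α β →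
      1 < headLength Λ d α β + s * tailDegree d α β := fun α β h1 h2 =>
    (hb α β h1 h2).trans_lt (by have := mul_lt_mul_of_pos_right hts h2; linarith)
  have hder := hs.pderiv_eq_zero habove hF hΨ hP₀ hq₀
    (isAbsent_iff.1 (isAbsent_of_lt hΛ hΨ hs0 hP₀ hstrict ((tail_iff h.le).2 hi))).1 hjk
  have hw1 : tailWeight Λ d s j = Λ j := tailWeight_head ((head_iff h.le).2 hjk)
  have hcomp : q₀ (some j) = weightedHomogeneousComponent (hw (tailWeight Λ d s)) (Λ j) (f j) := by
    have h1 : IsApprox (hDil (tailWeight Λ d s) (tailWeight_pos hΛ _ hs0)) N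
      (fun x => hcoord (F x) (some j)) (f j) := hf j
    have h2 := (hq₀ (some j)).2
    have h3 : hw (tailWeight Λ d s) (some j) = Λ j := hw1
    rw [h3] at h2
    have h4 := h1.wlim_component ((h.lt_one j).trans (hNs s hts.le)) h2
    refine MvPolynomial.funext fun c => ?_
    obtain ⟨x, rfl⟩ := hcoord_surjective c
    exact congrFun h4 x
  have h5 : rename some (toZ (q₀ (some j))) = q₀ (some j) :=
    rename_toZ (tailWeight_pos hΛ _ hs0) (hq₀ (some j)).1 (habove.lt_one j)
  have h6 : pderiv (some i) (q₀ (some j)) = 0 := by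
    rw [← h5, pderiv_rename (Option.some_injective _), hder, map_zero]
  -- The homogeneous part of the component `j` contains `m`, and `m` contains the tail variable
  -- `z_i`, on which this part does not depend.
  refine hmi (pderiv_eq_zero_iff.1 h6 m ?_)
  rw [hcomp, coeff_weightedHomogeneousComponent, if_pos (by rw [weight_tailWeight, hsT])]
  exact mem_support_iff.1 hms

end TailWeight

/-! ### The procedure -/

section Procedure

open MvPolynomial

variable {n : ℕ} {M : Set (Fin (n + 1) → ℂ)} {p : Fin (n + 1) → ℂ} {Λ μ : Fin n → ℚ}
  {Φ Φ' Φs : (Fin (n + 1) → ℂ) → CoordSpace n} {Ψ Ψ' Ψs : GraphSpace n → ℝ} {P P' Q Ps : ZPoly n}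
  {k d : ℕ} {t : ℚ}

/-- Coordinates are open at `p`, so relations between germs of transition maps may be checked along
the coordinates. -/
lemma IsCoord.eventually_of_comp (h : IsCoord M p Φ Ψ) {R : CoordSpace n → Prop}
    (hR : ∀ᶠ x in 𝓝 p, R (Φ x)) : ∀ᶠ y in 𝓝 0, R y := by
  obtain ⟨g, hg, hg0, -, -, hgi⟩ := exists_localInverse h.1 h.2.2.1
  rw [h.2.1] at hg hg0 hgi
  have ht : Tendsto g (𝓝 0) (𝓝 p) := by
    have := hg.continuousAt.tendsto
    rwa [hg0] at this
  filter_upwards [ht.eventually hR, hgi] with y h1 h2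
  rwa [h2] at h1

/-- The new `k'` is the first index from `k` on at which `μ` drops below the tail value `t`; before
it the tail entries have become equal to those of `μ`. -/
lemma exists_isAbove (hμ : ∀ i j, i ≤ j → μ j ≤ μ i) (h1 : ∀ i, Λ i < 1)
    (hanti : ∀ i j, i ≤ j → Λ j ≤ Λ i) (hk : k ≤ n) (heq : ∀ i : Fin n, i.val < k → Λ i = μ i)
    (ht : ∀ i : Fin n, k ≤ i.val → Λ i = t) (hle : ∀ i : Fin n, k ≤ i.val → μ i ≤ t) :
    ∃ k', k ≤ k' ∧ IsAbove μ Λ k' := by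
  classical
  have hex : ∃ k', k ≤ k' ∧ ∀ i : Fin n, k' ≤ i.val → μ i < t :=
    ⟨n, hk, fun i hi => absurd i.isLt (not_lt.2 hi)⟩
  obtain ⟨hk', hlt⟩ := Nat.find_spec hex
  refine ⟨Nat.find hex, hk', h1, hanti, Nat.find_min' hex ⟨hk, fun i hi =>
    absurd i.isLt (not_lt.2 hi)⟩, fun i hi => ?_, fun i hi => ?_⟩
  · rcases lt_or_ge i.val k with hik | hik
    · exact heq i hik
    · rw [ht i hik]
      refine le_antisymm ?_ (hle i hik)
      by_contra hlt'
      rw [not_le] at hlt'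
      exact Nat.find_min hex hi ⟨hik, fun j hj => (hμ i j hj).trans_lt hlt'⟩
  · rw [ht i (hk'.trans hi)]
    exact hlt i hi

lemma le_absentCount (hk : k ≤ n) (h : ∀ i : Fin n, k ≤ i.val → IsAbsent P i) :
    n - k ≤ absentCount P := by
  classical
  have h1 : {i : Fin n | k ≤ i.val} ⊆ {i | IsAbsent P i} := fun i hi => h i hi
  refine le_trans ?_ (Set.ncard_le_ncard h1 (Set.toFinite _))
  have h2 := Set.ncard_add_ncard_compl {i : Fin n | k ≤ i.val}
  have h3 : ({i : Fin n | k ≤ i.val}ᶜ : Set (Fin n)).ncard = k := by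
    have : ({i : Fin n | k ≤ i.val}ᶜ : Set (Fin n)) =
        ((Finset.univ.filter fun i : Fin n => i.val < k : Finset (Fin n)) : Set (Fin n)) := by
      ext i; simp
    rw [this, Set.ncard_coe_finset, Fin.card_filter_val_lt, min_eq_right hk]
  rw [h3, Nat.card_eq_fintype_card, Fintype.card_fin] at h2
  omega

/-- Coordinates with a superhomogeneous transition to a minimal system, for a weight with exactly `k`
entries equal to those of the minimal weight and a constant tail. -/
structure IsTracked (M : Set (Fin (n + 1) → ℂ)) (p : Fin (n + 1) → ℂ) (μ : Fin n → ℚ)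
    (Φs : (Fin (n + 1) → ℂ) → CoordSpace n) (Ψs : GraphSpace n → ℝ) (Λ : Fin n → ℚ)
    (Φ : (Fin (n + 1) → ℂ) → CoordSpace n) (Ψ : GraphSpace n → ℝ) (k : ℕ) : Prop where
  isWeight : IsWeight Λ
  above : IsAbove μ Λ k
  pos : 0 < k
  tail : ∃ lam, ∀ i : Fin n, k ≤ i.val → Λ i = lam
  isCoord : IsCoord M p Φ Ψ
  lead : ∃ P, IsLeading Λ Ψ P
  map : ∃ F, IsTransition Ψ Ψs F ∧ (∀ᶠ x in 𝓝 p, F (Φ x) = Φs x) ∧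
    ∃ (hΛ : ∀ i, 0 < Λ i) (q : Option (Fin n) → HPoly n), IsSuperHom Λ hΛ F q

lemma IsTracked.absentCount_add_le (h : IsTracked M p μ Φs Ψs Λ Φ Ψ k)
    (hs : IsMinimalSystem M p μ Φs Ψs Ps) (hP : IsLeading Λ Ψ P) : absentCount P + k ≤ n := by
  obtain ⟨F, hF, -, hΛ, q, hq⟩ := h.map
  exact hs.absentCount_add_le h.above hF h.isCoord.isGraphFun hP hq

lemma IsTracked.change (h : IsTracked M p μ Φs Ψs Λ Φ Ψ k) (hs : IsMinimalSystem M p μ Φs Ψs Ps)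
    (hch : HomogeneousChange Λ Φ Φ') (hc : IsCoord M p Φ' Ψ') :
    IsTracked M p μ Φs Ψs Λ Φ' Ψ' k := by
  obtain ⟨F, hF, hFΦ, hΛ, q, hq⟩ := h.map
  obtain ⟨P, hP⟩ := h.lead
  obtain ⟨q₀, hq₀, hΦ'⟩ := homogeneousChange_iff.1 hch
  obtain ⟨T, hT, hTΦ⟩ := h.isCoord.exists_transition hc
  obtain ⟨F', hF', hFΦ'⟩ := hc.exists_transition hs.isCoord
  have hTq : ∀ᶠ y in 𝓝 0, polyMap q₀ y = T y := h.isCoord.eventually_of_comp <| by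
    filter_upwards [hTΦ] with x hx
    rw [hx, hΦ' x]
  have hTsup : IsSuperHom Λ hΛ T q₀ := (isSuperHom_polyMap hΛ hq₀).congr hTq
  -- The old transition factors through the change, so superhomogeneity passes to the new one by
  -- `exists_isSuperHom_of_comp`.
  have hFT : ∀ᶠ y in 𝓝 0, F y = F' (T y) := h.isCoord.eventually_of_comp <| by
    filter_upwards [hFΦ, hTΦ, hFΦ'] with x h1 h2 h3
    rw [h1, h2, h3]
  refine ⟨h.isWeight, h.above, h.pos, h.tail, hc, hT.exists_isLeading h.isCoord.isGraphFun
    hc.isGraphFun hP h.above.lt_one hTsup, F', hF', hFΦ', hΛ, ?_⟩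
  exact exists_isSuperHom_of_comp hT.toIsGermIso hTsup hF'.toIsGermIso (hq.congr hFT)

/-- The truncated leading polynomial of the minimal system can be attained. -/
lemma IsTracked.exists_change (h : IsTracked M p μ Φs Ψs Λ Φ Ψ k)
    (hs : IsMinimalSystem M p μ Φs Ψs Ps) :
    ∃ Φ' Ψ', HomogeneousChange Λ Φ Φ' ∧ IsCoord M p Φ' Ψ' ∧
      IsLeading Λ Ψ' (kill (tailSet n k) Ps) := by
  obtain ⟨F, hF, hFΦ, hΛ, q, hq⟩ := h.map
  obtain ⟨P, hP⟩ := h.lead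
  have hΨ := h.isCoord.isGraphFun
  have hΛ1 := h.above.lt_one
  have hQ := hs.isLeading_kill h.above
  have hqhom : IsHomMap Λ q := fun o => (hq o).1
  have hgerm := hF.toIsGermIso.polyMap hq
  obtain ⟨c, -, hc1, hrel⟩ := hF.exists_pull_eq hΨ hs.isCoord.isGraphFun hP hQ hΛ1 hq
  obtain ⟨Ψ', hc'⟩ := h.isCoord.exists_polyMap hΛ1 hqhom hgerm hc1
  have hT := h.isCoord.isTransition_polyMap hgerm hc'
  have hTsup := isSuperHom_polyMap hΛ hqhom
  obtain ⟨P', hP'⟩ := hT.exists_isLeading hΨ hc'.isGraphFun hP hΛ1 hTsup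
  obtain ⟨c', -, hc1', hrel'⟩ := hT.exists_pull_eq hΨ hc'.isGraphFun hP hP' hΛ1 hTsup
  have hcc : (c : ℂ) = c' := by rw [← hc1, ← hc1']
  rw [← hcc, ← hrel] at hrel'
  obtain ⟨G, hG, hGF, hFG⟩ := hF.toIsGermIso.exists_inverse
  obtain ⟨r, hr⟩ := exists_isSuperHom_inverse hF.toIsGermIso hq hG hGF
  -- The new leading polynomial and the truncation of `Ps` have the same pull-back under the
  -- homogeneous part of `F`; composing with its inverse identifies them.
  have h1 := congrArg (pull fun i => toZ (r (some i))) hrel'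
  simp only [pull_pull, aeval_toZ_eq_X hΛ1 hr hq hFG] at h1
  have h2 : (pull X : ZPoly n →ₐ[ℂ] ZPoly n) = AlgHom.id ℂ _ := by
    refine algHom_ext fun o => ?_
    rcases o with l | l <;> simp [pull, antiPoly, conjPoly]
  simp only [h2, AlgHom.id_apply] at h1
  rw [h1] at hP'
  exact ⟨_, Ψ', homogeneousChange_iff.2 ⟨q, hqhom, fun _ => rfl⟩, hc', hP'⟩

lemma isAbsent_kill_tailSet {i : Fin n} (hi : k ≤ i.val) : IsAbsent (kill (tailSet n k) P) i :=
  isAbsent_iff.2 ⟨pderiv_eq_zero_of_kill_eq (kill_tailSet_tailSet le_rfl P) (inl_mem_tailSet.2 hi),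
    pderiv_eq_zero_of_kill_eq (kill_tailSet_tailSet le_rfl P) (inr_mem_tailSet.2 hi)⟩

/-- The truncation of `Ps` attains `n - k`. Every competitor is again tracked with the same `k`, so
the rank count bounds it. -/
lemma IsTracked.isGreatest (h : IsTracked M p μ Φs Ψs Λ Φ Ψ k)
    (hs : IsMinimalSystem M p μ Φs Ψs Ps) : IsGreatest (absentCounts M p Λ Φ) (n - k) := by
  have hk := h.above.le
  constructor
  · obtain ⟨Φ', Ψ', hch, hc, hP⟩ := h.exists_change hs
    refine ⟨Φ', Ψ', _, hch, hc, hP, le_antisymm ?_ (le_absentCount hk fun i hi =>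
      isAbsent_kill_tailSet hi)⟩
    have := (h.change hs hch hc).absentCount_add_le hs hP
    omega
  · rintro _ ⟨Φ', Ψ', P, hch, hc, hP, rfl⟩
    have := (h.change hs hch hc).absentCount_add_le hs hP
    omega

lemma IsTracked.exists_isOptimalChange (h : IsTracked M p μ Φs Ψs Λ Φ Ψ k)
    (hs : IsMinimalSystem M p μ Φs Ψs Ps) : ∃ Φ' Ψ' d', IsOptimalChange M p Λ Φ Φ' Ψ' d' ∧
      IsAdapted M p Λ Φ' Ψ' := by
  obtain ⟨Φ', Ψ', hch, hc, hP⟩ := h.exists_change hs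
  exact ⟨Φ', Ψ', n - k, ⟨hch, hc, h.isGreatest hs, _, hP, fun i hi =>
    isAbsent_kill_tailSet ((tail_iff h.above.le).1 hi)⟩, hc, _,
    hs.kill_tailSet_ne_zero h.above.isBreak h.pos, noPluriharmonic_kill hs.noPluriharmonic, hP⟩

/-- When the tail variables are absent, a monomial with positive tail degree and nonzero coefficient
automatically has weight more than one. So the condition on the weight can be replaced by one on the
tail degree, the denominator of the ratio. -/
lemma mem_Theta_iff (hΛ : ∀ i, 0 < Λ i) (hΨ : IsGraphFun Ψ) (hP : IsLeading Λ Ψ P)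
    (ha : ∀ i : Fin n, n ≤ i.val + d → IsAbsent P i) {γ : (Fin n → ℕ) × (Fin n → ℕ)} :
    γ ∈ Theta Λ d Ψ ↔ taylorCoeff Ψ γ.1 γ.2 ≠ 0 ∧ headLength Λ d γ.1 γ.2 < 1 ∧
      0 < tailDegree d γ.1 γ.2 := by
  constructor
  · rintro ⟨h1, h2, h3⟩
    refine ⟨h2, h3, lt_of_le_of_ne (tailDegree_nonneg _ _ _) fun h0 => ?_⟩
    rw [wlen_eq_head_of_tailDegree h0.symm] at h1
    exact lt_asymm h1 h3
  · rintro ⟨h1, h2, h3⟩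
    refine ⟨?_, h1, h2⟩
    by_contra hle
    rw [not_lt] at hle
    have h4 := ((isLeading_iff_coeff hΛ hΨ P).1 hP).2 _ _ hle
    rw [h4] at h1
    refine h3.ne' (tailDegree_eq_zero_iff.2 fun i hi => ?_)
    obtain ⟨h5, h6⟩ := isAbsent_iff.1 (ha i hi)
    exact ⟨pderiv_eq_zero_iff.1 h5 _ h1, pderiv_eq_zero_iff.1 h6 _ h1⟩

lemma IsAbove.tailWeight_lt_one_and_anti (hμ : IsWeight μ) (h : IsAbove μ Λ k) (hkn : k < n) :
    (∀ i, tailWeight Λ (n - k) (μ ⟨k, hkn⟩) i < 1) ∧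
      ∀ i j, i ≤ j → tailWeight Λ (n - k) (μ ⟨k, hkn⟩) j ≤ tailWeight Λ (n - k) (μ ⟨k, hkn⟩) i := by
  constructor
  · intro i
    unfold tailWeight; split_ifs
    exacts [h.lt_one i, hμ.lt_one _]
  · intro i j hij
    have hij' : i.val ≤ j.val := hij
    rcases lt_or_ge j.val k with hj | hj
    · rw [tailWeight_head ((head_iff h.le).2 hj), tailWeight_head ((head_iff h.le).2 (by omega))]
      exact h.anti i j hij
    · rw [tailWeight_tail ((tail_iff h.le).2 hj)]
      rcases lt_or_ge i.val k with hi | hi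
      · rw [tailWeight_head ((head_iff h.le).2 hi), h.eq i hi]
        exact hμ.2.1 i _ (by rw [Fin.le_def]; exact hi.le)
      · rw [tailWeight_tail ((tail_iff h.le).2 hi)]

/-- The maximal ratio exists, and the coordinates are tracked for the next weight. -/
lemma IsTracked.exists_next (h : IsTracked M p μ Φs Ψs Λ Φ Ψ k)
    (hs : IsMinimalSystem M p μ Φs Ψs Ps) (hkn : k < n) (hP : IsLeading Λ Ψ P)
    (ha : ∀ i : Fin n, n ≤ i.val + (n - k) → IsAbsent P i) :
    ∃ W, IsGreatest (ratioW Λ (n - k) '' Theta Λ (n - k) Ψ) W ∧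
      (∀ i : Fin n, k ≤ i.val → W < Λ i) ∧
      ∃ k', k ≤ k' ∧ IsTracked M p μ Φs Ψs (tailWeight Λ (n - k) W) Φ Ψ k' := by
  obtain ⟨F, hF, hFΦ, hΛ, q, hq⟩ := h.map
  obtain ⟨lam, hlam⟩ := h.tail
  have hk := h.above.le
  have hΨ := h.isCoord.isGraphFun
  set d := n - k with hd
  set e : Fin n := ⟨k, hkn⟩ with he
  have hTh : ∀ {γ : (Fin n → ℕ) × (Fin n → ℕ)}, γ ∈ Theta Λ d Ψ ↔ taylorCoeff Ψ γ.1 γ.2 ≠ 0 ∧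
    headLength Λ d γ.1 γ.2 < 1 ∧ 0 < tailDegree d γ.1 γ.2 := mem_Theta_iff hΛ hΨ hP ha
  have hμe : ∀ i : Fin n, k ≤ i.val → μ i ≤ μ e := fun i hi => hs.isWeight.2.1 e i hi
  have hμlam : μ e < lam := hlam e le_rfl ▸ h.above.lt e le_rfl
  have hratio : ∀ γ ∈ Theta Λ d Ψ, ratioW Λ d γ < lam := fun γ hγ => by
    have h1 := hγ.1
    obtain ⟨-, -, h3⟩ := hTh.1 hγ
    rw [wlen_eq_of_tail (d := d) (W := lam) fun i hi => hlam i ((tail_iff hk).1 hi)] at h1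
    rw [ratioW, div_lt_iff₀ h3]; linarith
  -- If all ratios were below the next entry `μ e`, the tail could be lowered to `μ e` with strict
  -- bounds. This covers the case of empty `Theta` as well.
  have hbig : ∃ γ ∈ Theta Λ d Ψ, μ e ≤ ratioW Λ d γ := by
    by_contra hno
    push Not at hno
    have hstrict : ∀ α β, taylorCoeff Ψ α β ≠ 0 → 0 < tailDegree d α β →
        1 < headLength Λ d α β + μ e * tailDegree d α β := by
      intro α β h1 h2
      rcases lt_or_ge (headLength Λ d α β) 1 with h3 | h3
      · have := hno (α, β) (hTh.2 ⟨h1, h3, h2⟩)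
        rw [ratioW, div_lt_iff₀ h2] at this
        linarith
      · have := mul_pos (hs.pos e) h2
        linarith
    have hb : TailBound Λ d Ψ (μ e) := fun α β h1 h2 => (hstrict α β h1 h2).le
    obtain ⟨q', hq'⟩ := hs.exists_isSuperHom_tailWeight h.above hlam hkn hF hΨ hP hq (hs.pos e) hμe
      hμlam.le hb
    obtain ⟨P', hP'⟩ := exists_isLeading_tailWeight hΛ hΨ hP (hs.pos e) hb
    obtain ⟨h1, h2⟩ := h.above.tailWeight_lt_one_and_anti hs.isWeight hkn
    obtain ⟨k', hkk', habove⟩ := exists_isAbove (t := μ e) hs.isWeight.2.1 h1 h2 hk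
      (fun i hi => (tailWeight_head ((head_iff hk).2 hi)).trans (h.above.eq i hi))
      (fun i hi => tailWeight_tail ((tail_iff hk).2 hi)) hμe
    -- At the lowered weight more than `k` entries agree with `μ`, while all `n - k` tail variables
    -- are absent; this contradicts the rank count.
    have hne : k' ≠ k := by
      rintro rfl
      have := habove.lt e le_rfl
      rw [tailWeight_tail ((tail_iff hk).2 le_rfl)] at this
      exact lt_irrefl _ this
    have h3 := hs.absentCount_add_le habove hF hΨ hP' hq'
    have h4 := le_absentCount (P := P') hk fun i hi =>
      isAbsent_of_lt hΛ hΨ (hs.pos e) hP' hstrict ((tail_iff hk).2 hi)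
    omega
  obtain ⟨γ₀, hγ₀, hge⟩ := hbig
  obtain ⟨W, hW0, hW⟩ := exists_isGreatest_ratioW hΛ ⟨γ₀, hγ₀⟩ fun γ hγ => (hTh.1 hγ).2
  have hμW : μ e ≤ W := hge.trans (hW.2 ⟨γ₀, hγ₀, rfl⟩)
  have hWlam : W < lam := by
    obtain ⟨γ, hγ, rfl⟩ := hW.1
    exact hratio γ hγ
  have hlamle : ∀ i : Fin n, i.val < k → lam ≤ Λ i := fun i hi => by
    rw [← hlam e le_rfl]
    exact h.above.anti i e hi.le
  -- Maximality of `W` is exactly the tail bound for the monomials in `Theta`; for head length at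
  -- least one it is trivial.
  have hb : TailBound Λ d Ψ W := fun α β h1 h2 => by
    rcases lt_or_ge (headLength Λ d α β) 1 with h3 | h3
    · have := hW.2 ⟨(α, β), hTh.2 ⟨h1, h3, h2⟩, rfl⟩
      rw [ratioW, div_le_iff₀ h2] at this
      linarith
    · have := mul_pos hW0 h2
      linarith
  have hWt : IsWeight (tailWeight Λ d W) := by
    obtain ⟨⟨γ, hγ, rfl⟩, -⟩ := hW
    have h1 := hTh.1 hγ
    exact isWeight_tailWeight_ratioW h.isWeight h1.2.1.le h1.2.2
      (hWlam.le.trans (hlam e le_rfl ▸ (h.isWeight.1 e).2))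
      fun i hi => hWlam.le.trans (hlamle i ((head_iff hk).1 hi))
  obtain ⟨k', hkk', habove⟩ := exists_isAbove (t := W) hs.isWeight.2.1 hWt.lt_one hWt.2.1 hk
    (fun i hi => (tailWeight_head ((head_iff hk).2 hi)).trans (h.above.eq i hi))
    (fun i hi => tailWeight_tail ((tail_iff hk).2 hi)) fun i hi => (hμe i hi).trans hμW
  exact ⟨W, hW, fun i hi => hlam i hi ▸ hWlam, k', hkk', hWt, habove, h.pos.trans_le hkk',
    ⟨W, fun i hi => tailWeight_tail ((tail_iff hk).2 (hkk'.trans hi))⟩, h.isCoord,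
    exists_isLeading_tailWeight hΛ hΨ hP hW0 hb, F, hF, hFΦ, _,
    hs.exists_isSuperHom_tailWeight h.above hlam hkn hF hΨ hP hq hW0
      (fun i hi => (hμe i hi).trans hμW) hWlam.le hb⟩

lemma IsMinimalSystem.isTracked_of_isInitial (hs : IsMinimalSystem M p μ Φs Ψs Ps) {S : Stage n}
    (hS : IsInitial M p S) : ∃ k, IsTracked M p μ Φs Ψs S.Λ S.Φ S.Ψ k := by
  obtain ⟨-, m, hm, hΛ, hc, P, hP0, hn, hP⟩ := hS
  rw [hΛ] at hP
  obtain ⟨hw, hle, hF, ⟨i, hi⟩, -⟩ := hs.initial hc hP0 hn hm hP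
  obtain ⟨k, -, habove⟩ := exists_isAbove (k := 0) (t := 1 / (m : ℚ)) hs.isWeight.2.1 hw.lt_one hw.2.1
    (Nat.zero_le _) (fun i hi => absurd hi (Nat.not_lt_zero _)) (fun _ _ => rfl) fun i _ => hle i
  obtain ⟨F, hF', hFΦ⟩ := hc.exists_transition hs.isCoord
  obtain ⟨q, hq⟩ := hF F hF'
  rw [hΛ]
  refine ⟨k, hw, habove, Nat.pos_of_ne_zero ?_, ⟨_, fun _ _ => rfl⟩, hc, ⟨P, hP⟩, F, hF', hFΦ, _, q, hq⟩
  rintro rfl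
  exact (habove.lt i (Nat.zero_le _)).ne hi

/-- If `k = n` there is no tail: the next weight is `Λ` itself, with no condition on ratios.
Otherwise the maximal ratio lies strictly below the old tail value. -/
lemma IsTracked.exists_isNextWeight (h : IsTracked M p μ Φs Ψs Λ Φ Ψ k)
    (hs : IsMinimalSystem M p μ Φs Ψs Ps) (hopt : IsOptimalChange M p Λ Φ Φ' Ψ' d) :
    d = n - k ∧ ∃ Λ' k', k ≤ k' ∧ (∀ Λ'', IsNextWeight Λ d Ψ' Λ'' ↔ Λ'' = Λ') ∧
      IsTracked M p μ Φs Ψs Λ' Φ' Ψ' k' ∧ (d ≠ 0 → Λ' < Λ) := by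
  obtain ⟨hch, hc, hg, P, hP, ha⟩ := hopt
  have hdk : d = n - k := hg.unique (h.isGreatest hs)
  subst hdk
  refine ⟨rfl, ?_⟩
  have h' := h.change hs hch hc
  have hk := h.above.le
  rcases hk.eq_or_lt with hkn | hkn
  · refine ⟨Λ, k, le_rfl, fun Λ'' => ⟨fun h2 => funext fun i => h2.1 i ((head_iff hk).2 (by omega)), ?_⟩,
      h', fun h0 => absurd (by omega) h0⟩
    rintro rfl
    exact ⟨fun _ _ => rfl, fun i hi => absurd ((tail_iff hk).1 hi) (by omega)⟩
  · obtain ⟨W, hW, hWlt, k', hkk', hT⟩ := h'.exists_next hs hkn hP ha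
    refine ⟨_, k', hkk', fun Λ'' => ⟨fun h2 => funext fun i => ?_, ?_⟩, hT, fun _ => ?_⟩
    · rcases lt_or_ge (i.val + (n - k)) n with hi | hi
      · rw [tailWeight_head hi, h2.1 i hi]
      · rw [tailWeight_tail hi]; exact (h2.2 i hi).unique hW
    · rintro rfl
      exact ⟨fun i hi => tailWeight_head hi, fun i hi => by rw [tailWeight_tail hi]; exact hW⟩
    · refine Pi.lt_def.2 ⟨fun i => ?_, ⟨k, hkn⟩, ?_⟩
      · rcases lt_or_ge i.val k with hi | hi
        · rw [tailWeight_head ((head_iff hk).2 hi)]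
        · rw [tailWeight_tail ((tail_iff hk).2 hi)]; exact (hWlt i hi).le
      · rw [tailWeight_tail ((tail_iff hk).2 le_rfl)]; exact hWlt _ le_rfl

/-- The invariant of the procedure. The index `k` may exceed `n - S.d`, since entries that already
agree with `μ` are recognized only in the next step. -/
lemma IsMinimalSystem.isTracked_of_reaches (hs : IsMinimalSystem M p μ Φs Ψs Ps) {j : ℕ} {S : Stage n}
    (hS : Reaches M p j S) :
    S.d ≤ n ∧ ∃ k, n - S.d ≤ k ∧ IsTracked M p μ Φs Ψs S.Λ S.Φ S.Ψ k := by
  induction hS with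
  | first S hS =>
    obtain ⟨k, hk⟩ := hs.isTracked_of_isInitial hS
    exact ⟨hS.1.le, k, by rw [hS.1]; omega, hk⟩
  | next j S S' _ hstep ih =>
    obtain ⟨-, k, -, hT⟩ := ih
    obtain ⟨-, hopt, hnext⟩ := hstep
    obtain ⟨hd, Λ', k', hkk', hiff, hT', -⟩ := hT.exists_isNextWeight hs hopt
    rw [(hiff _).1 hnext]
    exact ⟨by omega, k', by have := hT.above.le; omega, hT'⟩

/-- The number of weights above `μ` and below `Λ`. -/
def weightRank (μ Λ : Fin n → ℚ) : ℕ := {Λ' | (IsWeight Λ' ∧ ∀ i, μ i ≤ Λ' i) ∧ Λ' < Λ}.ncard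

/-- While entries are missing, each step strictly lowers the weight inside the finite set of weights
above `μ`. -/
lemma IsMinimalSystem.exists_bound (hs : IsMinimalSystem M p μ Φs Ψs Ps) :
    ∃ N : ℕ, ∀ (j : ℕ) (S : Stage n), Reaches M p j S → j ≤ N := by
  set A := {Λ : Fin n → ℚ | IsWeight Λ ∧ ∀ i, μ i ≤ Λ i} with hA
  have hfin : A.Finite := finite_setOf_isWeight hs.pos
  -- The counting starts at step one with rank at most the cardinality of `A`, whence the `+ 1`. The
  -- last step, with `S.d = 0`, need not lower the weight and costs one more.
  have key : ∀ (j : ℕ) (S : Stage n), Reaches M p j S →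
      (S.d ≠ 0 → j + weightRank μ S.Λ ≤ A.ncard + 1) ∧ j ≤ A.ncard + 2 := by
    intro j S hS
    induction hS with
    | first S hS =>
      have : weightRank μ S.Λ ≤ A.ncard := Set.ncard_le_ncard (fun _ h => h.1) hfin
      exact ⟨fun _ => by omega, by omega⟩
    | next j S S' hR hstep ih =>
      obtain ⟨-, k, -, hT⟩ := hs.isTracked_of_reaches hR
      obtain ⟨hd0, hopt, hnext⟩ := hstep
      obtain ⟨-, Λ', k', -, hiff, hT', hlt⟩ := hT.exists_isNextWeight hs hopt
      have h1 := ih.1 hd0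
      refine ⟨fun hd => ?_, by omega⟩
      have h2 : weightRank μ S'.Λ < weightRank μ S.Λ := by
        have h3 := hlt hd
        rw [← (hiff _).1 hnext] at h3 hT'
        refine Set.ncard_lt_ncard ⟨fun _ h => ⟨h.1, h.2.trans h3⟩, fun hsub => ?_⟩
          (hfin.subset fun _ h => h.1)
        exact lt_irrefl _ (hsub ⟨⟨hT'.isWeight, hT'.above.ge⟩, h3⟩).2
      omega
  exact ⟨_, fun j S hS => (key j S hS).2⟩

end Procedure

end Catlin

end

/-! ### The theorem on the procedure. -/

theorem mainTheorem3 {n : ℕ} (M : Set (Fin (n + 1) → ℂ)) (p : Fin (n + 1) → ℂ)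
    (hM : Catlin.IsSmoothHypersurfaceAt M p)
    (μ : Fin n → ℚ) (hμ : Catlin.IsMultitypeWeight M p μ) (hfin : ∀ i, 0 < μ i) :
    -- the first step can be performed, and it yields the first multitype entry
    (∃ S : Catlin.Stage n, Catlin.IsInitial M p S) ∧
    (∀ S : Catlin.Stage n, Catlin.IsInitial M p S →
      ∀ i : Fin n, (i : ℕ) = 0 → S.Λ i = μ i) ∧
    -- every further step can be performed, whatever was chosen before, and it determines entries
    (∀ (j : ℕ) (S : Catlin.Stage n), Catlin.Reaches M p j S →
      Catlin.IsWeight S.Λ ∧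
      (S.d ≠ 0 →
        (∃ (Φ' : (Fin (n + 1) → ℂ) → Catlin.CoordSpace n) (Ψ' : Catlin.GraphSpace n → ℝ) (d' : ℕ),
          Catlin.IsOptimalChange M p S.Λ S.Φ Φ' Ψ' d' ∧ Catlin.IsAdapted M p S.Λ Φ' Ψ') ∧
        ∀ (Φ' : (Fin (n + 1) → ℂ) → Catlin.CoordSpace n) (Ψ' : Catlin.GraphSpace n → ℝ) (d' : ℕ),
          Catlin.IsOptimalChange M p S.Λ S.Φ Φ' Ψ' d' →
            d' ≤ S.d ∧
            (∀ i : Fin n, (i : ℕ) + d' < n → μ i = S.Λ i) ∧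
            (∀ i : Fin n, n ≤ (i : ℕ) + d' → μ i < S.Λ i) ∧
            ∃! Λ' : Fin n → ℚ, Catlin.IsNextWeight S.Λ d' Ψ' Λ')) ∧
    -- the procedure terminates after finitely many steps
    (∃ N : ℕ, ∀ (j : ℕ) (S : Catlin.Stage n), Catlin.Reaches M p j S → j ≤ N) ∧
    -- and then it has determined the whole multitype weight
    (∀ (j : ℕ) (S : Catlin.Stage n), Catlin.Reaches M p j S → S.d = 0 → S.Λ = μ) := by
  classical
  obtain ⟨Φs, Ψs, Ps, hs⟩ := hμ.exists_isMinimalSystem hfin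
  refine ⟨?_, fun S hS i hi => ?_, fun j S hS => ?_, hs.exists_bound, fun j S hS hd => ?_⟩
  · obtain ⟨m, Φ, Ψ, hm, hA⟩ := hs.exists_initial
    exact ⟨⟨fun _ => 1 / (m : ℚ), Φ, Ψ, n⟩, rfl, m, hm, rfl, hA⟩
  · obtain ⟨k, hT⟩ := hs.isTracked_of_isInitial hS
    exact hT.above.eq i (hi ▸ hT.pos)
  · obtain ⟨hdn, k, hk, hT⟩ := hs.isTracked_of_reaches hS
    refine ⟨hT.isWeight, fun _ => ⟨hT.exists_isOptimalChange hs, fun Φ' Ψ' d' hopt => ?_⟩⟩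
    obtain ⟨hd, Λ', k', -, hiff, -, -⟩ := hT.exists_isNextWeight hs hopt
    have hkn := hT.above.le
    refine ⟨by omega, fun i hi => (hT.above.eq i (by omega)).symm,
      fun i hi => hT.above.lt i (by omega), Λ', (hiff _).2 rfl, fun Λ'' h => (hiff _).1 h⟩
  · obtain ⟨-, k, hk, hT⟩ := hs.isTracked_of_reaches hS
    exact funext fun i => hT.above.eq i (by omega)
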